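/- **Spectral data of the two-gap Lamé and primitive Treibich–Verdier potentials.** *Setting.* Let $\Lambda_0\subset\mathbb C$ be a lattice, $\wp,\zeta,\sigma$ its Weierstrass functions, $(\wp')^2=4\wp^3-g_2\wp-g_3$, $\omega_1,\omega_2,\omega_3$ the half-periods (modulo $\Lambda_0$), $e_a=\wp(\omega_a)$, $\eta_a=\zeta(\omega_a)$, and $\{i,j,k\}=\{1,2,3\}$. Put $$\Phi(x;u)=\frac{\sigma(x-u)}{\sigma(x)\sigma(u)}e^{\zeta(u)x},\qquad \Phi_a(x;u)=e^{\eta_au-\zeta(u)\omega_a}\Phi(x+\omega_a;u),\qquad \sqrt{\wp(x)-e_a}:=\frac{e^{-\eta_ax}\sigma(x+\omega_a)}{\sigma(\omega_a)\sigma(x)}.$$ (These are single-valued branches, $(\sqrt{\wp-e_a})^2=\wp-e_a$, and $\prod_a\sqrt{\wp-e_a}=-\tfrac12\wp'$.) Consider $-\psi''+V\psi=z\psi$ with $$V_3=6\wp(x),\quad V_4=6\wp(x)+2\wp(x+\omega_i)-2e_i,\quad V_5=6\wp(x)+2\wp(x+\omega_i)+2\wp(x+\omega_j)+2e_k,$$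 that is, $u_3,u_4,u_5$ with the additive constant for which the band edges have sum $0$. The *spectral polynomial* of $V$ is the monic quintic $P(z)=\tfrac12FF''-\tfrac14F'^2+(z-V)F^2$, where $F=z^2+f_1(x)z+f_2(x)$, with $f_1,f_2$ holomorphic off the poles of $V$, makes this expression independent of $x$. The spectral curve is $C_2:\ w^2=-P(z)$; it is nonsingular of genus $2$ iff $P$ has simple zeros. Define $$q_a(z)=(z-e_a-2e_i)^2-4(e_i-e_a)(2e_a+7e_i)\quad(a=j,k),\qquad c(z)=z^3-3e_kz^2+(51e_k^2-20g_2)z-369e_k^3+132e_kg_2,$$ $D(z)=5z^2+6e_kz+261e_k^2-108g_2$, and $r_a(z)=z^2+(8e_a-2e_k)z+33e_k^2-24e_ke_a-144e_a^2$. "$N$-sheeted" means that the stated function $\wp(u)$ or $\widetilde\wp$ is a rational function of $z$ of degree $N$. **1. Spectral curves.** The spectral polynomials of $V_3,V_4,V_5$ are $$P_3=(z^2-3g_2)\prod_{a=1}^3(z-3e_a),\qquad P_4=(z+6e_i)\,q_j\,q_k,\qquad P_5=c(z)\,(z-6e_i+3e_j)(z-6e_j+3e_i);$$ the zeros of $q_a$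 are $e_a+2e_i\pm2\sqrt{(e_i-e_a)(2e_a+7e_i)}$. They have simple zeros iff, respectively, $g_2\ne0$; $(2e_j+7e_i)(2e_k+7e_i)\neq0$; $125g_2\neq348e_k^2$. With $$\lambda=\frac{2w}{3(z^2-3g_2)},\qquad \lambda=\frac{3w}{2(6e_i+z)(15e_i-2z)},\qquad \lambda=\frac{-4w}{D(z)}$$ and $(\wp,\wp')$ given by the first cover below, the points of $C_2$ at which these denominators do not vanish satisfy, respectively, $$\lambda^3-3\lambda\wp+\wp'=0,\qquad \lambda^4-3(2\wp-e_i)\lambda^2+4\lambda\wp'-3(\wp-e_j)(\wp-e_k)=0,$$ $$\lambda^5-2(e_k+5\wp)\lambda^3+10\wp'\lambda^2+3(3e_k+5\wp)(e_k-\wp)\lambda-2\wp'(e_k-\wp)=0 .$$ For $V_3$ the map $(z,w)\mapsto(\wp,\wp',\lambda)$ is a bijection from the points of $C_2$ with $z^2\neq3g_2$ onto the affine curve given by this equation and $(\wp')^2=4\wp^3-g_2\wp-g_3$; for $V_4,V_5$ it is a bijection between the points with $w\ne0$ and nonvanishing denominator and the points with $\lambda\neq0$. **2. First covers** $\pi:C_2\to\mathbb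 C/\Lambda_0$, with $N=3,4,5$ sheets. Every point of $C_2$ with nonvanishing denominators is mapped to a $u\in\mathbb C\setminus\Lambda_0$ with the following values of $\wp(u),\wp'(u)$, and the holomorphic differential reduces as stated: * $V_3$: $\wp(u)=-\dfrac{z^3-27g_3}{9(z^2-3g_2)}$, $\ \wp'(u)=\dfrac{2w(z^3-9g_2z+54g_3)}{27(z^2-3g_2)^2}$, $\ \dfrac{d\wp}{\wp'}=-\dfrac{3z}{2}\dfrac{dz}{w}$. * $V_4$: $\wp(u)=e_j-\dfrac{(z-3e_i+9e_j)^2q_j(z)}{4(z+6e_i)(15e_i-2z)^2}=e_k-\dfrac{(z-3e_i+9e_k)^2q_k(z)}{4(z+6e_i)(15e_i-2z)^2}$, $\ \wp'(u)=\dfrac{w(z-3e_i+9e_j)(z-3e_i+9e_k)(z^2+3e_iz-72e_i^2-27e_je_k)}{4(z+6e_i)^2(15e_i-2z)^3}$, $\ \dfrac{d\wp}{\wp'}=(2z+3e_i)\dfrac{dz}{w}$. * $V_5$: $\wp(u)=e_k-\dfrac{c(z)(z+15e_k)^2}{D(z)^2}$, $\ \wp'(u)=-\dfrac{2w(z+15e_k)r_i(z)r_j(z)}{D(z)^3}$,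 $\ \dfrac{d\wp}{\wp'}=\dfrac{5z+3e_k}{2}\dfrac{dz}{w}$. **3. Second covers** $\widetilde\pi:C_2\to\widetilde C_1=\{(\widetilde\wp')^2=4\widetilde\wp^3-\widetilde g_2\widetilde\wp-\widetilde g_3\}$, with $N=3,4,5$ sheets, with $\dfrac{d\widetilde\wp}{\widetilde\wp'}=-\dfrac{dz}{w}$: * $V_3$: $\widetilde\wp=-\tfrac9{16}(4z^3-9g_2z-9g_3)$. * $V_4$: $\widetilde\wp=\widetilde e_j-\dfrac{9q_j(z)(z+4e_i-e_k)^2}{4(z+6e_i)}=\widetilde e_k-\dfrac{9q_k(z)(z+4e_i-e_j)^2}{4(z+6e_i)}$, where $\widetilde e_j=3(e_j-e_k)^3+3(e_j-e_i)(7e_i+2e_j)^2$, $\widetilde e_k=3(e_k-e_j)^3+3(e_k-e_i)(7e_i+2e_k)^2$ and $\widetilde e_i=-\widetilde e_j-\widetilde e_k$ are the zeros of $4t^3-\widetilde g_2t-\widetilde g_3$. * $V_5$: $\widetilde\wp=-\dfrac{9N_5(z)}{4(z-3e_k-9e_i)(z-3e_k-9e_j)}$, where $$\begin{aligned}N_5={}&z^5+3e_kz^4+(150e_ie_j-42e_k^2)z^3+30e_k(e_ie_j-e_k^2)z^2\\&+9\bigl(69e_k^4+625e_i^2e_j^2-\tfrac{221}2e_kg_3\bigr)z-27e_k\bigl(11e_k^4-\tfrac{81}2e_kg_3+475e_i^2e_j^2\bigr).\end{aligned}$$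 **4. Moduli.** If $P_N$ has simple zeros then $\widetilde g_2^3\neq27\widetilde g_3^2$. Here * $V_3$: $\widetilde g_2=\dfrac{3^7(g_2^3+9g_3^2)}{2^6}$, $\widetilde g_3=\dfrac{3^{11}(g_3g_2^3-3g_3^3)}{2^9}$. If $k_0^2=\frac{e_j-e_k}{e_i-e_k}$ and $s^2=k_0^4-k_0^2+1$, then $\widetilde e_1=-\frac{81}8g_3$, $\widetilde e_{2},\widetilde e_3=\frac{81}{16}g_3\mp\frac{27}8g_2(e_i-e_k)s$ are the zeros of $4t^3-\widetilde g_2t-\widetilde g_3$, and for $g_2\ne0$ the moduli $\widetilde k$ with $\widetilde k^2=\frac{\widetilde e_2-\widetilde e_3}{\widetilde e_1-\widetilde e_3}$ are exactly the solutions of $$\frac1{\widetilde k^2}=\frac12+\frac{(k_0^2-2)(2k_0^2-1)(k_0^2+1)}{4s^3}.$$ * $V_4$: $\widetilde g_2=3^7\tfrac{83}4g_2g_3e_i+3^6\tfrac{89}4g_2^2e_i^2+3^4g_2^3+14\cdot3^7g_3^2$, $\widetilde g_3=\tfrac{3^7\cdot11\cdot17}4e_ig_2^4+\tfrac{3^{10}\cdot307}8e_ig_3^2g_2+\tfrac{3^{10}\cdot457}{16}g_2^2g_3e_i^2+\tfrac{3^8\cdot61}4g_3g_2^3+\tfrac{3^{11}\cdot5\cdot19}{16}g_3^3$.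 If $k_0^2=\frac{e_i-e_k}{e_j-e_k}$ and $k_0'^2=\frac{e_j-e_i}{e_j-e_k}$, then $\widetilde k=k_0'(1-4k_0^2)$ and $\widetilde k'=k_0(1-4k_0'^2)$ satisfy $\widetilde k^2=\frac{\widetilde e_i-\widetilde e_j}{\widetilde e_k-\widetilde e_j}$, $\widetilde k'^2=\frac{\widetilde e_k-\widetilde e_i}{\widetilde e_k-\widetilde e_j}$. * $V_5$: $\widetilde g_2=2^2\cdot3^7\cdot5\cdot23\,e_k^6-3^7\cdot11\cdot17\,e_k^4g_2-\tfrac{3^6\cdot5^3}{2^2}e_k^2g_2^2+\tfrac{3^4\cdot5^5}{2^4}g_2^3$, $\widetilde g_3=-\tfrac{3^7}{2^6}e_k\bigl(5^7g_2^4+2^8\cdot3^5\cdot191e_k^8+2^5\cdot3^3\cdot13\cdot457e_k^4g_2^2-2^8\cdot3^3\cdot23\cdot79e_k^6g_2-2^4\cdot3^2\cdot5^4\cdot11e_k^2g_2^3\bigr)$. **5. Wave functions.** For every $(z,w)\in C_2$ and $u=\pi(z,w)$ as above for which the denominators occurring do not vanish, the following is a nonzero solution of $-\Psi''+V\Psi=z\Psi$,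 holomorphic off the poles of $V$: * $V_3$: $\Psi=\partial_x\bigl(e^{\lambda x}\Phi(x;u)\bigr)$; * $V_4$: $\Psi=\partial_x\bigl(e^{\lambda x}\Phi(x;u)\bigr)+\dfrac{3\lambda^2-3\wp(u)+z}{6\sqrt{\wp(u)-e_i}}\,\Phi_i(x;u)e^{\lambda x}$; * $V_5$: $\Psi=\partial_x\bigl(e^{\lambda x}\Phi(x;u)\bigr)+\bigl[a_{i,j}\Phi_i(x;u)+a_{j,i}\Phi_j(x;u)\bigr]e^{\lambda x}$, $\quad a_{i,j}=\dfrac{3\lambda^3-9\lambda\wp(u)+\lambda z+6\lambda e_j+3\wp'(u)}{6\lambda\sqrt{\wp(u)-e_i}+6\sqrt{\wp(u)-e_j}\sqrt{\wp(u)-e_k}}$. **6. Lamé polynomials.** Write $R_a=\sqrt{\wp(x)-e_a}$. Each function $\Lambda$ below is a nonzero solution for $z=z_0$, $P_N(z_0)=0$, and is the value of the wave function at this band edge: $\Psi(x)\to\Lambda(x)$ for each $x$ that is not a pole of $V$, as $z\to z_0$ along the points $(z,w,u)$ of part 5. * $V_3$: $R_iR_j$ ($z_0=3e_k$); $\ \wp(x)\pm\tfrac12\sqrt{g_2/3}$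 ($z_0=\pm\sqrt{3g_2}=\pm3\sqrt{g_2/3}$). * $V_4$: $R_iR_j+\tfrac13\bigl[(e_i-e_k)\pm\rho\bigr]\dfrac{R_j}{R_i}$ ($z_0=e_k+2e_i\pm2\rho$, $\rho^2=(e_i-e_k)(7e_i+2e_k)$), the same with $j,k$ interchanged, and $\wp(x)-e_i$ ($z_0=-6e_i$). * $V_5$: $R_iR_k+(e_i-e_j)\dfrac{R_k}{R_i}$ ($z_0=6e_i-3e_j$); $\ R_jR_k+(e_j-e_i)\dfrac{R_k}{R_j}$ ($z_0=6e_j-3e_i$); and for each zero $z_0$ of $c$: $\ R_iR_j+\tilde a_{ij}\dfrac{R_i}{R_j}+\tilde a_{ji}\dfrac{R_j}{R_i}$ with $\tilde a_{ij}=\dfrac{15e_j^2+27e_i^2-6e_ie_j-z_0^2+2z_0(e_i-e_j)}{24(e_i-e_j)}$. -/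

import Mathlib

open Polynomial Filter Topology

noncomputable section

namespace TreibichVerdier

/-! ### Weierstrass functions of a lattice

The lattice of `L : PeriodPair` is spanned by the full periods `L.ω₁`, `L.ω₂`. -/

/-- The Weierstrass function `ζ`. -/
def zeta (L : PeriodPair) (x : ℂ) : ℂ :=
  ∑' l : L.lattice, if (l : ℂ) = 0 then 1 / x else 1 / (x - l) + 1 / l + x / (l : ℂ) ^ 2

/-- The Weierstrass function `σ`, by its canonical product. -/
def sigma (L : PeriodPair) (x : ℂ) : ℂ :=
  ∏' l : L.lattice, if (l : ℂ) = 0 then x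
    else (1 - x / l) * Complex.exp (x / l + x ^ 2 / (2 * (l : ℂ) ^ 2))

/-- The three half periods. -/
def halfPeriod (L : PeriodPair) : Fin 3 → ℂ :=
  ![L.ω₁ / 2, L.ω₂ / 2, (L.ω₁ + L.ω₂) / 2]

/-- The values `e i = ℘ (ω i)` at the half periods. -/
def e (L : PeriodPair) (i : Fin 3) : ℂ := L.weierstrassP (halfPeriod L i)

/-- The single-valued branch `σ_i (x) / σ (x)` of `√(℘ (x) - e i)`, where
`σ_i (x) = exp (- η_i x) σ (x + ω i) / σ (ω i)` and `η_i = ζ (ω i)`; it behaves like `1 / x` at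
`x = 0`. -/
def rootP (L : PeriodPair) (i : Fin 3) (x : ℂ) : ℂ :=
  Complex.exp (-(zeta L (halfPeriod L i) * x)) * sigma L (x + halfPeriod L i) /
    (sigma L (halfPeriod L i) * sigma L x)

/-- The solution `Φ (x; u) = σ (x - u) / (σ (x) σ (u)) · exp (ζ (u) x)` of the one-gap Lamé
equation. -/
def Phi (L : PeriodPair) (x u : ℂ) : ℂ :=
  sigma L (x - u) / (sigma L x * sigma L u) * Complex.exp (zeta L u * x)

/-- The translate of `Φ` by a half period, normalised by a factor independent of `x`:
`Φ_i (x; u) = exp (η_i u - ζ (u) ω i) Φ (x + ω i; u)`. -/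
def PhiShift (L : PeriodPair) (i : Fin 3) (x u : ℂ) : ℂ :=
  Complex.exp (zeta L (halfPeriod L i) * u - zeta L u * halfPeriod L i) *
    Phi L (x + halfPeriod L i) u

/-! ### The potentials -/

/-- `u₃ = 6 ℘ (x)`. -/
def u3 (L : PeriodPair) (x : ℂ) : ℂ := 6 * L.weierstrassP x

/-- `u₄ = 6 ℘ (x) + 2 ℘ (x + ω i)`. -/
def u4 (L : PeriodPair) (i : Fin 3) (x : ℂ) : ℂ :=
  6 * L.weierstrassP x + 2 * L.weierstrassP (x + halfPeriod L i)

/-- `u₅ = 6 ℘ (x) + 2 ℘ (x + ω i) + 2 ℘ (x + ω j)`. -/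
def u5 (L : PeriodPair) (i j : Fin 3) (x : ℂ) : ℂ :=
  6 * L.weierstrassP x + 2 * L.weierstrassP (x + halfPeriod L i) +
    2 * L.weierstrassP (x + halfPeriod L j)

/-- The poles of `u₃`. -/
def poles3 (L : PeriodPair) : Set ℂ := {x | x ∈ L.lattice}

/-- The poles of `u₄`. -/
def poles4 (L : PeriodPair) (i : Fin 3) : Set ℂ :=
  {x | x ∈ L.lattice ∨ x + halfPeriod L i ∈ L.lattice}

/-- The poles of `u₅`. -/
def poles5 (L : PeriodPair) (i j : Fin 3) : Set ℂ :=
  {x | x ∈ L.lattice ∨ x + halfPeriod L i ∈ L.lattice ∨ x + halfPeriod L j ∈ L.lattice}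

/-! ### General notions -/

/-- `ψ` is holomorphic off `S` and solves `- ψ'' + V ψ = z ψ` there. -/
def SolvesSchrodinger (V : ℂ → ℂ) (S : Set ℂ) (z : ℂ) (ψ : ℂ → ℂ) : Prop :=
  DifferentiableOn ℂ ψ Sᶜ ∧ ∀ x ∈ Sᶜ, -deriv (deriv ψ) x + V x * ψ x = z * ψ x

/-- `P` is the polynomial of the band edges of the two-gap potential `V`, i.e. its spectral curve
is the double cover of the `z`-line branched at the zeros of `P` and at infinity. As usual this is
expressed through the product `F = z² + f₁ z + f₂ = (z - μ₁) (z - μ₂)` of two Bloch solutions. -/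
def IsSpectralPolynomial (V : ℂ → ℂ) (S : Set ℂ) (P : ℂ[X]) : Prop :=
  P.Monic ∧ P.natDegree = 5 ∧
    ∃ f₁ f₂ : ℂ → ℂ, DifferentiableOn ℂ f₁ Sᶜ ∧ DifferentiableOn ℂ f₂ Sᶜ ∧
      ∀ F : ℂ → ℂ → ℂ, (∀ z x, F z x = z ^ 2 + f₁ x * z + f₂ x) →
        ∀ z, ∀ x ∈ Sᶜ, F z x * deriv (deriv (F z)) x / 2 - deriv (F z) x ^ 2 / 4 +
          (z - V x) * F z x ^ 2 = P.eval z

/-- The affine curve `w² = - P (z)`. -/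
def Curve (P : ℂ[X]) : Set (ℂ × ℂ) := {p | p.2 ^ 2 = -P.eval p.1}

/-- The map `f` is, where `D ≠ 0`, a rational function of degree `N` with poles at the zeros of
`D` (and possibly at infinity). -/
def IsRationalOfDegree (D f : ℂ → ℂ) (N : ℕ) : Prop :=
  ∃ p q : ℂ[X], IsCoprime p q ∧ max p.natDegree q.natDegree = N ∧
    ∀ z, (q.eval z ≠ 0 ↔ D z ≠ 0) ∧ (D z ≠ 0 → f z = p.eval z / q.eval z)

/-- `(z, w) ↦ (X (z), Y (z, w))` is an `N`-sheeted cover of the cubic `y² = 4 x³ - g₂ x - g₃` by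
the curve `w² = - P (z)`, and the holomorphic differential `dx / y` pulls back to
`ρ (z) dz / w`. -/
structure IsTorusCover (P : ℂ[X]) (D X : ℂ → ℂ) (Y : ℂ → ℂ → ℂ) (ρ : ℂ → ℂ) (g₂ g₃ : ℂ) (N : ℕ) :
    Prop where
  degree : IsRationalOfDegree D X N
  mapsTo : ∀ z w, (z, w) ∈ Curve P → D z ≠ 0 →
    Y z w ^ 2 = 4 * X z ^ 3 - g₂ * X z - g₃
  reduction : ∀ z w, (z, w) ∈ Curve P → D z ≠ 0 →
    DifferentiableAt ℂ X z ∧ deriv X z * w = ρ z * Y z w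

/-- The points `(X, Y, l)` with `(X, Y)` on the torus and `K X Y l = 0`. -/
def KricheverCurve (L : PeriodPair) (K : ℂ → ℂ → ℂ → ℂ) : Set (ℂ × ℂ × ℂ) :=
  {p | p.2.1 ^ 2 = 4 * p.1 ^ 3 - L.g₂ * p.1 - L.g₃ ∧ K p.1 p.2.1 p.2.2 = 0}

/-- Triples `(z, w, u)`: a point of the curve with `D z ≠ 0`, together with a parameter `u` of its
image `(℘ (u), ℘' (u)) = (X, Y)` on the torus. -/
def Uniformised (L : PeriodPair) (P : ℂ[X]) (D X : ℂ → ℂ) (Y : ℂ → ℂ → ℂ) : Set (ℂ × ℂ × ℂ) :=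
  {p | (p.1, p.2.1) ∈ Curve P ∧ D p.1 ≠ 0 ∧ p.2.2 ∉ L.lattice ∧
    L.weierstrassP p.2.2 = X p.1 ∧ L.derivWeierstrassP p.2.2 = Y p.1 p.2.1}

/-- Every `Ψ (·; z, w, u)`, `(z, w, u) ∈ Ω`, is a non-zero solution for the spectral parameter
`z`. -/
def IsWaveFunction (V : ℂ → ℂ) (S : Set ℂ) (Ω : Set (ℂ × ℂ × ℂ)) (Ψ : ℂ × ℂ × ℂ → ℂ → ℂ) : Prop :=
  ∀ p ∈ Ω, SolvesSchrodinger V S p.1 (Ψ p) ∧ ∃ x ∈ Sᶜ, Ψ p x ≠ 0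

/-- `Λ` is the Lamé polynomial at the band edge `z₀`: a non-zero solution there, which is the value
of the wave function `Ψ` at this edge (as a limit, since the formula for `Ψ` may be indeterminate
at the edge itself). -/
def IsLamePolynomial (V : ℂ → ℂ) (S : Set ℂ) (P : ℂ[X]) (Ω : Set (ℂ × ℂ × ℂ))
    (Ψ : ℂ × ℂ × ℂ → ℂ → ℂ) (z₀ : ℂ) (Λ : ℂ → ℂ) : Prop :=
  P.eval z₀ = 0 ∧ SolvesSchrodinger V S z₀ Λ ∧ (∃ x ∈ Sᶜ, Λ x ≠ 0) ∧
    ∀ x ∈ Sᶜ, Tendsto (fun p ↦ Ψ p x) (comap Prod.fst (𝓝 z₀) ⊓ 𝓟 Ω) (𝓝 (Λ x))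

/-- `k` is the Jacobi modulus `k² = (e₂ - e₃) / (e₁ - e₃)` for the ordered roots `e₁, e₂, e₃`;
the complementary modulus is obtained by interchanging `e₁` and `e₃`. -/
def IsJacobiModulus (k e₁ e₂ e₃ : ℂ) : Prop := e₁ ≠ e₃ ∧ k ^ 2 = (e₂ - e₃) / (e₁ - e₃)

/-! ### Data for `u₃` -/

def P3 (L : PeriodPair) : ℂ[X] := (X ^ 2 - C (3 * L.g₂)) * ∏ i, (X - C (3 * e L i))

def D3 (L : PeriodPair) (z : ℂ) : ℂ := z ^ 2 - 3 * L.g₂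

def lambda3 (L : PeriodPair) (z w : ℂ) : ℂ := 2 * w / (3 * (z ^ 2 - 3 * L.g₂))

def X3 (L : PeriodPair) (z : ℂ) : ℂ := -(z ^ 3 - 27 * L.g₃) / (9 * (z ^ 2 - 3 * L.g₂))

def Y3 (L : PeriodPair) (z w : ℂ) : ℂ :=
  2 * w * (z ^ 3 - 9 * L.g₂ * z + 54 * L.g₃) / (27 * (z ^ 2 - 3 * L.g₂) ^ 2)

def K3 (x y l : ℂ) : ℂ := l ^ 3 - 3 * l * x + y

def tX3 (L : PeriodPair) (z : ℂ) : ℂ := -(9 / 16) * (4 * z ^ 3 - 9 * L.g₂ * z - 9 * L.g₃)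

def tg₂3 (L : PeriodPair) : ℂ := 3 ^ 7 * (L.g₂ ^ 3 + 9 * L.g₃ ^ 2) / 2 ^ 6

def tg₃3 (L : PeriodPair) : ℂ := 3 ^ 11 * (L.g₃ * L.g₂ ^ 3 - 3 * L.g₃ ^ 3) / 2 ^ 9

def Omega3 (L : PeriodPair) : Set (ℂ × ℂ × ℂ) := Uniformised L (P3 L) (D3 L) (X3 L) (Y3 L)

def Psi3 (L : PeriodPair) (p : ℂ × ℂ × ℂ) (x : ℂ) : ℂ :=
  deriv (fun t ↦ Complex.exp (lambda3 L p.1 p.2.1 * t) * Phi L t p.2.2) x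

/-! ### Data for `u₄`; the indices `i, j, k` are pairwise different, the potential is `u4 L i` -/

/-- The quadratic polynomial with the zeros `e j + 2 e i ± 2 √((e i - e j) (2 e j + 7 e i))`. -/
def Q4 (L : PeriodPair) (i j : Fin 3) : ℂ[X] :=
  (X - C (e L j + 2 * e L i)) ^ 2 - C (4 * ((e L i - e L j) * (2 * e L j + 7 * e L i)))

def P4 (L : PeriodPair) (i j k : Fin 3) : ℂ[X] := (X + C (6 * e L i)) * Q4 L i j * Q4 L i k

def D4 (L : PeriodPair) (i : Fin 3) (z : ℂ) : ℂ := (z + 6 * e L i) * (15 * e L i - 2 * z)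

def lambda4 (L : PeriodPair) (i : Fin 3) (z w : ℂ) : ℂ :=
  3 * w / (2 * (6 * e L i + z) * (15 * e L i - 2 * z))

def X4 (L : PeriodPair) (i j : Fin 3) (z : ℂ) : ℂ :=
  e L j - (z - 3 * e L i + 9 * e L j) ^ 2 * (Q4 L i j).eval z /
    (4 * (z + 6 * e L i) * (15 * e L i - 2 * z) ^ 2)

def Y4 (L : PeriodPair) (i j k : Fin 3) (z w : ℂ) : ℂ :=
  w * (z - 3 * e L i + 9 * e L j) * (z - 3 * e L i + 9 * e L k) *
    (z ^ 2 + 3 * e L i * z - 72 * e L i ^ 2 - 27 * e L j * e L k) /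
      (4 * (z + 6 * e L i) ^ 2 * (15 * e L i - 2 * z) ^ 3)

def K4 (L : PeriodPair) (i j k : Fin 3) (x y l : ℂ) : ℂ :=
  l ^ 4 - 3 * (2 * x - e L i) * l ^ 2 + 4 * l * y - 3 * (x - e L j) * (x - e L k)

/-- The root `ẽ i` of the second torus. -/
def te4 (L : PeriodPair) (i j k : Fin 3) : ℂ :=
  -3 * (e L j - e L i) * (7 * e L i + 2 * e L j) ^ 2 -
    3 * (e L k - e L i) * (7 * e L i + 2 * e L k) ^ 2

/-- The root `ẽ j` of the second torus (and `ẽ k`, after interchanging `j` and `k`). -/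
def te4' (L : PeriodPair) (i j k : Fin 3) : ℂ :=
  3 * (e L j - e L k) ^ 3 + 3 * (e L j - e L i) * (7 * e L i + 2 * e L j) ^ 2

def tX4 (L : PeriodPair) (i j k : Fin 3) (z : ℂ) : ℂ :=
  te4' L i j k - 9 * (Q4 L i j).eval z * (z + 4 * e L i - e L k) ^ 2 / (4 * (z + 6 * e L i))

def tg₂4 (L : PeriodPair) (i : Fin 3) : ℂ :=
  3 ^ 7 * (83 / 4) * L.g₂ * L.g₃ * e L i + 3 ^ 6 * (89 / 4) * L.g₂ ^ 2 * e L i ^ 2 +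
    3 ^ 4 * L.g₂ ^ 3 + 14 * 3 ^ 7 * L.g₃ ^ 2

def tg₃4 (L : PeriodPair) (i : Fin 3) : ℂ :=
  3 ^ 7 * 11 * 17 / 4 * e L i * L.g₂ ^ 4 + 3 ^ 10 * 307 / 8 * e L i * L.g₃ ^ 2 * L.g₂ +
    3 ^ 10 * 457 / 16 * L.g₂ ^ 2 * L.g₃ * e L i ^ 2 + 3 ^ 8 * 61 / 4 * L.g₃ * L.g₂ ^ 3 +
    3 ^ 11 * 5 * 19 / 16 * L.g₃ ^ 3

/-- Points with `℘ (u) ≠ e i`, so that the formula for the wave function is defined. -/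
def Omega4 (L : PeriodPair) (i j k : Fin 3) : Set (ℂ × ℂ × ℂ) :=
  {p ∈ Uniformised L (P4 L i j k) (D4 L i) (X4 L i j) (Y4 L i j k) | rootP L i p.2.2 ≠ 0}

def Psi4 (L : PeriodPair) (i : Fin 3) (p : ℂ × ℂ × ℂ) (x : ℂ) : ℂ :=
  deriv (fun t ↦ Complex.exp (lambda4 L i p.1 p.2.1 * t) * Phi L t p.2.2) x +
    (3 * lambda4 L i p.1 p.2.1 ^ 2 - 3 * L.weierstrassP p.2.2 + p.1) /
      (6 * rootP L i p.2.2) * PhiShift L i x p.2.2 * Complex.exp (lambda4 L i p.1 p.2.1 * x)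

/-! ### Data for `u₅`; the indices `i, j, k` are pairwise different, the potential is
`u5 L i j` -/

/-- The cubic factor of the spectral polynomial. -/
def Q5 (L : PeriodPair) (k : Fin 3) : ℂ[X] :=
  X ^ 3 - C (3 * e L k) * X ^ 2 + C (51 * e L k ^ 2 - 20 * L.g₂) * X +
    C (-369 * e L k ^ 3 + 132 * e L k * L.g₂)

def P5 (L : PeriodPair) (i j k : Fin 3) : ℂ[X] :=
  Q5 L k * (X - C (6 * e L i - 3 * e L j)) * (X - C (6 * e L j - 3 * e L i))

def D5 (L : PeriodPair) (k : Fin 3) (z : ℂ) : ℂ :=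
  5 * z ^ 2 + 6 * z * e L k + 261 * e L k ^ 2 - 108 * L.g₂

def lambda5 (L : PeriodPair) (k : Fin 3) (z w : ℂ) : ℂ :=
  -4 * w / (5 * z ^ 2 + 6 * z * e L k + 261 * e L k ^ 2 - 108 * L.g₂)

def X5 (L : PeriodPair) (k : Fin 3) (z : ℂ) : ℂ :=
  e L k - (Q5 L k).eval z * (z + 15 * e L k) ^ 2 /
    (5 * z ^ 2 + 6 * z * e L k + 261 * e L k ^ 2 - 108 * L.g₂) ^ 2

/-- An auxiliary quadratic factor of `Y5`. -/
def R5 (L : PeriodPair) (k a : Fin 3) (z : ℂ) : ℂ :=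
  z ^ 2 + (8 * e L a - 2 * e L k) * z + 33 * e L k ^ 2 - 24 * e L k * e L a - 144 * e L a ^ 2

def Y5 (L : PeriodPair) (i j k : Fin 3) (z w : ℂ) : ℂ :=
  -2 * w * (z + 15 * e L k) * R5 L k i z * R5 L k j z /
    (5 * z ^ 2 + 6 * z * e L k + 261 * e L k ^ 2 - 108 * L.g₂) ^ 3

def K5 (L : PeriodPair) (k : Fin 3) (x y l : ℂ) : ℂ :=
  l ^ 5 - 2 * (e L k + 5 * x) * l ^ 3 + 10 * y * l ^ 2 +
    3 * (3 * e L k + 5 * x) * (e L k - x) * l - 2 * y * (e L k - x)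

/-- The numerator of the second cover. -/
def N5 (L : PeriodPair) (i j k : Fin 3) (z : ℂ) : ℂ :=
  z ^ 5 + 3 * e L k * z ^ 4 - 42 * e L k ^ 2 * z ^ 3 + 150 * e L i * e L j * z ^ 3 +
    30 * e L k * (e L i * e L j - e L k ^ 2) * z ^ 2 +
    9 * (69 * e L k ^ 4 + 625 * e L i ^ 2 * e L j ^ 2 - 221 * e L k * L.g₃ / 2) * z -
    27 * e L k * (11 * e L k ^ 4 - 81 * e L k * L.g₃ / 2 + 475 * e L i ^ 2 * e L j ^ 2)

def tD5 (L : PeriodPair) (i j k : Fin 3) (z : ℂ) : ℂ :=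
  (z - 3 * e L k - 9 * e L i) * (z - 3 * e L k - 9 * e L j)

def tX5 (L : PeriodPair) (i j k : Fin 3) (z : ℂ) : ℂ :=
  -9 * N5 L i j k z / (4 * (z - 3 * e L k - 9 * e L i) * (z - 3 * e L k - 9 * e L j))

def tg₂5 (L : PeriodPair) (k : Fin 3) : ℂ :=
  2 ^ 2 * 3 ^ 7 * 5 * 23 * e L k ^ 6 - 3 ^ 7 * 11 * 17 * e L k ^ 4 * L.g₂ -
    3 ^ 6 * 5 ^ 3 / 2 ^ 2 * e L k ^ 2 * L.g₂ ^ 2 + 3 ^ 4 / 2 ^ 4 * 5 ^ 5 * L.g₂ ^ 3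

def tg₃5 (L : PeriodPair) (k : Fin 3) : ℂ :=
  -(3 ^ 7 / 2 ^ 6) * e L k * (5 ^ 7 * L.g₂ ^ 4 + 2 ^ 8 * 3 ^ 5 * 191 * e L k ^ 8 +
    2 ^ 5 * 3 ^ 3 * 13 * 457 * e L k ^ 4 * L.g₂ ^ 2 -
    2 ^ 8 * 3 ^ 3 * 23 * 79 * e L k ^ 6 * L.g₂ -
    2 ^ 4 * 3 ^ 2 * 5 ^ 4 * 11 * e L k ^ 2 * L.g₂ ^ 3)

/-- The denominator of `a5`. -/
def den5 (L : PeriodPair) (i j k : Fin 3) (p : ℂ × ℂ × ℂ) : ℂ :=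
  6 * lambda5 L k p.1 p.2.1 * rootP L i p.2.2 + 6 * rootP L j p.2.2 * rootP L k p.2.2

/-- The coefficient `a_{i,j}` of the wave function. -/
def a5 (L : PeriodPair) (i j k : Fin 3) (p : ℂ × ℂ × ℂ) : ℂ :=
  (3 * lambda5 L k p.1 p.2.1 ^ 3 - 9 * lambda5 L k p.1 p.2.1 * L.weierstrassP p.2.2 +
    lambda5 L k p.1 p.2.1 * p.1 + 6 * lambda5 L k p.1 p.2.1 * e L j +
    3 * L.derivWeierstrassP p.2.2) / den5 L i j k p

/-- Points where the two coefficients of the wave function are defined. -/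
def Omega5 (L : PeriodPair) (i j k : Fin 3) : Set (ℂ × ℂ × ℂ) :=
  {p ∈ Uniformised L (P5 L i j k) (D5 L k) (X5 L k) (Y5 L i j k) |
    den5 L i j k p ≠ 0 ∧ den5 L j i k p ≠ 0}

def Psi5 (L : PeriodPair) (i j k : Fin 3) (p : ℂ × ℂ × ℂ) (x : ℂ) : ℂ :=
  deriv (fun t ↦ Complex.exp (lambda5 L k p.1 p.2.1 * t) * Phi L t p.2.2) x +
    (a5 L i j k p * PhiShift L i x p.2.2 + a5 L j i k p * PhiShift L j x p.2.2) *
      Complex.exp (lambda5 L k p.1 p.2.1 * x)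

/-- The coefficient `ã_{ij}` of the Lamé polynomials at the zeros `z` of `Q5`. -/
def ta5 (L : PeriodPair) (i j : Fin 3) (z : ℂ) : ℂ :=
  (15 * e L j ^ 2 + 27 * e L i ^ 2 - 6 * e L i * e L j - z ^ 2 + 2 * z * (e L i - e L j)) /
    (24 * (e L i - e L j))

end TreibichVerdier

end

open TreibichVerdier

noncomputable section

namespace TreibichVerdier

variable (L : PeriodPair)

/-! ### The functions `ζ` and `σ` -/

/-! Write `Z = ζ(x - u) - ζ(x) + ζ(u)`, so that `Φ' = Z Φ`. The addition theorem `℘(x - u) = Z² -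
℘(x) - ℘(u)` gives the one-gap Lamé equation `Φ'' = (2℘(x) + ℘(u)) Φ` (`hasDerivAt_dPhi`), and the
addition theorem for the branches of `√(℘ - e_i)` (`rootP_mul_rootP_sub`) writes `Φ_i` through `Φ`
and `Φ'`. As a result the products of the shifted `℘(x + ω_i)` with `Φ`, `Φ'`, `Φ_j` are linear
combinations of `Φ`, `Φ'`, `Φ_i`, `Φ_i'`, `Φ_j` whose coefficients depend on `u` only. Inserting the
ansatz `e^{λx} (λΦ + Φ' + AΦ_i + BΦ_j)` into the Schrödinger equation therefore leaves finitely many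
algebraic conditions on `λ, z, A, B, ℘(u), ℘'(u)`: these are the hypotheses of
`solvesSchrodinger_wave3`, `solvesSchrodinger_wave4`, `solvesSchrodinger_wave5`.

On the spectral curve `λ²`, `℘(u)` and `℘'(u)/λ` are rational functions of `z`. All statements on
covers, reductions and wave conditions thus become identities of rational functions in `z` and two
of the `e_a`. Conversely `z` is a rational function of `(℘, ℘', λ)`, which gives the bijections with
the Krichever curves; surjectivity is an elimination argument in which vanishing denominators
contradict the distinctness of the `e_a`. The spectral polynomials come from explicit products `F`,
and simplicity of zeros and nondegeneracy of the second tori from factored discriminants.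

For the Lamé polynomials, `Φ` and `Φ'` are periodic in `u`, so limits at a band edge need only the
limit of `℘(u)`. If this is some `e_a`, then `λ → 0` and `Φ' → R_b R_c`, and the limit is the
limiting coefficient of `Φ'` times `R_b R_c`. If `℘(u) → ∞`, then `λ` is asymptotic to
`℘'(u)/(2℘(u))`, which cancels the essential singularity `e^{ζ(u)x}` of `Φ` at `u = 0`; the limit is
read off from `tendsto_wave_cobounded`.

The analytic base is the product formula for `σ(x - u) σ(x + u)`, proved by Liouville's theorem for
elliptic functions (`exists_eq_const_of_periodic`). Signs of square roots are fixed by the identity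
theorem on the connected complement of a countable closed set (`eq_of_sq_eq_sq`). -/

lemma hasSumLocallyUniformly_zeta :
    HasSumLocallyUniformly (fun (l : L.lattice) (x : ℂ) ↦
      if (l : ℂ) = 0 then 1 / x else 1 / (x - l) + 1 / l + x / (l : ℂ) ^ 2) (zeta L) := by
  refine L.hasSumLocallyUniformly_aux (u := (2 * · ^ 2 * ‖·‖ ^ (-3 : ℝ))) _
    (fun _ _ ↦ (ZLattice.summable_norm_rpow _ _ (by simp; norm_num)).mul_left _) fun r hr ↦
    Filter.eventually_atTop.mpr ⟨2 * r, ?_⟩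
  rintro _ h s hs l rfl
  have hl : 0 < ‖(l : ℂ)‖ := by linarith
  have hl0 : (l : ℂ) ≠ 0 := norm_pos_iff.mp hl
  have hsl : ‖(l : ℂ)‖ / 2 ≤ ‖s - l‖ := by
    have := norm_sub_norm_le (l : ℂ) s
    rw [norm_sub_rev] at this
    linarith
  have hsl0 : s - l ≠ 0 := norm_pos_iff.mp (by linarith)
  rw [if_neg hl0]
  -- The correction terms cancel the expansion of `1 / (s - l)` through first order in `s`; what
  -- remains is `O(‖l‖⁻³)`, summable over a lattice of rank two.
  have : 1 / (s - l) + 1 / (l : ℂ) + s / (l : ℂ) ^ 2 = s ^ 2 / ((l : ℂ) ^ 2 * (s - l)) := by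
    field_simp
    ring
  rw [this, norm_div, norm_mul, norm_pow, norm_pow]
  calc ‖s‖ ^ 2 / (‖(l : ℂ)‖ ^ 2 * ‖s - l‖) ≤ r ^ 2 / (‖(l : ℂ)‖ ^ 2 * (‖(l : ℂ)‖ / 2)) := by
        gcongr
    _ = 2 * r ^ 2 / ‖(l : ℂ)‖ ^ 3 := by field
    _ = 2 * r ^ 2 * ‖l‖ ^ (-3 : ℝ) := by
        rw [div_eq_mul_inv]
        congr 1
        norm_cast

variable {L}

lemma sub_ne_zero_of_notMem {x : ℂ} (hx : x ∉ L.lattice) (l : L.lattice) : x - l ≠ 0 :=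
  fun h ↦ hx (sub_eq_zero.mp h ▸ l.2)

lemma ne_zero_of_notMem {x : ℂ} (hx : x ∉ L.lattice) : x ≠ 0 :=
  fun h ↦ hx (h ▸ L.lattice.zero_mem)

lemma hasDerivAt_zetaTerm {x : ℂ} (hx : x ∉ L.lattice) (l : L.lattice) :
    HasDerivAt (fun x : ℂ ↦ if (l : ℂ) = 0 then 1 / x else 1 / (x - l) + 1 / l + x / (l : ℂ) ^ 2)
      (-(1 / (x - l) ^ 2 - 1 / (l : ℂ) ^ 2)) x := by
  have h := sub_ne_zero_of_notMem hx l
  have h1 : HasDerivAt (fun x : ℂ ↦ 1 / (x - l)) (-1 / (x - l) ^ 2) x := by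
    simpa using ((hasDerivAt_id x).sub_const (l : ℂ)).fun_inv h
  split_ifs with hl
  · simp only [hl, sub_zero] at h1 ⊢
    convert h1 using 1
    simp [neg_div]
  · exact ((h1.add_const (1 / (l : ℂ))).fun_add
      ((hasDerivAt_id x).div_const ((l : ℂ) ^ 2))).congr_deriv (by ring)

variable (L)

lemma isOpen_compl_lattice : IsOpen ((L.lattice : Set ℂ)ᶜ) := L.isClosed_lattice.isOpen_compl

/-- Termwise differentiation of a locally uniformly convergent series of holomorphic functions. -/
lemma deriv_zeta {x : ℂ} (hx : x ∉ L.lattice) : HasDerivAt (zeta L) (-L.weierstrassP x) x := by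
  have hU := isOpen_compl_lattice L
  have hdiff : ∀ᶠ s : Finset L.lattice in atTop, DifferentiableOn ℂ (fun x ↦ ∑ l ∈ s,
      if (l : ℂ) = 0 then 1 / x else 1 / (x - l) + 1 / l + x / (l : ℂ) ^ 2)
      (L.lattice : Set ℂ)ᶜ :=
    .of_forall fun s ↦ .fun_sum fun l _ y hy ↦
      (hasDerivAt_zetaTerm hy l).differentiableAt.differentiableWithinAt
  have hz : TendstoLocallyUniformlyOn (fun (s : Finset L.lattice) x ↦ ∑ l ∈ s,
      if (l : ℂ) = 0 then 1 / x else 1 / (x - l) + 1 / l + x / (l : ℂ) ^ 2) (zeta L) atTop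
      (L.lattice : Set ℂ)ᶜ :=
    (hasSumLocallyUniformly_zeta L).tendstoLocallyUniformlyOn
  have hd : DifferentiableAt ℂ (zeta L) x :=
    (hz.differentiableOn hdiff hU).differentiableAt (hU.mem_nhds hx)
  have h1 := (hz.deriv hdiff hU).tendsto_at hx
  have h2 : Tendsto (fun s : Finset L.lattice ↦ ∑ l ∈ s, -(1 / (x - l) ^ 2 - 1 / (l : ℂ) ^ 2))
      atTop (𝓝 (-L.weierstrassP x)) := (L.hasSum_weierstrassP x).neg
  have h3 : deriv (zeta L) x = -L.weierstrassP x := by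
    refine tendsto_nhds_unique (h1.congr fun s ↦ ?_) h2
    exact (HasDerivAt.fun_sum fun l _ ↦ hasDerivAt_zetaTerm hx l).deriv
  exact h3 ▸ hd.hasDerivAt

/-- The factors of the canonical product of `σ`. -/
def sigmaFactor (l x : ℂ) : ℂ :=
  if l = 0 then x else (1 - x / l) * Complex.exp (x / l + x ^ 2 / (2 * l ^ 2))

/-- The logarithm of the factor is the remainder of the Taylor series of `log (1 - t)` after the
quadratic term, hence `O(t³)`. This is the order needed for the product over the lattice to
converge. -/
lemma norm_elementaryFactor_sub_one_le {t : ℂ} (ht : ‖t‖ ≤ 1 / 2) :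
    ‖(1 - t) * Complex.exp (t + t ^ 2 / 2) - 1‖ ≤ 2 * ‖t‖ ^ 3 := by
  have ht1 : ‖t‖ < 1 := by linarith
  have h := Complex.norm_log_sub_logTaylor_le 2 (z := -t) (by simpa using ht1)
  have hT : Complex.logTaylor (2 + 1) (-t) = -t - t ^ 2 / 2 := by
    simp [Complex.logTaylor_succ, Complex.logTaylor_zero]
    ring
  rw [hT, norm_neg] at h
  have h1t : 1 - t ≠ 0 := by
    intro h0
    rw [sub_eq_zero] at h0
    rw [← h0] at ht1
    simp at ht1
  set s := Complex.log (1 + -t) - (-t - t ^ 2 / 2) with hs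
  have hexp : (1 - t) * Complex.exp (t + t ^ 2 / 2) = Complex.exp s := by
    have : s = Complex.log (1 - t) + (t + t ^ 2 / 2) := by rw [hs, ← sub_eq_add_neg]; ring
    rw [this, Complex.exp_add (Complex.log _), Complex.exp_log h1t]
  have hinv : (1 - ‖t‖)⁻¹ ≤ 2 := by
    rw [inv_le_comm₀ (by linarith) (by norm_num)]
    linarith
  have hn : 0 ≤ ‖t‖ ^ 3 := by positivity
  have h3 : ‖s‖ ≤ ‖t‖ ^ 3 := by
    refine h.trans ?_
    have : ‖t‖ ^ 3 * (1 - ‖t‖)⁻¹ ≤ ‖t‖ ^ 3 * 2 := by gcongr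
    norm_num
    linarith
  have h4 : ‖t‖ ^ 3 ≤ 1 := pow_le_one₀ (norm_nonneg _) ht1.le
  rw [hexp]
  exact (Complex.norm_exp_sub_one_le (h3.trans h4)).trans (by linarith)

lemma norm_sigmaFactor_sub_one_le {r : ℝ} {s l : ℂ} (hs : ‖s‖ < r) (h : 2 * r ≤ ‖l‖) :
    ‖sigmaFactor l s - 1‖ ≤ 2 * r ^ 3 * ‖l‖ ^ (-3 : ℝ) := by
  have hr : 0 < r := (norm_nonneg _).trans_lt hs
  have hl : 0 < ‖l‖ := by linarith
  have hl0 : l ≠ 0 := norm_pos_iff.mp hl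
  have h1 : s / l + s ^ 2 / (2 * l ^ 2) = s / l + (s / l) ^ 2 / 2 := by field
  rw [sigmaFactor, if_neg hl0, h1]
  refine (norm_elementaryFactor_sub_one_le ?_).trans ?_
  · rw [norm_div, div_le_iff₀ hl]
    linarith
  · rw [norm_div, div_pow, mul_assoc]
    gcongr 2 * ?_
    rw [div_eq_mul_inv]
    gcongr ?_ * ?_
    · gcongr
    · exact le_of_eq (by norm_cast)

lemma summable_rpow_lattice (c : ℝ) : Summable fun l : L.lattice ↦ c * ‖(l : ℂ)‖ ^ (-3 : ℝ) :=
  (ZLattice.summable_norm_rpow L.lattice (-3) (by simp; norm_num)).mul_left c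

lemma eventually_norm_lattice_ge (r : ℝ) :
    ∀ᶠ l : L.lattice in cofinite, r ≤ ‖(l : ℂ)‖ := by
  refine (isCompact_iff_finite.mp (isCompact_closedBall (0 : L.lattice) r)).subset ?_
  intro l hl
  simp only [Set.mem_compl_iff, Set.mem_ofPred_eq, not_le] at hl
  simpa using hl.le

@[fun_prop]
lemma differentiable_sigmaFactor (l : ℂ) : Differentiable ℂ (sigmaFactor l) := by
  unfold sigmaFactor
  split_ifs <;> fun_prop

lemma multipliableLocallyUniformlyOn_sigmaFactor (r : ℝ) :
    MultipliableLocallyUniformlyOn (fun l : L.lattice ↦ sigmaFactor l) (Metric.ball 0 r) := by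
  have h := (summable_rpow_lattice L (2 * r ^ 3)).multipliableLocallyUniformlyOn_one_add
    (f := fun l : L.lattice ↦ fun x ↦ sigmaFactor l x - 1) (K := Metric.ball 0 r)
    Metric.isOpen_ball ?_ fun l ↦ ((differentiable_sigmaFactor l).continuous.sub
      continuous_const).continuousOn
  · simpa using h
  · filter_upwards [eventually_norm_lattice_ge L (2 * r)] with l hl x hx
    exact norm_sigmaFactor_sub_one_le (by simpa using hx) hl

lemma sigma_eq_tprod (x : ℂ) : sigma L x = ∏' l : L.lattice, sigmaFactor l x := rfl

@[fun_prop]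
lemma differentiable_sigma : Differentiable ℂ (sigma L) := by
  intro x
  have h := (multipliableLocallyUniformlyOn_sigmaFactor L (‖x‖ + 1)).hasProdLocallyUniformlyOn
  refine (h.differentiableOn (.of_forall fun s ↦ ?_) Metric.isOpen_ball).differentiableAt
    (Metric.isOpen_ball.mem_nhds (by simp))
  exact DifferentiableOn.fun_finsetProd fun l _ ↦ (differentiable_sigmaFactor l).differentiableOn

lemma sigma_eq_zero_of_mem {x : ℂ} (hx : x ∈ L.lattice) : sigma L x = 0 := by
  refine tprod_of_exists_eq_zero ⟨⟨x, hx⟩, ?_⟩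
  split_ifs with h
  · exact h
  · simp [div_self (show x ≠ 0 from h)]

variable {L} in
lemma sigmaFactor_ne_zero {x : ℂ} (hx : x ∉ L.lattice) (l : L.lattice) :
    sigmaFactor l x ≠ 0 := by
  unfold sigmaFactor
  split_ifs with hl
  · exact ne_zero_of_notMem hx
  · refine mul_ne_zero ?_ (Complex.exp_ne_zero _)
    rw [sub_ne_zero, ne_eq, eq_comm, div_eq_one_iff_eq hl]
    exact sub_ne_zero.mp (sub_ne_zero_of_notMem hx l)

lemma summable_norm_sigmaFactor_sub_one (x : ℂ) :
    Summable fun l : L.lattice ↦ ‖sigmaFactor l x - 1‖ := by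
  refine .of_norm_bounded_eventually (summable_rpow_lattice L (2 * (‖x‖ + 1) ^ 3)) ?_
  filter_upwards [eventually_norm_lattice_ge L (2 * (‖x‖ + 1))] with l hl
  simpa using norm_sigmaFactor_sub_one_le (lt_add_one _) hl

lemma sigma_ne_zero {x : ℂ} (hx : x ∉ L.lattice) : sigma L x ≠ 0 := by
  have h := tprod_one_add_ne_zero_of_summable (f := fun l : L.lattice ↦ sigmaFactor l x - 1)
    (by simpa using sigmaFactor_ne_zero hx) (summable_norm_sigmaFactor_sub_one L x)
  simpa [sigma_eq_tprod] using h

lemma sigma_eq_zero_iff {x : ℂ} : sigma L x = 0 ↔ x ∈ L.lattice :=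
  ⟨fun h ↦ by_contra fun hx ↦ sigma_ne_zero L hx h, sigma_eq_zero_of_mem L⟩

variable {L} in
lemma logDeriv_sigmaFactor {x : ℂ} (hx : x ∉ L.lattice) (l : L.lattice) :
    logDeriv (sigmaFactor l) x =
      if (l : ℂ) = 0 then 1 / x else 1 / (x - l) + 1 / l + x / (l : ℂ) ^ 2 := by
  have h := sub_ne_zero_of_notMem hx l
  split_ifs with hl
  · have : sigmaFactor l = id := by ext; simp [sigmaFactor, hl]
    simp [this, logDeriv_apply]
  · have he : HasDerivAt (fun x : ℂ ↦ (1 - x / l) * Complex.exp (x / l + x ^ 2 / (2 * (l : ℂ) ^ 2)))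
        (-(1 / l) * Complex.exp (x / l + x ^ 2 / (2 * (l : ℂ) ^ 2)) + (1 - x / l) *
          (Complex.exp (x / l + x ^ 2 / (2 * (l : ℂ) ^ 2)) * (1 / l + 2 * x / (2 * (l : ℂ) ^ 2)))) x := by
      have h1 : HasDerivAt (fun x : ℂ ↦ 1 - x / l) (-(1 / l)) x :=
        ((hasDerivAt_id x).div_const (l : ℂ)).const_sub 1
      have h2 : HasDerivAt (fun x : ℂ ↦ x / l + x ^ 2 / (2 * (l : ℂ) ^ 2))
          (1 / l + 2 * x / (2 * (l : ℂ) ^ 2)) x := by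
        simpa using ((hasDerivAt_id x).div_const (l : ℂ)).fun_add
          ((hasDerivAt_pow 2 x).div_const (2 * (l : ℂ) ^ 2))
      exact h1.mul h2.cexp
    have hs : sigmaFactor l =
        fun x ↦ (1 - x / l) * Complex.exp (x / l + x ^ 2 / (2 * (l : ℂ) ^ 2)) := by
      ext; simp [sigmaFactor, hl]
    rw [hs, logDeriv_apply, he.deriv]
    have h1 : (1 - x / l) ≠ 0 := by
      rw [sub_ne_zero, ne_eq, eq_comm, div_eq_one_iff_eq hl]
      exact sub_ne_zero.mp h
    have hlx : (l : ℂ) - x ≠ 0 := fun h0 ↦ h (by linear_combination -h0)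
    have := Complex.exp_ne_zero (x / l + x ^ 2 / (2 * (l : ℂ) ^ 2))
    field_simp
    ring

/-- The logarithmic derivatives of the factors of the product are the terms of `ζ`. -/
lemma hasDerivAt_sigma {x : ℂ} (hx : x ∉ L.lattice) :
    HasDerivAt (sigma L) (zeta L x * sigma L x) x := by
  have hs := sigma_ne_zero L hx
  have h := logDeriv_tprod_eq_tsum (f := fun l : L.lattice ↦ sigmaFactor l) Metric.isOpen_ball
    (show x ∈ Metric.ball 0 (‖x‖ + 1) by simp) (sigmaFactor_ne_zero hx)
    (fun l ↦ (differentiable_sigmaFactor l).differentiableOn) ?_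
    (multipliableLocallyUniformlyOn_sigmaFactor L _) (by simpa [sigma_eq_tprod] using hs)
  · simp_rw [logDeriv_sigmaFactor hx] at h
    have h' : logDeriv (sigma L) x = zeta L x := h
    rw [logDeriv_apply, div_eq_iff hs] at h'
    exact h' ▸ (differentiable_sigma L x).hasDerivAt
  · simp_rw [logDeriv_sigmaFactor hx]
    exact ((hasSumLocallyUniformly_zeta L).hasSum (x := x)).summable

/-- The canonical product of `σ (x) / x`. -/
def sigmaExcept (x : ℂ) : ℂ := ∏' l : L.lattice, if (l : ℂ) = 0 then 1 else sigmaFactor l x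

lemma multipliableLocallyUniformlyOn_sigmaExcept (r : ℝ) :
    MultipliableLocallyUniformlyOn
      (fun (l : L.lattice) x ↦ if (l : ℂ) = 0 then 1 else sigmaFactor l x)
      (Metric.ball 0 r) := by
  have h := (summable_rpow_lattice L (2 * r ^ 3)).multipliableLocallyUniformlyOn_one_add
    (f := fun l : L.lattice ↦ fun x ↦ (if (l : ℂ) = 0 then 1 else sigmaFactor l x) - 1)
    (K := Metric.ball 0 r) Metric.isOpen_ball ?_ fun l ↦ ?_
  · simpa using h
  · filter_upwards [eventually_norm_lattice_ge L (2 * r)] with l hl x hx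
    have hx' : ‖x‖ < r := by simpa using hx
    rw [if_neg (norm_pos_iff.mp (by linarith [norm_nonneg x]))]
    exact norm_sigmaFactor_sub_one_le hx' hl
  · split_ifs
    · fun_prop
    · exact ((differentiable_sigmaFactor l).continuous.sub continuous_const).continuousOn

@[fun_prop]
lemma differentiable_sigmaExcept : Differentiable ℂ (sigmaExcept L) := by
  intro x
  have h := (multipliableLocallyUniformlyOn_sigmaExcept L (‖x‖ + 1)).hasProdLocallyUniformlyOn
  refine (h.differentiableOn (.of_forall fun s ↦ ?_) Metric.isOpen_ball).differentiableAt
    (Metric.isOpen_ball.mem_nhds (by simp))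
  refine DifferentiableOn.fun_finsetProd fun l _ ↦ ?_
  split_ifs
  · fun_prop
  · exact (differentiable_sigmaFactor l).differentiableOn

lemma sigmaExcept_zero : sigmaExcept L 0 = 1 := by
  have : ∀ l : L.lattice, (if (l : ℂ) = 0 then (1 : ℂ) else sigmaFactor l 0) = 1 := by
    intro l
    split_ifs with h <;> simp [sigmaFactor, h]
  exact (tprod_congr this).trans tprod_one

lemma sigmaExcept_neg (x : ℂ) : sigmaExcept L (-x) = sigmaExcept L x := by
  unfold sigmaExcept
  rw [← (Equiv.neg L.lattice).tprod_eq]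
  congr with l
  simp only [Equiv.neg_apply, NegMemClass.coe_neg, neg_eq_zero]
  split_ifs with h <;> simp [sigmaFactor, h]

lemma sigma_eq_mul_sigmaExcept (x : ℂ) : sigma L x = x * sigmaExcept L x := by
  have h0 : HasProd (fun l : L.lattice ↦ if l = 0 then x else 1) x := hasProd_ite_eq 0 x
  have h1 := ((multipliableLocallyUniformlyOn_sigmaExcept L (‖x‖ + 1)).multipliable
    (show x ∈ Metric.ball 0 (‖x‖ + 1) by simp)).hasProd
  refine (tprod_congr fun l ↦ ?_).trans (h0.mul h1).tprod_eq
  have : l = 0 ↔ (l : ℂ) = 0 := by simp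
  simp only [this, sigmaFactor]
  split_ifs <;> simp

lemma sigma_neg (x : ℂ) : sigma L (-x) = -sigma L x := by
  simp [sigma_eq_mul_sigmaExcept, sigmaExcept_neg]

lemma zeta_neg (x : ℂ) : zeta L (-x) = -zeta L x := by
  unfold zeta
  rw [← tsum_neg, ← (Equiv.neg L.lattice).tsum_eq]
  congr with l
  simp only [Equiv.neg_apply, NegMemClass.coe_neg, neg_eq_zero]
  split_ifs
  · rw [one_div, one_div, inv_neg]
  · rw [show -x - -(l : ℂ) = -(x - l) by ring, neg_sq]
    simp only [one_div, inv_neg]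
    ring

/-! ### Behaviour at the origin -/

/-- `σ(x)/x` is even; this removes the constant term of `ζ(x) - 1/x` at the origin. -/
lemma deriv_sigmaExcept_zero : deriv (sigmaExcept L) 0 = 0 := by
  have h : deriv (fun x ↦ sigmaExcept L (-x)) 0 = -deriv (sigmaExcept L) (-0) :=
    deriv_comp_neg _ _
  simp only [sigmaExcept_neg, neg_zero] at h
  exact CharZero.eq_neg_self_iff.mp h

lemma deriv_sigma (x : ℂ) :
    HasDerivAt (sigma L) (sigmaExcept L x + x * deriv (sigmaExcept L) x) x := by
  have h := (hasDerivAt_id x).fun_mul (differentiable_sigmaExcept L x).hasDerivAt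
  simp only [id, one_mul] at h
  exact h.congr_of_eventuallyEq (.of_forall (sigma_eq_mul_sigmaExcept L))

lemma zeta_eq {x : ℂ} (hx : x ∉ L.lattice) :
    zeta L x = 1 / x + deriv (sigmaExcept L) x / sigmaExcept L x := by
  have h := (hasDerivAt_sigma L hx).unique (deriv_sigma L x)
  have h0 := sigma_ne_zero L hx
  rw [sigma_eq_mul_sigmaExcept] at h h0
  have h1 := left_ne_zero_of_mul h0
  have h2 := right_ne_zero_of_mul h0
  field_simp
  linear_combination h

lemma eventually_notMem_lattice (x : ℂ) : ∀ᶠ y in 𝓝[≠] x, y ∉ L.lattice := by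
  filter_upwards [self_mem_nhdsWithin,
    mem_nhdsWithin_of_mem_nhds (L.compl_lattice_sdiff_singleton_mem_nhds x)] with y hy hy' h
  exact hy' ⟨h, hy⟩

lemma tendsto_zeta_sub_inv : Tendsto (fun x ↦ zeta L x - 1 / x) (𝓝[≠] 0) (𝓝 0) := by
  have hd : ContinuousAt (fun x ↦ deriv (sigmaExcept L) x / sigmaExcept L x) 0 := by
    refine ContinuousAt.div ?_ (differentiable_sigmaExcept L).continuous.continuousAt
      (by simp [sigmaExcept_zero])
    exact ((differentiable_sigmaExcept L).contDiff (n := 1)).continuous_deriv le_rfl |>.continuousAt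
  have h := hd.tendsto
  rw [deriv_sigmaExcept_zero, zero_div] at h
  refine (h.mono_left nhdsWithin_le_nhds).congr' ?_
  filter_upwards [eventually_notMem_lattice L 0] with x hx
  rw [zeta_eq L hx]
  ring

lemma tendsto_sigma_div : Tendsto (fun x ↦ sigma L x / x) (𝓝[≠] 0) (𝓝 1) := by
  have h : Tendsto (sigmaExcept L) (𝓝 0) (𝓝 1) := by
    simpa [sigmaExcept_zero] using (differentiable_sigmaExcept L).continuous.tendsto 0
  refine (h.mono_left nhdsWithin_le_nhds).congr' ?_
  filter_upwards [self_mem_nhdsWithin] with x hx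
  rw [sigma_eq_mul_sigmaExcept, mul_div_cancel_left₀ _ hx]

lemma tendsto_mul_zeta : Tendsto (fun x ↦ x * zeta L x) (𝓝[≠] 0) (𝓝 1) := by
  have h1 : Tendsto (fun x : ℂ ↦ x) (𝓝[≠] 0) (𝓝 0) := tendsto_nhdsWithin_of_tendsto_nhds tendsto_id
  have h := (h1.mul (tendsto_zeta_sub_inv L)).const_add 1
  simp only [mul_zero, add_zero] at h
  refine h.congr' ?_
  filter_upwards [self_mem_nhdsWithin] with x hx
  have : x ≠ 0 := hx
  field_simp
  ring

lemma weierstrassP_eq {x : ℂ} :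
    L.weierstrassP x = L.weierstrassPExcept 0 x + 1 / x ^ 2 := by
  simpa using (L.weierstrassPExcept_add 0 x).symm

lemma derivWeierstrassP_eq {x : ℂ} :
    L.derivWeierstrassP x = L.derivWeierstrassPExcept 0 x - 2 / x ^ 3 := by
  simpa using (L.derivWeierstrassPExcept_sub 0 x).symm

lemma tendsto_weierstrassPExcept : Tendsto (L.weierstrassPExcept 0) (𝓝[≠] 0) (𝓝 0) := by
  have := (L.analyticAt_weierstrassPExcept 0).continuousAt.tendsto
  rw [L.weierstrassPExcept_zero] at this
  exact this.mono_left nhdsWithin_le_nhds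

lemma tendsto_derivWeierstrassPExcept : Tendsto (L.derivWeierstrassPExcept 0) (𝓝[≠] 0) (𝓝 0) := by
  have := (L.analyticAt_derivWeierstrassPExcept 0).continuousAt.tendsto
  rw [L.derivWeierstrassPExcept_zero_zero] at this
  exact this.mono_left nhdsWithin_le_nhds

lemma tendsto_id_punctured : Tendsto (fun x : ℂ ↦ x) (𝓝[≠] 0) (𝓝 0) :=
  tendsto_nhdsWithin_of_tendsto_nhds tendsto_id

lemma tendsto_sq_mul_weierstrassP : Tendsto (fun x ↦ x ^ 2 * L.weierstrassP x) (𝓝[≠] 0) (𝓝 1) := by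
  have h := ((tendsto_id_punctured.pow 2).mul (tendsto_weierstrassPExcept L)).const_add 1
  simp only [mul_zero, add_zero] at h
  refine h.congr' ?_
  filter_upwards [self_mem_nhdsWithin] with x hx
  have : x ≠ 0 := hx
  rw [weierstrassP_eq]
  field_simp
  ring

lemma tendsto_cube_mul_derivWeierstrassP :
    Tendsto (fun x ↦ x ^ 3 * L.derivWeierstrassP x) (𝓝[≠] 0) (𝓝 (-2)) := by
  have h := ((tendsto_id_punctured.pow 3).mul (tendsto_derivWeierstrassPExcept L)).sub_const 2
  simp only [mul_zero, zero_sub] at h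
  refine h.congr' ?_
  filter_upwards [self_mem_nhdsWithin] with x hx
  have : x ≠ 0 := hx
  rw [derivWeierstrassP_eq]
  field_simp

/-- Near `0` the elliptic function `℘'/(2℘)` is `-1/u + o(1)`, as is `-ζ(u)`. It serves to
compensate `e^{ζ(u)x}` in `Φ` as `u → 0` without leaving the elliptic functions. -/
lemma tendsto_derivWeierstrassP_div_add_zeta :
    Tendsto (fun u ↦ L.derivWeierstrassP u / (2 * L.weierstrassP u) + zeta L u)
      (𝓝[≠] 0) (𝓝 0) := by
  have hE := tendsto_weierstrassPExcept L
  have hE' := tendsto_derivWeierstrassPExcept L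
  have hi := tendsto_id_punctured
  have h1 : Tendsto (fun u ↦ u * (u * L.derivWeierstrassPExcept 0 u +
      2 * L.weierstrassPExcept 0 u) / (2 * (1 + u ^ 2 * L.weierstrassPExcept 0 u)))
      (𝓝[≠] 0) (𝓝 0) := by
    have hn := hi.mul ((hi.mul hE').add (hE.const_mul 2))
    have hd := (((hi.pow 2).mul hE).const_add 1).const_mul 2
    simpa [Pi.div_def] using hn.div hd (by norm_num)
  have h := h1.add (tendsto_zeta_sub_inv L)
  rw [add_zero] at h
  refine h.congr' ?_
  have hne : ∀ᶠ u in 𝓝[≠] (0 : ℂ), u ^ 2 * L.weierstrassP u ≠ 0 :=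
    (tendsto_sq_mul_weierstrassP L).eventually_ne one_ne_zero
  filter_upwards [self_mem_nhdsWithin, hne] with u hu hP
  have hu0 : u ≠ 0 := hu
  have e1 : L.weierstrassPExcept 0 u = L.weierstrassP u - 1 / u ^ 2 := by
    rw [weierstrassP_eq]; ring
  have e2 : L.derivWeierstrassPExcept 0 u = L.derivWeierstrassP u + 2 / u ^ 3 := by
    rw [derivWeierstrassP_eq]; ring
  have hP' : L.weierstrassP u ≠ 0 := right_ne_zero_of_mul hP
  have e3 : 1 + u ^ 2 * (L.weierstrassP u - 1 / u ^ 2) = u ^ 2 * L.weierstrassP u := by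
    field_simp; ring
  rw [e1, e2, e3]
  field_simp
  ring

end TreibichVerdier
end

noncomputable section

namespace TreibichVerdier

variable (L : PeriodPair)

/-! ### Complements of countable closed sets -/

lemma countable_lattice : (L.lattice : Set ℂ).Countable :=
  Set.countable_coe_iff.mp L.latticeEquivProd.injective.countable

lemma countable_translate (u : ℂ) : {x : ℂ | x + u ∈ L.lattice}.Countable :=
  (countable_lattice L).preimage (add_left_injective u)

lemma isClosed_translate (u : ℂ) : IsClosed {x : ℂ | x + u ∈ L.lattice} :=
  L.isClosed_lattice.preimage (continuous_add_const u)

lemma isPreconnected_compl_of_countable {S : Set ℂ} (hS : S.Countable) : IsPreconnected Sᶜ :=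
  (hS.isConnected_compl_of_one_lt_rank (by simp [Complex.rank_real_complex])).isPreconnected

/-- Identities proved by dividing hold off a countable set, whose complement is dense; continuity
supplies the rest. -/
lemma eq_of_eq_off_countable {S C : Set ℂ} (hS : IsClosed S) (hC : C.Countable) {f g : ℂ → ℂ}
    (hf : ContinuousOn f Sᶜ) (hg : ContinuousOn g Sᶜ) (h : ∀ x ∉ S, x ∉ C → f x = g x) {x : ℂ}
    (hx : x ∉ S) : f x = g x := by
  refine Set.EqOn.of_subset_closure (s := Sᶜ ∩ Cᶜ) (fun x hx ↦ h x hx.1 hx.2) hf hg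
    Set.inter_subset_left ?_ hx
  exact (hC.dense_compl ℂ).open_subset_closure_inter hS.isOpen_compl

/-- On a connected domain `(f - g)(f + g) = 0` forces one factor to vanish identically, so a single
point decides the sign. -/
lemma eq_of_sq_eq_sq {S : Set ℂ} (hS : IsClosed S) (hC : S.Countable) {f g : ℂ → ℂ}
    (hf : DifferentiableOn ℂ f Sᶜ) (hg : DifferentiableOn ℂ g Sᶜ)
    (h : ∀ x ∉ S, f x ^ 2 = g x ^ 2) (h0 : ∃ x ∉ S, f x + g x ≠ 0) {x : ℂ} (hx : x ∉ S) :
    f x = g x := by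
  have hU := hS.isOpen_compl
  have := AnalyticOnNhd.eq_zero_or_eq_zero_of_mul_eq_zero
    ((hf.sub hg).analyticOnNhd hU) ((hf.add hg).analyticOnNhd hU)
    (fun z hz ↦ by simp only [Pi.sub_apply, Pi.add_apply]; linear_combination h z hz)
    (isPreconnected_compl_of_countable hC)
  obtain h1 | h1 := this
  · exact sub_eq_zero.mp (h1 x hx)
  · obtain ⟨y, hy, hy0⟩ := h0
    exact absurd (h1 y hy) hy0

/-! ### Liouville's theorem for elliptic functions -/

/-- Boundedness removes the singularity at `0`, periodicity removes all others, and a periodic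
entire function is bounded. -/
lemma exists_eq_const_of_periodic {f : ℂ → ℂ} (hd : DifferentiableOn ℂ f (L.lattice : Set ℂ)ᶜ)
    (hp : ∀ x ∉ L.lattice, ∀ l ∈ L.lattice, f (x + l) = f x)
    (hb : f =O[𝓝[≠] 0] (1 : ℂ → ℝ)) : ∃ c, ∀ x ∉ L.lattice, f x = c := by
  classical
  have hU : ((L.lattice : Set ℂ) \ {0})ᶜ ∈ 𝓝 (0 : ℂ) := L.compl_lattice_sdiff_singleton_mem_nhds 0
  have hsub : ((L.lattice : Set ℂ) \ {0})ᶜ \ {0} ⊆ (L.lattice : Set ℂ)ᶜ :=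
    fun x hx hxl ↦ hx.1 ⟨hxl, hx.2⟩
  set g := Function.update f 0 (limUnder (𝓝[≠] 0) f) with hg
  have hgd : DifferentiableOn ℂ g ((L.lattice : Set ℂ) \ {0})ᶜ := by
    refine Complex.differentiableOn_update_limUnder_of_isLittleO hU (hd.mono hsub) ?_
    have h1 : (fun z ↦ f z - f 0) =O[𝓝[≠] 0] (fun _ ↦ (1 : ℝ)) :=
      hb.sub (Asymptotics.isBigO_const_one ℝ (f 0) _)
    refine h1.trans_isLittleO ((Asymptotics.isLittleO_one_left_iff ℝ).mpr ?_)
    simpa using tendsto_norm_inv_nhdsNE_zero_atTop (α := ℂ)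
  -- Periodicity forces the removed value at `0` to be the value at every lattice point.
  let F : ℂ → ℂ := fun x ↦ if x ∈ L.lattice then g 0 else f x
  have hF0 : ∀ x ∈ ((L.lattice : Set ℂ) \ {0})ᶜ, F x = g x := by
    intro x hx
    by_cases hx0 : x = 0
    · simp [F, hx0]
    · have : x ∉ L.lattice := fun h ↦ hx ⟨h, hx0⟩
      simp [F, this, hg, hx0]
  have hFp : ∀ x, ∀ l ∈ L.lattice, F (x + l) = F x := by
    intro x l hl
    have : x + l ∈ L.lattice ↔ x ∈ L.lattice := L.lattice.add_mem_iff_left hl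
    by_cases hx : x ∈ L.lattice
    · simp [F, this, hx]
    · simp [F, this, hx, hp x hx l hl]
  have hFd0 : DifferentiableAt ℂ F 0 :=
    (hgd.differentiableAt hU).congr_of_eventuallyEq (by filter_upwards [hU] with x hx; exact hF0 x hx)
  have hFd : Differentiable ℂ F := by
    intro x
    by_cases hx : x ∈ L.lattice
    · have h1 : F = fun y ↦ F (y - x) := by
        ext y
        rw [sub_eq_add_neg, hFp _ _ (L.lattice.neg_mem hx)]
      rw [h1]
      exact DifferentiableAt.comp (f := fun y ↦ y - x) x (by simpa using hFd0) (by fun_prop)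
    · have hx' : (L.lattice : Set ℂ)ᶜ ∈ 𝓝 x := (isOpen_compl_lattice L).mem_nhds hx
      refine (hd.differentiableAt hx').congr_of_eventuallyEq ?_
      filter_upwards [hx'] with y hy
      exact if_neg hy
  have hc := hFd.apply_eq_apply_of_bounded
    (IsZLattice.isCompact_range_of_periodic L.lattice F hFd.continuous hFp).isBounded
  refine ⟨F 0, fun x hx ↦ ?_⟩
  rw [← hc x 0]
  exact (if_neg hx).symm

/-! ### Quasi-periodicity -/

variable {L} in
lemma add_notMem {x l : ℂ} (hx : x ∉ L.lattice) (hl : l ∈ L.lattice) : x + l ∉ L.lattice :=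
  fun h ↦ hx ((L.lattice.add_mem_iff_left hl).mp h)

lemma weierstrassP_add {l : ℂ} (hl : l ∈ L.lattice) (x : ℂ) :
    L.weierstrassP (x + l) = L.weierstrassP x := L.weierstrassP_add_coe x ⟨l, hl⟩

lemma derivWeierstrassP_add {l : ℂ} (hl : l ∈ L.lattice) (x : ℂ) :
    L.derivWeierstrassP (x + l) = L.derivWeierstrassP x := L.derivWeierstrassP_add_coe x ⟨l, hl⟩

/-- `ζ(x + l) - ζ(x)` has derivative zero on the connected complement of the lattice. With its
constant value `η`, the quotient `σ(x + l) / (e^{ηx} σ(x))` has derivative zero as well. -/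
lemma exists_quasiPeriod {l : ℂ} (hl : l ∈ L.lattice) :
    ∃ η C : ℂ, C ≠ 0 ∧ (∀ x ∉ L.lattice, zeta L (x + l) = zeta L x + η) ∧
      ∀ x, sigma L (x + l) = C * Complex.exp (η * x) * sigma L x := by
  have hU := isOpen_compl_lattice L
  have hpre := isPreconnected_compl_of_countable (countable_lattice L)
  have hzd : ∀ x ∈ (L.lattice : Set ℂ)ᶜ, HasDerivAt (fun x ↦ zeta L (x + l) - zeta L x) 0 x := by
    intro x hx
    have h1 := (deriv_zeta L (add_notMem hx hl)).comp_add_const x l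
    refine (h1.fun_sub (deriv_zeta L hx)).congr_deriv ?_
    rw [weierstrassP_add L hl]
    ring
  obtain ⟨η, hη⟩ := hU.exists_is_const_of_deriv_eq_zero hpre
    (fun x hx ↦ (hzd x hx).differentiableAt.differentiableWithinAt) (fun x hx ↦ (hzd x hx).deriv)
  have hη' : ∀ x ∉ L.lattice, zeta L (x + l) = zeta L x + η := fun x hx ↦ by
    linear_combination hη x hx
  have hsd : ∀ x ∈ (L.lattice : Set ℂ)ᶜ,
      HasDerivAt (fun x ↦ sigma L (x + l) / (Complex.exp (η * x) * sigma L x)) 0 x := by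
    intro x hx
    have h1 := (hasDerivAt_sigma L (add_notMem hx hl)).comp_add_const x l
    have h2 : HasDerivAt (fun x ↦ Complex.exp (η * x)) (Complex.exp (η * x) * η) x := by
      simpa using ((hasDerivAt_id x).const_mul η).cexp
    have hs := sigma_ne_zero L hx
    have he := Complex.exp_ne_zero (η * x)
    refine (h1.fun_div (h2.fun_mul (hasDerivAt_sigma L hx)) (mul_ne_zero he hs)).congr_deriv ?_
    rw [hη' x hx]
    field_simp
    ring
  obtain ⟨C, hC⟩ := hU.exists_is_const_of_deriv_eq_zero hpre
    (fun x hx ↦ (hsd x hx).differentiableAt.differentiableWithinAt) (fun x hx ↦ (hsd x hx).deriv)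
  have hC' : ∀ x ∉ L.lattice, sigma L (x + l) = C * Complex.exp (η * x) * sigma L x := by
    intro x hx
    rw [← hC x hx]
    have hs := sigma_ne_zero L hx
    have he := Complex.exp_ne_zero (η * x)
    field_simp
  refine ⟨η, C, ?_, hη', fun x ↦ ?_⟩
  · rintro rfl
    have hx := L.ω₁_div_two_notMem_lattice
    exact sigma_ne_zero L (add_notMem hx hl) (by simp [hC' _ hx])
  · by_cases hx : x ∈ L.lattice
    · simp [sigma_eq_zero_of_mem L hx, sigma_eq_zero_of_mem L (L.lattice.add_mem hx hl)]
    · exact hC' x hx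

/-! ### The half periods -/

lemma two_mul_halfPeriod_mem (a : Fin 3) : 2 * halfPeriod L a ∈ L.lattice := by
  fin_cases a <;> simp only [halfPeriod, PeriodPair.mem_lattice]
  · exact ⟨1, 0, by simp; ring⟩
  · exact ⟨0, 1, by simp; ring⟩
  · exact ⟨1, 1, by simp; ring⟩

lemma halfPeriod_notMem (a : Fin 3) : halfPeriod L a ∉ L.lattice := by
  fin_cases a
  · exact L.ω₁_div_two_notMem_lattice
  · exact L.ω₂_div_two_notMem_lattice
  · have h := (L.mul_ω₁_add_mul_ω₂_mem_lattice (α := 1 / 2) (β := 1 / 2)).not.mpr (by norm_num)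
    have e1 : (L.ω₁ + L.ω₂) / 2 = ((1 / 2 : ℚ) : ℂ) * L.ω₁ + ((1 / 2 : ℚ) : ℂ) * L.ω₂ := by
      push_cast; ring
    change (L.ω₁ + L.ω₂) / 2 ∉ L.lattice
    rwa [e1]

lemma halfPeriod_add_add_mem {i j k : Fin 3} (hij : i ≠ j) (hjk : j ≠ k) (hik : i ≠ k) :
    halfPeriod L i + halfPeriod L j + halfPeriod L k ∈ L.lattice := by
  have h : halfPeriod L i + halfPeriod L j + halfPeriod L k = L.ω₁ + L.ω₂ := by
    fin_cases i <;> fin_cases j <;> fin_cases k <;>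
      simp_all only [halfPeriod, ne_eq, not_true_eq_false] <;> simp <;> ring
  exact h ▸ L.lattice.add_mem L.ω₁_mem_lattice L.ω₂_mem_lattice

lemma exists_third {i j : Fin 3} (hij : i ≠ j) : ∃ k, j ≠ k ∧ i ≠ k := by
  decide +revert

lemma halfPeriod_add_notMem {i j : Fin 3} (hij : i ≠ j) :
    halfPeriod L i + halfPeriod L j ∉ L.lattice := by
  obtain ⟨k, hjk, hik⟩ := exists_third hij
  intro h
  refine halfPeriod_notMem L k ?_
  have := L.lattice.sub_mem (halfPeriod_add_add_mem L hij hjk hik) h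
  simpa using this

lemma halfPeriod_sub_notMem {i j : Fin 3} (hij : i ≠ j) :
    halfPeriod L i - halfPeriod L j ∉ L.lattice := by
  intro h
  refine halfPeriod_add_notMem L hij ?_
  have := L.lattice.add_mem h (two_mul_halfPeriod_mem L j)
  rwa [show halfPeriod L i - halfPeriod L j + 2 * halfPeriod L j =
    halfPeriod L i + halfPeriod L j by ring] at this

/-- Oddness of `ζ` at `x = -ω_a` identifies the quasi-period. -/
lemma zeta_add_two_mul_halfPeriod (a : Fin 3) {x : ℂ} (hx : x ∉ L.lattice) :
    zeta L (x + 2 * halfPeriod L a) = zeta L x + 2 * zeta L (halfPeriod L a) := by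
  obtain ⟨η, C, -, h, -⟩ := exists_quasiPeriod L (two_mul_halfPeriod_mem L a)
  have hn : -halfPeriod L a ∉ L.lattice := fun h ↦ halfPeriod_notMem L a (by simpa using h)
  have h1 := h _ hn
  rw [show -halfPeriod L a + 2 * halfPeriod L a = halfPeriod L a by ring, zeta_neg] at h1
  rw [h x hx]
  linear_combination -h1

lemma sigma_add_two_mul_halfPeriod (a : Fin 3) (x : ℂ) :
    sigma L (x + 2 * halfPeriod L a) =
      -Complex.exp (2 * zeta L (halfPeriod L a) * (x + halfPeriod L a)) * sigma L x := by
  obtain ⟨η, C, -, h, hs⟩ := exists_quasiPeriod L (two_mul_halfPeriod_mem L a)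
  have hw := halfPeriod_notMem L a
  have hn : -halfPeriod L a ∉ L.lattice := fun h ↦ hw (by simpa using h)
  have h1 := h _ hn
  rw [zeta_add_two_mul_halfPeriod L a hn] at h1
  have h2 := hs (-halfPeriod L a)
  rw [show -halfPeriod L a + 2 * halfPeriod L a = halfPeriod L a by ring, sigma_neg] at h2
  obtain rfl : 2 * zeta L (halfPeriod L a) = η := by linear_combination h1
  have h3 : C = -Complex.exp (2 * zeta L (halfPeriod L a) * halfPeriod L a) := by
    have h4 := sigma_ne_zero L hw
    have h5 : C * Complex.exp (2 * zeta L (halfPeriod L a) * -halfPeriod L a) = -1 := by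
      apply mul_right_cancel₀ h4
      linear_combination h2
    rw [mul_neg, Complex.exp_neg] at h5
    have h6 := Complex.exp_ne_zero (2 * zeta L (halfPeriod L a) * halfPeriod L a)
    field_simp at h5
    linear_combination h5
  rw [hs, h3, mul_add, Complex.exp_add]
  ring

end TreibichVerdier
end

noncomputable section

namespace TreibichVerdier

variable (L : PeriodPair)

/-! ### Addition theorems -/

lemma hasDerivAt_weierstrassP {x : ℂ} (hx : x ∉ L.lattice) :
    HasDerivAt L.weierstrassP (L.derivWeierstrassP x) x := by
  have := (L.differentiableOn_weierstrassP.differentiableAt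
    ((isOpen_compl_lattice L).mem_nhds hx)).hasDerivAt
  rwa [L.deriv_weierstrassP] at this

lemma differentiableAt_derivWeierstrassP {x : ℂ} (hx : x ∉ L.lattice) :
    DifferentiableAt ℂ L.derivWeierstrassP x :=
  L.differentiableOn_derivWeierstrassP.differentiableAt ((isOpen_compl_lattice L).mem_nhds hx)

/-- Differentiating the cubic relation gives the claim multiplied by `℘'`. The factor `℘'` is
cancelled by the identity theorem, since it does not vanish near the origin. -/
lemma hasDerivAt_derivWeierstrassP {x : ℂ} (hx : x ∉ L.lattice) :
    HasDerivAt L.derivWeierstrassP (6 * L.weierstrassP x ^ 2 - L.g₂ / 2) x := by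
  have hU := isOpen_compl_lattice L
  have hd : ∀ y ∉ L.lattice, (deriv L.derivWeierstrassP y - (6 * L.weierstrassP y ^ 2 - L.g₂ / 2)) *
      L.derivWeierstrassP y = 0 := by
    intro y hy
    have h1 := (differentiableAt_derivWeierstrassP L hy).hasDerivAt.fun_pow 2
    have h2 := (((hasDerivAt_weierstrassP L hy).fun_pow 3).const_mul 4).fun_sub
      ((hasDerivAt_weierstrassP L hy).const_mul L.g₂) |>.sub_const L.g₃
    have h3 := h1.unique (h2.congr_of_eventuallyEq (by
      filter_upwards [hU.mem_nhds hy] with t ht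
      exact L.derivWeierstrassP_sq t ht))
    norm_num at h3
    linear_combination h3 / 2
  have hP := L.differentiableOn_weierstrassP
  have hP' := L.differentiableOn_derivWeierstrassP
  have hc := AnalyticOnNhd.eq_zero_or_eq_zero_of_mul_eq_zero
    (f := fun y ↦ deriv L.derivWeierstrassP y - (6 * L.weierstrassP y ^ 2 - L.g₂ / 2))
    (((hP'.deriv hU).fun_sub (((hP.fun_pow 2).const_mul 6).sub_const _)).analyticOnNhd hU)
    (hP'.analyticOnNhd hU) hd (isPreconnected_compl_of_countable (countable_lattice L))
  obtain h | h := hc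
  · have := (differentiableAt_derivWeierstrassP L hx).hasDerivAt
    rwa [show deriv L.derivWeierstrassP x = _ from sub_eq_zero.mp (h x hx)] at this
  · obtain ⟨y, hy1, hy2⟩ := (((tendsto_cube_mul_derivWeierstrassP L).eventually_ne
      (by norm_num : (-2 : ℂ) ≠ 0)).and (eventually_notMem_lattice L 0)).exists
    simp [h y hy2] at hy1

lemma isBigO_sq_of_even {h : ℂ → ℂ} (hd : AnalyticAt ℂ h 0) (he : ∀ x, h (-x) = h x)
    (h0 : h 0 = 0) : h =O[𝓝 0] fun x ↦ x ^ 2 := by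
  obtain ⟨p, hp⟩ := hd
  have h1 : deriv h 0 = 0 := by
    have : deriv (fun x ↦ h (-x)) 0 = -deriv h (-0) := deriv_comp_neg _ _
    simp only [he, neg_zero] at this
    exact CharZero.eq_neg_self_iff.mp this
  have h2 := hp.isBigO_sub_partialSum_pow 2
  have e0 : p.coeff 0 = 0 := (hp.coeff_zero _).trans h0
  have e1 : p.coeff 1 = 0 := hp.deriv.symm.trans h1
  have h3 : ∀ y, p.partialSum 2 y = 0 := by
    simp [FormalMultilinearSeries.partialSum, Finset.sum_range_succ, e0, e1]
  simp only [zero_add, h3, sub_zero] at h2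
  simp_rw [← norm_pow] at h2
  exact h2.of_norm_right

/-- After division by `σ(x)²` the two sides differ by an elliptic function `f` of `x` with poles at
most on the lattice. `x² f` is even and vanishes at `0`, so `f` is bounded there, hence constant; it
vanishes at `x = u`. -/
lemma sigma_sub_mul_sigma_add {x u : ℂ} (hx : x ∉ L.lattice) (hu : u ∉ L.lattice) :
    sigma L (x - u) * sigma L (x + u) =
      -(sigma L x ^ 2 * sigma L u ^ 2 * (L.weierstrassP x - L.weierstrassP u)) := by
  have hU := isOpen_compl_lattice L
  have hσ := differentiable_sigma L
  set f : ℂ → ℂ := fun x ↦ sigma L (x - u) * sigma L (x + u) / sigma L x ^ 2 +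
    sigma L u ^ 2 * (L.weierstrassP x - L.weierstrassP u) with hf
  have hd : DifferentiableOn ℂ f (L.lattice : Set ℂ)ᶜ := by
    have h1 : Differentiable ℂ fun x ↦ sigma L (x - u) * sigma L (x + u) := by fun_prop
    refine (h1.differentiableOn.fun_div (hσ.fun_pow 2).differentiableOn fun y hy ↦ ?_).fun_add
      ((L.differentiableOn_weierstrassP.sub_const _).const_mul _)
    exact pow_ne_zero _ (sigma_ne_zero L hy)
  have hp : ∀ x ∉ L.lattice, ∀ l ∈ L.lattice, f (x + l) = f x := by
    intro x hx l hl
    obtain ⟨η, C, hC, -, hs⟩ := exists_quasiPeriod L hl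
    have e1 : sigma L (x + l - u) = C * Complex.exp (η * (x - u)) * sigma L (x - u) := by
      rw [← hs, sub_add_eq_add_sub]
    have e2 : sigma L (x + l + u) = C * Complex.exp (η * (x + u)) * sigma L (x + u) := by
      rw [← hs, add_right_comm]
    simp only [hf, weierstrassP_add L hl, e1, e2, hs x]
    have h0 := sigma_ne_zero L hx
    have h1 := Complex.exp_ne_zero (η * x)
    have h2 : Complex.exp (η * (x - u)) * Complex.exp (η * (x + u)) =
        Complex.exp (η * x) ^ 2 := by
      rw [← Complex.exp_add, ← Complex.exp_nat_mul]
      congr 1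
      push_cast
      ring
    congr 1
    field_simp
    linear_combination sigma L (x - u) * sigma L (x + u) * h2
  have hb : f =O[𝓝[≠] 0] (1 : ℂ → ℝ) := by
    -- `h` is `x² f` with its singularity removed: `σ(x) = x · sigmaExcept`, and `℘` is `1/x²` plus
    -- a function analytic at `0`.
    set h : ℂ → ℂ := fun x ↦ sigma L (x - u) * sigma L (x + u) / sigmaExcept L x ^ 2 +
      sigma L u ^ 2 * (x ^ 2 * L.weierstrassPExcept 0 x + 1 - x ^ 2 * L.weierstrassP u) with hh
    have hE : ∀ x, L.weierstrassPExcept 0 (-x) = L.weierstrassPExcept 0 x := fun x ↦ by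
      rw [L.weierstrassPExcept_neg, neg_zero]
    have ha : AnalyticAt ℂ h 0 := by
      have h1 : AnalyticAt ℂ (fun x ↦ sigma L (x - u) * sigma L (x + u)) 0 :=
        Differentiable.analyticAt (by fun_prop) 0
      have h2 : AnalyticAt ℂ (fun x ↦ sigmaExcept L x ^ 2) 0 :=
        Differentiable.analyticAt (by fun_prop) 0
      have h3 := L.analyticAt_weierstrassPExcept 0
      exact (h1.fun_div h2 (by simp [sigmaExcept_zero])).fun_add (by fun_prop)
    have he : ∀ x, h (-x) = h x := by
      intro x
      simp only [hh, sigmaExcept_neg, hE, neg_sq]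
      rw [show -x - u = -(x + u) by ring, show -x + u = -(x - u) by ring, sigma_neg, sigma_neg]
      ring
    have h0 : h 0 = 0 := by
      simp [hh, sigmaExcept_zero, sigma_neg]
      ring
    have hO := (isBigO_sq_of_even ha he h0).mono (nhdsWithin_le_nhds (s := {0}ᶜ))
    have hO2 := hO.mul (Asymptotics.isBigO_refl (fun x : ℂ ↦ (x ^ 2)⁻¹) (𝓝[≠] 0))
    have hO3 : f =O[𝓝[≠] 0] fun _ ↦ (1 : ℂ) := by
      refine hO2.congr' ?_ ?_
      · filter_upwards [eventually_notMem_lattice L 0] with x hx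
        have hx0 := ne_zero_of_notMem hx
        have h1 := sigma_ne_zero L hx
        simp only [hh, hf, weierstrassP_eq L (x := x), sigma_eq_mul_sigmaExcept L x] at h1 ⊢
        have h2 := right_ne_zero_of_mul h1
        field_simp
      · filter_upwards [self_mem_nhdsWithin] with x hx
        have : x ≠ 0 := hx
        simp [this]
    exact hO3.trans (Asymptotics.isBigO_const_one ℝ (1 : ℂ) _)
  obtain ⟨c, hc⟩ := exists_eq_const_of_periodic L hd hp hb
  have hc0 : c = 0 := by
    rw [← hc u hu]
    simp [hf, sigma_eq_zero_of_mem L L.lattice.zero_mem]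
  have h1 := hc x hx
  have h2 := sigma_ne_zero L hx
  rw [hc0, hf] at h1
  field_simp at h1
  linear_combination h1

lemma weierstrassP_eq_iff {x u : ℂ} (hx : x ∉ L.lattice) (hu : u ∉ L.lattice) :
    L.weierstrassP x = L.weierstrassP u ↔ x - u ∈ L.lattice ∨ x + u ∈ L.lattice := by
  have h := sigma_sub_mul_sigma_add L hx hu
  have h1 := sigma_ne_zero L hx
  have h2 := sigma_ne_zero L hu
  rw [← sigma_eq_zero_iff, ← sigma_eq_zero_iff, ← mul_eq_zero, h, neg_eq_zero]
  simp [h1, h2, sub_eq_zero]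

/-- The logarithmic derivative `ζ (x - u) - ζ (x) + ζ (u)` of `Φ (x; u)`. -/
def zetaSum (x u : ℂ) : ℂ := zeta L (x - u) - zeta L x + zeta L u

variable {L}

/-- The logarithmic derivatives of the product formula in `x` and in `u` contain `ζ(x + u)` with the
same sign and `ζ(x - u)` with opposite signs; subtraction leaves `Z`. Points with `x + u` in the
lattice follow by continuity. -/
lemma two_mul_zetaSum_mul {x u : ℂ} (hx : x ∉ L.lattice) (hu : u ∉ L.lattice)
    (hxu : x - u ∉ L.lattice) :
    2 * zetaSum L x u * (L.weierstrassP x - L.weierstrassP u) =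
      L.derivWeierstrassP x + L.derivWeierstrassP u := by
  have key : ∀ x ∉ {x | x ∈ L.lattice ∨ x + -u ∈ L.lattice}, x ∉ {x | x + u ∈ L.lattice} →
      2 * zetaSum L x u * (L.weierstrassP x - L.weierstrassP u) =
        L.derivWeierstrassP x + L.derivWeierstrassP u := by
    intro x hx hxu'
    simp only [Set.mem_ofPred_eq, not_or, ← sub_eq_add_neg] at hx hxu'
    obtain ⟨hx, hxu⟩ := hx
    have dx : HasDerivAt (fun t ↦ sigma L (t - u) * sigma L (t + u)) _ x :=
      ((hasDerivAt_sigma L hxu).comp_sub_const x u).fun_mul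
        ((hasDerivAt_sigma L hxu').comp_add_const x u)
    have dx' := ((((hasDerivAt_sigma L hx).fun_pow 2).mul_const (sigma L u ^ 2)).fun_mul
      ((hasDerivAt_weierstrassP L hx).sub_const (L.weierstrassP u))).fun_neg
    have du : HasDerivAt (fun t ↦ sigma L (x - t) * sigma L (x + t)) _ u :=
      ((hasDerivAt_sigma L hxu).comp_const_sub x u).fun_mul
        ((hasDerivAt_sigma L hxu').comp_const_add x u)
    have du' := ((((hasDerivAt_sigma L hu).fun_pow 2).const_mul (sigma L x ^ 2)).fun_mul
      ((hasDerivAt_weierstrassP L hu).const_sub (L.weierstrassP x))).fun_neg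
    have e1 := dx.unique (dx'.congr_of_eventuallyEq (by
      filter_upwards [(isOpen_compl_lattice L).mem_nhds hx] with t ht
      exact sigma_sub_mul_sigma_add L ht hu))
    have e2 := du.unique (du'.congr_of_eventuallyEq (by
      filter_upwards [(isOpen_compl_lattice L).mem_nhds hu] with t ht
      exact sigma_sub_mul_sigma_add L hx ht))
    have e3 := sigma_sub_mul_sigma_add L hx hu
    have h1 := sigma_ne_zero L hx
    have h2 := sigma_ne_zero L hu
    apply mul_left_cancel₀ (mul_ne_zero (pow_ne_zero 2 h1) (pow_ne_zero 2 h2))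
    simp only [zetaSum]
    norm_num at e1 e2
    linear_combination -e1 + e2 + 2 * zeta L (x - u) * e3
  have hcl : IsClosed {x | x ∈ L.lattice ∨ x + -u ∈ L.lattice} :=
    L.isClosed_lattice.union (isClosed_translate L (-u))
  have hz : ContinuousOn (zeta L) (L.lattice : Set ℂ)ᶜ := fun y hy ↦
    (deriv_zeta L hy).continuousAt.continuousWithinAt
  have hsub : {x | x ∈ L.lattice ∨ x + -u ∈ L.lattice}ᶜ ⊆ (L.lattice : Set ℂ)ᶜ :=
    fun y hy h ↦ hy (.inl h)
  refine eq_of_eq_off_countable (f := fun x ↦ 2 * zetaSum L x u * _) hcl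
    (countable_translate L u) ?_ ?_ key (by simp [hx, ← sub_eq_add_neg, hxu])
  · unfold zetaSum
    refine ((ContinuousOn.add (ContinuousOn.sub ?_ (hz.mono hsub)) continuousOn_const).const_mul
      2).mul ((L.differentiableOn_weierstrassP.continuousOn.mono hsub).sub continuousOn_const)
    exact hz.comp (by fun_prop) fun y hy h ↦ hy (.inr (by simpa [← sub_eq_add_neg] using h))
  · exact (L.differentiableOn_derivWeierstrassP.continuousOn.mono hsub).add continuousOn_const

/-- `Z` has the derivative `℘(x) - ℘(x - u)` in `x`, so differentiating `two_mul_zetaSum_mul` brings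
in `℘(x - u)`. -/
lemma weierstrassP_sub {x u : ℂ} (hx : x ∉ L.lattice) (hu : u ∉ L.lattice)
    (hxu : x - u ∉ L.lattice) (hxu' : x + u ∉ L.lattice) :
    L.weierstrassP (x - u) = zetaSum L x u ^ 2 - L.weierstrassP x - L.weierstrassP u := by
  have hne : L.weierstrassP x - L.weierstrassP u ≠ 0 := by
    rw [sub_ne_zero, ne_eq, weierstrassP_eq_iff L hx hu]
    tauto
  have hZ : HasDerivAt (fun t ↦ zetaSum L t u) (-L.weierstrassP (x - u) + L.weierstrassP x) x := by
    have := (((deriv_zeta L hxu).comp_sub_const x u).fun_sub (deriv_zeta L hx)).add_const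
      (zeta L u)
    exact this.congr_deriv (by ring)
  have h1 := (hZ.const_mul 2).fun_mul ((hasDerivAt_weierstrassP L hx).sub_const (L.weierstrassP u))
  have h2 := (hasDerivAt_derivWeierstrassP L hx).add_const (L.derivWeierstrassP u)
  have e := h1.unique (h2.congr_of_eventuallyEq (by
    have hc : IsClosed {x | x ∈ L.lattice ∨ x + -u ∈ L.lattice} :=
      L.isClosed_lattice.union (isClosed_translate L (-u))
    have : x ∈ {x | x ∈ L.lattice ∨ x + -u ∈ L.lattice}ᶜ := by simp [hx, ← sub_eq_add_neg, hxu]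
    filter_upwards [hc.isOpen_compl.mem_nhds this] with t ht
    simp only [Set.mem_compl_iff, Set.mem_ofPred_eq, not_or, ← sub_eq_add_neg] at ht
    exact two_mul_zetaSum_mul ht.1 hu ht.2))
  have hz := two_mul_zetaSum_mul hx hu hxu
  have q1 := L.derivWeierstrassP_sq x hx
  have q2 := L.derivWeierstrassP_sq u hu
  set Z := zetaSum L x u
  set p := L.weierstrassP x
  set q := L.derivWeierstrassP x
  set X := L.weierstrassP u
  set Y := L.derivWeierstrassP u
  -- The companion of `hz`, from the difference of the two cubic equations, `(q - Y)(q + Y)`.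
  have e4 : (q - Y) * Z = 2 * (p ^ 2 + p * X + X ^ 2) - L.g₂ / 2 := by
    apply mul_right_cancel₀ hne
    linear_combination (q - Y) * hz / 2 + q1 / 2 - q2 / 2
  apply mul_right_cancel₀ hne
  linear_combination -e / 2 + e4 / 2 - Z / 2 * hz

/-- If `c` were omitted, `1/(℘ - c)` would be elliptic without poles, hence constant, while it tends
to `0` at the origin. -/
lemma exists_weierstrassP_eq (c : ℂ) : ∃ u ∉ L.lattice, L.weierstrassP u = c := by
  by_contra! h
  have h' : ∀ u ∉ L.lattice, L.weierstrassP u - c ≠ 0 := fun u hu ↦ sub_ne_zero.mpr (h u hu)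
  have ht : Tendsto (fun u ↦ 1 / (L.weierstrassP u - c)) (𝓝[≠] 0) (𝓝 0) := by
    have h1 := (tendsto_id_punctured.pow 2).div ((tendsto_sq_mul_weierstrassP L).sub
      ((tendsto_id_punctured.pow 2).mul_const c)) (by norm_num)
    norm_num at h1
    refine h1.congr' ?_
    filter_upwards [eventually_notMem_lattice L 0] with x hx
    have hx0 := ne_zero_of_notMem hx
    have := h' x hx
    simp only [Pi.div_apply]
    rw [show x ^ 2 * L.weierstrassP x - x ^ 2 * c = x ^ 2 * (L.weierstrassP x - c) by ring]
    field_simp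
  obtain ⟨k, hk⟩ := exists_eq_const_of_periodic L (f := fun u ↦ 1 / (L.weierstrassP u - c))
    ((differentiableOn_const 1).div (L.differentiableOn_weierstrassP.sub_const c) h')
    (fun x hx l hl ↦ by simp only [weierstrassP_add L hl]) (ht.isBigO_one ℝ)
  have hk0 : k = 0 := by
    refine tendsto_nhds_unique (tendsto_const_nhds.congr' ?_) ht
    filter_upwards [eventually_notMem_lattice L 0] with x hx
    exact (hk x hx).symm
  have hw := L.ω₁_div_two_notMem_lattice
  have := hk _ hw
  rw [hk0] at this
  exact one_div_ne_zero (h' _ hw) this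

lemma exists_uniformisation {X Y : ℂ} (h : Y ^ 2 = 4 * X ^ 3 - L.g₂ * X - L.g₃) :
    ∃ u ∉ L.lattice, L.weierstrassP u = X ∧ L.derivWeierstrassP u = Y := by
  obtain ⟨u, hu, rfl⟩ := exists_weierstrassP_eq (L := L) X
  rw [← L.derivWeierstrassP_sq u hu, sq_eq_sq_iff_eq_or_eq_neg] at h
  obtain rfl | rfl := h
  · exact ⟨u, hu, rfl, rfl⟩
  · exact ⟨-u, by simpa using hu, L.weierstrassP_neg u, L.derivWeierstrassP_neg u⟩

end TreibichVerdier
end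

noncomputable section

namespace TreibichVerdier

variable (L : PeriodPair)

/-! ### The values at the half periods -/

lemma derivWeierstrassP_halfPeriod (a : Fin 3) : L.derivWeierstrassP (halfPeriod L a) = 0 := by
  have h := derivWeierstrassP_add L (two_mul_halfPeriod_mem L a) (-halfPeriod L a)
  rw [show -halfPeriod L a + 2 * halfPeriod L a = halfPeriod L a by ring,
    L.derivWeierstrassP_neg] at h
  exact CharZero.eq_neg_self_iff.mp h

lemma e_cubic (a : Fin 3) : 4 * e L a ^ 3 - L.g₂ * e L a - L.g₃ = 0 := by
  have h := L.derivWeierstrassP_sq _ (halfPeriod_notMem L a)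
  rw [derivWeierstrassP_halfPeriod] at h
  simpa [e] using h.symm

lemma e_ne {i j : Fin 3} (hij : i ≠ j) : e L i ≠ e L j := by
  unfold e
  rw [ne_eq, weierstrassP_eq_iff L (halfPeriod_notMem L i) (halfPeriod_notMem L j), not_or]
  exact ⟨halfPeriod_sub_notMem L hij, halfPeriod_add_notMem L hij⟩

variable {i j k : Fin 3}

/-- The difference of two cubic equations, divided by `e i - e j`. Two such relations with different
indices give the vanishing of the sum of the `e a`. -/
lemma g₂_eq_aux (hij : i ≠ j) :
    L.g₂ = 4 * (e L i ^ 2 + e L i * e L j + e L j ^ 2) := by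
  apply mul_left_cancel₀ (sub_ne_zero.mpr (e_ne L hij))
  linear_combination e_cubic L j - e_cubic L i

lemma e_add_add (hij : i ≠ j) (hjk : j ≠ k) (hik : i ≠ k) : e L i + e L j + e L k = 0 := by
  apply mul_left_cancel₀ (sub_ne_zero.mpr (e_ne L hjk))
  linear_combination (g₂_eq_aux L hik - g₂_eq_aux L hij) / 4

lemma e_third (hij : i ≠ j) (hjk : j ≠ k) (hik : i ≠ k) : e L k = -e L i - e L j := by
  linear_combination e_add_add L hij hjk hik

lemma g₂_eq (hij : i ≠ j) (hjk : j ≠ k) (hik : i ≠ k) :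
    L.g₂ = -4 * (e L i * e L j + e L i * e L k + e L j * e L k) := by
  linear_combination g₂_eq_aux L hij + 4 * (e L i + e L j) * e_add_add L hij hjk hik

lemma g₃_eq (hij : i ≠ j) (hjk : j ≠ k) (hik : i ≠ k) :
    L.g₃ = 4 * e L i * e L j * e L k := by
  linear_combination -e_cubic L i - e L i * g₂_eq L hij hjk hik +
    4 * e L i ^ 2 * e_add_add L hij hjk hik

lemma derivWeierstrassP_sq_eq (hij : i ≠ j) (hjk : j ≠ k) (hik : i ≠ k) {x : ℂ}
    (hx : x ∉ L.lattice) : L.derivWeierstrassP x ^ 2 = 4 * (L.weierstrassP x - e L i) *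
      (L.weierstrassP x - e L j) * (L.weierstrassP x - e L k) := by
  linear_combination L.derivWeierstrassP_sq x hx - L.weierstrassP x * g₂_eq L hij hjk hik -
    g₃_eq L hij hjk hik + 4 * L.weierstrassP x ^ 2 * e_add_add L hij hjk hik

/-! ### The branches of the square roots -/

lemma sigma_sub_halfPeriod (a : Fin 3) (x : ℂ) : sigma L (x - halfPeriod L a) =
    -Complex.exp (-(2 * zeta L (halfPeriod L a) * x)) * sigma L (x + halfPeriod L a) := by
  have h := sigma_add_two_mul_halfPeriod L a (x - halfPeriod L a)
  rw [show x - halfPeriod L a + 2 * halfPeriod L a = x + halfPeriod L a by ring,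
    sub_add_cancel] at h
  rw [h, Complex.exp_neg]
  have := Complex.exp_ne_zero (2 * zeta L (halfPeriod L a) * x)
  field_simp

/-- The product formula at `u = ω_a`: `σ(x - ω_a)` is `σ(x + ω_a)` up to an exponential, which is
the square of the one in `rootP`. -/
lemma rootP_sq (a : Fin 3) {x : ℂ} (hx : x ∉ L.lattice) :
    rootP L a x ^ 2 = L.weierstrassP x - e L a := by
  have hw := halfPeriod_notMem L a
  have h := sigma_sub_mul_sigma_add L hx hw
  have h1 := sigma_ne_zero L hx
  have h2 := sigma_ne_zero L hw
  rw [sigma_sub_halfPeriod, show -(2 * zeta L (halfPeriod L a) * x) =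
    -(zeta L (halfPeriod L a) * x) + -(zeta L (halfPeriod L a) * x) by ring, Complex.exp_add] at h
  simp only [rootP, e]
  field_simp
  linear_combination -h

lemma rootP_neg (a : Fin 3) (x : ℂ) : rootP L a (-x) = -rootP L a x := by
  simp only [rootP, sigma_neg]
  rw [show -x + halfPeriod L a = -(x - halfPeriod L a) by ring, sigma_neg, sigma_sub_halfPeriod,
    show -(2 * zeta L (halfPeriod L a) * x) =
    -(zeta L (halfPeriod L a) * x) + -(zeta L (halfPeriod L a) * x) by ring, Complex.exp_add,
    show -(zeta L (halfPeriod L a) * -x) = -(-(zeta L (halfPeriod L a) * x)) by ring,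
    Complex.exp_neg (-(zeta L (halfPeriod L a) * x))]
  have := Complex.exp_ne_zero (-(zeta L (halfPeriod L a) * x))
  field_simp

lemma rootP_eq_zero_iff (a : Fin 3) {x : ℂ} (hx : x ∉ L.lattice) :
    rootP L a x = 0 ↔ x + halfPeriod L a ∈ L.lattice := by
  simp [rootP, sigma_ne_zero L hx, sigma_ne_zero L (halfPeriod_notMem L a), Complex.exp_ne_zero,
    sigma_eq_zero_iff]

lemma weierstrassP_sub_e_ne_zero (a : Fin 3) {x : ℂ} (hx : x ∉ L.lattice)
    (hxa : x + halfPeriod L a ∉ L.lattice) : L.weierstrassP x - e L a ≠ 0 := by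
  rw [← rootP_sq L a hx]
  exact pow_ne_zero 2 ((rootP_eq_zero_iff L a hx).not.mpr hxa)

lemma differentiableAt_rootP (a : Fin 3) {x : ℂ} (hx : x ∉ L.lattice) :
    DifferentiableAt ℂ (rootP L a) x := by
  unfold rootP
  have h := differentiable_sigma L
  refine DifferentiableAt.fun_div (by fun_prop) (by fun_prop) ?_
  exact mul_ne_zero (sigma_ne_zero L (halfPeriod_notMem L a)) (sigma_ne_zero L hx)

lemma differentiableOn_rootP (a : Fin 3) : DifferentiableOn ℂ (rootP L a) (L.lattice : Set ℂ)ᶜ :=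
  fun _ hx ↦ (differentiableAt_rootP L a hx).differentiableWithinAt

lemma tendsto_mul_rootP (a : Fin 3) : Tendsto (fun x ↦ x * rootP L a x) (𝓝[≠] 0) (𝓝 1) := by
  have h2 := sigma_ne_zero L (halfPeriod_notMem L a)
  have h1 : Tendsto (fun x ↦ Complex.exp (-(zeta L (halfPeriod L a) * x)) *
      sigma L (x + halfPeriod L a) / sigma L (halfPeriod L a)) (𝓝[≠] 0) (𝓝 1) := by
    have hc : Continuous fun x ↦ Complex.exp (-(zeta L (halfPeriod L a) * x)) *
      sigma L (x + halfPeriod L a) / sigma L (halfPeriod L a) := by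
      have := (differentiable_sigma L).continuous
      fun_prop
    have := hc.tendsto 0
    simp only [mul_zero, neg_zero, Complex.exp_zero, zero_add, one_mul, div_self h2] at this
    exact this.mono_left nhdsWithin_le_nhds
  have h := h1.div (tendsto_sigma_div L) one_ne_zero
  rw [one_div_one] at h
  refine h.congr' ?_
  filter_upwards [eventually_notMem_lattice L 0] with x hx
  have := sigma_ne_zero L hx
  have := ne_zero_of_notMem hx
  simp only [rootP, Pi.div_apply]
  field_simp

/-- The squares agree by the cubic equation; `x³` times either side tends to `1` at the origin,
which fixes the sign. -/
lemma rootP_mul_mul (hij : i ≠ j) (hjk : j ≠ k) (hik : i ≠ k) {x : ℂ} (hx : x ∉ L.lattice) :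
    rootP L i x * rootP L j x * rootP L k x = -L.derivWeierstrassP x / 2 := by
  refine eq_of_sq_eq_sq (f := fun x ↦ rootP L i x * rootP L j x * rootP L k x)
    (g := fun x ↦ -L.derivWeierstrassP x / 2) L.isClosed_lattice (countable_lattice L)
    (((differentiableOn_rootP L i).fun_mul (differentiableOn_rootP L j)).fun_mul
      (differentiableOn_rootP L k))
    (L.differentiableOn_derivWeierstrassP.fun_neg.div_const 2) ?_ ?_ hx
  · intro x hx
    rw [mul_pow, mul_pow, rootP_sq L i hx, rootP_sq L j hx, rootP_sq L k hx]
    linear_combination -derivWeierstrassP_sq_eq L hij hjk hik hx / 4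
  · have h1 := ((tendsto_mul_rootP L i).mul (tendsto_mul_rootP L j)).mul (tendsto_mul_rootP L k)
    have h2 := h1.sub ((tendsto_cube_mul_derivWeierstrassP L).div_const 2)
    obtain ⟨y, hy, hy'⟩ := ((h2.eventually_ne (show (1 * 1 * 1 - -2 / 2 : ℂ) ≠ 0 by norm_num)).and
      (eventually_notMem_lattice L 0)).exists
    refine ⟨y, hy', fun h ↦ hy ?_⟩
    linear_combination y ^ 3 * h

lemma hasDerivAt_rootP (hij : i ≠ j) (hjk : j ≠ k) (hik : i ≠ k) {x : ℂ} (hx : x ∉ L.lattice) :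
    HasDerivAt (rootP L i) (-(rootP L j x * rootP L k x)) x := by
  have hU := isOpen_compl_lattice L
  have hd : ∀ x ∉ L.lattice, deriv (rootP L i) x = -(rootP L j x * rootP L k x) := by
    intro x hx
    refine eq_of_eq_off_countable (g := fun x ↦ -(rootP L j x * rootP L k x)) L.isClosed_lattice
      (countable_translate L (halfPeriod L i)) ((differentiableOn_rootP L i).deriv hU).continuousOn
      (((differentiableOn_rootP L j).fun_mul (differentiableOn_rootP L k)).fun_neg).continuousOn
      (fun x hx hxi ↦ ?_) hx
    have h0 : rootP L i x ≠ 0 := (rootP_eq_zero_iff L i hx).not.mpr hxi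
    have h1 := (differentiableAt_rootP L i hx).hasDerivAt.fun_pow 2
    have h2 := h1.unique (((hasDerivAt_weierstrassP L hx).sub_const (e L i)).congr_of_eventuallyEq
      (by filter_upwards [hU.mem_nhds hx] with t ht; exact rootP_sq L i ht))
    norm_num at h2
    apply mul_left_cancel₀ h0
    linear_combination h2 / 2 + rootP_mul_mul L hij hjk hik hx
  exact hd x hx ▸ (differentiableAt_rootP L i hx).hasDerivAt

/-- The addition theorem at `u = ω_i`. There `℘'(u) = 0`, so `2Z(℘ - e_i) = ℘'` and `Z²(℘ - e_i) =
(℘ - e_j)(℘ - e_k)`. -/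
lemma weierstrassP_add_halfPeriod (hij : i ≠ j) (hjk : j ≠ k) (hik : i ≠ k) {x : ℂ}
    (hx : x ∉ L.lattice) (hxi : x + halfPeriod L i ∉ L.lattice) :
    L.weierstrassP (x + halfPeriod L i) =
      e L i + (e L i - e L j) * (e L i - e L k) / (L.weierstrassP x - e L i) := by
  have hw := halfPeriod_notMem L i
  have h2 := two_mul_halfPeriod_mem L i
  have hxi' : x - halfPeriod L i ∉ L.lattice := fun h ↦ hxi (by
    have := L.lattice.add_mem h h2
    rwa [show x - halfPeriod L i + 2 * halfPeriod L i = x + halfPeriod L i by ring] at this)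
  have h0 := weierstrassP_sub_e_ne_zero L i hx hxi
  have h := weierstrassP_sub hx hw hxi' hxi
  rw [← weierstrassP_add L h2 (x - halfPeriod L i),
    show x - halfPeriod L i + 2 * halfPeriod L i = x + halfPeriod L i by ring] at h
  have hZ := two_mul_zetaSum_mul hx hw hxi'
  rw [derivWeierstrassP_halfPeriod, add_zero] at hZ
  change _ = _ - _ - e L i at h
  change 2 * _ * (_ - e L i) = _ at hZ
  have hq := derivWeierstrassP_sq_eq L hij hjk hik hx
  rw [h]
  set Z := zetaSum L x (halfPeriod L i)
  set p := L.weierstrassP x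
  have hZ2 : Z ^ 2 * (p - e L i) = (p - e L j) * (p - e L k) := by
    apply mul_right_cancel₀ h0
    rw [← hZ] at hq
    linear_combination hq / 4
  field_simp
  linear_combination hZ2 - p * e_add_add L hij hjk hik + e L i * e_add_add L hij hjk hik

/-! ### The functions `Φ` and `Φ_i` -/

variable {L} in
lemma differentiableAt_Phi {x : ℂ} (u : ℂ) (hx : x ∉ L.lattice) :
    DifferentiableAt ℂ (fun t ↦ Phi L t u) x := by
  unfold Phi
  have h := differentiable_sigma L
  by_cases hu : u ∈ L.lattice
  · simp [sigma_eq_zero_of_mem L hu]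
  · refine DifferentiableAt.fun_mul (DifferentiableAt.fun_div (by fun_prop) (by fun_prop) ?_)
      (by fun_prop)
    exact mul_ne_zero (sigma_ne_zero L hx) (sigma_ne_zero L hu)

/-- The derivative of `Φ (x; u)` with respect to `x`. -/
def dPhi (x u : ℂ) : ℂ := deriv (fun t ↦ Phi L t u) x

variable {L}

lemma differentiableOn_Phi (u : ℂ) :
    DifferentiableOn ℂ (fun t ↦ Phi L t u) (L.lattice : Set ℂ)ᶜ :=
  fun _ hx ↦ (differentiableAt_Phi u hx).differentiableWithinAt

lemma differentiableOn_dPhi (u : ℂ) :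
    DifferentiableOn ℂ (fun t ↦ dPhi L t u) (L.lattice : Set ℂ)ᶜ :=
  (differentiableOn_Phi u).deriv (isOpen_compl_lattice L)

lemma hasDerivAt_Phi {x : ℂ} (u : ℂ) (hx : x ∉ L.lattice) :
    HasDerivAt (fun t ↦ Phi L t u) (dPhi L x u) x := (differentiableAt_Phi u hx).hasDerivAt

lemma dPhi_eq_mul_zetaSum {x u : ℂ} (hx : x ∉ L.lattice) (hu : u ∉ L.lattice)
    (hxu : x - u ∉ L.lattice) : dPhi L x u = Phi L x u * zetaSum L x u := by
  have h1 := sigma_ne_zero L hx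
  have h2 := sigma_ne_zero L hu
  have he : HasDerivAt (fun x ↦ Complex.exp (zeta L u * x))
      (Complex.exp (zeta L u * x) * zeta L u) x := by
    simpa using ((hasDerivAt_id x).const_mul (zeta L u)).cexp
  have h : HasDerivAt (fun t ↦ Phi L t u) _ x :=
    (((hasDerivAt_sigma L hxu).comp_sub_const x u).fun_div
    ((hasDerivAt_sigma L hx).mul_const (sigma L u)) (mul_ne_zero h1 h2)).fun_mul he
  rw [dPhi, h.deriv]
  simp only [Phi, zetaSum]
  field_simp

/-- Continuity extends identities from `x - u ∉ Λ`, `x + u ∉ Λ`. -/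
lemma eq_of_eq_off_translates {f g : ℂ → ℂ} (u : ℂ) {S : Set ℂ} (hS : IsClosed S)
    (hf : ContinuousOn f Sᶜ) (hg : ContinuousOn g Sᶜ)
    (h : ∀ x ∉ S, x - u ∉ L.lattice → x + u ∉ L.lattice → f x = g x) {x : ℂ} (hx : x ∉ S) :
    f x = g x := by
  refine eq_of_eq_off_countable hS ((countable_translate L (-u)).union (countable_translate L u))
    hf hg (fun x hx hxu ↦ ?_) hx
  simp only [Set.mem_union, Set.mem_ofPred_eq, not_or, ← sub_eq_add_neg] at hxu
  exact h x hx hxu.1 hxu.2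

/-- The relation for `Z` multiplied by `Φ`. In this form it has no pole at `x ≡ u`, where `Φ`
vanishes, and it expresses `℘'(x) Φ` through `Φ` and `Φ'`. -/
lemma derivWeierstrassP_mul_Phi {x u : ℂ} (hx : x ∉ L.lattice) (hu : u ∉ L.lattice) :
    L.derivWeierstrassP x * Phi L x u =
      2 * (L.weierstrassP x - L.weierstrassP u) * dPhi L x u - L.derivWeierstrassP u * Phi L x u := by
  have hΦ := differentiableOn_Phi (L := L) u
  refine eq_of_eq_off_translates (L := L) (f := fun x ↦ L.derivWeierstrassP x * Phi L x u)
    (g := fun x ↦ 2 * (L.weierstrassP x - L.weierstrassP u) * dPhi L x u -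
      L.derivWeierstrassP u * Phi L x u) u L.isClosed_lattice
    (L.differentiableOn_derivWeierstrassP.fun_mul hΦ).continuousOn
    ((((L.differentiableOn_weierstrassP.sub_const _).const_mul 2).fun_mul
      (differentiableOn_dPhi u)).fun_sub (hΦ.const_mul _)).continuousOn
    (fun x hx hxu _ ↦ ?_) hx
  rw [dPhi_eq_mul_zetaSum hx hu hxu]
  linear_combination -Phi L x u * two_mul_zetaSum_mul hx hu hxu

/-- The one-gap Lamé equation: `Z' + Z² = 2℘(x) + ℘(u)` by the addition theorem. -/
lemma hasDerivAt_dPhi {x u : ℂ} (hx : x ∉ L.lattice) (hu : u ∉ L.lattice) :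
    HasDerivAt (fun t ↦ dPhi L t u) ((2 * L.weierstrassP x + L.weierstrassP u) * Phi L x u) x := by
  have hU := isOpen_compl_lattice L
  have hΦ := differentiableOn_Phi (L := L) u
  have hd := differentiableOn_dPhi (L := L) u
  have key : deriv (fun t ↦ dPhi L t u) x =
      (2 * L.weierstrassP x + L.weierstrassP u) * Phi L x u := by
    refine eq_of_eq_off_translates (L := L) (f := fun x ↦ deriv (fun t ↦ dPhi L t u) x)
      (g := fun x ↦ (2 * L.weierstrassP x + L.weierstrassP u) * Phi L x u) u L.isClosed_lattice
      (hd.deriv hU).continuousOn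
      (((L.differentiableOn_weierstrassP.const_mul 2).add_const _).fun_mul hΦ).continuousOn
      (fun x hx hxu hxu' ↦ ?_) hx
    have hZ : HasDerivAt (fun t ↦ zetaSum L t u) (-L.weierstrassP (x - u) + L.weierstrassP x) x := by
      have := (((deriv_zeta L hxu).comp_sub_const x u).fun_sub (deriv_zeta L hx)).add_const
        (zeta L u)
      exact this.congr_deriv (by ring)
    have h1 := (hasDerivAt_Phi u hx).fun_mul hZ
    have hc : IsClosed {x | x ∈ L.lattice ∨ x + -u ∈ L.lattice} :=
      L.isClosed_lattice.union (isClosed_translate L (-u))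
    have hmem : x ∈ {x | x ∈ L.lattice ∨ x + -u ∈ L.lattice}ᶜ := by
      rw [Set.mem_compl_iff, Set.mem_ofPred_eq, not_or, ← sub_eq_add_neg]
      exact ⟨hx, hxu⟩
    have h2 := h1.congr_of_eventuallyEq (f₁ := fun t ↦ dPhi L t u) (by
      filter_upwards [hc.isOpen_compl.mem_nhds hmem] with t ht
      simp only [Set.mem_compl_iff, Set.mem_ofPred_eq, not_or, ← sub_eq_add_neg] at ht
      exact dPhi_eq_mul_zetaSum ht.1 hu ht.2)
    rw [h2.deriv, dPhi_eq_mul_zetaSum hx hu hxu, weierstrassP_sub hx hu hxu hxu']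
    ring
  exact key ▸ (hd.differentiableAt (hU.mem_nhds hx)).hasDerivAt

lemma derivWeierstrassP_mul_dPhi {x u : ℂ} (hx : x ∉ L.lattice) (hu : u ∉ L.lattice) :
    L.derivWeierstrassP x * dPhi L x u =
      (2 * (L.weierstrassP x ^ 2 + L.weierstrassP x * L.weierstrassP u + L.weierstrassP u ^ 2) -
        L.g₂ / 2) * Phi L x u + L.derivWeierstrassP u * dPhi L x u := by
  have h1 := (hasDerivAt_derivWeierstrassP L hx).fun_mul (hasDerivAt_Phi u hx)
  have h2 := ((((hasDerivAt_weierstrassP L hx).sub_const (L.weierstrassP u)).const_mul 2).fun_mul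
    (hasDerivAt_dPhi hx hu)).fun_sub ((hasDerivAt_Phi u hx).const_mul (L.derivWeierstrassP u))
  have h3 := h1.unique (h2.congr_of_eventuallyEq (by
    filter_upwards [(isOpen_compl_lattice L).mem_nhds hx] with t ht
    exact derivWeierstrassP_mul_Phi ht hu))
  linear_combination -h3

lemma tendsto_mul_zetaSum {u : ℂ} (hu : u ∉ L.lattice) :
    Tendsto (fun x ↦ x * zetaSum L x u) (𝓝[≠] 0) (𝓝 (-1)) := by
  have h : ContinuousAt (fun x ↦ zeta L (x - u)) 0 := by
    refine ContinuousAt.comp (g := zeta L) ?_ (by fun_prop)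
    exact (deriv_zeta L (by simpa using hu)).continuousAt
  have := ((tendsto_id_punctured.mul (h.tendsto.mono_left nhdsWithin_le_nhds)).sub
    (tendsto_mul_zeta L)).add (tendsto_id_punctured.mul_const (zeta L u))
  simp only [zero_mul, zero_sub, add_zero] at this
  refine this.congr fun x ↦ ?_
  simp only [zetaSum]
  ring

/-- The addition theorem for `√(℘ - e_i)`. The squares agree by that for `℘`; both sides behave like
`-R_i(u)/x` at `x = 0`, which fixes the sign as long as `R_i(u) ≠ 0`. The remaining `u` follow by
continuity in `u`. -/
lemma rootP_mul_rootP_sub (hij : i ≠ j) (hjk : j ≠ k) (hik : i ≠ k) {x u : ℂ}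
    (hx : x ∉ L.lattice) (hu : u ∉ L.lattice) (hxu : x - u ∉ L.lattice) :
    rootP L i x * rootP L i (x - u) =
      rootP L i u * zetaSum L x u - rootP L j u * rootP L k u := by
  have hz : DifferentiableOn ℂ (zeta L) (L.lattice : Set ℂ)ᶜ := fun y hy ↦
    (deriv_zeta L hy).differentiableAt.differentiableWithinAt
  -- squares agree
  have hsq : ∀ x u, x ∉ L.lattice → u ∉ L.lattice → x - u ∉ L.lattice → x + u ∉ L.lattice →
      (rootP L i x * rootP L i (x - u)) ^ 2 =
        (rootP L i u * zetaSum L x u - rootP L j u * rootP L k u) ^ 2 := by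
    intro x u hx hu hxu hxu'
    have e1 := weierstrassP_sub hx hu hxu hxu'
    have e2 := two_mul_zetaSum_mul hx hu hxu
    have hne : L.weierstrassP x - L.weierstrassP u ≠ 0 := by
      rw [sub_ne_zero, ne_eq, weierstrassP_eq_iff L hx hu]
      tauto
    have e3 := rootP_mul_mul L hij hjk hik hu
    have e4 := rootP_sq L i hu
    have e5 := rootP_sq L j hu
    have e6 := rootP_sq L k hu
    have q1 := L.derivWeierstrassP_sq x hx
    have q2 := L.derivWeierstrassP_sq u hu
    have hg := g₂_eq L hij hjk hik
    have hs := e_add_add L hij hjk hik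
    rw [mul_pow, rootP_sq L i hx, rootP_sq L i hxu, e1]
    set Z := zetaSum L x u
    set p := L.weierstrassP x
    set q := L.derivWeierstrassP x
    set X := L.weierstrassP u
    set Y := L.derivWeierstrassP u
    have e7 : (q - Y) * Z = 2 * (p ^ 2 + p * X + X ^ 2) - L.g₂ / 2 := by
      apply mul_right_cancel₀ hne
      linear_combination (q - Y) * e2 / 2 + q1 / 2 - q2 / 2
    have e8 : rootP L j u ^ 2 * rootP L k u ^ 2 = (X - e L j) * (X - e L k) := by rw [e5, e6]
    linear_combination Z * e2 / 2 + e7 / 2 - Z ^ 2 * e4 + 2 * Z * e3 - e8 +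
      (-hg / 4 + (X + e L i) * hs)
  have hS : ∀ u : ℂ, IsClosed {x | x ∈ L.lattice ∨ x + -u ∈ L.lattice ∨ x + u ∈ L.lattice} :=
    fun u ↦ L.isClosed_lattice.union ((isClosed_translate L (-u)).union (isClosed_translate L u))
  have hSc : ∀ u : ℂ, {x | x ∈ L.lattice ∨ x + -u ∈ L.lattice ∨ x + u ∈ L.lattice}.Countable :=
    fun u ↦ (countable_lattice L).union ((countable_translate L (-u)).union (countable_translate L u))
  have key : ∀ x u, u ∉ L.lattice → rootP L i u ≠ 0 → x ∉ L.lattice → x - u ∉ L.lattice →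
      x + u ∉ L.lattice → rootP L i x * rootP L i (x - u) =
        rootP L i u * zetaSum L x u - rootP L j u * rootP L k u := by
    intro x u hu hu0 hx hxu hxu'
    set S := {x | x ∈ L.lattice ∨ x + -u ∈ L.lattice ∨ x + u ∈ L.lattice} with hSdef
    have hS1 : Sᶜ ⊆ (L.lattice : Set ℂ)ᶜ := fun y hy h ↦ hy (.inl h)
    have hS2 : Set.MapsTo (fun y ↦ y - u) Sᶜ (L.lattice : Set ℂ)ᶜ :=
      fun y hy h ↦ hy (.inr (.inl (by simpa [← sub_eq_add_neg] using h)))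
    refine eq_of_sq_eq_sq (f := fun x ↦ rootP L i x * rootP L i (x - u))
      (g := fun x ↦ rootP L i u * zetaSum L x u - rootP L j u * rootP L k u) (hS u) (hSc u)
      ?_ ?_ ?_ ?_ (by simp [hx, ← sub_eq_add_neg, hxu, hxu'])
    · exact ((differentiableOn_rootP L i).mono hS1).fun_mul
        ((differentiableOn_rootP L i).fun_comp (by fun_prop) hS2)
    · unfold zetaSum
      exact ((((hz.fun_comp (by fun_prop) hS2).fun_sub (hz.mono hS1)).add_const _).const_mul
        _).sub_const _
    · intro y hy
      simp only [Set.mem_ofPred_eq, not_or, ← sub_eq_add_neg] at hy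
      exact hsq y u hy.1 hu hy.2.1 hy.2.2
    · have hnu : -u ∉ L.lattice := fun h ↦ hu (by simpa using h)
      have t1 : Tendsto (fun x ↦ rootP L i (x - u)) (𝓝[≠] 0) (𝓝 (-rootP L i u)) := by
        have : ContinuousAt (fun x ↦ rootP L i (x - u)) 0 := by
          refine ContinuousAt.comp (g := rootP L i) ?_ (by fun_prop)
          exact (differentiableAt_rootP L i (by simpa using hu)).continuousAt
        have := this.tendsto
        simp only [zero_sub, rootP_neg] at this
        exact this.mono_left nhdsWithin_le_nhds
      have t3 := (tendsto_mul_rootP L i).mul t1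
      have t5 := (t3.add ((tendsto_mul_zetaSum hu).const_mul (rootP L i u))).sub
        (tendsto_id_punctured.mul_const (rootP L j u * rootP L k u))
      have hne : 1 * -rootP L i u + rootP L i u * -1 - 0 * (rootP L j u * rootP L k u) ≠ 0 := by
        intro h
        exact hu0 (by linear_combination -h / 2)
      have hmem : ∀ᶠ y in 𝓝[≠] (0 : ℂ), y ∉ S := by
        have h1 : ∀ᶠ y in 𝓝 (0 : ℂ), y ∉ {y | y + -u ∈ L.lattice ∨ y + u ∈ L.lattice} :=
          ((isClosed_translate L (-u)).union (isClosed_translate L u)).isOpen_compl.mem_nhds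
            (by simp [hu])
        filter_upwards [eventually_notMem_lattice L 0, nhdsWithin_le_nhds h1] with y h1 h2
        simp only [hSdef, Set.mem_ofPred_eq, not_or] at h2 ⊢
        exact ⟨h1, h2⟩
      obtain ⟨y, hy1, hy2⟩ := ((t5.eventually_ne hne).and hmem).exists
      refine ⟨y, hy2, fun h ↦ hy1 ?_⟩
      linear_combination y * h
  -- extend by continuity in `u`
  have hT : IsClosed {u | u ∈ L.lattice ∨ x - u ∈ L.lattice} :=
    L.isClosed_lattice.union (L.isClosed_lattice.preimage (by fun_prop))
  have hT1 : {u | u ∈ L.lattice ∨ x - u ∈ L.lattice}ᶜ ⊆ (L.lattice : Set ℂ)ᶜ :=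
    fun y hy h ↦ hy (.inl h)
  have hT2 : Set.MapsTo (fun u ↦ x - u) {u | u ∈ L.lattice ∨ x - u ∈ L.lattice}ᶜ
      (L.lattice : Set ℂ)ᶜ := fun y hy h ↦ hy (.inr h)
  refine eq_of_eq_off_countable (f := fun u ↦ rootP L i x * rootP L i (x - u))
    (g := fun u ↦ rootP L i u * zetaSum L x u - rootP L j u * rootP L k u) hT
    ((countable_translate L (halfPeriod L i)).union (countable_translate L x)) ?_ ?_ ?_
    (by simp [hu, hxu])
  · exact ContinuousOn.mul continuousOn_const
      ((differentiableOn_rootP L i).continuousOn.comp (by fun_prop) hT2)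
  · have hr := fun a ↦ (differentiableOn_rootP L a).continuousOn.mono hT1
    unfold zetaSum
    exact ((hr i).mul (((hz.continuousOn.comp (by fun_prop) hT2).sub continuousOn_const).add
      (hz.continuousOn.mono hT1))).sub ((hr j).mul (hr k))
  · intro u hu hu'
    simp only [Set.mem_union, Set.mem_ofPred_eq, not_or] at hu hu'
    exact key x u hu.1 ((rootP_eq_zero_iff L i hu.1).not.mpr hu'.1) hx hu.2
      (by rw [add_comm]; exact hu'.2)

end TreibichVerdier
end

noncomputable section

namespace TreibichVerdier

variable {L : PeriodPair} {i j k : Fin 3}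

/-! ### Relations between `Φ` and its translates -/

lemma isClosed_poles3 (L : PeriodPair) : IsClosed (poles3 L) := L.isClosed_lattice

lemma isClosed_poles4 (L : PeriodPair) (i : Fin 3) : IsClosed (poles4 L i) :=
  L.isClosed_lattice.union (isClosed_translate L (halfPeriod L i))

lemma isClosed_poles5 (L : PeriodPair) (i j : Fin 3) : IsClosed (poles5 L i j) :=
  L.isClosed_lattice.union
    ((isClosed_translate L (halfPeriod L i)).union (isClosed_translate L (halfPeriod L j)))

lemma mem_compl_poles4 {x : ℂ} : x ∈ (poles4 L i)ᶜ ↔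
    x ∉ L.lattice ∧ x + halfPeriod L i ∉ L.lattice := by
  simp [poles4]

lemma mem_compl_poles5 {x : ℂ} : x ∈ (poles5 L i j)ᶜ ↔
    x ∉ L.lattice ∧ x + halfPeriod L i ∉ L.lattice ∧ x + halfPeriod L j ∉ L.lattice := by
  simp [poles5]

/-- The derivative of `Φ_i (x; u)` with respect to `x`. -/
def dPhiShift (L : PeriodPair) (i : Fin 3) (x u : ℂ) : ℂ :=
  Complex.exp (zeta L (halfPeriod L i) * u - zeta L u * halfPeriod L i) *
    dPhi L (x + halfPeriod L i) u

lemma hasDerivAt_PhiShift {x : ℂ} (u : ℂ) (hxi : x + halfPeriod L i ∉ L.lattice) :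
    HasDerivAt (fun t ↦ PhiShift L i t u) (dPhiShift L i x u) x :=
  ((hasDerivAt_Phi u hxi).comp_add_const x _).const_mul _

lemma hasDerivAt_dPhiShift {x u : ℂ} (hxi : x + halfPeriod L i ∉ L.lattice) (hu : u ∉ L.lattice) :
    HasDerivAt (fun t ↦ dPhiShift L i t u)
      ((2 * L.weierstrassP (x + halfPeriod L i) + L.weierstrassP u) * PhiShift L i x u) x := by
  refine (((hasDerivAt_dPhi hxi hu).comp_add_const x _).const_mul _).congr_deriv ?_
  simp only [PhiShift]
  ring

/-- The constant exponential in `PhiShift` is the one for which all exponentials cancel here. -/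
lemma rootP_mul_PhiShift (i : Fin 3) {x u : ℂ} (hx : x ∉ L.lattice)
    (hxi : x + halfPeriod L i ∉ L.lattice) (hu : u ∉ L.lattice) (hxu : x - u ∉ L.lattice) :
    rootP L i x * PhiShift L i x u = Phi L x u * rootP L i (x - u) := by
  have h1 := sigma_ne_zero L hx
  have h2 := sigma_ne_zero L hxi
  have h3 := sigma_ne_zero L hu
  have h4 := sigma_ne_zero L hxu
  have h5 := sigma_ne_zero L (halfPeriod_notMem L i)
  have he : Complex.exp (-(zeta L (halfPeriod L i) * x)) *
      Complex.exp (zeta L (halfPeriod L i) * u - zeta L u * halfPeriod L i) *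
      Complex.exp (zeta L u * (x + halfPeriod L i)) =
      Complex.exp (zeta L u * x) * Complex.exp (-(zeta L (halfPeriod L i) * (x - u))) := by
    rw [← Complex.exp_add, ← Complex.exp_add, ← Complex.exp_add]
    ring_nf
  simp only [rootP, PhiShift, Phi]
  rw [show x - u + halfPeriod L i = x + halfPeriod L i - u by ring]
  generalize Complex.exp (-(zeta L (halfPeriod L i) * (x - u))) = E₁ at he ⊢
  generalize Complex.exp (zeta L u * x) = E₂ at he ⊢
  generalize Complex.exp (zeta L u * (x + halfPeriod L i)) = E₃ at he ⊢
  generalize Complex.exp (zeta L (halfPeriod L i) * u - zeta L u * halfPeriod L i) = E₄ at he ⊢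
  field_simp
  linear_combination sigma L (x + halfPeriod L i - u) * he

/-- `rootP_mul_PhiShift` multiplied by `R_i(x)`, with the addition theorem for `R_i` inserted and `Z
Φ = Φ'`. -/
lemma PhiShift_eq (hij : i ≠ j) (hjk : j ≠ k) (hik : i ≠ k) {x u : ℂ} (hx : x ∉ L.lattice)
    (hxi : x + halfPeriod L i ∉ L.lattice) (hu : u ∉ L.lattice) :
    (L.weierstrassP x - e L i) * PhiShift L i x u =
      rootP L i u * dPhi L x u - rootP L j u * rootP L k u * Phi L x u := by
  have hS : (poles4 L i)ᶜ ⊆ (L.lattice : Set ℂ)ᶜ := fun y hy h ↦ hy (.inl h)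
  refine eq_of_eq_off_translates (L := L)
    (f := fun x ↦ (L.weierstrassP x - e L i) * PhiShift L i x u)
    (g := fun x ↦ rootP L i u * dPhi L x u - rootP L j u * rootP L k u * Phi L x u) u
    (isClosed_poles4 L i)
    (ContinuousOn.mul ((L.differentiableOn_weierstrassP.sub_const _).continuousOn.mono hS)
      (fun y hy ↦ (hasDerivAt_PhiShift u
        (mem_compl_poles4.mp hy).2).continuousAt.continuousWithinAt))
    ((((differentiableOn_dPhi u).const_mul _).fun_sub
      ((differentiableOn_Phi u).const_mul _)).continuousOn.mono hS)
    (fun x hx hxu _ ↦ ?_) (x := x) (mem_compl_poles4.mpr ⟨hx, hxi⟩)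
  obtain ⟨hx, hxi⟩ := mem_compl_poles4.mp hx
  rw [dPhi_eq_mul_zetaSum hx hu hxu, ← rootP_sq L i hx]
  linear_combination rootP L i x * rootP_mul_PhiShift i hx hxi hu hxu +
    Phi L x u * rootP_mul_rootP_sub hij hjk hik hx hu hxu

lemma dPhiShift_eq (hij : i ≠ j) (hjk : j ≠ k) (hik : i ≠ k) {x u : ℂ} (hx : x ∉ L.lattice)
    (hxi : x + halfPeriod L i ∉ L.lattice) (hu : u ∉ L.lattice) :
    (L.weierstrassP x - e L i) * dPhiShift L i x u =
      rootP L j u * rootP L k u * dPhi L x u -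
        (2 * e L i + L.weierstrassP u) * rootP L i u * Phi L x u := by
  have h1 := ((hasDerivAt_weierstrassP L hx).sub_const (e L i)).fun_mul (hasDerivAt_PhiShift u hxi)
  have h2 := ((hasDerivAt_dPhi hx hu).const_mul (rootP L i u)).fun_sub
    ((hasDerivAt_Phi u hx).const_mul (rootP L j u * rootP L k u))
  have h3 := h1.unique (h2.congr_of_eventuallyEq (by
    filter_upwards [(isClosed_poles4 L i).isOpen_compl.mem_nhds
      (mem_compl_poles4.mpr ⟨hx, hxi⟩)] with t ht
    obtain ⟨ht, hti⟩ := mem_compl_poles4.mp ht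
    exact PhiShift_eq hij hjk hik ht hti hu))
  apply mul_left_cancel₀ (weierstrassP_sub_e_ne_zero L i hx hxi)
  linear_combination (L.weierstrassP x - e L i) * h3 -
    L.derivWeierstrassP x * PhiShift_eq hij hjk hik hx hxi hu -
    rootP L i u * derivWeierstrassP_mul_dPhi hx hu +
    rootP L j u * rootP L k u * derivWeierstrassP_mul_Phi hx hu -
    dPhi L x u * (-2 * rootP L j u * rootP L k u * rootP_sq L i hu +
      2 * rootP L i u * rootP_mul_mul L hij hjk hik hu) +
    Phi L x u * (-2 * rootP L j u * rootP L k u * rootP_mul_mul L hij hjk hik hu +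
      2 * rootP L i u * (rootP L k u ^ 2 * rootP_sq L j hu +
        (L.weierstrassP u - e L j) * rootP_sq L k hu) +
      rootP L i u / 2 * g₂_eq L hij hjk hik -
      2 * rootP L i u * (L.weierstrassP u + e L i) * e_add_add L hij hjk hik)

/-- This and the next two lemmas remove the shifted `℘` from the Schrödinger equation: the new
coefficients depend on `u` only, so the equation holds once finitely many constants vanish. -/
lemma weierstrassP_shift_mul_Phi (hij : i ≠ j) (hjk : j ≠ k) (hik : i ≠ k) {x u : ℂ}
    (hx : x ∉ L.lattice) (hxi : x + halfPeriod L i ∉ L.lattice) (hu : u ∉ L.lattice) :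
    L.weierstrassP (x + halfPeriod L i) * Phi L x u = e L i * Phi L x u +
      rootP L i u * dPhiShift L i x u - rootP L j u * rootP L k u * PhiShift L i x u := by
  have h0 := weierstrassP_sub_e_ne_zero L i hx hxi
  have h1 := PhiShift_eq hij hjk hik hx hxi hu
  have h2 := dPhiShift_eq hij hjk hik hx hxi hu
  rw [weierstrassP_add_halfPeriod L hij hjk hik hx hxi]
  field_simp
  linear_combination (-rootP L i u) * h2 + rootP L j u * rootP L k u * h1 +
    Phi L x u * ((2 * e L i + L.weierstrassP u) * rootP_sq L i hu -
      rootP L k u ^ 2 * rootP_sq L j hu - (L.weierstrassP u - e L j) * rootP_sq L k hu) +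
    Phi L x u * (L.weierstrassP u - e L i) * e_add_add L hij hjk hik

lemma weierstrassP_shift_mul_dPhi (hij : i ≠ j) (hjk : j ≠ k) (hik : i ≠ k) {x u : ℂ}
    (hx : x ∉ L.lattice) (hxi : x + halfPeriod L i ∉ L.lattice) (hu : u ∉ L.lattice) :
    L.weierstrassP (x + halfPeriod L i) * dPhi L x u = e L i * dPhi L x u +
      rootP L j u * rootP L k u * dPhiShift L i x u -
      (2 * e L i + L.weierstrassP u) * rootP L i u * PhiShift L i x u := by
  have h0 := weierstrassP_sub_e_ne_zero L i hx hxi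
  have h1 := PhiShift_eq hij hjk hik hx hxi hu
  have h2 := dPhiShift_eq hij hjk hik hx hxi hu
  rw [weierstrassP_add_halfPeriod L hij hjk hik hx hxi]
  field_simp
  linear_combination (-rootP L j u * rootP L k u) * h2 +
    (2 * e L i + L.weierstrassP u) * rootP L i u * h1 +
    dPhi L x u * ((2 * e L i + L.weierstrassP u) * rootP_sq L i hu -
      rootP L k u ^ 2 * rootP_sq L j hu - (L.weierstrassP u - e L j) * rootP_sq L k hu) +
    dPhi L x u * (L.weierstrassP u - e L i) * e_add_add L hij hjk hik

lemma weierstrassP_shift_mul_PhiShift (hij : i ≠ j) (hjk : j ≠ k) (hik : i ≠ k) {x u : ℂ}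
    (hx : x ∉ L.lattice) (hxi : x + halfPeriod L i ∉ L.lattice)
    (hxj : x + halfPeriod L j ∉ L.lattice) (hu : u ∉ L.lattice) :
    L.weierstrassP (x + halfPeriod L j) * PhiShift L i x u = e L k * PhiShift L i x u +
      rootP L k u * dPhiShift L j x u - rootP L i u * rootP L j u * PhiShift L j x u := by
  have h0 := weierstrassP_sub_e_ne_zero L j hx hxj
  have h1 := PhiShift_eq hij hjk hik hx hxi hu
  have h2 := PhiShift_eq hij.symm hik hjk hx hxj hu
  have h3 := dPhiShift_eq hij.symm hik hjk hx hxj hu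
  rw [weierstrassP_add_halfPeriod L hij.symm hik hjk hx hxj]
  field_simp
  linear_combination (e L j - e L k) * h1 - rootP L k u * h3 + rootP L i u * rootP L j u * h2 +
    rootP L i u * dPhi L x u * (rootP_sq L j hu - rootP_sq L k hu) -
    rootP L j u * rootP L k u * Phi L x u * (rootP_sq L i hu - e_add_add L hij hjk hik)

/-! ### Solutions of the Schrödinger equation -/

lemma solvesSchrodinger_of_hasDerivAt {V : ℂ → ℂ} {S : Set ℂ} (hS : IsClosed S) {z : ℂ}
    {ψ ψ₁ ψ₂ : ℂ → ℂ} (h₁ : ∀ x ∈ Sᶜ, HasDerivAt ψ (ψ₁ x) x)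
    (h₂ : ∀ x ∈ Sᶜ, HasDerivAt ψ₁ (ψ₂ x) x) (h : ∀ x ∈ Sᶜ, -ψ₂ x + V x * ψ x = z * ψ x) :
    SolvesSchrodinger V S z ψ := by
  refine ⟨fun x hx ↦ (h₁ x hx).differentiableAt.differentiableWithinAt, fun x hx ↦ ?_⟩
  rw [((h₂ x hx).congr_of_eventuallyEq (by
    filter_upwards [hS.isOpen_compl.mem_nhds hx] with t ht using (h₁ t ht).deriv)).deriv]
  exact h x hx

lemma solvesSchrodinger_congr {V : ℂ → ℂ} {S : Set ℂ} (hS : IsClosed S) {z : ℂ}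
    {ψ φ : ℂ → ℂ} (h : SolvesSchrodinger V S z φ) (heq : ∀ x ∈ Sᶜ, ψ x = φ x) :
    SolvesSchrodinger V S z ψ := by
  refine ⟨h.1.congr heq, fun x hx ↦ ?_⟩
  have h1 : ψ =ᶠ[𝓝 x] φ := by
    filter_upwards [hS.isOpen_compl.mem_nhds hx] with t ht using heq t ht
  rw [h1.deriv.deriv_eq, heq x hx]
  exact h.2 x hx

/-- The general form of the wave functions. -/
def wave (L : PeriodPair) (i j : Fin 3) (l A B u x : ℂ) : ℂ :=
  Complex.exp (l * x) *
    (l * Phi L x u + dPhi L x u + A * PhiShift L i x u + B * PhiShift L j x u)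

lemma hasDerivAt_exp_mul (l x : ℂ) :
    HasDerivAt (fun t ↦ Complex.exp (l * t)) (l * Complex.exp (l * x)) x := by
  simpa [mul_comm] using ((hasDerivAt_id x).const_mul l).cexp

lemma deriv_exp_mul_Phi (l u : ℂ) {x : ℂ} (hx : x ∉ L.lattice) :
    deriv (fun t ↦ Complex.exp (l * t) * Phi L t u) x =
      Complex.exp (l * x) * (l * Phi L x u + dPhi L x u) := by
  rw [((hasDerivAt_exp_mul l x).fun_mul (hasDerivAt_Phi u hx)).deriv]
  ring

lemma solvesSchrodinger_exp_mul {V : ℂ → ℂ} {S : Set ℂ} (hS : IsClosed S) {z l : ℂ}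
    {g g₁ g₂ : ℂ → ℂ} (h₁ : ∀ x ∈ Sᶜ, HasDerivAt g (g₁ x) x)
    (h₂ : ∀ x ∈ Sᶜ, HasDerivAt g₁ (g₂ x) x)
    (h : ∀ x ∈ Sᶜ, g₂ x + 2 * l * g₁ x + l ^ 2 * g x = (V x - z) * g x) :
    SolvesSchrodinger V S z (fun x ↦ Complex.exp (l * x) * g x) := by
  refine solvesSchrodinger_of_hasDerivAt hS
    (ψ₁ := fun x ↦ Complex.exp (l * x) * (l * g x + g₁ x))
    (ψ₂ := fun x ↦ Complex.exp (l * x) * (g₂ x + 2 * l * g₁ x + l ^ 2 * g x))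
    (fun x hx ↦ ?_) (fun x hx ↦ ?_) (fun x hx ↦ ?_)
  · exact ((hasDerivAt_exp_mul l x).fun_mul (h₁ x hx)).congr_deriv (by ring)
  · exact ((hasDerivAt_exp_mul l x).fun_mul
      (((h₁ x hx).const_mul l).fun_add (h₂ x hx))).congr_deriv (by ring)
  · linear_combination -Complex.exp (l * x) * h x hx

/-- The second derivative of `Φ'`. -/
lemma hasDerivAt_deriv_dPhi {x u : ℂ} (hx : x ∉ L.lattice) (hu : u ∉ L.lattice) :
    HasDerivAt (fun t ↦ (2 * L.weierstrassP t + L.weierstrassP u) * Phi L t u)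
      ((6 * L.weierstrassP x - 3 * L.weierstrassP u) * dPhi L x u -
        2 * L.derivWeierstrassP u * Phi L x u) x := by
  refine ((((hasDerivAt_weierstrassP L hx).const_mul 2).add_const _).fun_mul
    (hasDerivAt_Phi u hx)).congr_deriv ?_
  linear_combination 2 * derivWeierstrassP_mul_Phi hx hu

/-- The coefficient of `Φ'` fixes `z`; what is then left of the coefficient of `Φ` is a multiple of
the Krichever polynomial. -/
lemma solvesSchrodinger_wave3 {l z u : ℂ} (hu : u ∉ L.lattice)
    (hz : z = 3 * L.weierstrassP u - 3 * l ^ 2) (hK : K3 (L.weierstrassP u) (L.derivWeierstrassP u) l = 0) :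
    SolvesSchrodinger (u3 L) (poles3 L) z (wave L i j l 0 0 u) := by
  refine solvesSchrodinger_exp_mul (isClosed_poles3 L)
    (g₁ := fun x ↦ l * dPhi L x u + (2 * L.weierstrassP x + L.weierstrassP u) * Phi L x u)
    (g₂ := fun x ↦ l * ((2 * L.weierstrassP x + L.weierstrassP u) * Phi L x u) +
      ((6 * L.weierstrassP x - 3 * L.weierstrassP u) * dPhi L x u -
        2 * L.derivWeierstrassP u * Phi L x u)) (fun x hx ↦ ?_) (fun x hx ↦ ?_) (fun x hx ↦ ?_)
  · simp only [zero_mul, add_zero]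
    exact ((hasDerivAt_Phi u hx).const_mul l).fun_add (hasDerivAt_dPhi hx hu)
  · exact ((hasDerivAt_dPhi hx hu).const_mul l).fun_add (hasDerivAt_deriv_dPhi hx hu)
  · simp only [u3]
    unfold K3 at hK
    linear_combination (dPhi L x u + l * Phi L x u) * hz - 2 * Phi L x u * hK

/-- The conditions after `hu` say, in order, that the coefficients of `Φ'`, `Φ`, `Φ_i'` and `Φ_i`
vanish. -/
lemma solvesSchrodinger_wave4 (hij : i ≠ j) (hjk : j ≠ k) (hik : i ≠ k) {l z A u : ℂ}
    (hu : u ∉ L.lattice) (hz : z = 3 * L.weierstrassP u - 3 * l ^ 2 + 6 * A * rootP L i u)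
    (h₁ : l ^ 3 + 3 * l * L.weierstrassP u + l * z - 2 * L.derivWeierstrassP u +
      6 * A * rootP L j u * rootP L k u = 0)
    (h₂ : l * A = l * rootP L i u + rootP L j u * rootP L k u)
    (h₃ : A * (L.weierstrassP u + l ^ 2 + z - 4 * e L i) + 2 * l * rootP L j u * rootP L k u +
      2 * (2 * e L i + L.weierstrassP u) * rootP L i u = 0) :
    SolvesSchrodinger (fun x ↦ u4 L i x - 2 * e L i) (poles4 L i) z (wave L i j l A 0 u) := by
  refine solvesSchrodinger_exp_mul (isClosed_poles4 L i)
    (g₁ := fun x ↦ l * dPhi L x u + (2 * L.weierstrassP x + L.weierstrassP u) * Phi L x u +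
      A * dPhiShift L i x u)
    (g₂ := fun x ↦ l * ((2 * L.weierstrassP x + L.weierstrassP u) * Phi L x u) +
      ((6 * L.weierstrassP x - 3 * L.weierstrassP u) * dPhi L x u -
        2 * L.derivWeierstrassP u * Phi L x u) +
      A * ((2 * L.weierstrassP (x + halfPeriod L i) + L.weierstrassP u) * PhiShift L i x u))
    (fun x hx ↦ ?_) (fun x hx ↦ ?_) (fun x hx ↦ ?_)
  all_goals obtain ⟨hx, hxi⟩ := mem_compl_poles4.mp hx
  · simp only [zero_mul, add_zero]
    exact (((hasDerivAt_Phi u hx).const_mul l).fun_add (hasDerivAt_dPhi hx hu)).fun_add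
      ((hasDerivAt_PhiShift u hxi).const_mul A)
  · exact (((hasDerivAt_dPhi hx hu).const_mul l).fun_add (hasDerivAt_deriv_dPhi hx hu)).fun_add
      ((hasDerivAt_dPhiShift hxi hu).const_mul A)
  · have r1 := PhiShift_eq hij hjk hik hx hxi hu
    have r2 := weierstrassP_shift_mul_Phi hij hjk hik hx hxi hu
    have r3 := weierstrassP_shift_mul_dPhi hij hjk hik hx hxi hu
    simp only [u4]
    linear_combination dPhi L x u * hz + Phi L x u * h₁ + 2 * dPhiShift L i x u * h₂ +
      PhiShift L i x u * h₃ - 6 * A * r1 - 2 * l * r2 - 2 * r3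

/-- The conditions after `hu` belong to `Φ'`, `Φ`, `Φ_i'`, `Φ_j'`, `Φ_i` and `Φ_j`, in this order.
-/
lemma solvesSchrodinger_wave5 (hij : i ≠ j) (hjk : j ≠ k) (hik : i ≠ k) {l z A B u : ℂ}
    (hu : u ∉ L.lattice)
    (hz : z = 3 * L.weierstrassP u - 3 * l ^ 2 + 6 * (A * rootP L i u + B * rootP L j u))
    (h₁ : l ^ 3 + 3 * l * L.weierstrassP u + l * z - 2 * L.derivWeierstrassP u +
      6 * rootP L k u * (A * rootP L j u + B * rootP L i u) = 0)
    (h₂ : l * A = l * rootP L i u + rootP L j u * rootP L k u + B * rootP L k u)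
    (h₂' : l * B = l * rootP L j u + rootP L i u * rootP L k u + A * rootP L k u)
    (h₃ : A * (L.weierstrassP u + l ^ 2 + z - 4 * e L k - 6 * e L i) +
      2 * l * rootP L j u * rootP L k u + 2 * (2 * e L i + L.weierstrassP u) * rootP L i u +
      2 * rootP L i u * rootP L j u * B = 0)
    (h₃' : B * (L.weierstrassP u + l ^ 2 + z - 4 * e L k - 6 * e L j) +
      2 * l * rootP L i u * rootP L k u + 2 * (2 * e L j + L.weierstrassP u) * rootP L j u +
      2 * rootP L i u * rootP L j u * A = 0) :
    SolvesSchrodinger (fun x ↦ u5 L i j x + 2 * e L k) (poles5 L i j) z (wave L i j l A B u) := by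
  refine solvesSchrodinger_exp_mul (isClosed_poles5 L i j)
    (g₁ := fun x ↦ l * dPhi L x u + (2 * L.weierstrassP x + L.weierstrassP u) * Phi L x u +
      A * dPhiShift L i x u + B * dPhiShift L j x u)
    (g₂ := fun x ↦ l * ((2 * L.weierstrassP x + L.weierstrassP u) * Phi L x u) +
      ((6 * L.weierstrassP x - 3 * L.weierstrassP u) * dPhi L x u -
        2 * L.derivWeierstrassP u * Phi L x u) +
      A * ((2 * L.weierstrassP (x + halfPeriod L i) + L.weierstrassP u) * PhiShift L i x u) +
      B * ((2 * L.weierstrassP (x + halfPeriod L j) + L.weierstrassP u) * PhiShift L j x u))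
    (fun x hx ↦ ?_) (fun x hx ↦ ?_) (fun x hx ↦ ?_)
  all_goals obtain ⟨hx, hxi, hxj⟩ := mem_compl_poles5.mp hx
  · exact ((((hasDerivAt_Phi u hx).const_mul l).fun_add (hasDerivAt_dPhi hx hu)).fun_add
      ((hasDerivAt_PhiShift u hxi).const_mul A)).fun_add ((hasDerivAt_PhiShift u hxj).const_mul B)
  · exact ((((hasDerivAt_dPhi hx hu).const_mul l).fun_add (hasDerivAt_deriv_dPhi hx hu)).fun_add
      ((hasDerivAt_dPhiShift hxi hu).const_mul A)).fun_add
      ((hasDerivAt_dPhiShift hxj hu).const_mul B)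
  · have r1 := PhiShift_eq hij hjk hik hx hxi hu
    have r1' := PhiShift_eq hij.symm hik hjk hx hxj hu
    have r2 := weierstrassP_shift_mul_Phi hij hjk hik hx hxi hu
    have r2' := weierstrassP_shift_mul_Phi hij.symm hik hjk hx hxj hu
    have r3 := weierstrassP_shift_mul_dPhi hij hjk hik hx hxi hu
    have r3' := weierstrassP_shift_mul_dPhi hij.symm hik hjk hx hxj hu
    have r4 := weierstrassP_shift_mul_PhiShift hij hjk hik hx hxi hxj hu
    have r4' := weierstrassP_shift_mul_PhiShift hij.symm hik hjk hx hxj hxi hu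
    have hs := e_add_add L hij hjk hik
    simp only [u5]
    linear_combination dPhi L x u * hz + Phi L x u * h₁ + 2 * dPhiShift L i x u * h₂ +
      2 * dPhiShift L j x u * h₂' + PhiShift L i x u * h₃ + PhiShift L j x u * h₃' -
      6 * A * r1 - 6 * B * r1' - 2 * l * r2 - 2 * l * r2' - 2 * r3 - 2 * r3' -
      2 * A * r4 - 2 * B * r4' - 2 * (dPhi L x u + l * Phi L x u) * hs

end TreibichVerdier
end

noncomputable section

namespace TreibichVerdier

variable {L : PeriodPair} {i j k : Fin 3}

/-! ### Evaluation of the spectral polynomials -/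

lemma prod_univ_fin_three {M : Type*} [CommMonoid M] (hij : i ≠ j) (hjk : j ≠ k) (hik : i ≠ k)
    (f : Fin 3 → M) : ∏ a, f a = f i * f j * f k := by
  have h : (Finset.univ : Finset (Fin 3)) = {i, j, k} := by
    revert i j k
    decide
  rw [h, Finset.prod_insert (by simp [hij, hik]), Finset.prod_insert (by simp [hjk]),
    Finset.prod_singleton, mul_assoc]

lemma P3_eval (hij : i ≠ j) (hjk : j ≠ k) (hik : i ≠ k) (z : ℂ) : (P3 L).eval z =
    (z ^ 2 - 3 * L.g₂) * ((z - 3 * e L i) * (z - 3 * e L j) * (z - 3 * e L k)) := by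
  simp [P3, prod_univ_fin_three hij hjk hik]

lemma Q4_eval (z : ℂ) : (Q4 L i j).eval z = (z - (e L j + 2 * e L i)) ^ 2 -
    4 * ((e L i - e L j) * (2 * e L j + 7 * e L i)) := by
  simp [Q4]

lemma P4_eval (z : ℂ) : (P4 L i j k).eval z =
    (z + 6 * e L i) * (Q4 L i j).eval z * (Q4 L i k).eval z := by
  simp [P4]

lemma Q5_eval (z : ℂ) : (Q5 L k).eval z = z ^ 3 - 3 * e L k * z ^ 2 +
    (51 * e L k ^ 2 - 20 * L.g₂) * z + (-369 * e L k ^ 3 + 132 * e L k * L.g₂) := by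
  simp [Q5]

lemma P5_eval (z : ℂ) : (P5 L i j k).eval z = (Q5 L k).eval z *
    (z - (6 * e L i - 3 * e L j)) * (z - (6 * e L j - 3 * e L i)) := by
  simp [P5]

/-! ### The first covers as algebraic relations -/

section

variable (hij : i ≠ j) (hjk : j ≠ k) (hik : i ≠ k) {z w : ℂ}

include hij hjk hik in
lemma g₃_eq' : L.g₃ = -4 * e L i * e L j * (e L i + e L j) := by
  rw [g₃_eq L hij hjk hik, e_third L hij hjk hik]
  ring

/-- With `w² = -P` inserted, `λ²` is rational in `z`, and so is `℘'/λ` by `Y3_eq`. Identities on the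
curve thereby become identities in `z` alone; the other two potentials are treated likewise. -/
lemma lambda3_sq (h : (z, w) ∈ Curve (P3 L)) (hD : D3 L z ≠ 0) : lambda3 L z w ^ 2 =
    -4 * (z ^ 3 - 9 / 4 * L.g₂ * z - 27 / 4 * L.g₃) / (9 * D3 L z) := by
  change w ^ 2 = -(P3 L).eval z at h
  rw [P3_eval (by decide : (0 : Fin 3) ≠ 1) (by decide : (1 : Fin 3) ≠ 2) (by decide)] at h
  have e1 : (z - 3 * e L 0) * (z - 3 * e L 1) * (z - 3 * e L 2) =
      z ^ 3 - 9 / 4 * L.g₂ * z - 27 / 4 * L.g₃ := by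
    rw [g₃_eq' (by decide : (0 : Fin 3) ≠ 1) (by decide : (1 : Fin 3) ≠ 2) (by decide),
      e_third L (by decide : (0 : Fin 3) ≠ 1) (by decide : (1 : Fin 3) ≠ 2) (by decide),
      g₂_eq_aux L (by decide : (0 : Fin 3) ≠ 1)]
    ring
  rw [e1] at h
  rw [lambda3, ← D3, div_pow, mul_pow, h, ← D3]
  field_simp
  ring

lemma Y3_eq (hD : D3 L z ≠ 0) : Y3 L z w =
    lambda3 L z w * (z ^ 3 - 9 * L.g₂ * z + 54 * L.g₃) / (9 * D3 L z) := by
  rw [Y3, lambda3, ← D3]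
  field_simp
  ring

lemma X3_eq : X3 L z = -(z ^ 3 - 27 * L.g₃) / (9 * D3 L z) := rfl

lemma mapsTo_krichever3 (h : (z, w) ∈ Curve (P3 L)) (hD : D3 L z ≠ 0) :
    (X3 L z, Y3 L z w, lambda3 L z w) ∈ KricheverCurve L K3 := by
  have h1 := lambda3_sq h hD
  refine ⟨?_, ?_⟩ <;> simp only
  · rw [Y3_eq hD, div_pow, mul_pow, h1, X3_eq]
    field_simp
    unfold D3
    ring
  · have : lambda3 L z w ^ 3 = lambda3 L z w ^ 2 * lambda3 L z w := by ring
    rw [K3, this, h1, Y3_eq hD, X3_eq]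
    field_simp
    ring

/-- The inverse of the map to the Krichever curve, and at the same time the condition on `Φ'` in
`solvesSchrodinger_wave3`. -/
lemma eq_of_krichever3 (h : (z, w) ∈ Curve (P3 L)) (hD : D3 L z ≠ 0) :
    z = 3 * X3 L z - 3 * lambda3 L z w ^ 2 := by
  rw [lambda3_sq h hD, X3_eq]
  field_simp
  unfold D3
  ring

/-- The quotient `S` of `Y4` by its linear factors. -/
def S4 (L : PeriodPair) (i j k : Fin 3) (z : ℂ) : ℂ :=
  z ^ 2 + 3 * e L i * z - 72 * e L i ^ 2 - 27 * e L j * e L k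

lemma D4_ne_zero_iff : D4 L i z ≠ 0 ↔ z + 6 * e L i ≠ 0 ∧ 15 * e L i - 2 * z ≠ 0 := by
  rw [D4, mul_ne_zero_iff]

lemma lambda4_sq (h : (z, w) ∈ Curve (P4 L i j k)) (hD : D4 L i z ≠ 0) : lambda4 L i z w ^ 2 =
    -9 * (Q4 L i j).eval z * (Q4 L i k).eval z /
      (4 * (z + 6 * e L i) * (15 * e L i - 2 * z) ^ 2) := by
  change w ^ 2 = -(P4 L i j k).eval z at h
  obtain ⟨h1, h2⟩ := D4_ne_zero_iff.mp hD
  rw [P4_eval] at h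
  rw [lambda4, div_pow, mul_pow, h, add_comm (6 * e L i)]
  field_simp
  ring

include hij hjk hik in
-- The third of the expressions for `℘(u)`, based on `e_i`. It is symmetric in `j` and `k`, and `S4`
-- is the square root of its numerator.
lemma X4_eq (hD : D4 L i z ≠ 0) : X4 L i j z =
    e L i - S4 L i j k z ^ 2 / (4 * (z + 6 * e L i) * (15 * e L i - 2 * z) ^ 2) := by
  obtain ⟨h1, h2⟩ := D4_ne_zero_iff.mp hD
  rw [X4, S4, Q4_eval, e_third L hij hjk hik]
  -- The linear denominators are made atoms, so that they are cleared without being expanded.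
  generalize hs : z + 6 * e L i = s at *
  generalize hd : 15 * e L i - 2 * z = d at *
  field_simp
  rw [← hs, ← hd]
  ring

lemma S4_swap : S4 L i k j z = S4 L i j k z := by
  rw [S4, S4]
  ring

include hij hjk hik in
lemma X4_swap (hD : D4 L i z ≠ 0) : X4 L i j z = X4 L i k z := by
  rw [X4_eq hij hjk hik hD, X4_eq hik hjk.symm hij hD, S4_swap]

lemma Y4_eq (hD : D4 L i z ≠ 0) : Y4 L i j k z w =
    lambda4 L i z w * ((z - 3 * e L i + 9 * e L j) * (z - 3 * e L i + 9 * e L k) * S4 L i j k z /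
      (6 * (z + 6 * e L i) * (15 * e L i - 2 * z) ^ 2)) := by
  obtain ⟨h1, h2⟩ := D4_ne_zero_iff.mp hD
  rw [Y4, lambda4, ← S4, add_comm (6 * e L i)]
  generalize z + 6 * e L i = s at *
  generalize 15 * e L i - 2 * z = d at *
  field_simp
  ring

include hij hjk hik in
lemma mapsTo_krichever4 (h : (z, w) ∈ Curve (P4 L i j k)) (hD : D4 L i z ≠ 0) :
    (X4 L i j z, Y4 L i j k z w, lambda4 L i z w) ∈ KricheverCurve L (K4 L i j k) := by
  have hl := lambda4_sq h hD
  obtain ⟨h1, h2⟩ := D4_ne_zero_iff.mp hD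
  refine ⟨?_, ?_⟩ <;> simp only
  · rw [Y4_eq hD, mul_pow, hl, X4_eq hij hjk hik hD, Q4_eval, Q4_eval, S4, g₂_eq_aux L hij,
      g₃_eq' hij hjk hik, e_third L hij hjk hik]
    generalize hs : z + 6 * e L i = s at *
    generalize hd : 15 * e L i - 2 * z = d at *
    field_simp
    rw [← hs, ← hd]
    ring
  · rw [K4, show lambda4 L i z w ^ 4 = (lambda4 L i z w ^ 2) ^ 2 by ring, Y4_eq hD,
      show ∀ l y : ℂ, 4 * l * (l * y) = l ^ 2 * 4 * y by intros; ring, hl, X4_eq hij hjk hik hD,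
      Q4_eval, Q4_eval, S4, e_third L hij hjk hik]
    generalize hs : z + 6 * e L i = s at *
    generalize hd : 15 * e L i - 2 * z = d at *
    field_simp
    rw [← hs, ← hd]
    ring

include hij hjk hik in
/-- The numerator of the coefficient of `Φ_i` in the wave function of `u₄`. -/
lemma kappa4_eq (h : (z, w) ∈ Curve (P4 L i j k)) (hD : D4 L i z ≠ 0) :
    3 * lambda4 L i z w ^ 2 - 3 * X4 L i j z + z = S4 L i j k z / (15 * e L i - 2 * z) := by
  obtain ⟨h1, h2⟩ := D4_ne_zero_iff.mp hD
  rw [lambda4_sq h hD, X4_eq hij hjk hik hD, Q4_eval, Q4_eval, S4, e_third L hij hjk hik]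
  generalize hs : z + 6 * e L i = s at *
  generalize hd : 15 * e L i - 2 * z = d at *
  field_simp
  rw [← hs, ← hd]
  ring

lemma lambda5_sq (h : (z, w) ∈ Curve (P5 L i j k)) : lambda5 L k z w ^ 2 =
    -16 * ((Q5 L k).eval z * (z - (6 * e L i - 3 * e L j)) * (z - (6 * e L j - 3 * e L i))) /
      D5 L k z ^ 2 := by
  change w ^ 2 = -(P5 L i j k).eval z at h
  rw [P5_eval] at h
  rw [lambda5, ← D5, div_pow, mul_pow, h]
  ring

lemma X5_eq : X5 L k z = e L k - (Q5 L k).eval z * (z + 15 * e L k) ^ 2 / D5 L k z ^ 2 := rfl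

lemma Y5_eq (hD : D5 L k z ≠ 0) : Y5 L i j k z w = lambda5 L k z w *
    ((z + 15 * e L k) * R5 L k i z * R5 L k j z / (2 * D5 L k z ^ 2)) := by
  rw [Y5, lambda5, ← D5]
  field_simp
  ring

include hij hjk hik in
lemma mapsTo_krichever5 (h : (z, w) ∈ Curve (P5 L i j k)) (hD : D5 L k z ≠ 0) :
    (X5 L k z, Y5 L i j k z w, lambda5 L k z w) ∈ KricheverCurve L (K5 L k) := by
  have hl := lambda5_sq h
  refine ⟨?_, ?_⟩ <;> simp only
  · rw [Y5_eq hD, mul_pow, hl, X5_eq]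
    field_simp
    rw [D5, Q5_eval, R5, R5, g₂_eq_aux L hij, g₃_eq' hij hjk hik, e_third L hij hjk hik]
    ring
  · rw [K5, Y5_eq hD]
    generalize lambda5 L k z w = l at *
    -- `K5` is odd in `(l, y)`: with `y` a multiple of `l`, a factor `l` splits off and only `l²`
    -- remains.
    have : ∀ x y : ℂ, l ^ 5 - 2 * (e L k + 5 * x) * l ^ 3 + 10 * (l * y) * l ^ 2 +
        3 * (3 * e L k + 5 * x) * (e L k - x) * l - 2 * (l * y) * (e L k - x) =
        l * ((l ^ 2) ^ 2 - 2 * (e L k + 5 * x) * l ^ 2 + 10 * y * l ^ 2 +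
        3 * (3 * e L k + 5 * x) * (e L k - x) - 2 * y * (e L k - x)) := by intros; ring
    rw [this, mul_eq_zero, hl, X5_eq]
    right
    field_simp
    rw [D5, Q5_eval, R5, R5, g₂_eq_aux L hij, e_third L hij hjk hik]
    ring

end

end TreibichVerdier
end

noncomputable section

namespace TreibichVerdier

variable {L : PeriodPair} {i j k : Fin 3}

/-! ### The correspondence with the curves of the coverings -/

section

variable (hij : i ≠ j) (hjk : j ≠ k) (hik : i ≠ k) {z w : ℂ}

/-- `9 e_a² - 3 g₂ = -3 (e_b - e_c)²`, so the edges `3 e_a` are never zeros of `D3`. -/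
lemma three_mul_e_sq_ne {a b c : Fin 3} (hab : a ≠ b) (hbc : b ≠ c) (hac : a ≠ c) :
    (3 * e L a) ^ 2 ≠ 3 * L.g₂ := by
  intro h
  apply pow_ne_zero 2 (sub_ne_zero.mpr (e_ne L hbc))
  rw [g₂_eq_aux L hab] at h
  rw [e_third L hab hbc hac]
  linear_combination -h / 3

lemma bijOn_krichever3 : Set.BijOn (fun p : ℂ × ℂ ↦ (X3 L p.1, Y3 L p.1 p.2, lambda3 L p.1 p.2))
    {p ∈ Curve (P3 L) | D3 L p.1 ≠ 0} (KricheverCurve L K3) := by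
  refine ⟨fun p hp ↦ mapsTo_krichever3 hp.1 hp.2, ?_, ?_⟩
  · rintro ⟨z, w⟩ ⟨h, hD⟩ ⟨z', w'⟩ ⟨h', hD'⟩ heq
    simp only [Prod.mk.injEq] at heq
    obtain ⟨h1, -, h3⟩ := heq
    have hz : z = z' := by
      rw [eq_of_krichever3 h hD, eq_of_krichever3 h' hD', h1, h3]
    subst hz
    rw [lambda3, lambda3, ← D3] at h3
    simp only at hD
    field_simp at h3
    rw [h3]
  · rintro ⟨x, y, l⟩ ⟨hE, hK⟩
    simp only [K3] at hE hK
    set z := 3 * x - 3 * l ^ 2 with hz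
    -- Elimination of `y` between the torus and `K3 = 0`.
    have hr : 9 * D3 L z * l ^ 2 = -(4 * z ^ 3 - 9 * L.g₂ * z - 27 * L.g₃) := by
      unfold D3
      linear_combination 27 * (y - l ^ 3 + 3 * l * x) * hK - 27 * hE
    have e01 : (0 : Fin 3) ≠ 1 := by decide
    have e12 : (1 : Fin 3) ≠ 2 := by decide
    have e02 : (0 : Fin 3) ≠ 2 := by decide
    have hprod : 4 * z ^ 3 - 9 * L.g₂ * z - 27 * L.g₃ =
        4 * ((z - 3 * e L 0) * (z - 3 * e L 1) * (z - 3 * e L 2)) := by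
      rw [g₃_eq' e01 e12 e02, e_third L e01 e12 e02, g₂_eq_aux L e01]
      ring
    -- If `D3 = 0`, then `hr` makes `z` one of the `3 e_a`, where `D3` does not vanish.
    have hD : D3 L z ≠ 0 := by
      intro hD
      rw [hD, hprod] at hr
      have aux : ∀ {a b c : Fin 3}, a ≠ b → b ≠ c → a ≠ c → z - 3 * e L a ≠ 0 := by
        intro a b c hab hbc hac h
        refine three_mul_e_sq_ne (L := L) hab hbc hac ?_
        rw [D3] at hD
        linear_combination hD - (z + 3 * e L a) * h
      have h0 := mul_ne_zero (mul_ne_zero (aux e01 e12 e02) (aux e01.symm e02 e12))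
        (aux e02.symm e01 e12.symm)
      apply h0
      linear_combination hr / 4
    have hmem : (z, 3 * D3 L z * l / 2) ∈ Curve (P3 L) := by
      change (3 * D3 L z * l / 2) ^ 2 = -(P3 L).eval z
      rw [P3_eval e01 e12 e02, ← D3]
      linear_combination D3 L z / 4 * hr - D3 L z / 4 * hprod
    have hl : lambda3 L z (3 * D3 L z * l / 2) = l := by
      rw [lambda3, ← D3]
      field_simp
    have hx : X3 L z = x := by
      have := eq_of_krichever3 hmem hD
      rw [hl] at this
      linear_combination -this / 3 + hz / 3
    refine ⟨(z, 3 * D3 L z * l / 2), ⟨hmem, hD⟩, ?_⟩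
    have hK' := (mapsTo_krichever3 hmem hD).2
    simp only [K3, hl, hx] at hK'
    simp only [hx, hl, Prod.mk.injEq, true_and, and_true]
    linear_combination hK' - hK

include hij hjk hik in
-- By `kappa4_eq` the fraction on the left is `κ = 3λ² - 3℘ + z`. Hence this relation determines `z`
-- from `(℘, ℘', λ)` wherever `λ ≠ 0`.
lemma lambda4_mul_kappa4 (hD : D4 L i z ≠ 0) :
    lambda4 L i z w * (S4 L i j k z / (15 * e L i - 2 * z)) =
      6 * lambda4 L i z w * (X4 L i j z - e L i) - 3 * Y4 L i j k z w := by
  obtain ⟨h1, h2⟩ := D4_ne_zero_iff.mp hD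
  rw [Y4_eq hD, X4_eq hij hjk hik hD]
  generalize lambda4 L i z w = l
  have : ∀ a b : ℂ, 6 * l * (e L i - a - e L i) - 3 * (l * b) = l * (- 6 * a - 3 * b) := by
    intros; ring
  rw [this]
  congr 1
  rw [S4, e_third L hij hjk hik]
  generalize hs : z + 6 * e L i = s at *
  generalize hd : 15 * e L i - 2 * z = d at *
  field_simp
  rw [← hs, ← hd]
  ring

include hij hjk hik in
lemma eq_of_krichever4 (h : (z, w) ∈ Curve (P4 L i j k)) (hD : D4 L i z ≠ 0) (hw : w ≠ 0) :
    z = 9 * X4 L i j z - 6 * e L i - 3 * lambda4 L i z w ^ 2 -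
      3 * Y4 L i j k z w / lambda4 L i z w := by
  obtain ⟨h1, h2⟩ := D4_ne_zero_iff.mp hD
  have hl : lambda4 L i z w ≠ 0 := by
    rw [lambda4, add_comm (6 * e L i)]
    simp [hw, h1, h2]
  have h3 := kappa4_eq hij hjk hik h hD
  have h4 := lambda4_mul_kappa4 hij hjk hik (w := w) hD
  rw [← h3] at h4
  field_simp
  linear_combination h4

include hij hjk hik in
lemma e_sub_mul_sub_ne_zero : (e L i - e L j) * (e L i - e L k) ≠ 0 ∧
    (e L j - e L k) ^ 2 ≠ 0 :=
  ⟨mul_ne_zero (sub_ne_zero.mpr (e_ne L hij)) (sub_ne_zero.mpr (e_ne L hik)),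
    pow_ne_zero 2 (sub_ne_zero.mpr (e_ne L hjk))⟩

include hij hjk hik in
lemma bijOn_krichever4 : Set.BijOn
    (fun p : ℂ × ℂ ↦ (X4 L i j p.1, Y4 L i j k p.1 p.2, lambda4 L i p.1 p.2))
    {p ∈ Curve (P4 L i j k) | D4 L i p.1 ≠ 0 ∧ p.2 ≠ 0}
    {p ∈ KricheverCurve L (K4 L i j k) | p.2.2 ≠ 0} := by
  have hlam : ∀ {z w}, D4 L i z ≠ 0 → (lambda4 L i z w * (2 * D4 L i z) / 3 = w) := by
    intro z w hD
    obtain ⟨h1, h2⟩ := D4_ne_zero_iff.mp hD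
    rw [lambda4, D4, add_comm (6 * e L i)]
    generalize z + 6 * e L i = s at *
    generalize 15 * e L i - 2 * z = d at *
    field_simp
  refine ⟨fun p hp ↦ ⟨mapsTo_krichever4 hij hjk hik hp.1 hp.2.1, ?_⟩, ?_, ?_⟩
  · intro h
    simp only at h
    apply hp.2.2
    rw [← hlam (w := p.2) hp.2.1, h]
    ring
  · rintro ⟨z, w⟩ ⟨h, hD, hw⟩ ⟨z', w'⟩ ⟨h', hD', hw'⟩ heq
    simp only [Prod.mk.injEq] at heq hD hD' hw hw'
    obtain ⟨h1, h2, h3⟩ := heq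
    have hz : z = z' := by
      rw [eq_of_krichever4 hij hjk hik h hD hw, eq_of_krichever4 hij hjk hik h' hD' hw',
        h1, h2, h3]
    subst hz
    rw [← hlam (w := w) hD, h3, hlam hD]
  · rintro ⟨x, Y, l⟩ ⟨⟨hE, hK⟩, hl⟩
    simp only [K4] at hE hK hl
    obtain ⟨y, rfl⟩ : ∃ y, Y = l * y := ⟨Y / l, by field_simp⟩
    obtain ⟨hh, hh'⟩ := e_sub_mul_sub_ne_zero (L := L) hij hjk hik
    have hc : y ^ 2 * l ^ 2 = 4 * (x - e L i) * (x - e L j) * (x - e L k) := by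
      rw [g₂_eq_aux L hij, g₃_eq' hij hjk hik] at hE
      rw [e_third L hij hjk hik]
      linear_combination hE
    have hl2 : l ^ 2 ≠ 0 := pow_ne_zero 2 hl
    obtain ⟨T, hT⟩ : ∃ T, x = T + e L i := ⟨x - e L i, by ring⟩
    -- `s` is to become `z + 6 e_i` and `κ` to become `S4 / (15 e_i - 2z)`; both values are dictated
    -- by `eq_of_krichever4` and `lambda4_mul_kappa4`.
    obtain ⟨s, hs⟩ : ∃ s, s = 9 * x - 3 * l ^ 2 - 3 * y := ⟨_, rfl⟩
    obtain ⟨κ, hκ⟩ : ∃ κ, κ = 6 * T - 3 * y := ⟨_, rfl⟩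
    have hsum := e_add_add L hij hjk hik
    have hk := e_third L hij hjk hik
    -- `X4_eq` in the new variables; it combines the torus equation with `K4 = 0`.
    have h4 : 4 * s * T = -κ ^ 2 := by
      apply mul_left_cancel₀ hl2
      rw [hs, hκ]
      subst hT
      rw [hk] at hK hc
      linear_combination 9 * hc - 12 * T * hK
    -- `s = 0` gives `κ = 0`. The torus equation then forces `T = 0`, and `K4 = 0` forces `(e_i -
    -- e_j)(e_i - e_k) = 0`.
    have hs0 : s ≠ 0 := by
      intro h
      rw [h] at h4
      have hκ0 : κ = 0 := by
        rw [← sq_eq_zero_iff]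
        linear_combination h4
      have hy : y = 2 * T := by linear_combination (hκ - hκ0) / 3
      have hm : l ^ 2 = T + 3 * e L i := by
        linear_combination (hs - h) / 3 + 3 * hT - hy
      rw [hy, hm, hT] at hc
      have hT0 : T = 0 := by
        apply mul_left_cancel₀ hh
        rw [hk] at hc ⊢
        linear_combination -hc / 4
      apply hh
      rw [show l ^ 4 = (l ^ 2) ^ 2 by ring, show 4 * l * (l * y) = 4 * l ^ 2 * y by ring, hm, hy,
        hT, hT0] at hK
      rw [hk] at hK ⊢
      linear_combination -hK / 3
    obtain ⟨z, hz⟩ : ∃ z, s = z + 6 * e L i := ⟨s - 6 * e L i, by ring⟩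
    have hm : l ^ 2 = T + 3 * e L i + (κ - s) / 3 := by
      linear_combination hs / 3 + 3 * hT - hκ / 3
    have hy : y = 2 * T - κ / 3 := by linear_combination hκ / 3
    -- The torus equation yields this only after division by `κ²`. When `κ = 0` also `T = 0`, and
    -- `K4 = 0` gives `S4 = 0` directly.
    have hS : (15 * e L i - 2 * z) * κ = S4 L i j k z := by
      by_cases hκ0 : κ = 0
      · have hT0 : T = 0 := by
          rw [hκ0] at h4
          apply mul_left_cancel₀ hs0
          linear_combination h4 / 4
        rw [show l ^ 4 = (l ^ 2) ^ 2 by ring, show 4 * l * (l * y) = 4 * l ^ 2 * y by ring, hm, hy,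
          hT, hT0, hκ0] at hK
        rw [hκ0, S4]
        rw [hk] at hK ⊢
        rw [hz] at hK
        linear_combination -9 * hK
      · have h5 : κ ^ 2 * (κ ^ 2 - 3 * κ * (3 * e L i + (κ - s) / 3) -
            s * (3 * e L i + (κ - s) / 3) - 9 * ((e L i - e L j) * (e L i - e L k))) = 0 := by
          rw [hy, hm, hT] at hc
          rw [hk] at hc ⊢
          linear_combination (-9 * s) * hc + (-3 * s * T + κ ^ 2 -
            3 * κ * (3 * e L i + (κ - s) / 3) -
            9 * ((e L i - e L j) * (e L i - (-e L i - e L j)))) * h4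
        have h6 := (mul_eq_zero.mp h5).resolve_left (pow_ne_zero 2 hκ0)
        rw [S4]
        rw [hk, hz] at h6
        rw [hk]
        linear_combination -3 * h6
    -- At `z = 15 e_i / 2` the value of `S4` is `27/4 (e_j - e_k)²`.
    have hd : 15 * e L i - 2 * z ≠ 0 := by
      intro h
      apply hh'
      rw [h, S4] at hS
      rw [hk] at hS ⊢
      linear_combination -(4 / 27) * hS + 2 / 27 * (z + 21 / 2 * e L i) * h
    have hD : D4 L i z ≠ 0 := D4_ne_zero_iff.mpr ⟨hz ▸ hs0, hd⟩
    have hmem : (z, l * (2 * D4 L i z) / 3) ∈ Curve (P4 L i j k) := by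
      change (l * (2 * D4 L i z) / 3) ^ 2 = -(P4 L i j k).eval z
      have h7 : 4 * s * (15 * e L i - 2 * z) ^ 2 * l ^ 2 =
          -9 * (Q4 L i j).eval z * (Q4 L i k).eval z := by
        have h8 : 4 * s * (15 * e L i - 2 * z) ^ 2 * T = -S4 L i j k z ^ 2 := by
          rw [← hS]
          linear_combination (15 * e L i - 2 * z) ^ 2 * h4
        rw [hm, Q4_eval, Q4_eval]
        have h9 : 4 * s * (15 * e L i - 2 * z) ^ 2 * (T + 3 * e L i + (κ - s) / 3) =
            -S4 L i j k z ^ 2 + 4 * s * (15 * e L i - 2 * z) * ((15 * e L i - 2 * z) *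
            (3 * e L i - s / 3) + S4 L i j k z / 3) := by
          linear_combination h8 + 4 / 3 * s * (15 * e L i - 2 * z) * hS
        rw [h9, S4, hk, hz]
        ring
      rw [P4_eval, D4, ← hz]
      linear_combination s / 9 * h7
    have hl' : lambda4 L i z (l * (2 * D4 L i z) / 3) = l := by
      have := hlam (w := l * (2 * D4 L i z) / 3) hD
      apply mul_right_cancel₀ hD
      linear_combination 3 / 2 * this
    have hκ' : κ = S4 L i j k z / (15 * e L i - 2 * z) := by
      rw [← hS]
      field_simp
    have hX : X4 L i j z = x := by
      have h1 := kappa4_eq hij hjk hik hmem hD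
      rw [hl', ← hκ'] at h1
      linear_combination -h1 / 3 + hm - hz / 3 - hT
    refine ⟨(z, l * (2 * D4 L i z) / 3), ⟨hmem, hD, ?_⟩, ?_⟩
    · simp [hl, hD]
    · have h1 := lambda4_mul_kappa4 hij hjk hik (w := l * (2 * D4 L i z) / 3) hD
      rw [hl', ← hκ', hX] at h1
      simp only [hX, hl', Prod.mk.injEq, true_and, and_true]
      linear_combination h1 / 3 - l * hy + 2 * l * hT

end

end TreibichVerdier
end

noncomputable section

namespace TreibichVerdier

variable {L : PeriodPair} {i j k : Fin 3}

/-! ### The Krichever curve of the five-sheeted cover. -/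

section

variable (hij : i ≠ j) (hjk : j ≠ k) (hik : i ≠ k) {z w : ℂ}

include hij hjk hik in
-- This relation makes `λ² - (℘ - e_k)` the simple fraction `-3c/D` of `lambda5_sq_sub`, although
-- both terms have the denominator `D²`.
lemma three_mul_D5 : 3 * D5 L k z = 16 * ((z - (6 * e L i - 3 * e L j)) *
    (z - (6 * e L j - 3 * e L i))) - (z + 15 * e L k) ^ 2 := by
  rw [D5, g₂_eq_aux L hij, e_third L hij hjk hik]
  ring

include hij hjk hik in
lemma lambda5_sq_sub (h : (z, w) ∈ Curve (P5 L i j k)) (hD : D5 L k z ≠ 0) :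
    lambda5 L k z w ^ 2 - (X5 L k z - e L k) = -3 * (Q5 L k).eval z / D5 L k z := by
  rw [lambda5_sq h, X5_eq]
  field_simp
  linear_combination (Q5 L k).eval z * three_mul_D5 (L := L) (z := z) hij hjk hik

lemma lambda5_mul (hD : D5 L k z ≠ 0) : lambda5 L k z w * D5 L k z = -4 * w := by
  rw [lambda5, ← D5]
  field_simp

lemma Q5_ne_zero (h : (z, w) ∈ Curve (P5 L i j k)) (hw : w ≠ 0) : (Q5 L k).eval z ≠ 0 := by
  intro h0
  change w ^ 2 = -(P5 L i j k).eval z at h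
  rw [P5_eval, h0] at h
  exact hw (by simpa using h)

include hij hjk hik in
-- It determines `z` from `(℘, ℘', λ)` unless `λ² = ℘ - e_k`; where `D ≠ 0` the latter occurs only
-- at zeros of `c`, hence only for `w = 0`.
lemma krichever5_mul (h : (z, w) ∈ Curve (P5 L i j k)) (hD : D5 L k z ≠ 0) :
    (z - 3 * X5 L k z + 3 * lambda5 L k z w ^ 2) *
      (lambda5 L k z w ^ 2 - (X5 L k z - e L k)) =
    6 * ((lambda5 L k z w ^ 2 + (X5 L k z - e L k)) * (2 * X5 L k z + e L k) -
      2 * lambda5 L k z w * Y5 L i j k z w) := by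
  rw [lambda5_sq_sub hij hjk hik h hD, Y5_eq hD,
    show ∀ l y : ℂ, 2 * l * (l * y) = 2 * l ^ 2 * y by intros; ring, lambda5_sq h, X5_eq]
  field_simp
  rw [D5, Q5_eval, R5, R5, g₂_eq_aux L hij, e_third L hij hjk hik]
  ring

include hij hjk hik in
lemma eq_of_krichever5 (h : (z, w) ∈ Curve (P5 L i j k)) (hD : D5 L k z ≠ 0) (hw : w ≠ 0) :
    z = 3 * X5 L k z - 3 * lambda5 L k z w ^ 2 +
    6 * ((lambda5 L k z w ^ 2 + (X5 L k z - e L k)) * (2 * X5 L k z + e L k) -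
      2 * lambda5 L k z w * Y5 L i j k z w) / (lambda5 L k z w ^ 2 - (X5 L k z - e L k)) := by
  have h1 : lambda5 L k z w ^ 2 - (X5 L k z - e L k) ≠ 0 := by
    rw [lambda5_sq_sub hij hjk hik h hD]
    have := Q5_ne_zero h hw
    simp [hD, this]
  rw [← krichever5_mul hij hjk hik h hD]
  field_simp
  ring

include hij hjk hik in
-- Elimination in `m = l²` and `d = m - (x - e_k)`. Here `hK` is `K5 = 0` with `Y = l y`, divided by
-- `l`; the candidate `z` is the solution of the linear equation of `krichever5_mul`; then `hK`
-- turns into `h6` and the torus equation into `hW`, and together they yield `d D(z) = -3c(z)`.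
lemma surjOn_krichever5 {x y l : ℂ} (hl : l ≠ 0)
    (hc : y ^ 2 * l ^ 2 = 4 * (x - e L i) * (x - e L j) * (x - e L k))
    (hK : y * (10 * l ^ 2 + 2 * (x - e L k)) + l ^ 4 - 12 * e L k * l ^ 2 -
      10 * (x - e L k) * l ^ 2 - 24 * e L k * (x - e L k) - 15 * (x - e L k) ^ 2 = 0) :
    l ^ 2 - (x - e L k) ≠ 0 ∧ ∃ z, D5 L k z ≠ 0 ∧
      D5 L k z * (l ^ 2 - (x - e L k)) = -3 * (Q5 L k).eval z ∧
      3 * l ^ 2 * D5 L k z = 16 * (l ^ 2 - (x - e L k)) * ((z - (6 * e L i - 3 * e L j)) *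
        (z - (6 * e L j - 3 * e L i))) ∧
      (z - 3 * x + 3 * l ^ 2) * (l ^ 2 - (x - e L k)) =
        6 * ((l ^ 2 + (x - e L k)) * (2 * x + e L k) - 2 * l ^ 2 * y) := by
  obtain ⟨hh, hh'⟩ := e_sub_mul_sub_ne_zero (L := L) hik.symm hij hjk.symm
  have hk := e_third L hij hjk hik
  obtain ⟨m, hm⟩ : ∃ m, l ^ 2 = m := ⟨_, rfl⟩
  have hm0 : m ≠ 0 := hm ▸ pow_ne_zero 2 hl
  rw [show l ^ 4 = (l ^ 2) ^ 2 by ring] at hK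
  rw [hm] at hK hc ⊢
  obtain ⟨d, hd⟩ : ∃ d, m - (x - e L k) = d := ⟨_, rfl⟩
  have hx : x = m - d + e L k := by linear_combination -hd
  rw [hd]
  -- For `d = 0` the two equations reduce to `y = 2m + 3e_k` and `(e_i - e_j)² = 0`.
  have hd0 : d ≠ 0 := by
    intro h0
    rw [hx, h0] at hc hK
    have hy : y = 2 * m + 3 * e L k := by
      apply mul_left_cancel₀ hm0
      linear_combination hK / 12
    apply hh'
    rw [hy] at hc
    rw [hk] at hc
    apply mul_left_cancel₀ hm0
    linear_combination hc
  refine ⟨hd0, ?_⟩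
  obtain ⟨z, hz⟩ : ∃ z, (z - 3 * x + 3 * m) * d =
      6 * ((m + (x - e L k)) * (2 * x + e L k) - 2 * m * y) :=
    ⟨6 * ((m + (x - e L k)) * (2 * x + e L k) - 2 * m * y) / d + 3 * x - 3 * m, by
      field_simp
      ring⟩
  refine ⟨z, ?_⟩
  -- `K5 = 0` with `y` replaced through the definition of `z`; a factor `d` cancels.
  have h6 : 6 * m * (z - 3 * e L k) = d * (z + 15 * e L k - 9 * d) := by
    apply mul_left_cancel₀ hd0
    rw [hx] at hK hz
    linear_combination -6 * m * hK + (6 * m - d) * hz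
  have hW : (6 * (2 * m - d) * (2 * m - 2 * d + 3 * e L k) - (z - 3 * e L k + 3 * d) * d) ^ 2 =
      576 * m * (m - d) * ((m - d) ^ 2 + 3 * e L k * (m - d) +
        (e L k - e L i) * (e L k - e L j)) := by
    have hy : 6 * (2 * m - d) * (2 * m - 2 * d + 3 * e L k) - (z - 3 * e L k + 3 * d) * d =
        12 * m * y := by
      rw [hx] at hz
      linear_combination -hz
    rw [hy]
    rw [hx] at hc
    rw [hk] at hc ⊢
    linear_combination 144 * m * hc
  have hmain : D5 L k z * d = -3 * (Q5 L k).eval z ∧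
      3 * m * D5 L k z = 16 * d * ((z - (6 * e L i - 3 * e L j)) *
        (z - (6 * e L j - 3 * e L i))) := by
    -- At `z = 3 e_k` the relation `h6` no longer determines `m`, but it gives `d = 2 e_k`.
    -- Otherwise `m` can be eliminated from `hW`.
    by_cases hM : z - 3 * e L k = 0
    · have hz3 : z = 3 * e L k := by linear_combination hM
      have hd2 : d = 2 * e L k := by
        apply mul_left_cancel₀ hd0
        rw [hz3] at h6
        linear_combination h6 / 9
      rw [D5, Q5_eval, g₂_eq_aux L hij, hz3, hd2]
      rw [hz3, hd2] at hW
      refine ⟨by rw [hk]; ring, ?_⟩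
      apply mul_left_cancel₀ hm0
      rw [hk] at hW ⊢
      linear_combination -9 / 4 * hW
    · have hmU : m = d * (z + 15 * e L k - 9 * d) / (6 * (z - 3 * e L k)) := by
        rw [eq_div_iff (mul_ne_zero (by norm_num) hM)]
        linear_combination h6
      have hN : z + 15 * e L k - 9 * d ≠ 0 := by
        intro h
        rw [h] at hmU
        exact hm0 (by simpa using hmU)
      have h1 : D5 L k z * d = -3 * (Q5 L k).eval z := by
        have h2 : d ^ 2 * (z - 3 * e L k) ^ 2 * (z + 15 * e L k - 9 * d) *
            (D5 L k z * d + 3 * (Q5 L k).eval z) = 0 := by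
          rw [hmU] at hW
          generalize hMM : z - 3 * e L k = M at *
          field_simp at hW
          obtain rfl : z = M + 3 * e L k := by linear_combination hMM
          rw [D5, Q5_eval, g₂_eq_aux L hij]
          rw [hk] at hW ⊢
          linear_combination d ^ 2 / 432 * hW
        rcases mul_eq_zero.mp h2 with h3 | h3
        · exact absurd h3 (mul_ne_zero (mul_ne_zero (pow_ne_zero 2 hd0) (pow_ne_zero 2 hM)) hN)
        · linear_combination h3
      refine ⟨h1, ?_⟩
      have h4 : D5 L k z * (z + 15 * e L k) - 32 * (z - 3 * e L k) *
          ((z - (6 * e L i - 3 * e L j)) * (z - (6 * e L j - 3 * e L i))) =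
          -27 * (Q5 L k).eval z := by
        rw [D5, Q5_eval, g₂_eq_aux L hij, hk]
        ring
      apply mul_left_cancel₀ hM
      linear_combination D5 L k z / 2 * h6 + d / 2 * h4 - 9 / 2 * d * h1
  -- `D(z) = 0` would make `z` a common zero of `c` and of a linear factor of `P5`, where `c` equals
  -- a constant times the cube of `e_j - e_k` or `e_i - e_k`.
  refine ⟨fun hD ↦ ?_, hmain.1, hmain.2, hz⟩
  have hc0 : (Q5 L k).eval z = 0 := by linear_combination hmain.1 / 3 - d / 3 * hD
  have hQ0 : (z - (6 * e L i - 3 * e L j)) * (z - (6 * e L j - 3 * e L i)) = 0 := by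
    apply mul_left_cancel₀ hd0
    linear_combination (-1 / 16) * hmain.2 + 3 * m / 16 * hD
  have h1 := pow_ne_zero 3 (sub_ne_zero.mpr (e_ne L hjk))
  have h2 := pow_ne_zero 3 (sub_ne_zero.mpr (e_ne L hik))
  rw [Q5_eval, g₂_eq_aux L hij] at hc0
  rcases mul_eq_zero.mp hQ0 with h | h
  · apply h1
    rw [show z = 6 * e L i - 3 * e L j by linear_combination h] at hc0
    rw [hk] at hc0 ⊢
    linear_combination -hc0 / 9
  · apply h2
    rw [show z = 6 * e L j - 3 * e L i by linear_combination h] at hc0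
    rw [hk] at hc0 ⊢
    linear_combination -hc0 / 9

include hij hjk hik in
lemma bijOn_krichever5 : Set.BijOn
    (fun p : ℂ × ℂ ↦ (X5 L k p.1, Y5 L i j k p.1 p.2, lambda5 L k p.1 p.2))
    {p ∈ Curve (P5 L i j k) | D5 L k p.1 ≠ 0 ∧ p.2 ≠ 0}
    {p ∈ KricheverCurve L (K5 L k) | p.2.2 ≠ 0} := by
  refine ⟨fun p hp ↦ ⟨mapsTo_krichever5 hij hjk hik hp.1 hp.2.1, ?_⟩, ?_, ?_⟩
  · intro h
    simp only at h
    apply hp.2.2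
    have := lambda5_mul (w := p.2) hp.2.1
    rw [h] at this
    linear_combination this / 4
  · rintro ⟨z, w⟩ ⟨h, hD, hw⟩ ⟨z', w'⟩ ⟨h', hD', hw'⟩ heq
    simp only [Prod.mk.injEq] at heq hD hD' hw hw'
    obtain ⟨h1, h2, h3⟩ := heq
    have hz : z = z' := by
      rw [eq_of_krichever5 hij hjk hik h hD hw, eq_of_krichever5 hij hjk hik h' hD' hw',
        h1, h2, h3]
    subst hz
    rw [Prod.mk.injEq]
    refine ⟨rfl, ?_⟩
    linear_combination lambda5_mul (w := w) hD / 4 - lambda5_mul (w := w') hD / 4 -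
      D5 L k z / 4 * h3
  · rintro ⟨x, Y, l⟩ ⟨⟨hE, hK⟩, hl⟩
    simp only [K5] at hE hK hl
    obtain ⟨y, rfl⟩ : ∃ y, Y = l * y := ⟨Y / l, by field_simp⟩
    have hc : y ^ 2 * l ^ 2 = 4 * (x - e L i) * (x - e L j) * (x - e L k) := by
      rw [g₂_eq_aux L hij, g₃_eq' hij hjk hik] at hE
      rw [e_third L hij hjk hik]
      linear_combination hE
    obtain ⟨hd, z, hD, h1, h2, h3⟩ := surjOn_krichever5 hij hjk hik hl hc (by
      apply mul_left_cancel₀ hl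
      linear_combination hK)
    have hQ : D5 L k z ^ 2 * l ^ 2 = -16 * ((Q5 L k).eval z * (z - (6 * e L i - 3 * e L j)) *
        (z - (6 * e L j - 3 * e L i))) := by
      linear_combination D5 L k z / 3 * h2 + 16 / 3 * ((z - (6 * e L i - 3 * e L j)) *
        (z - (6 * e L j - 3 * e L i))) * h1
    have hmem : (z, -D5 L k z * l / 4) ∈ Curve (P5 L i j k) := by
      change (-D5 L k z * l / 4) ^ 2 = -(P5 L i j k).eval z
      rw [P5_eval]
      linear_combination hQ / 16
    have hl' : lambda5 L k z (-D5 L k z * l / 4) = l := by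
      apply mul_right_cancel₀ hD
      rw [lambda5_mul hD]
      ring
    have hX : X5 L k z = x := by
      have h4 := lambda5_sq_sub hij hjk hik hmem hD
      rw [hl', eq_div_iff hD, ← h1, mul_comm] at h4
      have h5 := mul_left_cancel₀ hD h4
      linear_combination -h5
    refine ⟨(z, -D5 L k z * l / 4), ⟨hmem, hD, ?_⟩, ?_⟩
    · simp [hl, hD]
    · have h4 := krichever5_mul hij hjk hik hmem hD
      rw [hl', hX, h3] at h4
      simp only [hX, hl', Prod.mk.injEq, true_and, and_true]
      apply mul_left_cancel₀ hl
      linear_combination h4 / 12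

end

end TreibichVerdier
end

noncomputable section

namespace TreibichVerdier

variable {L : PeriodPair} {i j k : Fin 3}

/-! ### The wave functions -/

lemma tendsto_mul_Phi {u : ℂ} (hu : u ∉ L.lattice) :
    Tendsto (fun x ↦ x * Phi L x u) (𝓝[≠] 0) (𝓝 (-1)) := by
  have h2 := sigma_ne_zero L hu
  have h1 : Tendsto (fun x ↦ sigma L (x - u) / sigma L u * Complex.exp (zeta L u * x))
      (𝓝[≠] 0) (𝓝 (-1)) := by
    have hc : Continuous fun x ↦ sigma L (x - u) / sigma L u * Complex.exp (zeta L u * x) := by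
      have := (differentiable_sigma L).continuous
      fun_prop
    have := hc.tendsto 0
    simp only [mul_zero, Complex.exp_zero, zero_sub, sigma_neg, mul_one, neg_div, div_self h2]
      at this
    exact this.mono_left nhdsWithin_le_nhds
  have h := h1.div (tendsto_sigma_div L) one_ne_zero
  rw [div_one] at h
  refine h.congr' ?_
  filter_upwards [eventually_notMem_lattice L 0] with x hx
  have := sigma_ne_zero L hx
  have := ne_zero_of_notMem hx
  simp only [Phi, Pi.div_apply]
  field_simp

lemma eventually_add_notMem (L : PeriodPair) (u : ℂ) (hu : u ∉ L.lattice) :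
    ∀ᶠ x in 𝓝[≠] (0 : ℂ), x + u ∉ L.lattice := by
  refine nhdsWithin_le_nhds ((isClosed_translate L u).isOpen_compl.mem_nhds ?_)
  simpa using hu

lemma tendsto_sq_mul_dPhi {u : ℂ} (hu : u ∉ L.lattice) :
    Tendsto (fun x ↦ x ^ 2 * dPhi L x u) (𝓝[≠] 0) (𝓝 1) := by
  have h := (tendsto_mul_Phi hu).mul (tendsto_mul_zetaSum hu)
  norm_num at h
  refine h.congr' ?_
  filter_upwards [eventually_notMem_lattice L 0, eventually_add_notMem L (-u) (by simpa using hu)]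
    with x hx hxu
  rw [dPhi_eq_mul_zetaSum hx hu (by simpa [sub_eq_add_neg] using hxu)]
  ring

lemma eventually_notMem_poles5 (L : PeriodPair) (i j : Fin 3) :
    ∀ᶠ x in 𝓝[≠] (0 : ℂ), x ∈ (poles5 L i j)ᶜ := by
  filter_upwards [eventually_notMem_lattice L 0, eventually_add_notMem L _ (halfPeriod_notMem L i),
    eventually_add_notMem L _ (halfPeriod_notMem L j)] with x h1 h2 h3
  exact mem_compl_poles5.mpr ⟨h1, h2, h3⟩

/-- Only `Φ'` has a double pole at the origin, with leading coefficient `1`; no choice of `l`, `A`,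
`B` can cancel it. -/
lemma exists_wave_ne_zero (i j : Fin 3) (l A B : ℂ) {u : ℂ} (hu : u ∉ L.lattice) :
    ∃ x ∈ (poles5 L i j)ᶜ, wave L i j l A B u x ≠ 0 := by
  have hshift : ∀ a : Fin 3, Tendsto (fun x ↦ PhiShift L a x u) (𝓝[≠] 0)
      (𝓝 (PhiShift L a 0 u)) := fun a ↦ by
    refine ((hasDerivAt_PhiShift u ?_).continuousAt.tendsto).mono_left nhdsWithin_le_nhds
    rw [zero_add]
    exact halfPeriod_notMem L a
  have hsq : Tendsto (fun x : ℂ ↦ x ^ 2) (𝓝[≠] 0) (𝓝 0) := by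
    simpa using tendsto_id_punctured.pow 2
  have hexp : Tendsto (fun x ↦ Complex.exp (l * x)) (𝓝[≠] 0) (𝓝 1) := by
    have := ((hasDerivAt_exp_mul l 0).continuousAt.tendsto).mono_left
      (nhdsWithin_le_nhds (s := {0}ᶜ))
    simpa using this
  have h := hexp.mul ((((((tendsto_mul_Phi hu).mul tendsto_id_punctured).const_mul l).add
    (tendsto_sq_mul_dPhi hu)).add ((hsq.mul (hshift i)).const_mul A)).add
    ((hsq.mul (hshift j)).const_mul B))
  have h1 : Tendsto (fun x ↦ x ^ 2 * wave L i j l A B u x) (𝓝[≠] 0) (𝓝 1) := by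
    convert h using 2
    · simp only [wave]
      ring
    · ring
  obtain ⟨x, hx, hx'⟩ :=
    ((h1.eventually_ne one_ne_zero).and (eventually_notMem_poles5 L i j)).exists
  exact ⟨x, hx', right_ne_zero_of_mul hx⟩

lemma compl_poles5_subset_poles4 : (poles5 L i j)ᶜ ⊆ (poles4 L i)ᶜ := fun _ hx ↦
  have h := mem_compl_poles5.mp hx
  mem_compl_poles4.mpr ⟨h.1, h.2.1⟩

lemma compl_poles4_subset_poles3 : (poles4 L i)ᶜ ⊆ (poles3 L)ᶜ := fun _ hx ↦
  (mem_compl_poles4.mp hx).1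

variable {z w u : ℂ}

lemma Psi3_eq_wave (i j : Fin 3) {p : ℂ × ℂ × ℂ} {x : ℂ} (hx : x ∉ L.lattice) :
    Psi3 L p x = wave L i j (lambda3 L p.1 p.2.1) 0 0 p.2.2 x := by
  rw [Psi3, deriv_exp_mul_Phi _ _ hx, wave]
  ring

lemma isWaveFunction3 : IsWaveFunction (u3 L) (poles3 L) (Omega3 L) (Psi3 L) := by
  rintro ⟨z, w, u⟩ ⟨hmem, hD, hu, hX, hY⟩
  simp only at hmem hD hu hX hY
  have hK := (mapsTo_krichever3 hmem hD).2
  simp only at hK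
  refine ⟨solvesSchrodinger_congr (isClosed_poles3 L) (solvesSchrodinger_wave3 (i := 0) (j := 0)
    (l := lambda3 L z w) hu ?_ ?_) (fun x hx ↦ Psi3_eq_wave 0 0 hx), ?_⟩
  · rw [hX]
    exact eq_of_krichever3 hmem hD
  · rw [hX, hY]
    exact hK
  · obtain ⟨x, hx, h⟩ := exists_wave_ne_zero 0 0 (lambda3 L z w) 0 0 hu
    have hx3 := compl_poles4_subset_poles3 (compl_poles5_subset_poles4 hx)
    exact ⟨x, hx3, by rwa [Psi3_eq_wave 0 0 hx3]⟩

/-- The coefficient of `Φ_i` in the wave function of `u₄`. -/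
def a4 (L : PeriodPair) (i : Fin 3) (p : ℂ × ℂ × ℂ) : ℂ :=
  (3 * lambda4 L i p.1 p.2.1 ^ 2 - 3 * L.weierstrassP p.2.2 + p.1) / (6 * rootP L i p.2.2)

lemma Psi4_eq_wave (j : Fin 3) {p : ℂ × ℂ × ℂ} {x : ℂ} (hx : x ∉ L.lattice) :
    Psi4 L i p x = wave L i j (lambda4 L i p.1 p.2.1) (a4 L i p) 0 p.2.2 x := by
  rw [Psi4, deriv_exp_mul_Phi _ _ hx, wave, a4]
  ring

lemma isWaveFunction4 (hij : i ≠ j) (hjk : j ≠ k) (hik : i ≠ k) :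
    IsWaveFunction (fun x ↦ u4 L i x - 2 * e L i) (poles4 L i) (Omega4 L i j k) (Psi4 L i) := by
  rintro ⟨z, w, u⟩ ⟨⟨hmem, hD, hu, hX, hY⟩, ha⟩
  simp only at hmem hD hu hX hY ha
  have hκ := kappa4_eq hij hjk hik hmem hD
  have h2 := lambda4_mul_kappa4 hij hjk hik (w := w) hD
  have hl := lambda4_sq hmem hD
  have hY4 := Y4_eq (L := L) (i := i) (j := j) (k := k) (z := z) (w := w) hD
  have hX4 := X4_eq (L := L) hij hjk hik (z := z) hD
  have hr := rootP_mul_mul L hij hjk hik hu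
  have hra := rootP_sq L i hu
  have hk := e_third L hij hjk hik
  obtain ⟨hs0, hd0⟩ := D4_ne_zero_iff.mp hD
  -- The coefficient of `Φ_i` times `R_i(u)` is rational in `z`. Multiplying the conditions by
  -- powers of `R_i(u)` thus removes all square roots except in products equal to `-℘'(u)/2`.
  have hA : a4 L i (z, w, u) * (6 * rootP L i u) = S4 L i j k z / (15 * e L i - 2 * z) := by
    rw [← hκ, a4, hX]
    field_simp
  rw [← hX] at hκ h2
  rw [← hY] at h2
  refine ⟨solvesSchrodinger_congr (isClosed_poles4 L i) (solvesSchrodinger_wave4 (j := j) hij hjk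
    hik (l := lambda4 L i z w) (A := a4 L i (z, w, u)) hu ?_ ?_ ?_ ?_)
    (fun x hx ↦ Psi4_eq_wave j (mem_compl_poles4.mp hx).1), ?_⟩
  · linear_combination hκ - hA
  · apply mul_left_cancel₀ (pow_ne_zero 2 ha)
    have key : (X4 L i j z - e L i) * (lambda4 L i z w ^ 3 + 3 * lambda4 L i z w * X4 L i j z +
        lambda4 L i z w * z - 2 * Y4 L i j k z w) -
        S4 L i j k z / (15 * e L i - 2 * z) * Y4 L i j k z w / 2 = 0 := by
      rw [hY4, show ∀ l x t a b : ℂ, t * (l ^ 3 + 3 * l * x + l * z - 2 * (l * a)) -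
        b * (l * a) / 2 = l * (t * (l ^ 2 + 3 * x + z - 2 * a) - b * a / 2) by intros; ring, hl,
        hX4, mul_eq_zero]
      right
      rw [Q4_eval, Q4_eval, S4, hk]
      generalize hs : z + 6 * e L i = s at *
      generalize hd : 15 * e L i - 2 * z = d at *
      field_simp
      rw [← hs, ← hd]
      ring
    rw [← hX, ← hY] at key
    linear_combination key + rootP L i u * rootP L j u * rootP L k u * hA +
      S4 L i j k z / (15 * e L i - 2 * z) * hr + (lambda4 L i z w ^ 3 + 3 * lambda4 L i z w *
      L.weierstrassP u + lambda4 L i z w * z - 2 * L.derivWeierstrassP u) * hra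
  · apply mul_left_cancel₀ ha
    linear_combination lambda4 L i z w / 6 * hA + h2 / 6 - lambda4 L i z w * hra - hr
  · apply mul_left_cancel₀ ha
    have key : S4 L i j k z / (15 * e L i - 2 * z) *
        (X4 L i j z + lambda4 L i z w ^ 2 + z - 4 * e L i) -
        6 * lambda4 L i z w * Y4 L i j k z w +
        12 * (2 * e L i + X4 L i j z) * (X4 L i j z - e L i) = 0 := by
      rw [hY4, show ∀ l y : ℂ, 6 * l * (l * y) = 6 * l ^ 2 * y by intros; ring, hl, hX4,
        Q4_eval, Q4_eval, S4, hk]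
      generalize hs : z + 6 * e L i = s at *
      generalize hd : 15 * e L i - 2 * z = d at *
      field_simp
      rw [← hs, ← hd]
      ring
    rw [← hX, ← hY] at key
    linear_combination key / 6 + (L.weierstrassP u + lambda4 L i z w ^ 2 + z - 4 * e L i) / 6 * hA +
      2 * lambda4 L i z w * hr + 2 * (2 * e L i + L.weierstrassP u) * hra
  · obtain ⟨x, hx, h⟩ := exists_wave_ne_zero i j (lambda4 L i z w) (a4 L i (z, w, u)) 0 hu
    have hx4 := compl_poles5_subset_poles4 hx
    exact ⟨x, hx4, by rwa [Psi4_eq_wave j (mem_compl_poles4.mp hx4).1]⟩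

lemma Psi5_eq_wave {p : ℂ × ℂ × ℂ} {x : ℂ} (hx : x ∉ L.lattice) : Psi5 L i j k p x =
    wave L i j (lambda5 L k p.1 p.2.1) (a5 L i j k p) (a5 L j i k p) p.2.2 x := by
  rw [Psi5, deriv_exp_mul_Phi _ _ hx, wave]
  ring

lemma P5_swap : P5 L j i k = P5 L i j k := by
  rw [P5, P5]
  ring

lemma Y5_swap : Y5 L j i k z w = Y5 L i j k z w := by
  rw [Y5, Y5]
  ring

/-- At `w = 0` both `λ` and `℘'(u)` vanish, and the two denominators become `6 R_j R_k` and `6 R_i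
R_k`. If both are nonzero, so is `R_i R_j R_k = -℘'(u)/2`. -/
lemma w_ne_zero_of_mem_Omega5 (hij : i ≠ j) (hjk : j ≠ k) (hik : i ≠ k)
    (h : (z, w, u) ∈ Omega5 L i j k) : w ≠ 0 := by
  obtain ⟨⟨hmem, hD, hu, hX, hY⟩, h1, h2⟩ := h
  rintro rfl
  simp only [den5, lambda5] at h1 h2 hY
  simp only [Y5, mul_zero, zero_mul, zero_div] at hY
  have h3 := rootP_mul_mul L hij hjk hik hu
  rw [hY] at h3
  simp only [mul_zero, zero_div, zero_mul, zero_add, ne_eq, mul_eq_zero, OfNat.ofNat_ne_zero,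
    false_or, not_or, neg_zero] at h1 h2 h3
  tauto

/-- The coefficients of the wave function of `u₅`, rationalised. -/
lemma num5_mul (hij : i ≠ j) (hjk : j ≠ k) (hik : i ≠ k)
    (hmem : (z, w) ∈ Curve (P5 L i j k)) (hD : D5 L k z ≠ 0) :
    (3 * lambda5 L k z w ^ 3 - 9 * lambda5 L k z w * X5 L k z + lambda5 L k z w * z +
      6 * lambda5 L k z w * e L j + 3 * Y5 L i j k z w) *
      (lambda5 L k z w ^ 2 - (X5 L k z - e L k)) =
    6 * (lambda5 L k z w ^ 3 * (X5 L k z - e L i) -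
      3 / 2 * lambda5 L k z w ^ 2 * Y5 L i j k z w +
      lambda5 L k z w * (X5 L k z - e L k) * (X5 L k z - e L i) +
      2 * lambda5 L k z w * (X5 L k z - e L k) * (X5 L k z - e L j) -
      (X5 L k z - e L k) * Y5 L i j k z w / 2) := by
  rw [lambda5_sq_sub hij hjk hik hmem hD, Y5_eq hD]
  have aux : ∀ l x a b c y : ℂ, l ^ 2 = a → (3 * a - 9 * x + z + 6 * e L j + 3 * y) * b =
      6 * (a * (x - e L i) - 3 / 2 * a * y + c * (x - e L i) + 2 * c * (x - e L j) - c * y / 2) →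
      (3 * l ^ 3 - 9 * l * x + l * z + 6 * l * e L j + 3 * (l * y)) * b =
      6 * (l ^ 3 * (x - e L i) - 3 / 2 * l ^ 2 * (l * y) + l * c * (x - e L i) +
        2 * l * c * (x - e L j) - c * (l * y) / 2) := by
    rintro l x a b c y rfl h
    linear_combination l * h
  refine aux _ _ _ _ _ _ (lambda5_sq hmem) ?_
  rw [X5_eq]
  field_simp
  rw [D5, Q5_eval, R5, R5, g₂_eq_aux L hij, e_third L hij hjk hik]
  ring

/-- The relation which makes the coefficients of `Φ_i` in the equation for the wave function of
`u₅` cancel. -/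
lemma coeff5_eq_zero (hij : i ≠ j) (hjk : j ≠ k) (hik : i ≠ k)
    (hmem : (z, w) ∈ Curve (P5 L i j k)) (hD : D5 L k z ≠ 0) {l x y t α β : ℂ}
    (hl : l = lambda5 L k z w) (hx : x = X5 L k z) (hy : y = Y5 L i j k z w) (ht : t = x - e L k)
    (hα : α = (l ^ 2 + t) * (x + l ^ 2 + z - 4 * e L k - 6 * e L i) +
      2 * (2 * e L i + x) * (l ^ 2 - t) + 2 * (x - e L j) * (l ^ 2 + t))
    (hβ : β = 2 * l * (x + l ^ 2 + z - 4 * e L k - 6 * e L i) + 2 * l * (l ^ 2 - t) +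
      4 * l * (x - e L i)) :
    l * ((x - e L i) * α - y * β / 2) + (-y * α / 2 + (x - e L j) * t * β) = 0 := by
  have hl2 := lambda5_sq hmem
  rw [Y5_eq hD, ← hl] at hy
  rw [← hl] at hl2
  obtain ⟨v, hv⟩ : ∃ v, v = (z + 15 * e L k) * R5 L k i z * R5 L k j z / (2 * D5 L k z ^ 2) :=
    ⟨_, rfl⟩
  rw [← hv] at hy
  have key : (x - e L i - v / 2) * ((l ^ 2 + t) * (x + l ^ 2 + z - 4 * e L k - 6 * e L i) +
      2 * (2 * e L i + x) * (l ^ 2 - t) + 2 * (x - e L j) * (l ^ 2 + t)) +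
      2 * (x + l ^ 2 + z - 4 * e L k - 6 * e L i + (l ^ 2 - t) + 2 * (x - e L i)) *
        ((x - e L j) * t - l ^ 2 * v / 2) = 0 := by
    rw [ht, hv, hl2, hx, X5_eq]
    field_simp
    rw [D5, Q5_eval, R5, R5, g₂_eq_aux L hij, e_third L hij hjk hik]
    ring
  rw [hy, hα, hβ]
  linear_combination l * key

/-- Pure algebra in the three roots `a, b, c`, in which `x`, `y` and the `e`'s are polynomials: `y =
-2abc`, `x = (a² + b² + c²)/3` and `e₁ = x - a²` etc. -/
lemma wave5_conditions {l z x y a b c e₁ e₂ e₃ A B : ℂ} (hs : e₁ + e₂ + e₃ = 0)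
    (hr : a * b * c = -y / 2) (ha : a ^ 2 = x - e₁) (hb : b ^ 2 = x - e₂) (hc : c ^ 2 = x - e₃)
    (hT : l ^ 2 - (x - e₃) ≠ 0) (hden : 6 * l * a + 6 * b * c ≠ 0)
    (hden' : 6 * l * b + 6 * a * c ≠ 0)
    (hA : A * (6 * l * a + 6 * b * c) = 3 * l ^ 3 - 9 * l * x + l * z + 6 * l * e₂ + 3 * y)
    (hB : B * (6 * l * b + 6 * a * c) = 3 * l ^ 3 - 9 * l * x + l * z + 6 * l * e₁ + 3 * y)
    (hE : (z - 3 * x + 3 * l ^ 2) * (l ^ 2 - (x - e₃)) =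
      6 * ((l ^ 2 + (x - e₃)) * (2 * x + e₃) - 2 * l * y))
    (hK : l ^ 5 - 2 * (e₃ + 5 * x) * l ^ 3 + 10 * y * l ^ 2 + 3 * (3 * e₃ + 5 * x) * (e₃ - x) * l -
      2 * y * (e₃ - x) = 0)
    (hnA : (3 * l ^ 3 - 9 * l * x + l * z + 6 * l * e₂ + 3 * y) * (l ^ 2 - (x - e₃)) =
      6 * (l ^ 3 * (x - e₁) - 3 / 2 * l ^ 2 * y + l * (x - e₃) * (x - e₁) +
        2 * l * (x - e₃) * (x - e₂) - (x - e₃) * y / 2))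
    (hnB : (3 * l ^ 3 - 9 * l * x + l * z + 6 * l * e₁ + 3 * y) * (l ^ 2 - (x - e₃)) =
      6 * (l ^ 3 * (x - e₂) - 3 / 2 * l ^ 2 * y + l * (x - e₃) * (x - e₂) +
        2 * l * (x - e₃) * (x - e₁) - (x - e₃) * y / 2))
    (hcA : l * ((x - e₁) * ((l ^ 2 + (x - e₃)) * (x + l ^ 2 + z - 4 * e₃ - 6 * e₁) +
        2 * (2 * e₁ + x) * (l ^ 2 - (x - e₃)) + 2 * (x - e₂) * (l ^ 2 + (x - e₃))) -
        y * (2 * l * (x + l ^ 2 + z - 4 * e₃ - 6 * e₁) + 2 * l * (l ^ 2 - (x - e₃)) +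
          4 * l * (x - e₁)) / 2) +
      (-y * ((l ^ 2 + (x - e₃)) * (x + l ^ 2 + z - 4 * e₃ - 6 * e₁) +
        2 * (2 * e₁ + x) * (l ^ 2 - (x - e₃)) + 2 * (x - e₂) * (l ^ 2 + (x - e₃))) / 2 +
        (x - e₂) * (x - e₃) * (2 * l * (x + l ^ 2 + z - 4 * e₃ - 6 * e₁) +
          2 * l * (l ^ 2 - (x - e₃)) + 4 * l * (x - e₁))) = 0)
    (hcB : l * ((x - e₂) * ((l ^ 2 + (x - e₃)) * (x + l ^ 2 + z - 4 * e₃ - 6 * e₂) +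
        2 * (2 * e₂ + x) * (l ^ 2 - (x - e₃)) + 2 * (x - e₁) * (l ^ 2 + (x - e₃))) -
        y * (2 * l * (x + l ^ 2 + z - 4 * e₃ - 6 * e₂) + 2 * l * (l ^ 2 - (x - e₃)) +
          4 * l * (x - e₂)) / 2) +
      (-y * ((l ^ 2 + (x - e₃)) * (x + l ^ 2 + z - 4 * e₃ - 6 * e₂) +
        2 * (2 * e₂ + x) * (l ^ 2 - (x - e₃)) + 2 * (x - e₁) * (l ^ 2 + (x - e₃))) / 2 +
        (x - e₁) * (x - e₃) * (2 * l * (x + l ^ 2 + z - 4 * e₃ - 6 * e₂) +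
          2 * l * (l ^ 2 - (x - e₃)) + 4 * l * (x - e₂))) = 0) :
    z = 3 * x - 3 * l ^ 2 + 6 * (A * a + B * b) ∧
    l ^ 3 + 3 * l * x + l * z - 2 * y + 6 * c * (A * b + B * a) = 0 ∧
    l * A = l * a + b * c + B * c ∧ l * B = l * b + a * c + A * c ∧
    A * (x + l ^ 2 + z - 4 * e₃ - 6 * e₁) + 2 * l * b * c + 2 * (2 * e₁ + x) * a +
      2 * a * b * B = 0 ∧
    B * (x + l ^ 2 + z - 4 * e₃ - 6 * e₂) + 2 * l * a * c + 2 * (2 * e₂ + x) * b +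
      2 * a * b * A = 0 := by
  obtain rfl : y = -2 * (a * b * c) := by linear_combination 2 * hr
  obtain rfl : x = (a ^ 2 + b ^ 2 + c ^ 2) / 3 := by linear_combination (-ha - hb - hc + hs) / 3
  obtain rfl : e₁ = (a ^ 2 + b ^ 2 + c ^ 2) / 3 - a ^ 2 := by linear_combination ha
  obtain rfl : e₂ = (a ^ 2 + b ^ 2 + c ^ 2) / 3 - b ^ 2 := by linear_combination hb
  obtain rfl : e₃ = (a ^ 2 + b ^ 2 + c ^ 2) / 3 - c ^ 2 := by linear_combination hc
  clear hs hr ha hb hc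
  generalize hx : (a ^ 2 + b ^ 2 + c ^ 2) / 3 = x at *
  simp only [sub_sub_cancel] at *
  -- The right side of `hnA` is `6 (la + bc)(l²a + 2lbc + ac²)`, so the denominator of `A` cancels.
  -- The resulting `A` and `B` solve the linear system `lA - cB = la + bc`, `lB - cA = lb + ac` of
  -- determinant `l² - c²`.
  have hA' : A * (l ^ 2 - c ^ 2) = l ^ 2 * a + 2 * l * b * c + a * c ^ 2 := by
    apply mul_right_cancel₀ hden
    linear_combination (l ^ 2 - c ^ 2) * hA + hnA
  have hB' : B * (l ^ 2 - c ^ 2) = l ^ 2 * b + 2 * l * a * c + b * c ^ 2 := by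
    apply mul_right_cancel₀ hden'
    linear_combination (l ^ 2 - c ^ 2) * hB + hnB
  refine ⟨?_, ?_, ?_, ?_, ?_, ?_⟩
  · apply mul_right_cancel₀ hT
    linear_combination hE - 6 * a * hA' - 6 * b * hB' +
      -18 * (l ^ 2 + c ^ 2) * hx
  · apply mul_right_cancel₀ hT
    linear_combination l * hE - 2 * hK + 6 * c * (b * hA' + a * hB') +
      36 * l * c ^ 2 * hx
  · apply mul_right_cancel₀ hT
    linear_combination l * hA' - c * hB'
  · apply mul_right_cancel₀ hT
    linear_combination l * hB' - c * hA'
  · apply mul_right_cancel₀ hden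
    apply mul_right_cancel₀ hT
    linear_combination (6 * l * a + 6 * b * c) * ((x + l ^ 2 + z - 4 * (x - c ^ 2) -
      6 * (x - a ^ 2)) * hA' + 2 * a * b * hB') + 6 * hcA
  · apply mul_right_cancel₀ hden'
    apply mul_right_cancel₀ hT
    linear_combination (6 * l * b + 6 * a * c) * ((x + l ^ 2 + z - 4 * (x - c ^ 2) -
      6 * (x - b ^ 2)) * hB' + 2 * a * b * hA') + 6 * hcB

/-- The relations between the coefficients of the wave function of `u₅`. -/
lemma a5_relations (hij : i ≠ j) (hjk : j ≠ k) (hik : i ≠ k) (hΩ : (z, w, u) ∈ Omega5 L i j k)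
    {l A B : ℂ} (hl : l = lambda5 L k z w) (hA₀ : A = a5 L i j k (z, w, u))
    (hB₀ : B = a5 L j i k (z, w, u)) :
    z = 3 * L.weierstrassP u - 3 * l ^ 2 + 6 * (A * rootP L i u + B * rootP L j u) ∧
    l ^ 3 + 3 * l * L.weierstrassP u + l * z - 2 * L.derivWeierstrassP u +
      6 * rootP L k u * (A * rootP L j u + B * rootP L i u) = 0 ∧
    l * A = l * rootP L i u + rootP L j u * rootP L k u + B * rootP L k u ∧
    l * B = l * rootP L j u + rootP L i u * rootP L k u + A * rootP L k u ∧
    A * (L.weierstrassP u + l ^ 2 + z - 4 * e L k - 6 * e L i) +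
      2 * l * rootP L j u * rootP L k u + 2 * (2 * e L i + L.weierstrassP u) * rootP L i u +
      2 * rootP L i u * rootP L j u * B = 0 ∧
    B * (L.weierstrassP u + l ^ 2 + z - 4 * e L k - 6 * e L j) +
      2 * l * rootP L i u * rootP L k u + 2 * (2 * e L j + L.weierstrassP u) * rootP L j u +
      2 * rootP L i u * rootP L j u * A = 0 := by
  subst hl hA₀ hB₀
  have hw := w_ne_zero_of_mem_Omega5 hij hjk hik hΩ
  obtain ⟨⟨hmem, hD, hu, hX, hY⟩, hden, hden'⟩ := hΩ
  simp only at hmem hD hu hX hY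
  have hmem' : (z, w) ∈ Curve (P5 L j i k) := by rwa [P5_swap]
  have hY' : L.derivWeierstrassP u = Y5 L j i k z w := by rwa [Y5_swap]
  have hA := div_mul_cancel₀ (3 * lambda5 L k z w ^ 3 - 9 * lambda5 L k z w * L.weierstrassP u +
    lambda5 L k z w * z + 6 * lambda5 L k z w * e L j + 3 * L.derivWeierstrassP u) hden
  have hB := div_mul_cancel₀ (3 * lambda5 L k z w ^ 3 - 9 * lambda5 L k z w * L.weierstrassP u +
    lambda5 L k z w * z + 6 * lambda5 L k z w * e L i + 3 * L.derivWeierstrassP u) hden'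
  change a5 L i j k (z, w, u) * _ = _ at hA
  change a5 L j i k (z, w, u) * _ = _ at hB
  have hE := krichever5_mul hij hjk hik hmem hD
  have hK := (mapsTo_krichever5 hij hjk hik hmem hD).2
  simp only [K5] at hK
  have hT : lambda5 L k z w ^ 2 - (L.weierstrassP u - e L k) ≠ 0 := by
    rw [hX, lambda5_sq_sub hij hjk hik hmem hD]
    have := Q5_ne_zero hmem hw
    simp [hD, this]
  have hnA := num5_mul hij hjk hik hmem hD
  have hnB := num5_mul hij.symm hik hjk hmem' hD
  have hcA := coeff5_eq_zero hij hjk hik hmem hD rfl hX hY rfl rfl rfl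
  have hcB := coeff5_eq_zero hij.symm hik hjk hmem' hD rfl hX hY' rfl rfl rfl
  rw [← hX, ← hY] at hE hK hnA
  rw [← hX, ← hY'] at hnB
  have hr := rootP_mul_mul L hij hjk hik hu
  have hra := rootP_sq L i hu
  have hrb := rootP_sq L j hu
  have hrc := rootP_sq L k hu
  have hs := e_add_add L hij hjk hik
  exact wave5_conditions hs hr hra hrb hrc hT hden hden' hA hB hE hK hnA hnB hcA hcB

lemma isWaveFunction5 (hij : i ≠ j) (hjk : j ≠ k) (hik : i ≠ k) :
    IsWaveFunction (fun x ↦ u5 L i j x + 2 * e L k) (poles5 L i j) (Omega5 L i j k)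
      (Psi5 L i j k) := by
  rintro ⟨z, w, u⟩ hΩ
  obtain ⟨c1, c2, c3, c4, c5, c6⟩ := a5_relations hij hjk hik hΩ rfl rfl rfl
  have hu := hΩ.1.2.2.1
  refine ⟨solvesSchrodinger_congr (isClosed_poles5 L i j) (solvesSchrodinger_wave5 hij hjk
    hik (l := lambda5 L k z w) (A := a5 L i j k (z, w, u)) (B := a5 L j i k (z, w, u)) hu
    c1 c2 c3 c4 c5 c6) (fun x hx ↦ Psi5_eq_wave (mem_compl_poles5.mp hx).1), ?_⟩
  obtain ⟨x, hx, h⟩ := exists_wave_ne_zero i j (lambda5 L k z w) (a5 L i j k (z, w, u))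
    (a5 L j i k (z, w, u)) hu
  exact ⟨x, hx, by rwa [Psi5_eq_wave (mem_compl_poles5.mp hx).1]⟩

end TreibichVerdier
end

noncomputable section

namespace TreibichVerdier

variable {L : PeriodPair} {i j k : Fin 3}

/-! ### The spectral polynomials -/

lemma monic_natDegree_quadratic (a b : ℂ) : ((X - C a) ^ 2 - C b : ℂ[X]).Monic ∧
    ((X - C a) ^ 2 - C b : ℂ[X]).natDegree = 2 := by
  have h : ((X - C a) ^ 2 - C b : ℂ[X]) = X ^ 2 - C (2 * a) * X + C (a ^ 2 - b) := by
    simp only [map_mul, map_sub, map_pow, map_ofNat]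
    ring
  rw [h]
  constructor
  · monicity!
  · compute_degree!

lemma P3_monic (L : PeriodPair) : (P3 L).Monic ∧ (P3 L).natDegree = 5 := by
  have h1 : (X ^ 2 - C (3 * L.g₂) : ℂ[X]).Monic := by monicity!
  have h2 : (∏ a, (X - C (3 * e L a))).Monic := monic_prod_of_monic _ _ fun a _ ↦ monic_X_sub_C _
  refine ⟨h1.mul h2, ?_⟩
  rw [P3, h1.natDegree_mul h2, natDegree_prod_of_monic _ _ fun a _ ↦ monic_X_sub_C _,
    natDegree_X_pow_sub_C]
  simp only [natDegree_X_sub_C]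
  rfl

lemma P4_monic : (P4 L i j k).Monic ∧ (P4 L i j k).natDegree = 5 := by
  have h1 : (X + C (6 * e L i) : ℂ[X]).Monic := monic_X_add_C _
  have h2 := fun a ↦ monic_natDegree_quadratic (e L a + 2 * e L i)
    (4 * ((e L i - e L a) * (2 * e L a + 7 * e L i)))
  refine ⟨(h1.mul (h2 j).1).mul (h2 k).1, ?_⟩
  rw [P4, Q4, Q4, (h1.mul (h2 j).1).natDegree_mul (h2 k).1, h1.natDegree_mul (h2 j).1, (h2 j).2,
    (h2 k).2, natDegree_X_add_C]

lemma Q5_monic : (Q5 L k).Monic ∧ (Q5 L k).natDegree = 3 := by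
  unfold Q5
  constructor
  · monicity!
  · compute_degree!

lemma P5_monic : (P5 L i j k).Monic ∧ (P5 L i j k).natDegree = 5 := by
  have h1 := Q5_monic (L := L) (k := k)
  have h2 := monic_X_sub_C (6 * e L i - 3 * e L j)
  have h3 := monic_X_sub_C (6 * e L j - 3 * e L i)
  refine ⟨(h1.1.mul h2).mul h3, ?_⟩
  rw [P5, (h1.1.mul h2).natDegree_mul h3, h1.1.natDegree_mul h2, h1.2, natDegree_X_sub_C,
    natDegree_X_sub_C]

lemma isSpectralPolynomial_of_hasDerivAt {V : ℂ → ℂ} {S : Set ℂ} (hS : IsClosed S) {P : ℂ[X]}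
    (hP : P.Monic ∧ P.natDegree = 5) {f f' f'' g g' g'' : ℂ → ℂ}
    (hf : ∀ x ∈ Sᶜ, HasDerivAt f (f' x) x) (hf' : ∀ x ∈ Sᶜ, HasDerivAt f' (f'' x) x)
    (hg : ∀ x ∈ Sᶜ, HasDerivAt g (g' x) x) (hg' : ∀ x ∈ Sᶜ, HasDerivAt g' (g'' x) x)
    (h : ∀ z, ∀ x ∈ Sᶜ, (z ^ 2 + f x * z + g x) * (f'' x * z + g'' x) / 2 -
      (f' x * z + g' x) ^ 2 / 4 + (z - V x) * (z ^ 2 + f x * z + g x) ^ 2 = P.eval z) :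
    IsSpectralPolynomial V S P := by
  refine ⟨hP.1, hP.2, f, g, fun x hx ↦ (hf x hx).differentiableAt.differentiableWithinAt,
    fun x hx ↦ (hg x hx).differentiableAt.differentiableWithinAt, fun F hF z x hx ↦ ?_⟩
  have h1 : ∀ x ∈ Sᶜ, HasDerivAt (F z) (f' x * z + g' x) x := by
    intro x hx
    rw [show F z = fun x ↦ z ^ 2 + f x * z + g x from funext (hF z)]
    exact (((hf x hx).mul_const z).const_add (z ^ 2)).fun_add (hg x hx)
  have h2 : HasDerivAt (deriv (F z)) (f'' x * z + g'' x) x :=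
    (((hf' x hx).mul_const z).fun_add (hg' x hx)).congr_of_eventuallyEq (by
      filter_upwards [hS.isOpen_compl.mem_nhds hx] with t ht using (h1 t ht).deriv)
  rw [h2.deriv, (h1 x hx).deriv, hF, ← h z x hx]

/-- For all three potentials `P` has no term in `z⁴`, which forces `f₁ = V/2`. The coefficient of
`z³` then gives `f₂ = (3f₁² - f₁''/2)/2` up to a constant read off from `P`. -/
lemma isSpectralPolynomial3 (hij : i ≠ j) (hjk : j ≠ k) (hik : i ≠ k) :
    IsSpectralPolynomial (u3 L) (poles3 L) (P3 L) := by
  refine isSpectralPolynomial_of_hasDerivAt (isClosed_poles3 L) (P3_monic L)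
    (f := fun x ↦ 3 * L.weierstrassP x) (f' := fun x ↦ 3 * L.derivWeierstrassP x)
    (f'' := fun x ↦ 3 * (6 * L.weierstrassP x ^ 2 - L.g₂ / 2))
    (g := fun x ↦ 9 * L.weierstrassP x ^ 2 - 9 * L.g₂ / 4)
    (g' := fun x ↦ 18 * (L.weierstrassP x * L.derivWeierstrassP x))
    (g'' := fun x ↦ 18 * (L.derivWeierstrassP x ^ 2 + L.weierstrassP x *
      (6 * L.weierstrassP x ^ 2 - L.g₂ / 2)))
    (fun x hx ↦ ?_) (fun x hx ↦ ?_) (fun x hx ↦ ?_) (fun x hx ↦ ?_) (fun z x hx ↦ ?_)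
  · exact (hasDerivAt_weierstrassP L hx).const_mul 3
  · exact (hasDerivAt_derivWeierstrassP L hx).const_mul 3
  · exact ((((hasDerivAt_weierstrassP L hx).fun_pow 2).const_mul 9).sub_const _).congr_deriv
      (by push_cast; ring)
  · exact (((hasDerivAt_weierstrassP L hx).fun_mul
      (hasDerivAt_derivWeierstrassP L hx)).const_mul 18).congr_deriv (by ring)
  · have hq := derivWeierstrassP_sq_eq L hij hjk hik hx
    rw [P3_eval hij hjk hik, u3]
    rw [e_third L hij hjk hik] at hq ⊢
    rw [g₂_eq_aux L hij]
    linear_combination (9 * (z ^ 2 + 3 * L.weierstrassP x * z + (9 * L.weierstrassP x ^ 2 -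
      9 * (e L i ^ 2 + e L i * e L j + e L j ^ 2))) -
      (3 * z + 18 * L.weierstrassP x) ^ 2 / 4) * hq

section

variable (hij : i ≠ j) (hjk : j ≠ k) (hik : i ≠ k) {x : ℂ}

lemma hasDerivAt_weierstrassP_shift (hx : x + halfPeriod L i ∉ L.lattice) :
    HasDerivAt (fun t ↦ L.weierstrassP (t + halfPeriod L i))
      (L.derivWeierstrassP (x + halfPeriod L i)) x :=
  (hasDerivAt_weierstrassP L hx).comp_add_const x _

lemma hasDerivAt_derivWeierstrassP_shift (hx : x + halfPeriod L i ∉ L.lattice) :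
    HasDerivAt (fun t ↦ L.derivWeierstrassP (t + halfPeriod L i))
      (6 * L.weierstrassP (x + halfPeriod L i) ^ 2 - L.g₂ / 2) x :=
  (hasDerivAt_derivWeierstrassP L hx).comp_add_const x _

include hij hjk hik in
lemma derivWeierstrassP_add_halfPeriod (hx : x ∉ L.lattice)
    (hxi : x + halfPeriod L i ∉ L.lattice) : L.derivWeierstrassP (x + halfPeriod L i) =
      -((e L i - e L j) * (e L i - e L k)) / (L.weierstrassP x - e L i) ^ 2 *
        L.derivWeierstrassP x := by
  have h0 := weierstrassP_sub_e_ne_zero L i hx hxi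
  have h1 := (((hasDerivAt_weierstrassP L hx).sub_const (e L i)).fun_inv h0).const_mul
    ((e L i - e L j) * (e L i - e L k))
  refine (hasDerivAt_weierstrassP_shift hxi).unique
    (((h1.const_add (e L i)).congr_of_eventuallyEq ?_).congr_deriv ?_)
  · filter_upwards [(isClosed_poles4 L i).isOpen_compl.mem_nhds
      (mem_compl_poles4.mpr ⟨hx, hxi⟩)] with t ht
    obtain ⟨ht, hti⟩ := mem_compl_poles4.mp ht
    rw [weierstrassP_add_halfPeriod L hij hjk hik ht hti]
    rfl
  · ring

include hij hjk hik in
lemma isSpectralPolynomial4 : IsSpectralPolynomial (fun x ↦ u4 L i x - 2 * e L i) (poles4 L i)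
    (P4 L i j k) := by
  refine isSpectralPolynomial_of_hasDerivAt (isClosed_poles4 L i) P4_monic
    (f := fun x ↦ 3 * L.weierstrassP x + L.weierstrassP (x + halfPeriod L i) - e L i)
    (f' := fun x ↦ 3 * L.derivWeierstrassP x + L.derivWeierstrassP (x + halfPeriod L i))
    (f'' := fun x ↦ 3 * (6 * L.weierstrassP x ^ 2 - L.g₂ / 2) +
      (6 * L.weierstrassP (x + halfPeriod L i) ^ 2 - L.g₂ / 2))
    (g := fun x ↦ 9 * L.weierstrassP x ^ 2 + 6 * e L i * L.weierstrassP (x + halfPeriod L i) +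
      (9 * (e L i ^ 2 + e L j * e L k) + 3 / 2 * e L i ^ 2 + L.g₂ / 2 +
        (-91 * e L i ^ 2 - 14 * e L j * e L k) / 2))
    (g' := fun x ↦ 18 * (L.weierstrassP x * L.derivWeierstrassP x) +
      6 * e L i * L.derivWeierstrassP (x + halfPeriod L i))
    (g'' := fun x ↦ 18 * (L.derivWeierstrassP x ^ 2 + L.weierstrassP x *
      (6 * L.weierstrassP x ^ 2 - L.g₂ / 2)) +
      6 * e L i * (6 * L.weierstrassP (x + halfPeriod L i) ^ 2 - L.g₂ / 2))
    (fun x hx ↦ ?_) (fun x hx ↦ ?_) (fun x hx ↦ ?_) (fun x hx ↦ ?_) (fun z x hx ↦ ?_)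
  all_goals obtain ⟨hx, hxi⟩ := mem_compl_poles4.mp hx
  · exact (((hasDerivAt_weierstrassP L hx).const_mul 3).fun_add
      (hasDerivAt_weierstrassP_shift hxi)).sub_const _
  · exact ((hasDerivAt_derivWeierstrassP L hx).const_mul 3).fun_add
      (hasDerivAt_derivWeierstrassP_shift hxi)
  · exact (((((hasDerivAt_weierstrassP L hx).fun_pow 2).const_mul 9).fun_add
      ((hasDerivAt_weierstrassP_shift hxi).const_mul _)).add_const _).congr_deriv
      (by push_cast; ring)
  · exact ((((hasDerivAt_weierstrassP L hx).fun_mul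
      (hasDerivAt_derivWeierstrassP L hx)).const_mul 18).fun_add
      ((hasDerivAt_derivWeierstrassP_shift hxi).const_mul _)).congr_deriv (by ring)
  · have h0 := weierstrassP_sub_e_ne_zero L i hx hxi
    rw [P4_eval, Q4_eval, Q4_eval]
    simp only [u4]
    rw [weierstrassP_add_halfPeriod L hij hjk hik hx hxi,
      derivWeierstrassP_add_halfPeriod hij hjk hik hx hxi]
    have hq := derivWeierstrassP_sq_eq L hij hjk hik hx
    obtain ⟨t, ht⟩ : ∃ t, t = L.weierstrassP x - e L i := ⟨_, rfl⟩
    have hp : L.weierstrassP x = t + e L i := by linear_combination -ht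
    rw [← ht] at h0
    rw [hp] at hq ⊢
    generalize L.derivWeierstrassP x = q at *
    -- The derivative of the shifted `℘` is a multiple of `℘'(x)` by a rational function of `℘(x)`,
    -- so `℘'(x)` enters only through its square.
    rw [show ∀ A B c₁ c₂ : ℂ, A - ((3 * q + c₁ * q) * z + (18 * ((t + e L i) * q) + c₂ * (c₁ * q))) ^ 2
      / 4 + B = A - ((3 + c₁) * z + (18 * (t + e L i) + c₂ * c₁)) ^ 2 * q ^ 2 / 4 + B by
        intros; ring, hq, g₂_eq_aux L hij, e_third L hij hjk hik]
    simp only [add_sub_cancel_right]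
    generalize e L i = a at *
    generalize e L j = b at *
    field_simp
    ring

include hij hjk hik in
lemma isSpectralPolynomial5 : IsSpectralPolynomial (fun x ↦ u5 L i j x + 2 * e L k)
    (poles5 L i j) (P5 L i j k) := by
  refine isSpectralPolynomial_of_hasDerivAt (isClosed_poles5 L i j) P5_monic
    (f := fun x ↦ 3 * L.weierstrassP x + L.weierstrassP (x + halfPeriod L i) +
      L.weierstrassP (x + halfPeriod L j) + e L k)
    (f' := fun x ↦ 3 * L.derivWeierstrassP x + L.derivWeierstrassP (x + halfPeriod L i) +
      L.derivWeierstrassP (x + halfPeriod L j))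
    (f'' := fun x ↦ 3 * (6 * L.weierstrassP x ^ 2 - L.g₂ / 2) +
      (6 * L.weierstrassP (x + halfPeriod L i) ^ 2 - L.g₂ / 2) +
      (6 * L.weierstrassP (x + halfPeriod L j) ^ 2 - L.g₂ / 2))
    (g := fun x ↦ 9 * L.weierstrassP x ^ 2 +
      (9 * e L i + 6 * e L k) * L.weierstrassP (x + halfPeriod L i) +
      (9 * e L j + 6 * e L k) * L.weierstrassP (x + halfPeriod L j) +
      (9 * (e L i ^ 2 + e L j ^ 2 - e L k ^ 2) + 3 * (e L k ^ 2 + e L i * e L j) +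
        3 / 2 * e L k ^ 2 + 5 * L.g₂ / 8 + (81 * e L i * e L j + 24 * e L k ^ 2 - 20 * L.g₂) / 2))
    (g' := fun x ↦ 18 * (L.weierstrassP x * L.derivWeierstrassP x) +
      (9 * e L i + 6 * e L k) * L.derivWeierstrassP (x + halfPeriod L i) +
      (9 * e L j + 6 * e L k) * L.derivWeierstrassP (x + halfPeriod L j))
    (g'' := fun x ↦ 18 * (L.derivWeierstrassP x ^ 2 + L.weierstrassP x *
      (6 * L.weierstrassP x ^ 2 - L.g₂ / 2)) +
      (9 * e L i + 6 * e L k) * (6 * L.weierstrassP (x + halfPeriod L i) ^ 2 - L.g₂ / 2) +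
      (9 * e L j + 6 * e L k) * (6 * L.weierstrassP (x + halfPeriod L j) ^ 2 - L.g₂ / 2))
    (fun x hx ↦ ?_) (fun x hx ↦ ?_) (fun x hx ↦ ?_) (fun x hx ↦ ?_) (fun z x hx ↦ ?_)
  all_goals obtain ⟨hx, hxi, hxj⟩ := mem_compl_poles5.mp hx
  · exact ((((hasDerivAt_weierstrassP L hx).const_mul 3).fun_add
      (hasDerivAt_weierstrassP_shift hxi)).fun_add
      (hasDerivAt_weierstrassP_shift hxj)).add_const _
  · exact (((hasDerivAt_derivWeierstrassP L hx).const_mul 3).fun_add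
      (hasDerivAt_derivWeierstrassP_shift hxi)).fun_add (hasDerivAt_derivWeierstrassP_shift hxj)
  · exact ((((((hasDerivAt_weierstrassP L hx).fun_pow 2).const_mul 9).fun_add
      ((hasDerivAt_weierstrassP_shift hxi).const_mul _)).fun_add
      ((hasDerivAt_weierstrassP_shift hxj).const_mul _)).add_const _).congr_deriv
      (by push_cast; ring)
  · exact (((((hasDerivAt_weierstrassP L hx).fun_mul
      (hasDerivAt_derivWeierstrassP L hx)).const_mul 18).fun_add
      ((hasDerivAt_derivWeierstrassP_shift hxi).const_mul _)).fun_add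
      ((hasDerivAt_derivWeierstrassP_shift hxj).const_mul _)).congr_deriv (by ring)
  · have h0 := weierstrassP_sub_e_ne_zero L i hx hxi
    have h0' := weierstrassP_sub_e_ne_zero L j hx hxj
    rw [P5_eval, Q5_eval]
    simp only [u5]
    rw [weierstrassP_add_halfPeriod L hij hjk hik hx hxi,
      derivWeierstrassP_add_halfPeriod hij hjk hik hx hxi,
      weierstrassP_add_halfPeriod L hij.symm hik hjk hx hxj,
      derivWeierstrassP_add_halfPeriod hij.symm hik hjk hx hxj]
    have hq := derivWeierstrassP_sq_eq L hij hjk hik hx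
    generalize L.derivWeierstrassP x = q at *
    rw [show ∀ A B c₁ c₂ d₁ d₂ : ℂ, A - ((3 * q + c₁ * q + d₁ * q) * z +
      (18 * (L.weierstrassP x * q) + c₂ * (c₁ * q) + d₂ * (d₁ * q))) ^ 2 / 4 + B =
      A - ((3 + c₁ + d₁) * z + (18 * L.weierstrassP x + c₂ * c₁ + d₂ * d₁)) ^ 2 * q ^ 2 / 4 + B by
        intros; ring, hq, g₂_eq_aux L hij, e_third L hij hjk hik]
    obtain ⟨t, ht⟩ : ∃ t, t = L.weierstrassP x - e L i := ⟨_, rfl⟩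
    obtain ⟨s, hs⟩ : ∃ s, s = L.weierstrassP x - e L j := ⟨_, rfl⟩
    have hp : L.weierstrassP x = t + e L i := by linear_combination -ht
    have hj : e L j = t + e L i - s := by linear_combination hs - ht
    rw [← ht] at h0 ⊢
    rw [← hs] at h0' ⊢
    rw [hp, hj]
    generalize e L i = a at *
    field_simp
    ring

/-! ### Simple zeros -/

lemma separable_five {a b c d f : ℂ} :
    ((X - C a) * (X - C b) * (X - C c) * (X - C d) * (X - C f) : ℂ[X]).Separable ↔
      (a ≠ b ∧ a ≠ c ∧ a ≠ d ∧ a ≠ f) ∧ (b ≠ c ∧ b ≠ d ∧ b ≠ f) ∧ (c ≠ d ∧ c ≠ f) ∧ d ≠ f := by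
  have h : ((X - C a) * (X - C b) * (X - C c) * (X - C d) * (X - C f) : ℂ[X]) =
      ∏ n, (X - C (![a, b, c, d, f] n)) := by
    simp [Fin.prod_univ_five]
  rw [h, separable_prod_X_sub_C_iff, ← List.nodup_ofFn]
  simp [List.ofFn_succ]

lemma exists_sq_eq (a : ℂ) : ∃ b, b ^ 2 = a := IsAlgClosed.exists_pow_nat_eq a two_pos

include hij hjk hik in
lemma separable_P3_iff : (P3 L).Separable ↔ L.g₂ ≠ 0 := by
  obtain ⟨s, hs⟩ := exists_sq_eq (3 * L.g₂)
  have hP : P3 L = (X - C s) * (X - C (-s)) * (X - C (3 * e L i)) * (X - C (3 * e L j)) *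
      (X - C (3 * e L k)) := by
    apply Polynomial.funext
    intro z
    rw [P3_eval hij hjk hik]
    simp only [eval_mul, eval_sub, eval_X, eval_C]
    linear_combination (z - 3 * e L i) * (z - 3 * e L j) * (z - 3 * e L k) * hs
  have h1 := hs ▸ (three_mul_e_sq_ne (L := L) hij hjk hik).symm
  have h2 := hs ▸ (three_mul_e_sq_ne (L := L) hij.symm hik hjk).symm
  have h3 := hs ▸ (three_mul_e_sq_ne (L := L) hik.symm hij hjk.symm).symm
  have d1 := e_ne L hij
  have d2 := e_ne L hjk
  have d3 := e_ne L hik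
  rw [hP, separable_five]
  have hne : ∀ {a : ℂ}, s ^ 2 ≠ a ^ 2 → s ≠ a ∧ -s ≠ a := by
    intro a h
    exact ⟨fun h' ↦ h (by rw [h']), fun h' ↦ h (by rw [← h']; ring)⟩
  constructor
  · rintro ⟨⟨h, -⟩, -⟩ h0
    rw [h0, mul_zero, sq_eq_zero_iff] at hs
    rw [hs] at h
    simp at h
  · intro h0
    have hs0 : s ≠ 0 := by
      rintro rfl
      apply h0
      linear_combination -hs / 3
    refine ⟨⟨fun h ↦ hs0 ?_, (hne h1).1, (hne h2).1, (hne h3).1⟩,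
      ⟨(hne h1).2, (hne h2).2, (hne h3).2⟩, ⟨?_, ?_⟩, ?_⟩
    · linear_combination h / 2
    all_goals simpa

include hij hjk hik in
lemma separable_P4_iff : (P4 L i j k).Separable ↔
    2 * e L j + 7 * e L i ≠ 0 ∧ 2 * e L k + 7 * e L i ≠ 0 := by
  have d1 := sub_ne_zero.mpr (e_ne L hij)
  have d2 := sub_ne_zero.mpr (e_ne L hjk)
  have d3 := sub_ne_zero.mpr (e_ne L hik)
  have hk := e_third L hij hjk hik
  obtain ⟨r, hr⟩ := exists_sq_eq ((e L i - e L j) * (2 * e L j + 7 * e L i))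
  obtain ⟨s, hs⟩ := exists_sq_eq ((e L i - e L k) * (2 * e L k + 7 * e L i))
  have hP : P4 L i j k = (X - C (-6 * e L i)) * (X - C (e L j + 2 * e L i + 2 * r)) *
      (X - C (e L j + 2 * e L i - 2 * r)) * (X - C (e L k + 2 * e L i + 2 * s)) *
      (X - C (e L k + 2 * e L i - 2 * s)) := by
    apply Polynomial.funext
    intro z
    rw [P4_eval, Q4_eval, Q4_eval, ← hr, ← hs]
    simp only [eval_mul, eval_sub, eval_X, eval_C]
    ring
  -- `q_j(-6 e_i) = 9 (e_i - e_k)²`, and likewise `q_k(-6 e_i) = 9 (e_i - e_j)²`.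
  have c1 : (e L j + 2 * e L i + 6 * e L i) ^ 2 ≠ 4 * r ^ 2 := by
    intro h
    apply mul_ne_zero (mul_ne_zero d3 d3) (show (9 : ℂ) ≠ 0 by norm_num)
    rw [hr] at h
    rw [hk]
    linear_combination h
  have c2 : (e L k + 2 * e L i + 6 * e L i) ^ 2 ≠ 4 * s ^ 2 := by
    intro h
    apply mul_ne_zero (mul_ne_zero d1 d1) (show (9 : ℂ) ≠ 0 by norm_num)
    rw [hs] at h
    rw [hk] at h
    linear_combination h
  -- `q_j - q_k` is a multiple of `(e_j - e_k)(15 e_i - 2z)`, so a common zero would be `15 e_i /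
  -- 2`, where `q_j` equals `9/4 (e_j - e_k)²`.
  have c3 : ∀ r' s' : ℂ, r' ^ 2 = r ^ 2 → s' ^ 2 = s ^ 2 →
      e L j + 2 * e L i + 2 * r' ≠ e L k + 2 * e L i + 2 * s' := by
    intro r' s' h1 h2 h
    have h3 : 15 * e L i - 2 * (e L j + 2 * e L i + 2 * r') = 0 := by
      apply mul_left_cancel₀ d2
      rw [hr] at h1
      rw [hs] at h2
      rw [hk] at h h2 ⊢
      linear_combination 4 * h1 - 4 * h2 + (-2 * s' - 2 * r' - e L j + (-e L i - e L j)) * h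
    apply pow_ne_zero 2 d2
    rw [hr] at h1
    rw [hk]
    linear_combination 16 / 9 * h1 + (11 * e L i - 2 * e L j + 4 * r') / 9 * h3
  rw [hP, separable_five]
  constructor
  · rintro ⟨-, ⟨h1, -, -⟩, -, h2⟩
    constructor
    · intro h
      rw [h, mul_zero, sq_eq_zero_iff] at hr
      simp [hr] at h1
    · intro h
      rw [h, mul_zero, sq_eq_zero_iff] at hs
      simp [hs] at h2
  · rintro ⟨h1, h2⟩
    have hr0 : r ≠ 0 := by
      rintro rfl
      exact mul_ne_zero d1 h1 (by rw [← hr]; ring)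
    have hs0 : s ≠ 0 := by
      rintro rfl
      exact mul_ne_zero d3 h2 (by rw [← hs]; ring)
    refine ⟨⟨fun h ↦ c1 ?_, fun h ↦ c1 ?_, fun h ↦ c2 ?_, fun h ↦ c2 ?_⟩,
      ⟨fun h ↦ hr0 ?_, c3 r s rfl rfl, fun h ↦ c3 r (-s) rfl (by ring) ?_⟩,
      ⟨fun h ↦ c3 (-r) s (by ring) rfl ?_, fun h ↦ c3 (-r) (-s) (by ring) (by ring) ?_⟩,
      fun h ↦ hs0 ?_⟩
    · rw [show e L j + 2 * e L i + 6 * e L i = -2 * r by linear_combination -h]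
      ring
    · rw [show e L j + 2 * e L i + 6 * e L i = 2 * r by linear_combination -h]
      ring
    · rw [show e L k + 2 * e L i + 6 * e L i = -2 * s by linear_combination -h]
      ring
    · rw [show e L k + 2 * e L i + 6 * e L i = 2 * s by linear_combination -h]
      ring
    · linear_combination h / 4
    · linear_combination h
    · linear_combination h
    · linear_combination h
    · linear_combination h / 4

lemma exists_Q5_eq (L : PeriodPair) (k : Fin 3) : ∃ a b c : ℂ, a + b + c = 3 * e L k ∧
    a * b + a * c + b * c = 51 * e L k ^ 2 - 20 * L.g₂ ∧
    -(a * b * c) = -369 * e L k ^ 3 + 132 * e L k * L.g₂ := by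
  obtain ⟨a, ha⟩ := Complex.exists_root (f := Q5 L k) (by
    rw [degree_eq_natDegree Q5_monic.1.ne_zero, Q5_monic.2]
    norm_num)
  rw [IsRoot, Q5_eval] at ha
  obtain ⟨s, hs⟩ := exists_sq_eq ((a - 3 * e L k) ^ 2 -
    4 * (a ^ 2 - 3 * e L k * a + 51 * e L k ^ 2 - 20 * L.g₂))
  refine ⟨a, (3 * e L k - a + s) / 2, (3 * e L k - a - s) / 2, by ring, ?_, ?_⟩
  · linear_combination -hs / 4
  · linear_combination a * hs / 4 - ha

include hij hjk hik in
lemma Q5_eval_ne_zero : (Q5 L k).eval (6 * e L i - 3 * e L j) ≠ 0 := by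
  rw [Q5_eval, g₂_eq_aux L hij]
  intro h
  apply pow_ne_zero 3 (sub_ne_zero.mpr (e_ne L hjk))
  rw [e_third L hij hjk hik] at h ⊢
  linear_combination -h / 9

include hij hjk hik in
-- The cubic and the linear factors never meet (`Q5_eval_ne_zero`), so everything depends on the
-- discriminant of the cubic, which is `125 g₂ - 348 e_k²` times a nonzero product of differences of
-- the `e`'s.
lemma separable_P5_iff : (P5 L i j k).Separable ↔ 125 * L.g₂ ≠ 348 * e L k ^ 2 := by
  have d1 := sub_ne_zero.mpr (e_ne L hij)
  have d2 := sub_ne_zero.mpr (e_ne L hjk)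
  have d3 := sub_ne_zero.mpr (e_ne L hik)
  have hk := e_third L hij hjk hik
  obtain ⟨a, b, c, h1, h2, h3⟩ := exists_Q5_eq L k
  have hQ : ∀ z, (Q5 L k).eval z = (z - a) * (z - b) * (z - c) := by
    intro z
    rw [Q5_eval]
    linear_combination z ^ 2 * h1 - z * h2 - h3
  have n1 := Q5_eval_ne_zero (L := L) hij hjk hik
  have n2 := Q5_eval_ne_zero (L := L) hij.symm hik hjk
  rw [hQ, mul_ne_zero_iff, mul_ne_zero_iff, sub_ne_zero, sub_ne_zero, sub_ne_zero] at n1 n2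
  have hP : P5 L i j k = (X - C a) * (X - C b) * (X - C c) * (X - C (6 * e L i - 3 * e L j)) *
      (X - C (6 * e L j - 3 * e L i)) := by
    apply Polynomial.funext
    intro z
    rw [P5_eval, hQ]
    simp only [eval_mul, eval_sub, eval_X, eval_C]
  have hdisc : ((a - b) * (a - c) * (b - c)) ^ 2 = -1024 * ((e L i - e L j) ^ 2 *
      ((e L i - e L k) * (e L j - e L k))) * (125 * L.g₂ - 348 * e L k ^ 2) := by
    -- The discriminant `-4p³ - 27q²` after shifting the cubic by the mean `e_k` of its zeros.
    have hd1 : ((a - b) * (a - c) * (b - c)) ^ 2 =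
        -4 * (51 * e L k ^ 2 - 20 * L.g₂ - 3 * e L k ^ 2) ^ 3 -
        27 * (-369 * e L k ^ 3 + 132 * e L k * L.g₂ + (51 * e L k ^ 2 - 20 * L.g₂) * e L k -
          2 * e L k ^ 3) ^ 2 := by
      rw [← h3, ← h2, show e L k = (a + b + c) / 3 by rw [h1]; ring]
      ring
    rw [hd1, g₂_eq_aux L hij, hk]
    ring
  rw [hP, separable_five]
  constructor
  · rintro ⟨⟨h4, h5, -⟩, ⟨h6, -⟩, -⟩ h
    rw [h, sub_self, mul_zero] at hdisc
    exact pow_ne_zero 2 (mul_ne_zero (mul_ne_zero (sub_ne_zero.mpr h4) (sub_ne_zero.mpr h5))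
      (sub_ne_zero.mpr h6)) hdisc
  · intro h
    have h4 : ((a - b) * (a - c) * (b - c)) ^ 2 ≠ 0 := by
      rw [hdisc]
      exact mul_ne_zero (mul_ne_zero (by norm_num) (mul_ne_zero (pow_ne_zero 2 d1)
        (mul_ne_zero d3 d2))) (sub_ne_zero.mpr h)
    rw [pow_ne_zero_iff two_ne_zero, mul_ne_zero_iff, mul_ne_zero_iff, sub_ne_zero, sub_ne_zero,
      sub_ne_zero] at h4
    refine ⟨⟨h4.1.1, h4.1.2, n1.1.1.symm, n2.1.1.symm⟩, ⟨h4.2, n1.1.2.symm, n2.1.2.symm⟩,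
      ⟨n1.2.symm, n2.2.symm⟩, fun h5 ↦ d1 ?_⟩
    linear_combination h5 / 9

end

end TreibichVerdier
end

noncomputable section

namespace TreibichVerdier

variable {L : PeriodPair} {i j k : Fin 3}

/-! ### Degrees of the covers -/

lemma isRationalOfDegree_of_eval {D f : ℂ → ℂ} {N : ℕ} (p q : ℂ[X]) (hp : p.natDegree = N)
    (hq : q.natDegree ≤ N) (hpq : ∀ z, q.eval z = 0 → p.eval z ≠ 0)
    (hD : ∀ z, q.eval z = 0 ↔ D z = 0) (hf : ∀ z, D z ≠ 0 → f z = p.eval z / q.eval z) :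
    IsRationalOfDegree D f N := by
  refine ⟨p, q, ?_, by rw [hp, max_eq_left hq], fun z ↦ ⟨not_congr (hD z), hf z⟩⟩
  rw [Polynomial.isCoprime_iff_aeval_ne_zero_of_isAlgClosed ℂ ℂ]
  intro z
  by_cases h : q.eval z = 0
  · exact .inl (by simpa using hpq z h)
  · exact .inr (by simpa using h)

section

variable (hij : i ≠ j) (hjk : j ≠ k) (hik : i ≠ k)

include hij hjk hik in
lemma numerator3_ne_zero {z : ℂ} (hz' : z ^ 2 = 3 * L.g₂) : z ^ 3 - 27 * L.g₃ ≠ 0 := by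
  intro h
  have hz := hz'
  have h0 : (z - 3 * e L i) * (z - 3 * e L j) * (z - 3 * e L k) = 0 := by
    rw [g₃_eq' hij hjk hik] at h
    rw [g₂_eq_aux L hij] at hz
    rw [e_third L hij hjk hik]
    linear_combination h / 4 + 3 * z / 4 * hz
  rcases mul_eq_zero.mp h0 with h0 | h0
  · rcases mul_eq_zero.mp h0 with h0 | h0
    · exact three_mul_e_sq_ne hij hjk hik (by rw [← sub_eq_zero.mp h0, hz'])
    · exact three_mul_e_sq_ne hjk hik.symm hij.symm (by rw [← sub_eq_zero.mp h0, hz'])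
  · exact three_mul_e_sq_ne hik.symm hij hjk.symm (by rw [← sub_eq_zero.mp h0, hz'])

include hij hjk hik in
lemma isRationalOfDegree_X3 : IsRationalOfDegree (D3 L) (X3 L) 3 := by
  refine isRationalOfDegree_of_eval (-(X ^ 3 - C (27 * L.g₃))) (C 9 * (X ^ 2 - C (3 * L.g₂)))
    (by compute_degree!) (by compute_degree!) (fun z hz h ↦ ?_) (fun z ↦ ?_) (fun z hz ↦ ?_)
  · simp only [eval_mul, eval_neg, eval_sub, eval_pow, eval_X, eval_C] at h hz
    exact numerator3_ne_zero hij hjk hik (by linear_combination hz / 9) (neg_eq_zero.mp h)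
  · simp [D3]
  · simp [X3]

lemma isRationalOfDegree_tX3 : IsRationalOfDegree (fun _ ↦ 1) (tX3 L) 3 := by
  refine isRationalOfDegree_of_eval
    (C (-(9 / 16)) * (C 4 * X ^ 3 - C (9 * L.g₂) * X - C (9 * L.g₃))) 1
    (by compute_degree!) (by compute_degree!) (fun z hz ↦ ?_) (fun z ↦ ?_) (fun z hz ↦ ?_)
  · simp at hz
  · simp
  · simp [tX3]

include hij hjk hik in
-- With `X4_eq` the numerator reduces to `-S4²` at the zeros of the denominator. There `S4` is a
-- nonzero multiple of `(e_i - e_j)(e_i - e_k)` or of `(e_j - e_k)²`.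
lemma isRationalOfDegree_X4 : IsRationalOfDegree (D4 L i) (X4 L i j) 4 := by
  have d1 := sub_ne_zero.mpr (e_ne L hij)
  have d2 := sub_ne_zero.mpr (e_ne L hjk)
  have d3 := sub_ne_zero.mpr (e_ne L hik)
  refine isRationalOfDegree_of_eval
    (C (e L i) * (C 4 * (X + C (6 * e L i)) * (C (15 * e L i) - C 2 * X) ^ 2) -
      (X ^ 2 + C (3 * e L i) * X - C (72 * e L i ^ 2 + 27 * e L j * e L k)) ^ 2)
    (C 4 * (X + C (6 * e L i)) * (C (15 * e L i) - C 2 * X) ^ 2)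
    (by compute_degree!) (by compute_degree!) (fun z hz h ↦ ?_) (fun z ↦ ?_) (fun z hz ↦ ?_)
  · rw [eval_sub, eval_mul, hz, mul_zero, zero_sub] at h
    simp only [eval_mul, eval_add, eval_sub, eval_pow, eval_X, eval_C] at h hz
    have h := pow_eq_zero_iff two_ne_zero |>.mp (neg_eq_zero.mp h)
    rw [e_third L hij hjk hik] at h
    rcases mul_eq_zero.mp hz with hz | hz
    · apply mul_ne_zero d1 d3
      rw [e_third L hij hjk hik]
      linear_combination -h / 27 + (z - 3 * e L i) / 108 * hz
    · apply pow_ne_zero 2 d2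
      rw [e_third L hij hjk hik]
      have hz := pow_eq_zero_iff two_ne_zero |>.mp hz
      linear_combination 4 / 27 * h + (2 * z + 21 * e L i) / 27 * hz
  · simp [D4]
  · rw [X4_eq hij hjk hik hz, S4, eval_sub, eval_mul, sub_div, mul_div_cancel_right₀]
    · simp
      ring
    · obtain ⟨h1, h2⟩ := D4_ne_zero_iff.mp hz
      simp [h1, h2]

include hij hjk hik in
lemma isRationalOfDegree_tX4 : IsRationalOfDegree (fun z ↦ z + 6 * e L i) (tX4 L i j k) 4 := by
  have d1 := sub_ne_zero.mpr (e_ne L hij)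
  have d3 := sub_ne_zero.mpr (e_ne L hik)
  refine isRationalOfDegree_of_eval
    (C (te4' L i j k) * (C 4 * (X + C (6 * e L i))) -
      C 9 * Q4 L i j * (X + C (4 * e L i - e L k)) ^ 2)
    (C 4 * (X + C (6 * e L i)))
    (by rw [Q4]; compute_degree!) (by compute_degree!) (fun z hz h ↦ ?_) (fun z ↦ ?_)
    (fun z hz ↦ ?_)
  · rw [eval_sub, eval_mul, hz, mul_zero, zero_sub] at h
    simp only [eval_mul, eval_add, eval_pow, eval_X, eval_C] at h hz
    have hz : z = -6 * e L i := by linear_combination hz / 4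
    rw [Q4_eval, hz] at h
    apply mul_ne_zero (pow_ne_zero 2 d1) (pow_ne_zero 2 d3)
    rw [e_third L hij hjk hik] at h ⊢
    linear_combination -h / 81
  · simp
  · rw [tX4, eval_sub, eval_mul, sub_div, mul_div_cancel_right₀]
    · simp only [eval_mul, eval_add, eval_pow, eval_X, eval_C]
      ring
    · simpa using hz

include hij hjk hik in
-- `D = 0` makes `(z + 15e_k)²` sixteen times the quadratic factor of `P5`, whose value at `-15e_k`
-- is a nonzero multiple of `(e_i - e_k)(e_j - e_k)`. A common zero of `c` and `D` is also a zero of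
-- `z - 3e_k` times that factor; at `z = 3e_k` one has `D ≠ 0`, and the other case leads back to `z
-- = -15e_k`.
lemma Q5_eval_mul_ne_zero {z : ℂ} (hz : D5 L k z = 0) :
    (Q5 L k).eval z * (z + 15 * e L k) ^ 2 ≠ 0 := by
  intro h
  have h3 := three_mul_D5 (L := L) (z := z) hij hjk hik
  rw [hz] at h3
  have hN : z + 15 * e L k ≠ 0 := by
    intro h0
    rw [h0] at h3
    rw [e_third L hij hjk hik] at h0
    apply mul_ne_zero (sub_ne_zero.mpr (e_ne L hik)) (sub_ne_zero.mpr (e_ne L hjk))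
    rw [e_third L hij hjk hik]
    rw [eq_neg_of_add_eq_zero_left h0] at h3
    linear_combination -h3 / 1296
  have hQ : (Q5 L k).eval z = 0 := by
    rcases mul_eq_zero.mp h with h | h
    · exact h
    · exact absurd (pow_eq_zero_iff two_ne_zero |>.mp h) hN
  have hM : (z - 3 * e L k) * ((z - (6 * e L i - 3 * e L j)) * (z - (6 * e L j - 3 * e L i))) =
      0 := by
    rw [Q5_eval, g₂_eq_aux L hij] at hQ
    rw [D5, g₂_eq_aux L hij] at hz
    rw [e_third L hij hjk hik] at hQ hz ⊢
    linear_combination 27 / 32 * hQ + (z + 15 * (-e L i - e L j)) / 32 * hz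
  rcases mul_eq_zero.mp hM with hM | hM
  · apply pow_ne_zero 2 (sub_ne_zero.mpr (e_ne L hij))
    rw [D5, g₂_eq_aux L hij, sub_eq_zero.mp hM, e_third L hij hjk hik] at hz
    linear_combination -hz / 108
  · rw [hM] at h3
    exact hN (pow_eq_zero_iff two_ne_zero |>.mp (by linear_combination h3))

include hij hjk hik in
lemma isRationalOfDegree_X5 : IsRationalOfDegree (D5 L k) (X5 L k) 5 := by
  have hev : ∀ z, (C 5 * X ^ 2 + C (6 * e L k) * X + C (261 * e L k ^ 2 - 108 * L.g₂)).eval z =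
      D5 L k z := by
    intro z
    simp [D5]
    ring
  refine isRationalOfDegree_of_eval
    (C (e L k) * (C 5 * X ^ 2 + C (6 * e L k) * X + C (261 * e L k ^ 2 - 108 * L.g₂)) ^ 2 -
      Q5 L k * (X + C (15 * e L k)) ^ 2)
    ((C 5 * X ^ 2 + C (6 * e L k) * X + C (261 * e L k ^ 2 - 108 * L.g₂)) ^ 2)
    (by rw [Q5]; compute_degree!) (by compute_degree!) (fun z hz h ↦ ?_) (fun z ↦ ?_)
    (fun z hz ↦ ?_)
  · rw [eval_sub, eval_mul, hz, mul_zero, zero_sub] at h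
    rw [eval_pow, hev] at hz
    simp only [eval_mul, eval_add, eval_pow, eval_X, eval_C] at h
    exact Q5_eval_mul_ne_zero hij hjk hik (pow_eq_zero_iff two_ne_zero |>.mp hz)
      (neg_eq_zero.mp h)
  · rw [eval_pow, hev]
    simp
  · rw [X5_eq, eval_sub, eval_mul, eval_pow, hev, sub_div, mul_div_cancel_right₀ _
      (pow_ne_zero 2 hz)]
    simp

include hij hjk hik in
lemma isRationalOfDegree_tX5 : IsRationalOfDegree (tD5 L i j k) (tX5 L i j k) 5 := by
  have d1 := sub_ne_zero.mpr (e_ne L hij)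
  have d2 := sub_ne_zero.mpr (e_ne L hjk)
  have d3 := sub_ne_zero.mpr (e_ne L hik)
  have hev : ∀ z, (C (-9) * (X ^ 5 + C (3 * e L k) * X ^ 4 +
      C (-42 * e L k ^ 2 + 150 * e L i * e L j) * X ^ 3 +
      C (30 * e L k * (e L i * e L j - e L k ^ 2)) * X ^ 2 +
      C (9 * (69 * e L k ^ 4 + 625 * e L i ^ 2 * e L j ^ 2 - 221 * e L k * L.g₃ / 2)) * X +
      C (-27 * e L k * (11 * e L k ^ 4 - 81 * e L k * L.g₃ / 2 +
        475 * e L i ^ 2 * e L j ^ 2)))).eval z = -9 * N5 L i j k z := by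
    intro z
    simp only [eval_mul, eval_add, eval_pow, eval_X, eval_C, N5]
    ring
  refine isRationalOfDegree_of_eval _
    (C 4 * ((X - C (3 * e L k + 9 * e L i)) * (X - C (3 * e L k + 9 * e L j))))
    (by compute_degree!) (by compute_degree!) (fun z hz ↦ (hev z).trans_ne fun h ↦ ?_) (fun z ↦ ?_)
    (fun z hz ↦ ?_)
  · simp only [eval_mul, eval_sub, eval_X, eval_C] at hz
    rw [N5, g₃_eq' hij hjk hik] at h
    rcases mul_eq_zero.mp hz with hz | hz
    · norm_num at hz
    rcases mul_eq_zero.mp hz with hz | hz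
    · apply mul_ne_zero (pow_ne_zero 2 d1) (pow_ne_zero 3 d2)
      rw [sub_eq_zero.mp hz] at h
      rw [e_third L hij hjk hik] at h ⊢
      linear_combination h / 729
    · apply mul_ne_zero (pow_ne_zero 2 d1) (pow_ne_zero 3 d3)
      rw [sub_eq_zero.mp hz] at h
      rw [e_third L hij hjk hik] at h ⊢
      linear_combination h / 729
  · simp only [eval_mul, eval_sub, eval_X, eval_C, tD5, mul_eq_zero, OfNat.ofNat_ne_zero,
      false_or, sub_sub]
  · rw [hev, tX5]
    simp [sub_sub, mul_assoc]

end

end TreibichVerdier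

end

noncomputable section

namespace TreibichVerdier

variable {L : PeriodPair} {i j k : Fin 3}

/-! ### The covers of the two elliptic curves -/

section

variable (hij : i ≠ j) (hjk : j ≠ k) (hik : i ≠ k) {z w : ℂ}

lemma hasDerivAt_X3 (hD : D3 L z ≠ 0) : HasDerivAt (X3 L) (-(3 * z / 2) * Y3 L z 1) z := by
  have h1 := ((hasDerivAt_pow 3 z).sub_const (27 * L.g₃)).fun_neg
  have h2 := ((hasDerivAt_pow 2 z).sub_const (3 * L.g₂)).const_mul 9
  have hD' : z ^ 2 - 3 * L.g₂ ≠ 0 := hD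
  refine (h1.fun_div h2 (mul_ne_zero (by norm_num) hD')).congr_deriv ?_
  rw [Y3]
  push_cast
  field_simp
  ring

include hij hjk hik in
lemma isTorusCover3 : IsTorusCover (P3 L) (D3 L) (X3 L) (Y3 L) (fun z ↦ -(3 * z / 2)) L.g₂ L.g₃ 3
    where
  degree := isRationalOfDegree_X3 hij hjk hik
  mapsTo _ _ h hD := (mapsTo_krichever3 h hD).1
  reduction z w h hD := by
    have := hasDerivAt_X3 hD
    refine ⟨this.differentiableAt, ?_⟩
    rw [this.deriv, Y3, Y3]
    ring

lemma exists_mem_Omega3 (h : (z, w) ∈ Curve (P3 L)) (hD : D3 L z ≠ 0) :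
    ∃ u, (z, w, u) ∈ Omega3 L := by
  obtain ⟨u, hu, h1, h2⟩ := exists_uniformisation (mapsTo_krichever3 h hD).1
  exact ⟨u, h, hD, hu, h1, h2⟩

include hij hjk hik in
-- The second coordinate is by definition `-X̃' w`, so the reduction of the differential is
-- automatic. What has to be checked is that `-X̃'² P` is the cubic in `X̃`.
lemma isTorusCover_second3 : IsTorusCover (P3 L) (fun _ ↦ 1) (tX3 L)
    (fun z w ↦ -(deriv (tX3 L) z * w)) (fun _ ↦ -1) (tg₂3 L) (tg₃3 L) 3 := by
  have hd (z : ℂ) : HasDerivAt (tX3 L) (-(9 / 16) * (12 * z ^ 2 - 9 * L.g₂)) z := by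
    refine (((((hasDerivAt_pow 3 z).const_mul 4).fun_sub
      ((hasDerivAt_id' z).const_mul (9 * L.g₂))).sub_const (9 * L.g₃)).const_mul
        (-(9 / 16))).congr_deriv ?_
    push_cast
    ring
  refine ⟨isRationalOfDegree_tX3, fun z w h _ ↦ ?_, fun z w h _ ↦ ⟨(hd z).differentiableAt, by ring⟩⟩
  change w ^ 2 = -(P3 L).eval z at h
  rw [(hd z).deriv, neg_sq, mul_pow, h, P3_eval hij hjk hik, tX3, tg₂3, tg₃3, g₂_eq_aux L hij,
    g₃_eq' hij hjk hik, e_third L hij hjk hik]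
  ring

include hij hjk hik in
lemma hasDerivAt_X4 (hD : D4 L i z ≠ 0) :
    HasDerivAt (X4 L i j) ((2 * z + 3 * e L i) * Y4 L i j k z 1) z := by
  obtain ⟨h1, h2⟩ := D4_ne_zero_iff.mp hD
  have hN := (((hasDerivAt_id' z).sub_const (3 * e L i)).add_const (9 * e L j)).fun_pow 2
  have hQ := (((hasDerivAt_id' z).sub_const (e L j + 2 * e L i)).fun_pow 2).sub_const
    (4 * ((e L i - e L j) * (2 * e L j + 7 * e L i)))
  have hs := ((hasDerivAt_id' z).add_const (6 * e L i)).const_mul 4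
  have hd := (((hasDerivAt_id' z).const_mul 2).const_sub (15 * e L i)).fun_pow 2
  have h0 := ((hN.fun_mul hQ).fun_div (hs.fun_mul hd) (by simp [h1, h2])).const_sub (e L j)
  rw [show X4 L i j = _ from funext fun z ↦ by rw [X4, Q4_eval]]
  refine h0.congr_deriv ?_
  rw [Y4, e_third L hij hjk hik]
  push_cast
  clear hN hQ hs hd h0
  generalize hs : z + 6 * e L i = s at *
  generalize hd : 15 * e L i - 2 * z = d at *
  field_simp
  rw [← hs, ← hd]
  ring

include hij hjk hik in
lemma isTorusCover4 : IsTorusCover (P4 L i j k) (D4 L i) (X4 L i j) (Y4 L i j k)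
    (fun z ↦ 2 * z + 3 * e L i) L.g₂ L.g₃ 4 where
  degree := isRationalOfDegree_X4 hij hjk hik
  mapsTo _ _ h hD := (mapsTo_krichever4 hij hjk hik h hD).1
  reduction z w h hD := by
    have := hasDerivAt_X4 hij hjk hik hD
    refine ⟨this.differentiableAt, ?_⟩
    rw [this.deriv, Y4, Y4]
    ring

include hij hjk hik in
lemma exists_mem_uniformised4 (h : (z, w) ∈ Curve (P4 L i j k)) (hD : D4 L i z ≠ 0) :
    ∃ u, (z, w, u) ∈ Uniformised L (P4 L i j k) (D4 L i) (X4 L i j) (Y4 L i j k) := by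
  obtain ⟨u, hu, h1, h2⟩ := exists_uniformisation (mapsTo_krichever4 hij hjk hik h hD).1
  exact ⟨u, h, hD, hu, h1, h2⟩

include hij hjk hik in
lemma tX4_swap (hs : z + 6 * e L i ≠ 0) : tX4 L i j k z = tX4 L i k j z := by
  rw [tX4, tX4, Q4_eval, Q4_eval, te4', te4', e_third L hij hjk hik]
  generalize hs' : z + 6 * e L i = s at *
  field_simp
  rw [← hs']
  ring

include hij hjk hik in
lemma te4_cubic (t : ℂ) : 4 * (t - te4 L i j k) * (t - te4' L i j k) * (t - te4' L i k j) =
    4 * t ^ 3 - tg₂4 L i * t - tg₃4 L i := by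
  rw [te4, te4', te4', tg₂4, tg₃4, g₂_eq_aux L hij, g₃_eq' hij hjk hik, e_third L hij hjk hik]
  ring

include hij hjk hik in
lemma isTorusCover_second4 : IsTorusCover (P4 L i j k) (fun z ↦ z + 6 * e L i) (tX4 L i j k)
    (fun z w ↦ -(deriv (tX4 L i j k) z * w)) (fun _ ↦ -1) (tg₂4 L i) (tg₃4 L i) 4 := by
  have hd {z : ℂ} (hz : z + 6 * e L i ≠ 0) : HasDerivAt (tX4 L i j k)
      (-9 * (z + 4 * e L i - e L k) * (z + 4 * e L i - e L j) *
        (3 * z ^ 2 + 9 * e L i * z - 72 * e L i ^ 2 - 9 * e L j * e L k) /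
        (4 * (z + 6 * e L i) ^ 2)) z := by
    have hN := (((hasDerivAt_id' z).add_const (4 * e L i)).sub_const (e L k)).fun_pow 2
    have hQ := ((((hasDerivAt_id' z).sub_const (e L j + 2 * e L i)).fun_pow 2).sub_const
      (4 * ((e L i - e L j) * (2 * e L j + 7 * e L i)))).const_mul 9
    have hs := ((hasDerivAt_id' z).add_const (6 * e L i)).const_mul 4
    have h0 := ((hQ.fun_mul hN).fun_div hs (by simpa using hz)).const_sub (te4' L i j k)
    rw [show tX4 L i j k = _ from funext fun z ↦ by rw [tX4, Q4_eval]]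
    refine h0.congr_deriv ?_
    rw [e_third L hij hjk hik]
    push_cast
    clear hN hQ hs h0
    generalize hs : z + 6 * e L i = s at *
    field_simp
    rw [← hs]
    ring
  refine ⟨isRationalOfDegree_tX4 hij hjk hik, fun z w h hz ↦ ?_,
    fun z w h hz ↦ ⟨(hd hz).differentiableAt, by ring⟩⟩
  change w ^ 2 = -(P4 L i j k).eval z at h
  -- Each difference of `X̃` with a root of the cubic is a square times factors of `P4`, or a square
  -- over `z + 6e_i`; their product is compared with `-X̃'² P4`.
  have h1 : tX4 L i j k z - te4 L i j k =
      -(3 * z ^ 2 + 9 * e L i * z - 72 * e L i ^ 2 - 9 * e L j * e L k) ^ 2 /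
        (4 * (z + 6 * e L i)) := by
    rw [tX4, te4, te4', Q4_eval, e_third L hij hjk hik]
    clear h
    generalize hs : z + 6 * e L i = s at *
    field_simp
    rw [← hs]
    ring
  have h2 (a b : Fin 3) : tX4 L i a b z - te4' L i a b =
      -9 * (Q4 L i a).eval z * (z + 4 * e L i - e L b) ^ 2 / (4 * (z + 6 * e L i)) := by
    rw [tX4]
    ring
  rw [(hd hz).deriv, neg_sq, mul_pow, h, P4_eval, ← te4_cubic hij hjk hik, h1, h2,
    tX4_swap hij hjk hik hz, h2]
  generalize z + 6 * e L i = s at *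
  field_simp

include hij hjk hik in
lemma hasDerivAt_X5 (hD : D5 L k z ≠ 0) :
    HasDerivAt (X5 L k) ((5 * z + 3 * e L k) / 2 * Y5 L i j k z 1) z := by
  have h1 : HasDerivAt (fun z ↦ z ^ 3 - 3 * e L k * z ^ 2 + (51 * e L k ^ 2 - 20 * L.g₂) * z +
      (-369 * e L k ^ 3 + 132 * e L k * L.g₂))
      (3 * z ^ 2 - 6 * e L k * z + (51 * e L k ^ 2 - 20 * L.g₂)) z :=
    ((((hasDerivAt_pow 3 z).fun_sub ((hasDerivAt_pow 2 z).const_mul (3 * e L k))).fun_add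
      ((hasDerivAt_id' z).const_mul _)).add_const _).congr_deriv (by push_cast; ring)
  have h2 := ((hasDerivAt_id' z).add_const (15 * e L k)).fun_pow 2
  have h3 : HasDerivAt (D5 L k) (10 * z + 6 * e L k) z :=
    (((((hasDerivAt_pow 2 z).const_mul 5).fun_add (((hasDerivAt_id' z).const_mul 6).mul_const
      (e L k))).add_const (261 * e L k ^ 2)).sub_const (108 * L.g₂)).congr_deriv
      (by push_cast; ring)
  have h0 := ((h1.fun_mul h2).fun_div (h3.fun_pow 2) (pow_ne_zero 2 hD)).const_sub (e L k)
  rw [show X5 L k = _ from funext fun z ↦ by rw [X5_eq, Q5_eval]]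
  refine h0.congr_deriv ?_
  rw [Y5, ← D5]
  push_cast
  clear h0 h1 h2 h3
  generalize hd : D5 L k z = d at *
  field_simp
  rw [← hd, D5, R5, R5, g₂_eq_aux L hij, e_third L hij hjk hik]
  ring

include hij hjk hik in
lemma isTorusCover5 : IsTorusCover (P5 L i j k) (D5 L k) (X5 L k) (Y5 L i j k)
    (fun z ↦ (5 * z + 3 * e L k) / 2) L.g₂ L.g₃ 5 where
  degree := isRationalOfDegree_X5 hij hjk hik
  mapsTo _ _ h hD := (mapsTo_krichever5 hij hjk hik h hD).1
  reduction z w h hD := by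
    have := hasDerivAt_X5 hij hjk hik hD
    refine ⟨this.differentiableAt, ?_⟩
    rw [this.deriv, Y5, Y5]
    ring

include hij hjk hik in
lemma exists_mem_uniformised5 (h : (z, w) ∈ Curve (P5 L i j k)) (hD : D5 L k z ≠ 0) :
    ∃ u, (z, w, u) ∈ Uniformised L (P5 L i j k) (D5 L k) (X5 L k) (Y5 L i j k) := by
  obtain ⟨u, hu, h1, h2⟩ := exists_uniformisation (mapsTo_krichever5 hij hjk hik h hD).1
  exact ⟨u, h, hD, hu, h1, h2⟩

include hij hjk hik in
lemma isTorusCover_second5 : IsTorusCover (P5 L i j k) (tD5 L i j k) (tX5 L i j k)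
    (fun z w ↦ -(deriv (tX5 L i j k) z * w)) (fun _ ↦ -1) (tg₂5 L k) (tg₃5 L k) 5 := by
  let N' (z : ℂ) : ℂ := 5 * z ^ 4 + 12 * e L k * z ^ 3 +
    3 * (150 * e L i * e L j - 42 * e L k ^ 2) * z ^ 2 +
    60 * e L k * (e L i * e L j - e L k ^ 2) * z +
    9 * (69 * e L k ^ 4 + 625 * e L i ^ 2 * e L j ^ 2 - 221 * e L k * L.g₃ / 2)
  have hd {z : ℂ} (hz : tD5 L i j k z ≠ 0) : HasDerivAt (tX5 L i j k)
      (-9 * (N' z * tD5 L i j k z - N5 L i j k z * (2 * z - 6 * e L k - 9 * e L i - 9 * e L j)) /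
        (4 * tD5 L i j k z ^ 2)) z := by
    have h1 : HasDerivAt (N5 L i j k) (N' z) z :=
      (((((((hasDerivAt_pow 5 z).fun_add ((hasDerivAt_pow 4 z).const_mul (3 * e L k))).fun_sub
        ((hasDerivAt_pow 3 z).const_mul (42 * e L k ^ 2))).fun_add
        ((hasDerivAt_pow 3 z).const_mul (150 * e L i * e L j))).fun_add
        ((hasDerivAt_pow 2 z).const_mul (30 * e L k * (e L i * e L j - e L k ^ 2)))).fun_add
        ((hasDerivAt_id' z).const_mul (9 * (69 * e L k ^ 4 + 625 * e L i ^ 2 * e L j ^ 2 -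
          221 * e L k * L.g₃ / 2)))).sub_const _).congr_deriv (by push_cast; ring)
    have h2 : HasDerivAt (tD5 L i j k) (2 * z - 6 * e L k - 9 * e L i - 9 * e L j) z :=
      ((((hasDerivAt_id' z).sub_const (3 * e L k)).sub_const (9 * e L i)).fun_mul
        (((hasDerivAt_id' z).sub_const (3 * e L k)).sub_const (9 * e L j))).congr_deriv (by ring)
    rw [show tX5 L i j k = fun z ↦ -9 * N5 L i j k z / (4 * tD5 L i j k z) from
      funext fun z ↦ by rw [tX5, tD5, mul_assoc 4]]
    refine ((h1.const_mul (-9)).fun_div (h2.const_mul 4) (by simpa using hz)).congr_deriv ?_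
    field_simp
    ring
  refine ⟨isRationalOfDegree_tX5 hij hjk hik, fun z w h hz ↦ ?_,
    fun z w h hz ↦ ⟨(hd hz).differentiableAt, by ring⟩⟩
  change w ^ 2 = -(P5 L i j k).eval z at h
  rw [(hd hz).deriv, neg_sq, mul_pow, h, P5_eval, Q5_eval, tX5, mul_assoc 4, ← tD5]
  clear h
  generalize hs : tD5 L i j k z = s at *
  field_simp
  rw [← hs, tD5, tg₂5, tg₃5, N5]
  simp only [N']
  rw [g₂_eq_aux L hij, g₃_eq' hij hjk hik, e_third L hij hjk hik]
  ring

end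

end TreibichVerdier

end

noncomputable section

namespace TreibichVerdier

variable {L : PeriodPair} {i j k : Fin 3}

/-! ### The moduli of the second covers -/

section

variable (hij : i ≠ j) (hjk : j ≠ k) (hik : i ≠ k)

include hij hjk hik in
-- The discriminant of the second torus is, up to a constant, `g₂³` times the square of the
-- discriminant of the first.
lemma discriminant3_ne_zero (h : L.g₂ ≠ 0) : tg₂3 L ^ 3 - 27 * tg₃3 L ^ 2 ≠ 0 := by
  have d1 := sub_ne_zero.mpr (e_ne L hij)
  have d2 := sub_ne_zero.mpr (e_ne L hjk)
  have d3 := sub_ne_zero.mpr (e_ne L hik)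
  have h1 : tg₂3 L ^ 3 - 27 * tg₃3 L ^ 2 = 3 ^ 21 / 2 ^ 18 * L.g₂ ^ 3 *
      (16 * ((e L i - e L j) * (e L j - e L k) * (e L i - e L k)) ^ 2) ^ 2 := by
    have h2 : 16 * ((e L i - e L j) * (e L j - e L k) * (e L i - e L k)) ^ 2 =
        L.g₂ ^ 3 - 27 * L.g₃ ^ 2 := by
      rw [g₂_eq_aux L hij, g₃_eq' hij hjk hik, e_third L hij hjk hik]
      ring
    rw [h2, tg₂3, tg₃3]
    ring
  rw [h1]
  exact mul_ne_zero (mul_ne_zero (by norm_num) (pow_ne_zero 3 h)) (pow_ne_zero 2 (mul_ne_zero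
    (by norm_num) (pow_ne_zero 2 (mul_ne_zero (mul_ne_zero d1 d2) d3))))

include hij hjk hik in
lemma te4'_sub : te4' L i j k - te4' L i k j = 9 * (e L j - e L k) ^ 3 := by
  rw [te4', te4', e_third L hij hjk hik]
  ring

include hij hjk hik in
lemma te4_sub : te4 L i j k - te4' L i j k =
    9 * (e L i - e L j) * (2 * e L j + 7 * e L i) ^ 2 := by
  rw [te4, te4', e_third L hij hjk hik]
  ring

lemma te4_swap : te4 L i k j = te4 L i j k := by
  rw [te4, te4]
  ring

include hij hjk hik in
lemma discriminant4_ne_zero (hj : 2 * e L j + 7 * e L i ≠ 0) (hk : 2 * e L k + 7 * e L i ≠ 0) :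
    tg₂4 L i ^ 3 - 27 * tg₃4 L i ^ 2 ≠ 0 := by
  have d1 := sub_ne_zero.mpr (e_ne L hij)
  have d2 := sub_ne_zero.mpr (e_ne L hjk)
  have d3 := sub_ne_zero.mpr (e_ne L hik)
  have h1 := te4'_sub (L := L) hij hjk hik
  have h2 := te4_sub (L := L) hij hjk hik
  have h3 := te4_sub (L := L) hik hjk.symm hij
  rw [te4_swap] at h3
  have hc := te4_cubic (L := L) hij hjk hik
  -- Comparing the cubic at `0` and `±1` recovers Vieta's formulas for its three roots.
  have hs : te4 L i j k + te4' L i j k + te4' L i k j = 0 := by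
    linear_combination -(hc 1 + hc (-1) - 2 * hc 0) / 8
  have hg₂ : tg₂4 L i = 4 * (te4' L i j k ^ 2 + te4' L i j k * te4' L i k j +
      te4' L i k j ^ 2) := by
    linear_combination (hc 1 - hc (-1)) / 2 - 4 * (te4' L i j k + te4' L i k j) * hs
  have hg₃ : tg₃4 L i = -4 * (te4' L i j k + te4' L i k j) * te4' L i j k * te4' L i k j := by
    have := hc 0
    rw [eq_neg_of_add_eq_zero_left ((add_assoc _ _ _).symm.trans hs)] at this
    linear_combination this
  have h4 : tg₂4 L i ^ 3 - 27 * tg₃4 L i ^ 2 = 16 * ((te4' L i j k - te4' L i k j) *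
      (te4 L i j k - te4' L i j k) * (te4 L i j k - te4' L i k j)) ^ 2 := by
    rw [hg₂, hg₃, eq_neg_of_add_eq_zero_left ((add_assoc _ _ _).symm.trans hs)]
    ring
  rw [h4, h1, h2, h3]
  have h9 : (9 : ℂ) ≠ 0 := by norm_num
  exact mul_ne_zero (by norm_num) (pow_ne_zero 2 (mul_ne_zero (mul_ne_zero
    (mul_ne_zero h9 (pow_ne_zero 3 d2)) (mul_ne_zero (mul_ne_zero h9 d1) (pow_ne_zero 2 hj)))
    (mul_ne_zero (mul_ne_zero h9 d3) (pow_ne_zero 2 hk))))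

include hij hjk hik in
lemma isJacobiModulus_te4 {κ κ' : ℂ} (h : IsJacobiModulus κ (e L j) (e L i) (e L k))
    (h' : IsJacobiModulus κ' (e L k) (e L i) (e L j)) :
    IsJacobiModulus (κ' * (1 - 4 * κ ^ 2)) (te4' L i k j) (te4 L i j k) (te4' L i j k) := by
  have d2 := sub_ne_zero.mpr (e_ne L hjk)
  have d2' := sub_ne_zero.mpr (e_ne L hjk.symm)
  have h1 := te4'_sub (L := L) hik hjk.symm hij
  refine ⟨fun h0 ↦ ?_, ?_⟩
  · rw [h0, sub_self] at h1
    exact mul_ne_zero (by norm_num) (pow_ne_zero 3 d2') h1.symm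
  · rw [h1, te4_sub hij hjk hik, mul_pow, h'.2, h.2]
    have h2 : 1 - 4 * ((e L i - e L k) / (e L j - e L k)) =
        (2 * e L j + 7 * e L i) / (e L k - e L j) := by
      rw [show e L j - e L k = -(e L k - e L j) by ring, div_neg]
      field_simp
      rw [e_third L hij hjk hik]
      ring
    rw [h2]
    field_simp

include hij hjk hik in
-- The discriminant of the second torus contains the separability condition of `P5` to the fifth
-- power; the other factors are differences of the `e`'s.
lemma discriminant5_ne_zero (h : 125 * L.g₂ ≠ 348 * e L k ^ 2) :
    tg₂5 L k ^ 3 - 27 * tg₃5 L k ^ 2 ≠ 0 := by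
  have d1 := sub_ne_zero.mpr (e_ne L hij)
  have d2 := sub_ne_zero.mpr (e_ne L hjk)
  have d3 := sub_ne_zero.mpr (e_ne L hik)
  have h0 := sub_ne_zero.mpr h
  have h1 : tg₂5 L k ^ 3 - 27 * tg₃5 L k ^ 2 = -(531441 / 64) * ((e L i - e L j) ^ 2 *
      ((e L i - e L k) * (e L j - e L k)) ^ 3) * (125 * L.g₂ - 348 * e L k ^ 2) ^ 5 := by
    have h2 : (e L i - e L k) * (e L j - e L k) = 3 * e L k ^ 2 - L.g₂ / 4 := by
      rw [g₂_eq_aux L hij, e_third L hij hjk hik]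
      ring
    have h3 : (e L i - e L j) ^ 2 = L.g₂ - 3 * e L k ^ 2 := by
      rw [g₂_eq_aux L hij, e_third L hij hjk hik]
      ring
    rw [h2, h3, tg₂5, tg₃5]
    ring
  rw [h1]
  exact mul_ne_zero (mul_ne_zero (by norm_num) (mul_ne_zero (pow_ne_zero 2 d1)
    (pow_ne_zero 3 (mul_ne_zero d3 d2)))) (pow_ne_zero 5 h0)

/-! ### The modulus of the second torus of `6℘` in terms of that of the first. -/

section

variable {κ s te₁ te₂ te₃ : ℂ} (hκ : IsJacobiModulus κ (e L i) (e L j) (e L k))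
  (hs : s ^ 2 = κ ^ 4 - κ ^ 2 + 1) (h₁ : te₁ = -(81 / 8) * L.g₃)
  (h₂ : te₂ = 81 / 16 * L.g₃ - 27 / 8 * L.g₂ * (e L i - e L k) * s)
  (h₃ : te₃ = 81 / 16 * L.g₃ + 27 / 8 * L.g₂ * (e L i - e L k) * s)

include hij hjk hik hκ in
lemma e_eq_of_isJacobiModulus : e L j = (2 * κ ^ 2 - 1) / 3 * (e L i - e L k) ∧
    e L k = -(κ ^ 2 + 1) / 3 * (e L i - e L k) ∧ e L i = (2 - κ ^ 2) / 3 * (e L i - e L k) := by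
  have h1 : κ ^ 2 * (e L i - e L k) = e L j - e L k := by
    rw [hκ.2, div_mul_cancel₀ _ (sub_ne_zero.mpr hκ.1)]
  have h2 := e_add_add L hij hjk hik
  refine ⟨?_, ?_, ?_⟩
  · linear_combination -2 / 3 * h1 + h2 / 3
  · linear_combination h1 / 3 + h2 / 3
  · linear_combination h1 / 3 + h2 / 3

include hij hjk hik hκ hs h₁ h₂ h₃ in
lemma te3_cubic (t : ℂ) :
    4 * (t - te₁) * (t - te₂) * (t - te₃) = 4 * t ^ 3 - tg₂3 L * t - tg₃3 L := by
  obtain ⟨hj, hk, hi⟩ := e_eq_of_isJacobiModulus hij hjk hik hκ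
  generalize e L i - e L k = d at *
  -- `s` is a square root of `g₂` up to scaling. Hence the product of `te₂` and `te₃`, which
  -- contains `s²`, is polynomial in `g₂` and `g₃`.
  have hg : L.g₂ = 4 / 3 * d ^ 2 * s ^ 2 := by
    rw [g₂_eq_aux L hij, hi, hj, hs]
    ring
  have hg' : L.g₂ ^ 2 * d ^ 2 * s ^ 2 = 3 / 4 * L.g₂ ^ 3 := by
    rw [hg]
    ring
  rw [h₁, h₂, h₃, tg₂3, tg₃3]
  linear_combination -4 * (27 / 8) ^ 2 * (t + 81 / 8 * L.g₃) * hg'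

include hij hjk hik hκ hs h₁ h₂ h₃ in
lemma isJacobiModulus_te3 (hg : L.g₂ ≠ 0) (κt : ℂ) : IsJacobiModulus κt te₁ te₂ te₃ ↔
    1 / κt ^ 2 = 1 / 2 + (κ ^ 2 - 2) * (2 * κ ^ 2 - 1) * (κ ^ 2 + 1) / (4 * s ^ 3) := by
  have hd := sub_ne_zero.mpr hκ.1
  obtain ⟨hj, hk, hi⟩ := e_eq_of_isJacobiModulus hij hjk hik hκ
  have hκ1 : κ ^ 2 ≠ 0 := by
    rw [hκ.2]
    exact div_ne_zero (sub_ne_zero.mpr (e_ne L hjk)) hd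
  have hκ2 : κ ^ 2 - 1 ≠ 0 := by
    intro h0
    apply sub_ne_zero.mpr (e_ne L hij)
    linear_combination hi - hj - (e L i - e L k) * h0
  have hg₃ : L.g₃ = 4 * e L i * e L j * e L k := g₃_eq L hij hjk hik
  have hg₂ := g₂_eq_aux L hij
  generalize e L i - e L k = d at *
  rw [hi, hj] at hg₂
  rw [hi, hj, hk] at hg₃
  have hg₂' : L.g₂ = 4 / 3 * d ^ 2 * s ^ 2 := by
    rw [hg₂, hs]
    ring
  have hs0 : s ≠ 0 := by
    rintro rfl
    exact hg (by rw [hg₂']; ring)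
  set M := (κ ^ 2 - 2) * (2 * κ ^ 2 - 1) * (κ ^ 2 + 1) with hM
  have h23 : te₂ - te₃ = -9 * (d * s) ^ 3 := by
    rw [h₂, h₃, hg₂']
    ring
  have h13 : te₁ - te₃ = -(9 / 4) * d ^ 3 * (M + 2 * s ^ 3) := by
    rw [h₁, h₃, hg₂', hg₃, hM]
    ring
  -- `4s⁶ - M² = 27 κ⁴ (κ² - 1)²`, which is nonzero because the `e a` are distinct.
  have hM2 : M + 2 * s ^ 3 ≠ 0 := by
    intro h0
    apply mul_ne_zero (pow_ne_zero 2 hκ1) (pow_ne_zero 2 hκ2)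
    have h5 : 4 * (s ^ 2) ^ 3 - M ^ 2 = 27 * ((κ ^ 2) ^ 2 * (κ ^ 2 - 1) ^ 2) := by
      rw [hs, hM]
      ring
    linear_combination -h5 / 27 + (2 * s ^ 3 - M) * h0 / 27
  have h13' : te₁ - te₃ ≠ 0 := by
    rw [h13]
    exact mul_ne_zero (mul_ne_zero (by norm_num) (pow_ne_zero 3 hd)) hM2
  have h6 : (1 / 2 + M / (4 * s ^ 3))⁻¹ = (te₂ - te₃) / (te₁ - te₃) := by
    have h7 : 1 / 2 + M / (4 * s ^ 3) = (M + 2 * s ^ 3) / (4 * s ^ 3) := by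
      field_simp
      ring
    rw [h23, h13, h7, inv_div]
    field_simp
  rw [IsJacobiModulus, and_iff_right (sub_ne_zero.mp h13'), ← h6, one_div (κt ^ 2),
    inv_eq_iff_eq_inv]

end

end

end TreibichVerdier

end

noncomputable section

namespace TreibichVerdier

variable {L : PeriodPair} {i j k : Fin 3}

/-! ### Limits of functions on the torus -/

/-- The quasi-period factors of `σ(x - u)`, `σ(u)` and `e^{ζ(u)x}` cancel, so `Φ` is a function of
the point `u` of the torus. -/
lemma Phi_add {l : ℂ} (hl : l ∈ L.lattice) (x u : ℂ) : Phi L x (u + l) = Phi L x u := by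
  by_cases hu : u ∈ L.lattice
  · simp [Phi, sigma_eq_zero_of_mem L hu, sigma_eq_zero_of_mem L (L.lattice.add_mem hu hl)]
  obtain ⟨η, C, hC, hζ, hσ⟩ := exists_quasiPeriod L hl
  have hu0 := sigma_ne_zero L hu
  have h1 := hσ u
  have h2 := hσ (x - (u + l))
  rw [show x - (u + l) + l = x - u by ring] at h2
  have h3 := hσ (-(u + l))
  rw [show -(u + l) + l = -u by ring, sigma_neg, sigma_neg, h1] at h3
  have h4 : C * Complex.exp (η * -(u + l)) * (C * Complex.exp (η * u)) = 1 := by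
    apply mul_right_cancel₀ hu0
    linear_combination h3
  have h5 : Complex.exp (η * x) = Complex.exp (η * u) * Complex.exp (η * (x - (u + l))) /
      Complex.exp (η * -(u + l)) / Complex.exp (η * u) := by
    rw [← Complex.exp_add, ← Complex.exp_sub, ← Complex.exp_sub]
    ring_nf
  have e1 := Complex.exp_ne_zero (η * u)
  have e2 := Complex.exp_ne_zero (η * (x - (u + l)))
  have e3 := Complex.exp_ne_zero (η * -(u + l))
  rw [Phi, Phi, h2, h1, hζ u hu, add_mul, Complex.exp_add, h5]
  generalize Complex.exp (η * u) = a at *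
  generalize Complex.exp (η * (x - (u + l))) = b at *
  generalize Complex.exp (η * -(u + l)) = c at *
  by_cases hx : sigma L x = 0
  · simp [hx]
  field_simp
  linear_combination -sigma L (x - (u + l)) * h4

lemma dPhi_add {l : ℂ} (hl : l ∈ L.lattice) (x u : ℂ) : dPhi L x (u + l) = dPhi L x u := by
  simp only [dPhi, Phi_add hl]

/-- A continuous function on the torus has the limit `f (ω a)` as `℘ (u)` tends to `e a`. -/
lemma tendsto_of_periodic {f : ℂ → ℂ} {c : ℂ} (hf : ∀ l ∈ L.lattice, ∀ u, f (u + l) = f u)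
    (a : Fin 3) (hc : Tendsto f (𝓝 (halfPeriod L a)) (𝓝 c)) :
    Tendsto f (comap L.weierstrassP (𝓝 (e L a)) ⊓ 𝓟 {u | u ∉ L.lattice}) (𝓝 c) := by
  intro V hV
  have hω := halfPeriod_notMem L a
  have hU := isOpen_compl_lattice L
  -- `℘(u)` determines `u` only up to periods and sign, so both `v` and `2ω_a - v`, which is `-v`
  -- modulo the lattice, must be admissible.
  have hW : {v | v ∉ L.lattice ∧ f v ∈ V ∧ f (2 * halfPeriod L a - v) ∈ V} ∈
      𝓝 (halfPeriod L a) := by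
    have h2 : Tendsto (fun v ↦ 2 * halfPeriod L a - v) (𝓝 (halfPeriod L a))
        (𝓝 (halfPeriod L a)) := by
      have : Continuous fun v ↦ 2 * halfPeriod L a - v := by fun_prop
      convert this.tendsto (halfPeriod L a) using 2
      ring
    filter_upwards [hU.mem_nhds hω, hc hV, (hc.comp h2) hV] with v h1 h2 h3 using ⟨h1, h2, h3⟩
  -- The open mapping theorem; `℘` is not constant near `ω_a`, since `℘ = e_a` only at translates of
  -- that half period.
  have hopen : 𝓝 (e L a) ≤ map L.weierstrassP (𝓝 (halfPeriod L a)) := by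
    have han : AnalyticAt ℂ L.weierstrassP (halfPeriod L a) :=
      L.differentiableOn_weierstrassP.analyticAt (hU.mem_nhds hω)
    refine han.eventually_constant_or_nhds_le_map_nhds.resolve_left fun h ↦ ?_
    have h1 : ∀ᶠ v in 𝓝[≠] halfPeriod L a, v + halfPeriod L a ∉ L.lattice := by
      have ht : Tendsto (fun v ↦ v + halfPeriod L a) (𝓝[≠] halfPeriod L a)
          (𝓝[≠] (halfPeriod L a + halfPeriod L a)) :=
        tendsto_nhdsWithin_of_tendsto_nhds_of_eventually_within _
          ((by fun_prop : Continuous fun v ↦ v + halfPeriod L a).continuousAt.tendsto.mono_left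
            nhdsWithin_le_nhds)
          (by filter_upwards [self_mem_nhdsWithin] with v hv using fun h ↦ hv (by simpa using h))
      exact ht.eventually (eventually_notMem_lattice L _)
    obtain ⟨v, ⟨h2, h3⟩, h4⟩ := ((h1.and (eventually_notMem_lattice L _)).and
      (nhdsWithin_le_nhds h)).exists
    exact weierstrassP_sub_e_ne_zero L a h3 h2 (sub_eq_zero.mpr h4)
  have himg := hopen (image_mem_map hW)
  rw [mem_map]
  filter_upwards [mem_inf_of_left (preimage_mem_comap himg), mem_inf_of_right (mem_principal_self _)]
    with u hu hu'
  obtain ⟨v, ⟨hv, hv1, hv2⟩, hvu⟩ := hu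
  rcases (weierstrassP_eq_iff L hv hu').mp hvu with h | h
  · have := hf _ h u
    rw [add_sub_cancel] at this
    rwa [Set.mem_preimage, ← this]
  · have := hf _ (L.lattice.sub_mem (two_mul_halfPeriod_mem L a) h) u
    rw [show u + (2 * halfPeriod L a - (v + u)) = 2 * halfPeriod L a - v by ring] at this
    rwa [Set.mem_preimage, ← this]

/-- A function on the torus which has the limit `c` at `0` tends to `c` as `℘ (u) → ∞`. -/
lemma tendsto_of_periodic_cobounded {f : ℂ → ℂ} {c : ℂ}
    (hf : ∀ l ∈ L.lattice, ∀ u, f (u + l) = f u) (hc : Tendsto f (𝓝[≠] 0) (𝓝 c)) :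
    Tendsto f (comap L.weierstrassP (Bornology.cobounded ℂ) ⊓ 𝓟 {u | u ∉ L.lattice}) (𝓝 c) := by
  classical
  -- Translation by a half period carries `℘ = ∞` to `℘ = e 0`, so that `tendsto_of_periodic`
  -- applies.
  set ω := halfPeriod L 0 with hω
  have hsub : Tendsto (fun u ↦ u - ω) (𝓝[≠] ω) (𝓝[≠] 0) :=
    tendsto_nhdsWithin_of_tendsto_nhds_of_eventually_within _ (by
      have := ((by fun_prop : Continuous fun u ↦ u - ω).tendsto ω).mono_left
        (nhdsWithin_le_nhds (s := {ω}ᶜ))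
      rwa [sub_self] at this)
      (by filter_upwards [self_mem_nhdsWithin] with v hv using sub_ne_zero.mpr hv)
  let g (u : ℂ) : ℂ := if u - ω ∈ L.lattice then c else f (u - ω)
  have hg0 : g ω = c := by simp [g]
  have hg : Tendsto g (𝓝 ω) (𝓝 c) := by
    have h : ContinuousAt g ω := by
      rw [continuousAt_iff_punctured_nhds, hg0]
      refine (hc.comp hsub).congr' ?_
      filter_upwards [hsub.eventually (eventually_notMem_lattice L 0)] with u hu
      simp [g, hu]
    simpa only [hg0] using h.tendsto
  have hgper : ∀ l ∈ L.lattice, ∀ u, g (u + l) = g u := by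
    intro l hl u
    have h1 : u + l - ω = u - ω + l := by ring
    have h2 : u - ω + l ∈ L.lattice ↔ u - ω ∈ L.lattice := L.lattice.add_mem_iff_left hl
    simp only [g, h1, h2, hf l hl]
  set F := comap L.weierstrassP (Bornology.cobounded ℂ) ⊓ 𝓟 {u | u ∉ L.lattice} with hF
  have hP : Tendsto L.weierstrassP F (Bornology.cobounded ℂ) :=
    tendsto_comap.mono_left inf_le_left
  have hmem : ∀ᶠ u in F, u ∉ L.lattice := mem_inf_of_right (mem_principal_self _)
  have hne : ∀ᶠ u in F, u + ω ∉ L.lattice := by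
    filter_upwards [hP.eventually (Bornology.eventually_ne_cobounded (e L 0)), hmem] with u hu hu' h
    exact hu ((weierstrassP_eq_iff L hu' (halfPeriod_notMem L 0)).mpr (.inr h))
  have ht : Tendsto (fun u ↦ u + ω) F
      (comap L.weierstrassP (𝓝 (e L 0)) ⊓ 𝓟 {u | u ∉ L.lattice}) := by
    rw [tendsto_inf, tendsto_comap_iff, tendsto_principal]
    refine ⟨?_, hne⟩
    have h1 : Tendsto (fun u ↦ e L 0 + (e L 0 - e L 1) * (e L 0 - e L 2) *
        (L.weierstrassP u - e L 0)⁻¹) F (𝓝 (e L 0)) := by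
      have := ((tendsto_inv₀_cobounded.comp ((tendsto_sub_const_cobounded (e L 0)).comp
        hP)).const_mul ((e L 0 - e L 1) * (e L 0 - e L 2))).const_add (e L 0)
      simpa using this
    refine h1.congr' ?_
    filter_upwards [hne, hmem] with u h1 h2
    rw [Function.comp_apply, weierstrassP_add_halfPeriod L (by decide : (0 : Fin 3) ≠ 1)
      (by decide : (1 : Fin 3) ≠ 2) (by decide) h2 h1, div_eq_mul_inv]
  refine ((tendsto_of_periodic hgper 0 hg).comp ht).congr' ?_
  filter_upwards [hmem] with u hu
  simp [g, hu]

/-! ### Values and limits of `Φ` and `Φ'` as functions of the parameter `u`. -/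

section

variable {x : ℂ} (hx : x ∉ L.lattice)

include hx in
lemma Phi_halfPeriod (a : Fin 3) : Phi L x (halfPeriod L a) = -rootP L a x := by
  rw [Phi, rootP, sigma_sub_halfPeriod]
  have h1 := sigma_ne_zero L hx
  have h2 := sigma_ne_zero L (halfPeriod_notMem L a)
  have h3 : Complex.exp (-(2 * zeta L (halfPeriod L a) * x)) *
      Complex.exp (zeta L (halfPeriod L a) * x) = Complex.exp (-(zeta L (halfPeriod L a) * x)) := by
    rw [← Complex.exp_add]
    ring_nf
  rw [← h3]
  field_simp

include hx in
lemma dPhi_halfPeriod (hij : i ≠ j) (hjk : j ≠ k) (hik : i ≠ k) :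
    dPhi L x (halfPeriod L i) = rootP L j x * rootP L k x := by
  refine (hasDerivAt_Phi _ hx).unique (((hasDerivAt_rootP L hij hjk hik hx).fun_neg.congr_deriv
    (neg_neg _)).congr_of_eventuallyEq ?_)
  filter_upwards [(isOpen_compl_lattice L).mem_nhds hx] with t ht using Phi_halfPeriod ht i

lemma continuousAt_Phi {u : ℂ} (hu : u ∉ L.lattice) (hx : x ∉ L.lattice) :
    ContinuousAt (fun u ↦ Phi L x u) u := by
  have h1 := (differentiable_sigma L).continuous
  have h2 := (deriv_zeta L hu).continuousAt
  have h3 : sigma L x * sigma L u ≠ 0 := mul_ne_zero (sigma_ne_zero L hx) (sigma_ne_zero L hu)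
  have h5 : ContinuousAt (fun u ↦ sigma L (x - u)) u := by fun_prop
  have h7 : ContinuousAt (fun u ↦ Complex.exp (zeta L u * x)) u := by fun_prop
  have h8 : ContinuousAt (fun u ↦ sigma L x * sigma L u) u := by fun_prop
  exact (h5.div h8 h3).mul h7

lemma dPhi_eq {u : ℂ} (hu : u ∉ L.lattice) (hx : x ∉ L.lattice) : dPhi L x u =
    (deriv (sigma L) (x - u) * (sigma L x * sigma L u) -
      sigma L (x - u) * (deriv (sigma L) x * sigma L u)) / (sigma L x * sigma L u) ^ 2 *
        Complex.exp (zeta L u * x) +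
      sigma L (x - u) / (sigma L x * sigma L u) * (zeta L u * Complex.exp (zeta L u * x)) := by
  have hσ := fun y ↦ (differentiable_sigma L y).hasDerivAt
  exact ((((hσ (x - u)).comp_sub_const x u).fun_div ((hσ x).mul_const (sigma L u))
    (mul_ne_zero (sigma_ne_zero L hx) (sigma_ne_zero L hu))).fun_mul
      (hasDerivAt_exp_mul (zeta L u) x)).deriv

lemma continuousAt_dPhi {u : ℂ} (hu : u ∉ L.lattice) (hx : x ∉ L.lattice) :
    ContinuousAt (fun u ↦ dPhi L x u) u := by
  have h1 := (differentiable_sigma L).continuous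
  have h2 := (deriv_zeta L hu).continuousAt
  have h3 : sigma L x * sigma L u ≠ 0 := mul_ne_zero (sigma_ne_zero L hx) (sigma_ne_zero L hu)
  have h4 : Continuous (deriv (sigma L)) :=
    (differentiable_sigma L).contDiff.continuous_deriv le_rfl
  have h5 : ContinuousAt (fun u ↦ sigma L (x - u)) u := by fun_prop
  have h6 : ContinuousAt (fun u ↦ deriv (sigma L) (x - u)) u := by fun_prop
  have h7 : ContinuousAt (fun u ↦ Complex.exp (zeta L u * x)) u := by fun_prop
  have h8 : ContinuousAt (fun u ↦ sigma L x * sigma L u) u := by fun_prop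
  have h9 : ContinuousAt (fun u ↦ deriv (sigma L) x * sigma L u) u := by fun_prop
  refine (((((h6.mul h8).sub (h5.mul h9)).div (h8.pow 2) (pow_ne_zero 2 h3)).mul h7).add
    ((h5.div h8 h3).mul (h2.mul h7))).congr ?_
  filter_upwards [(isOpen_compl_lattice L).mem_nhds hu] with v hv using (dPhi_eq hv hx).symm

include hx in
lemma tendsto_Phi (a : Fin 3) : Tendsto (fun u ↦ Phi L x u)
    (comap L.weierstrassP (𝓝 (e L a)) ⊓ 𝓟 {u | u ∉ L.lattice}) (𝓝 (-rootP L a x)) := by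
  refine tendsto_of_periodic (fun l hl u ↦ Phi_add hl x u) a ?_
  rw [← Phi_halfPeriod hx]
  exact (continuousAt_Phi (halfPeriod_notMem L a) hx).tendsto

include hx in
lemma tendsto_dPhi (hij : i ≠ j) (hjk : j ≠ k) (hik : i ≠ k) : Tendsto (fun u ↦ dPhi L x u)
    (comap L.weierstrassP (𝓝 (e L i)) ⊓ 𝓟 {u | u ∉ L.lattice})
      (𝓝 (rootP L j x * rootP L k x)) := by
  refine tendsto_of_periodic (fun l hl u ↦ dPhi_add hl x u) i ?_
  rw [← dPhi_halfPeriod hx hij hjk hik]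
  exact (continuousAt_dPhi (halfPeriod_notMem L i) hx).tendsto

include hx in
-- With `y = ℘'(u)/(2℘(u))`, the sum `y + ζ(u)` tends to `0` at `u = 0`. Hence `e^{yx}` cancels the
-- essential singularity of `Φ`, and only the simple pole `1/σ(u)`, asymptotic to `-y`, remains. The
-- quotient is periodic in `u`, so `℘(u) → ∞` suffices.
lemma tendsto_exp_mul_Phi_div : Tendsto (fun u ↦
    Complex.exp (L.derivWeierstrassP u / (2 * L.weierstrassP u) * x) * Phi L x u /
      (L.derivWeierstrassP u / (2 * L.weierstrassP u)))
    (comap L.weierstrassP (Bornology.cobounded ℂ) ⊓ 𝓟 {u | u ∉ L.lattice}) (𝓝 (-1)) := by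
  refine tendsto_of_periodic_cobounded (fun l hl u ↦ ?_) ?_
  · simp only [weierstrassP_add L hl, derivWeierstrassP_add L hl, Phi_add hl]
  have h1 := sigma_ne_zero L hx
  have h2 : Tendsto (fun u ↦ u * (L.derivWeierstrassP u / (2 * L.weierstrassP u))) (𝓝[≠] 0)
      (𝓝 (-1)) := by
    have := (tendsto_cube_mul_derivWeierstrassP L).div
      ((tendsto_sq_mul_weierstrassP L).const_mul 2) (by norm_num)
    norm_num at this
    refine this.congr' ?_
    filter_upwards [self_mem_nhdsWithin] with u hu
    have hu : u ≠ 0 := hu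
    simp only [Pi.div_apply]
    rw [show u ^ 3 * L.derivWeierstrassP u = u ^ 2 * (u * L.derivWeierstrassP u) by ring,
      show 2 * (u ^ 2 * L.weierstrassP u) = u ^ 2 * (2 * L.weierstrassP u) by ring,
      mul_div_mul_left _ _ (pow_ne_zero 2 hu), mul_div_assoc]
  have h3 : Tendsto (fun u ↦ sigma L (x - u) / sigma L x) (𝓝[≠] 0) (𝓝 1) := by
    have hc : Continuous fun u ↦ sigma L (x - u) / sigma L x := by
      have := (differentiable_sigma L).continuous
      fun_prop
    have := hc.tendsto 0
    rw [sub_zero, div_self h1] at this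
    exact this.mono_left nhdsWithin_le_nhds
  have h4 := (((tendsto_derivWeierstrassP_div_add_zeta L).mul_const x).cexp.mul h3).div
    (h2.mul (tendsto_sigma_div L)) (by norm_num)
  norm_num at h4
  refine h4.congr' ?_
  filter_upwards [eventually_notMem_lattice L 0] with u hu
  have := sigma_ne_zero L hu
  have := ne_zero_of_notMem hu
  simp only [Pi.div_apply]
  rw [add_mul, Complex.exp_add, Phi]
  generalize L.derivWeierstrassP u / (2 * L.weierstrassP u) = y
  by_cases hy : y = 0
  · simp [hy]
  field_simp

end

end TreibichVerdier

end

noncomputable section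

namespace TreibichVerdier

variable {L : PeriodPair} {i j k : Fin 3}

/-! ### The Lamé polynomials are solutions -/

section

variable (hij : i ≠ j) (hjk : j ≠ k) (hik : i ≠ k) {x : ℂ}

include hij hjk hik in
lemma hasDerivAt_rootP_mul (hx : x ∉ L.lattice) :
    HasDerivAt (fun t ↦ rootP L i t * rootP L j t)
      (-(rootP L k x * (rootP L i x ^ 2 + rootP L j x ^ 2))) x :=
  ((hasDerivAt_rootP L hij hjk hik hx).fun_mul
    (hasDerivAt_rootP L hij.symm hik hjk hx)).congr_deriv (by ring)

include hij hjk hik in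
lemma hasDerivAt_rootP_mul' (hx : x ∉ L.lattice) :
    HasDerivAt (fun t ↦ -(rootP L k t * (rootP L i t ^ 2 + rootP L j t ^ 2)))
      (rootP L i x * rootP L j x * (rootP L i x ^ 2 + rootP L j x ^ 2 + 4 * rootP L k x ^ 2)) x :=
  ((hasDerivAt_rootP L hik.symm hij hjk.symm hx).fun_mul
    (((hasDerivAt_rootP L hij hjk hik hx).fun_pow 2).fun_add
      ((hasDerivAt_rootP L hij.symm hik hjk hx).fun_pow 2))).fun_neg.congr_deriv
        (by push_cast; ring)

lemma rootP_ne_zero (hx : x ∉ L.lattice) (hxi : x + halfPeriod L i ∉ L.lattice) :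
    rootP L i x ≠ 0 :=
  (rootP_eq_zero_iff L i hx).not.mpr hxi

lemma e_sub_eq (i j : Fin 3) (hx : x ∉ L.lattice) :
    e L i - e L j = rootP L j x ^ 2 - rootP L i x ^ 2 := by
  rw [rootP_sq L i hx, rootP_sq L j hx]
  ring

include hij hjk hik in
lemma hasDerivAt_rootP_div (hx : x ∉ L.lattice) (hxi : x + halfPeriod L i ∉ L.lattice) :
    HasDerivAt (fun t ↦ rootP L j t / rootP L i t)
      ((e L i - e L j) * rootP L k x / rootP L i x ^ 2) x := by
  have h0 := rootP_ne_zero hx hxi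
  refine ((hasDerivAt_rootP L hij.symm hik hjk hx).fun_div
    (hasDerivAt_rootP L hij hjk hik hx) h0).congr_deriv ?_
  rw [e_sub_eq i j hx]
  ring

include hij hjk hik in
lemma hasDerivAt_rootP_div' (hx : x ∉ L.lattice) (hxi : x + halfPeriod L i ∉ L.lattice) :
    HasDerivAt (fun t ↦ (e L i - e L j) * rootP L k t / rootP L i t ^ 2)
      ((e L i - e L j) * (-(rootP L j x / rootP L i x) +
        2 * rootP L j x * rootP L k x ^ 2 / rootP L i x ^ 3)) x := by
  have h0 := rootP_ne_zero hx hxi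
  refine (((hasDerivAt_rootP L hik.symm hij hjk.symm hx).const_mul (e L i - e L j)).fun_div
    ((hasDerivAt_rootP L hij hjk hik hx).fun_pow 2) (pow_ne_zero 2 h0)).congr_deriv ?_
  push_cast
  field_simp
  ring

include hij hjk hik in
lemma eq_sub_rootP_sq (hx : x ∉ L.lattice) :
    L.weierstrassP x = (rootP L i x ^ 2 + rootP L j x ^ 2 + rootP L k x ^ 2) / 3 := by
  rw [rootP_sq L i hx, rootP_sq L j hx, rootP_sq L k hx]
  linear_combination e_add_add L hij hjk hik / 3

lemma e_eq_sub_rootP_sq (i : Fin 3) (hx : x ∉ L.lattice) :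
    e L i = L.weierstrassP x - rootP L i x ^ 2 := by
  rw [rootP_sq L i hx]
  ring

include hij hjk hik in
-- Writing `℘` and the `e`'s through `R_a² = ℘ - e_a` turns the equation into an identity in the
-- `R`'s, because `R_i' = -R_j R_k`. The same device serves the quotients below.
lemma solvesSchrodinger_lame3 : SolvesSchrodinger (u3 L) (poles3 L) (3 * e L k)
    (fun x ↦ rootP L i x * rootP L j x) := by
  refine solvesSchrodinger_of_hasDerivAt (isClosed_poles3 L)
    (fun x hx ↦ hasDerivAt_rootP_mul hij hjk hik hx)
    (fun x hx ↦ hasDerivAt_rootP_mul' hij hjk hik hx) (fun x hx ↦ ?_)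
  rw [u3, e_eq_sub_rootP_sq k hx, eq_sub_rootP_sq hij hjk hik hx]
  ring

lemma solvesSchrodinger_lame3' {r : ℂ} (hr : r ^ 2 = L.g₂ / 3) :
    SolvesSchrodinger (u3 L) (poles3 L) (3 * r) (fun x ↦ L.weierstrassP x + 1 / 2 * r) := by
  refine solvesSchrodinger_of_hasDerivAt (isClosed_poles3 L)
    (fun x hx ↦ (hasDerivAt_weierstrassP L hx).add_const _)
    (fun x hx ↦ hasDerivAt_derivWeierstrassP L hx) (fun x hx ↦ ?_)
  rw [u3]
  linear_combination (-3 / 2 : ℂ) * hr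

include hij hjk hik in
lemma u4_eq (hx : x ∉ L.lattice) (hxi : x + halfPeriod L i ∉ L.lattice) :
    u4 L i x - 2 * e L i = 6 * L.weierstrassP x + 2 * ((rootP L j x ^ 2 - rootP L i x ^ 2) *
      (rootP L k x ^ 2 - rootP L i x ^ 2)) / rootP L i x ^ 2 := by
  rw [u4, weierstrassP_add_halfPeriod L hij hjk hik hx hxi, ← e_sub_eq i j hx, ← e_sub_eq i k hx,
    rootP_sq L i hx]
  ring

include hij hjk hik in
lemma solvesSchrodinger_lame4 {r : ℂ} (hr : r ^ 2 = (e L i - e L k) * (7 * e L i + 2 * e L k)) :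
    SolvesSchrodinger (fun x ↦ u4 L i x - 2 * e L i) (poles4 L i) (e L k + 2 * e L i + 2 * r)
      (fun x ↦ rootP L i x * rootP L j x +
        1 / 3 * (e L i - e L k + r) * (rootP L j x / rootP L i x)) := by
  refine solvesSchrodinger_of_hasDerivAt (isClosed_poles4 L i)
    (fun x hx ↦ (hasDerivAt_rootP_mul hij hjk hik (mem_compl_poles4.mp hx).1).fun_add
      ((hasDerivAt_rootP_div hij hjk hik (mem_compl_poles4.mp hx).1
        (mem_compl_poles4.mp hx).2).const_mul _))
    (fun x hx ↦ (hasDerivAt_rootP_mul' hij hjk hik (mem_compl_poles4.mp hx).1).fun_add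
      ((hasDerivAt_rootP_div' hij hjk hik (mem_compl_poles4.mp hx).1
        (mem_compl_poles4.mp hx).2).const_mul _)) (fun x hx ↦ ?_)
  obtain ⟨hx, hxi⟩ := mem_compl_poles4.mp hx
  have h0 := rootP_ne_zero hx hxi
  rw [u4_eq hij hjk hik hx hxi]
  rw [e_eq_sub_rootP_sq i hx, e_eq_sub_rootP_sq k hx, eq_sub_rootP_sq hij hjk hik hx] at hr
  rw [e_eq_sub_rootP_sq i hx, e_eq_sub_rootP_sq j hx, e_eq_sub_rootP_sq k hx,
    eq_sub_rootP_sq hij hjk hik hx]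
  field_simp
  linear_combination (-18 * rootP L i x ^ 2 * rootP L j x) * hr

include hij hjk hik in
lemma solvesSchrodinger_lame4' : SolvesSchrodinger (fun x ↦ u4 L i x - 2 * e L i) (poles4 L i)
    (-6 * e L i) (fun x ↦ L.weierstrassP x - e L i) := by
  refine solvesSchrodinger_of_hasDerivAt (isClosed_poles4 L i)
    (fun x hx ↦ (hasDerivAt_weierstrassP L (mem_compl_poles4.mp hx).1).sub_const _)
    (fun x hx ↦ hasDerivAt_derivWeierstrassP L (mem_compl_poles4.mp hx).1) (fun x hx ↦ ?_)
  obtain ⟨hx, hxi⟩ := mem_compl_poles4.mp hx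
  have h0 := rootP_ne_zero hx hxi
  rw [u4_eq hij hjk hik hx hxi, g₂_eq_aux L hij, e_eq_sub_rootP_sq i hx, e_eq_sub_rootP_sq j hx,
    eq_sub_rootP_sq hij hjk hik hx]
  field_simp
  ring

include hij hjk hik in
lemma u5_eq (hx : x ∈ (poles5 L i j)ᶜ) : u5 L i j x + 2 * e L k = 6 * L.weierstrassP x +
    2 * ((rootP L j x ^ 2 - rootP L i x ^ 2) * (rootP L k x ^ 2 - rootP L i x ^ 2)) /
      rootP L i x ^ 2 + 2 * ((rootP L i x ^ 2 - rootP L j x ^ 2) *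
        (rootP L k x ^ 2 - rootP L j x ^ 2)) / rootP L j x ^ 2 := by
  obtain ⟨hx, hxi, hxj⟩ := mem_compl_poles5.mp hx
  rw [u5, weierstrassP_add_halfPeriod L hij hjk hik hx hxi,
    weierstrassP_add_halfPeriod L hij.symm hik hjk hx hxj, ← e_sub_eq i j hx, ← e_sub_eq i k hx,
    ← e_sub_eq j i hx, ← e_sub_eq j k hx, rootP_sq L i hx, rootP_sq L j hx]
  linear_combination 2 * e_add_add L hij hjk hik

include hij hjk hik in
lemma solvesSchrodinger_lame5 : SolvesSchrodinger (fun x ↦ u5 L i j x + 2 * e L k) (poles5 L i j)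
    (6 * e L i - 3 * e L j) (fun x ↦ rootP L i x * rootP L k x +
      (e L i - e L j) * (rootP L k x / rootP L i x)) := by
  refine solvesSchrodinger_of_hasDerivAt (isClosed_poles5 L i j)
    (fun x hx ↦ (hasDerivAt_rootP_mul hik hjk.symm hij (mem_compl_poles5.mp hx).1).fun_add
      ((hasDerivAt_rootP_div hik hjk.symm hij (mem_compl_poles5.mp hx).1
        (mem_compl_poles5.mp hx).2.1).const_mul _))
    (fun x hx ↦ (hasDerivAt_rootP_mul' hik hjk.symm hij (mem_compl_poles5.mp hx).1).fun_add
      ((hasDerivAt_rootP_div' hik hjk.symm hij (mem_compl_poles5.mp hx).1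
        (mem_compl_poles5.mp hx).2.1).const_mul _)) (fun x hx ↦ ?_)
  rw [u5_eq hij hjk hik hx]
  obtain ⟨hx, hxi, hxj⟩ := mem_compl_poles5.mp hx
  have h0 := rootP_ne_zero hx hxi
  have h1 := rootP_ne_zero hx hxj
  rw [e_eq_sub_rootP_sq i hx, e_eq_sub_rootP_sq j hx, e_eq_sub_rootP_sq k hx,
    eq_sub_rootP_sq hij hjk hik hx]
  field_simp
  ring

include hij hjk hik in
lemma solvesSchrodinger_lame5' {z : ℂ} (hz : (Q5 L k).eval z = 0) :
    SolvesSchrodinger (fun x ↦ u5 L i j x + 2 * e L k) (poles5 L i j) z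
      (fun x ↦ rootP L i x * rootP L j x + ta5 L i j z * (rootP L i x / rootP L j x) +
        ta5 L j i z * (rootP L j x / rootP L i x)) := by
  refine solvesSchrodinger_of_hasDerivAt (isClosed_poles5 L i j)
    (fun x hx ↦ ((hasDerivAt_rootP_mul hij hjk hik (mem_compl_poles5.mp hx).1).fun_add
      ((hasDerivAt_rootP_div hij.symm hik hjk (mem_compl_poles5.mp hx).1
        (mem_compl_poles5.mp hx).2.2).const_mul _)).fun_add
      ((hasDerivAt_rootP_div hij hjk hik (mem_compl_poles5.mp hx).1
        (mem_compl_poles5.mp hx).2.1).const_mul _))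
    (fun x hx ↦ ((hasDerivAt_rootP_mul' hij hjk hik (mem_compl_poles5.mp hx).1).fun_add
      ((hasDerivAt_rootP_div' hij.symm hik hjk (mem_compl_poles5.mp hx).1
        (mem_compl_poles5.mp hx).2.2).const_mul _)).fun_add
      ((hasDerivAt_rootP_div' hij hjk hik (mem_compl_poles5.mp hx).1
        (mem_compl_poles5.mp hx).2.1).const_mul _)) (fun x hx ↦ ?_)
  rw [u5_eq hij hjk hik hx]
  obtain ⟨hx, hxi, hxj⟩ := mem_compl_poles5.mp hx
  have h0 := rootP_ne_zero hx hxi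
  have h1 := rootP_ne_zero hx hxj
  have d1 : rootP L j x ^ 2 - rootP L i x ^ 2 ≠ 0 := by
    rw [← e_sub_eq i j hx]
    exact sub_ne_zero.mpr (e_ne L hij)
  have hm : ta5 L i j z * (24 * (e L i - e L j)) = _ :=
    div_mul_cancel₀ _ (mul_ne_zero (by norm_num) (sub_ne_zero.mpr (e_ne L hij)))
  have hn : ta5 L j i z * (24 * (e L j - e L i)) = _ :=
    div_mul_cancel₀ _ (mul_ne_zero (by norm_num) (sub_ne_zero.mpr (e_ne L hij.symm)))
  rw [Q5_eval, g₂_eq_aux L hij] at hz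
  rw [e_eq_sub_rootP_sq i hx, e_eq_sub_rootP_sq j hx, eq_sub_rootP_sq hij hjk hik hx] at *
  rw [e_eq_sub_rootP_sq k hx, eq_sub_rootP_sq hij hjk hik hx] at hz
  generalize ta5 L i j z = m at *
  generalize ta5 L j i z = n at *
  generalize rootP L i x = a at *
  generalize rootP L j x = b at *
  generalize rootP L k x = c at *
  apply mul_left_cancel₀ d1
  clear d1
  field_simp
  -- The first two multiples insert the definitions of the coefficients `ã`; what is left is a
  -- multiple of `c(z) = 0`.
  linear_combination (-3 * a ^ 4 * (a ^ 2 - b ^ 2) * (2 * c ^ 2 - b ^ 2) +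
      a ^ 2 * (b ^ 2 * (6 * a ^ 2 * (a ^ 2 + b ^ 2 + c ^ 2) +
        6 * (b ^ 2 - a ^ 2) * (c ^ 2 - a ^ 2)) + 6 * a ^ 2 * (a ^ 2 - b ^ 2) * (c ^ 2 - b ^ 2)) -
      3 * a ^ 4 * b ^ 2 * z) / 24 * hm -
    (-3 * b ^ 4 * (b ^ 2 - a ^ 2) * (2 * c ^ 2 - a ^ 2) +
      b ^ 2 * (b ^ 2 * (6 * a ^ 2 * (a ^ 2 + b ^ 2 + c ^ 2) +
        6 * (b ^ 2 - a ^ 2) * (c ^ 2 - a ^ 2)) + 6 * a ^ 2 * (a ^ 2 - b ^ 2) * (c ^ 2 - b ^ 2)) -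
      3 * a ^ 2 * b ^ 4 * z) / 24 * hn +
    a ^ 2 * b ^ 2 * (a ^ 2 - b ^ 2) / 8 * hz

lemma exists_ne_zero_of_tendsto (i j : Fin 3) {f : ℂ → ℂ}
    (hf : Tendsto (fun x ↦ x ^ 2 * f x) (𝓝[≠] 0) (𝓝 1)) : ∃ x ∈ (poles5 L i j)ᶜ, f x ≠ 0 := by
  obtain ⟨x, hx, hx'⟩ :=
    ((hf.eventually_ne one_ne_zero).and (eventually_notMem_poles5 L i j)).exists
  exact ⟨x, hx', right_ne_zero_of_mul hx⟩

lemma tendsto_sq_mul_rootP_mul (i j : Fin 3) :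
    Tendsto (fun x ↦ x ^ 2 * (rootP L i x * rootP L j x)) (𝓝[≠] 0) (𝓝 1) := by
  have h := (tendsto_mul_rootP L i).mul (tendsto_mul_rootP L j)
  rw [one_mul] at h
  exact h.congr fun x ↦ by ring

lemma tendsto_sq_mul_rootP_div (i j : Fin 3) :
    Tendsto (fun x ↦ x ^ 2 * (rootP L i x / rootP L j x)) (𝓝[≠] 0) (𝓝 0) := by
  have h := (tendsto_id_punctured.pow 2).mul ((tendsto_mul_rootP L i).div
    (tendsto_mul_rootP L j) one_ne_zero)
  norm_num at h
  refine h.congr' ?_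
  filter_upwards [self_mem_nhdsWithin] with x hx
  rw [mul_div_mul_left _ _ hx]

lemma tendsto_sq_mul_weierstrassP_add (c : ℂ) :
    Tendsto (fun x ↦ x ^ 2 * (L.weierstrassP x + c)) (𝓝[≠] 0) (𝓝 1) := by
  have h := (tendsto_sq_mul_weierstrassP L).add ((tendsto_id_punctured.pow 2).mul_const c)
  norm_num at h
  exact h.congr fun x ↦ by ring

lemma tendsto_sq_mul_lame (i j k a b c : Fin 3) (m n : ℂ) : Tendsto (fun x ↦ x ^ 2 *
    (rootP L i x * rootP L j x + m * (rootP L k x / rootP L a x) +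
      n * (rootP L b x / rootP L c x))) (𝓝[≠] 0) (𝓝 1) := by
  have h := ((tendsto_sq_mul_rootP_mul (L := L) i j).add
    ((tendsto_sq_mul_rootP_div (L := L) k a).const_mul m)).add
    ((tendsto_sq_mul_rootP_div (L := L) b c).const_mul n)
  norm_num at h
  exact h.congr fun x ↦ by ring

end

end TreibichVerdier

end

noncomputable section

namespace TreibichVerdier

variable {L : PeriodPair} {i j k : Fin 3}

/-! ### Limits of the wave functions at band edges over a half period -/

/-- The filter of points of `Ω` which approach the band edge `z₀`. -/
def nhdsEdge (Ω : Set (ℂ × ℂ × ℂ)) (z₀ : ℂ) : Filter (ℂ × ℂ × ℂ) :=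
  comap Prod.fst (𝓝 z₀) ⊓ 𝓟 Ω

variable {Ω : Set (ℂ × ℂ × ℂ)} {z₀ : ℂ}

lemma tendsto_fst_nhdsEdge : Tendsto (fun p : ℂ × ℂ × ℂ ↦ p.1) (nhdsEdge Ω z₀) (𝓝 z₀) :=
  tendsto_comap.mono_left inf_le_left

lemma eventually_mem_nhdsEdge : ∀ᶠ p in nhdsEdge Ω z₀, p ∈ Ω :=
  mem_inf_of_right (mem_principal_self _)

lemma tendsto_zero_of_sq {ι : Type*} {F : Filter ι} {f : ι → ℂ}
    (h : Tendsto (fun p ↦ f p ^ 2) F (𝓝 0)) : Tendsto f F (𝓝 0) := by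
  rw [tendsto_zero_iff_norm_tendsto_zero] at h ⊢
  have := (Real.continuous_sqrt.tendsto 0).comp h
  simpa [Function.comp_def, norm_pow] using this

section

variable {P : ℂ[X]} {D X : ℂ → ℂ} {Y : ℂ → ℂ → ℂ} (hΩ : Ω ⊆ Uniformised L P D X Y)

include hΩ in
lemma tendsto_w_nhdsEdge (hP : P.eval z₀ = 0) :
    Tendsto (fun p : ℂ × ℂ × ℂ ↦ p.2.1) (nhdsEdge Ω z₀) (𝓝 0) := by
  apply tendsto_zero_of_sq
  have h := ((P.continuous.tendsto z₀).comp (tendsto_fst_nhdsEdge (Ω := Ω))).neg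
  rw [hP, neg_zero] at h
  refine h.congr' ?_
  filter_upwards [eventually_mem_nhdsEdge] with p hp
  exact (hΩ hp).1.symm

include hΩ in
lemma tendsto_u_nhdsEdge {G : Filter ℂ}
    (hX : Tendsto (fun p : ℂ × ℂ × ℂ ↦ X p.1) (nhdsEdge Ω z₀) G) :
    Tendsto (fun p : ℂ × ℂ × ℂ ↦ p.2.2) (nhdsEdge Ω z₀)
      (comap L.weierstrassP G ⊓ 𝓟 {u | u ∉ L.lattice}) := by
  rw [tendsto_inf, tendsto_comap_iff, tendsto_principal]
  constructor
  · refine hX.congr' ?_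
    filter_upwards [eventually_mem_nhdsEdge] with p hp
    exact (hΩ hp).2.2.2.1.symm
  · filter_upwards [eventually_mem_nhdsEdge] with p hp
    exact (hΩ hp).2.2.1

end

/-! ### Limits when `℘(u)` tends to some `e_i`. -/

section

variable {ι : Type*} {F : Filter ι} {u l c₁ c₂ : ι → ℂ} {C : ℂ} {x : ℂ}

/-- The limit of `e^{l x} (c₁ Φ + c₂ Φ')` as `℘ (u) → e i`. -/
lemma tendsto_wave_halfPeriod (hij : i ≠ j) (hjk : j ≠ k) (hik : i ≠ k) (hx : x ∉ L.lattice)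
    (hu : Tendsto u F (comap L.weierstrassP (𝓝 (e L i)) ⊓ 𝓟 {u | u ∉ L.lattice}))
    (hl : Tendsto l F (𝓝 0)) (h₁ : Tendsto c₁ F (𝓝 0)) (h₂ : Tendsto c₂ F (𝓝 C)) :
    Tendsto (fun p ↦ Complex.exp (l p * x) * (c₁ p * Phi L x (u p) + c₂ p * dPhi L x (u p))) F
      (𝓝 (C * (rootP L j x * rootP L k x))) := by
  have h := ((hl.mul_const x).cexp).mul ((h₁.mul ((tendsto_Phi hx i).comp hu)).add
    (h₂.mul ((tendsto_dPhi hx hij hjk hik).comp hu)))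
  simpa using h

lemma tendsto_derivWeierstrassP_halfPeriod
    (hu : Tendsto u F (comap L.weierstrassP (𝓝 (e L i)) ⊓ 𝓟 {u | u ∉ L.lattice})) :
    Tendsto (fun p ↦ L.derivWeierstrassP (u p)) F (𝓝 0) := by
  refine (tendsto_of_periodic (fun l hl u ↦ derivWeierstrassP_add L hl u) i ?_).comp hu
  rw [← derivWeierstrassP_halfPeriod L i]
  exact (hasDerivAt_derivWeierstrassP L (halfPeriod_notMem L i)).continuousAt.tendsto

lemma tendsto_weierstrassP_halfPeriod
    (hu : Tendsto u F (comap L.weierstrassP (𝓝 (e L i)) ⊓ 𝓟 {u | u ∉ L.lattice})) :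
    Tendsto (fun p ↦ L.weierstrassP (u p)) F (𝓝 (e L i)) :=
  (tendsto_comap.mono_left inf_le_left).comp hu

end

section

variable (hij : i ≠ j) (hjk : j ≠ k) (hik : i ≠ k)

include hij hjk hik in
-- At `z = 3e_k` one has `X3 = e_k` and `λ = 0`, so the limit is that of `Φ'` alone.
lemma isLamePolynomial3 : IsLamePolynomial (u3 L) (poles3 L) (P3 L) (Omega3 L) (Psi3 L)
    (3 * e L k) (fun x ↦ rootP L i x * rootP L j x) := by
  have hP : (P3 L).eval (3 * e L k) = 0 := by
    rw [P3_eval hij hjk hik]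
    ring
  have hD : D3 L (3 * e L k) ≠ 0 := sub_ne_zero.mpr (three_mul_e_sq_ne hik.symm hij hjk.symm)
  have hX : X3 L (3 * e L k) = e L k := by
    rw [X3_eq]
    field_simp
    rw [D3, g₂_eq_aux L hik, g₃_eq' hik hjk.symm hij]
    ring
  refine ⟨hP, solvesSchrodinger_lame3 hij hjk hik, ?_, fun x hx ↦ ?_⟩
  · obtain ⟨x, hx, h⟩ := exists_ne_zero_of_tendsto i j (tendsto_sq_mul_rootP_mul (L := L) i j)
    exact ⟨x, compl_poles4_subset_poles3 (compl_poles5_subset_poles4 hx), h⟩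
  have hu := tendsto_u_nhdsEdge (L := L) (Ω := Omega3 L) subset_rfl
    ((hX ▸ (hasDerivAt_X3 hD).continuousAt.tendsto).comp tendsto_fst_nhdsEdge)
  have hw := tendsto_w_nhdsEdge (L := L) (Ω := Omega3 L) subset_rfl hP
  have hl : Tendsto (fun p : ℂ × ℂ × ℂ ↦ lambda3 L p.1 p.2.1) (nhdsEdge (Omega3 L) (3 * e L k))
      (𝓝 0) := by
    have h := (hw.const_mul 2).div (((tendsto_fst_nhdsEdge.pow 2).sub_const _).const_mul 3)
      (mul_ne_zero (by norm_num) hD)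
    rw [mul_zero, zero_div] at h
    exact h
  have h := tendsto_wave_halfPeriod hik.symm hij hjk.symm hx hu hl hl
    (tendsto_const_nhds (x := (1 : ℂ)))
  rw [one_mul] at h
  refine h.congr fun p ↦ ?_
  rw [Psi3, deriv_exp_mul_Phi _ _ hx, one_mul]

lemma P4_swap : P4 L i k j = P4 L i j k := by
  rw [P4, P4]
  ring

lemma Y4_swap (z w : ℂ) : Y4 L i k j z w = Y4 L i j k z w := by
  rw [Y4, Y4]
  ring

include hij hjk hik in
lemma Omega4_swap : Omega4 L i k j = Omega4 L i j k := by
  ext ⟨z, w, u⟩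
  simp only [Omega4, Uniformised, Set.mem_ofPred_eq, P4_swap, Y4_swap]
  refine and_congr_left fun _ ↦ and_congr_right fun _ ↦ and_congr_right fun hD ↦ ?_
  rw [X4_swap hij hjk hik hD]

/-- The wave function of `u₄` in terms of `Φ` and `Φ'`. -/
lemma Psi4_eq (hij : i ≠ j) (hjk : j ≠ k) (hik : i ≠ k) {z w u x : ℂ}
    (hΩ : (z, w, u) ∈ Omega4 L i j k) (hx : x ∈ (poles4 L i)ᶜ) {κ : ℂ}
    (hκ : κ = S4 L i j k z / (15 * e L i - 2 * z)) :
    Psi4 L i (z, w, u) x = Complex.exp (lambda4 L i z w * x) *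
      ((lambda4 L i z w + κ / (6 * (L.weierstrassP x - e L i)) *
        (L.derivWeierstrassP u / (2 * (L.weierstrassP u - e L i)))) * Phi L x u +
        (1 + κ / (6 * (L.weierstrassP x - e L i))) * dPhi L x u) := by
  obtain ⟨⟨hmem, hD, hu, hX, hY⟩, ha⟩ := hΩ
  simp only at hmem hD hu hX hY ha
  obtain ⟨hx, hxi⟩ := mem_compl_poles4.mp hx
  have h1 := PhiShift_eq hij hjk hik hx hxi hu
  have h2 := rootP_mul_mul L hij hjk hik hu
  have h3 := rootP_sq L i hu
  have h4 := weierstrassP_sub_e_ne_zero L i hx hxi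
  rw [← kappa4_eq hij hjk hik hmem hD, ← hX] at hκ
  have h5 : PhiShift L i x u = rootP L i u * (dPhi L x u + L.derivWeierstrassP u /
      (2 * (L.weierstrassP u - e L i)) * Phi L x u) / (L.weierstrassP x - e L i) := by
    rw [eq_div_iff h4, mul_comm, h1, ← h3]
    field_simp
    linear_combination -2 * Phi L x u * h2
  rw [Psi4_eq_wave j hx, wave, a4]
  simp only
  rw [← hκ, h5]
  field_simp
  ring

include hij hjk hik in
lemma isLamePolynomial4 {r : ℂ} (hr : r ^ 2 = (e L i - e L k) * (7 * e L i + 2 * e L k)) :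
    IsLamePolynomial (fun x ↦ u4 L i x - 2 * e L i) (poles4 L i) (P4 L i j k) (Omega4 L i j k)
      (Psi4 L i) (e L k + 2 * e L i + 2 * r) (fun x ↦ rootP L i x * rootP L j x +
        1 / 3 * (e L i - e L k + r) * (rootP L j x / rootP L i x)) := by
  have d2 := sub_ne_zero.mpr (e_ne L hjk)
  have d1 := sub_ne_zero.mpr (e_ne L hij)
  set z₀ := e L k + 2 * e L i + 2 * r with hz₀
  have hQ : (Q4 L i k).eval z₀ = 0 := by
    rw [Q4_eval]
    linear_combination 4 * hr
  have hP : (P4 L i j k).eval z₀ = 0 := by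
    rw [P4_eval, hQ, mul_zero]
  -- At a zero of `q_k` the numerator `S4` is divisible by `15e_i - 2z₀`; this gives the limit
  -- `2(e_i - e_k + r)` of `κ`, hence the coefficient of `R_j/R_i`.
  have hS : S4 L i j k z₀ = 2 * (e L i - e L k + r) * (15 * e L i - 2 * z₀) := by
    rw [S4, hz₀, e_third L hik hjk.symm hij]
    linear_combination 12 * hr
  have h6 : z₀ + 6 * e L i ≠ 0 := by
    intro h
    rw [eq_neg_of_add_eq_zero_left h, Q4_eval] at hQ
    apply pow_ne_zero 2 d1
    rw [e_third L hik hjk.symm hij]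
    linear_combination hQ / 9
  have h15 : 15 * e L i - 2 * z₀ ≠ 0 := by
    intro h
    rw [h, mul_zero, S4, show z₀ = 15 * e L i / 2 by linear_combination -h / 2] at hS
    apply pow_ne_zero 2 d2
    rw [e_third L hij hjk hik] at hS ⊢
    linear_combination hS * 4 / 27
  have hD : D4 L i z₀ ≠ 0 := mul_ne_zero h6 h15
  -- In the expression of `℘(u)` based on `e_k` the factor `q_k` vanishes.
  have hX : X4 L i j z₀ = e L k := by
    rw [X4_swap hij hjk hik hD, X4, hQ]
    ring
  refine ⟨hP, solvesSchrodinger_lame4 hij hjk hik hr, ?_, fun x hx ↦ ?_⟩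
  · obtain ⟨x, hx, h⟩ := exists_ne_zero_of_tendsto i j
      (tendsto_sq_mul_lame (L := L) i j j i j i (1 / 3 * (e L i - e L k + r)) 0)
    refine ⟨x, compl_poles5_subset_poles4 hx, ?_⟩
    rwa [zero_mul, add_zero] at h
  have hsub : Omega4 L i j k ⊆ Uniformised L (P4 L i j k) (D4 L i) (X4 L i j) (Y4 L i j k) :=
    fun p hp ↦ hp.1
  have hu := tendsto_u_nhdsEdge hsub
    ((hX ▸ (hasDerivAt_X4 hij hjk hik hD).continuousAt.tendsto).comp tendsto_fst_nhdsEdge)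
  have hw := tendsto_w_nhdsEdge hsub hP
  have hz := tendsto_fst_nhdsEdge (Ω := Omega4 L i j k) (z₀ := z₀)
  have hl : Tendsto (fun p : ℂ × ℂ × ℂ ↦ lambda4 L i p.1 p.2.1) (nhdsEdge (Omega4 L i j k) z₀)
      (𝓝 0) := by
    have h := (hw.const_mul 3).div (((hz.const_add (6 * e L i)).const_mul 2).mul
      ((hz.const_mul 2).const_sub (15 * e L i)))
      (mul_ne_zero (mul_ne_zero (by norm_num) (by rwa [add_comm] at h6)) h15)
    rw [mul_zero, zero_div] at h
    exact h
  have hκ : Tendsto (fun p : ℂ × ℂ × ℂ ↦ S4 L i j k p.1 / (15 * e L i - 2 * p.1))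
      (nhdsEdge (Omega4 L i j k) z₀) (𝓝 (2 * (e L i - e L k + r))) := by
    have h : Tendsto (S4 L i j k) (𝓝 z₀) (𝓝 (S4 L i j k z₀)) := by
      have : Continuous (S4 L i j k) := by
        unfold S4
        fun_prop
      exact this.tendsto z₀
    have h := (h.comp hz).div ((hz.const_mul 2).const_sub (15 * e L i)) h15
    rwa [hS, mul_div_cancel_right₀ _ h15] at h
  have hx' := mem_compl_poles4.mp hx
  have h0 := weierstrassP_sub_e_ne_zero L i hx'.1 hx'.2
  have hκ' := hκ.div_const (6 * (L.weierstrassP x - e L i))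
  have hy := (tendsto_derivWeierstrassP_halfPeriod hu).div
    (((tendsto_weierstrassP_halfPeriod hu).sub_const (e L i)).const_mul 2)
    (mul_ne_zero two_ne_zero (sub_ne_zero.mpr (e_ne L hik.symm)))
  have hc := hl.add (hκ'.mul hy)
  rw [zero_div, mul_zero, add_zero] at hc
  have h := tendsto_wave_halfPeriod hik.symm hij hjk.symm hx'.1 hu hl hc (hκ'.const_add 1)
  have hlim : (1 + 2 * (e L i - e L k + r) / (6 * (L.weierstrassP x - e L i))) *
      (rootP L i x * rootP L j x) = rootP L i x * rootP L j x +
        1 / 3 * (e L i - e L k + r) * (rootP L j x / rootP L i x) := by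
    rw [← rootP_sq L i hx'.1] at h0 ⊢
    have h0 := (pow_ne_zero_iff two_ne_zero).mp h0
    field_simp
    ring
  rw [hlim] at h
  refine h.congr' ?_
  filter_upwards [eventually_mem_nhdsEdge] with p hp
  exact (Psi4_eq hij hjk hik hp hx rfl).symm

include hij hjk hik in
lemma isLamePolynomial4_swap {r : ℂ} (hr : r ^ 2 = (e L i - e L j) * (7 * e L i + 2 * e L j)) :
    IsLamePolynomial (fun x ↦ u4 L i x - 2 * e L i) (poles4 L i) (P4 L i j k) (Omega4 L i j k)
      (Psi4 L i) (e L j + 2 * e L i + 2 * r) (fun x ↦ rootP L i x * rootP L k x +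
        1 / 3 * (e L i - e L j + r) * (rootP L k x / rootP L i x)) := by
  rw [← Omega4_swap hij hjk hik, ← P4_swap]
  exact isLamePolynomial4 hik hjk.symm hij hr

end

end TreibichVerdier

end

noncomputable section

namespace TreibichVerdier

variable {L : PeriodPair} {i j k : Fin 3}

/-! ### Limits of the wave function of the potential with three poles -/

/-- The product of the coefficient of `Φ_i` with `√(℘ (u) - e i)`, as a function of `z`. -/
def alpha5 (L : PeriodPair) (i j k : Fin 3) (z : ℂ) : ℂ :=
  (16 * ((z - (6 * e L i - 3 * e L j)) * (z - (6 * e L j - 3 * e L i))) *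
    (X5 L k z - e L i - (z + 15 * e L k) * R5 L k i z * R5 L k j z / (2 * D5 L k z ^ 2)) +
      (X5 L k z - e L i) * (z + 15 * e L k) ^ 2) / (3 * D5 L k z)

lemma Omega5_swap : Omega5 L j i k = Omega5 L i j k := by
  ext ⟨z, w, u⟩
  simp only [Omega5, Uniformised, Set.mem_ofPred_eq, P5_swap, Y5_swap]
  exact and_congr_right fun _ ↦ and_comm

lemma poles5_swap : poles5 L j i = poles5 L i j := by
  ext x
  simp only [poles5, Set.mem_ofPred_eq]
  tauto

lemma u5_swap (x : ℂ) : u5 L j i x = u5 L i j x := by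
  rw [u5, u5]
  ring

lemma Psi5_swap : Psi5 L j i k = Psi5 L i j k := by
  ext p x
  rw [Psi5, Psi5]
  ring

section

variable (hij : i ≠ j) (hjk : j ≠ k) (hik : i ≠ k) {z w u x : ℂ}

include hij hjk hik in
-- The conditions on `Φ_i'` and `Φ_j'` form a linear system for the two coefficients. Times `R_i(u)`
-- its solution contains the roots only as squares or as `R_i R_j R_k`, and the factor `c(z)`
-- cancels; so the product is rational in `z` and finite at edges with `D ≠ 0`.
lemma a5_mul_rootP (hΩ : (z, w, u) ∈ Omega5 L i j k) :
    a5 L i j k (z, w, u) * rootP L i u = alpha5 L i j k z := by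
  obtain ⟨-, -, c3, c4, -, -⟩ := a5_relations hij hjk hik hΩ rfl rfl rfl
  have hw := w_ne_zero_of_mem_Omega5 hij hjk hik hΩ
  obtain ⟨⟨hmem, hD, hu, hX, hY⟩, -, -⟩ := hΩ
  simp only at hmem hD hu hX hY
  have hQ := Q5_ne_zero hmem hw
  have hl := lambda5_sq hmem
  have hT := lambda5_sq_sub hij hjk hik hmem hD
  have hr := rootP_mul_mul L hij hjk hik hu
  have ha := rootP_sq L i hu
  have hc := rootP_sq L k hu
  rw [hY, Y5_eq hD] at hr
  rw [hX] at ha hc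
  have h1 : a5 L i j k (z, w, u) * rootP L i u * (lambda5 L k z w ^ 2 - (X5 L k z - e L k)) =
      lambda5 L k z w ^ 2 * (X5 L k z - e L i - (z + 15 * e L k) * R5 L k i z * R5 L k j z /
        (2 * D5 L k z ^ 2)) + (X5 L k z - e L i) * (X5 L k z - e L k) := by
    rw [← ha, ← hc]
    linear_combination lambda5 L k z w * rootP L i u * c3 + rootP L k u * rootP L i u * c4 +
      2 * lambda5 L k z w * hr
  rw [hT, hl] at h1
  have h2 : -3 * (Q5 L k).eval z / D5 L k z ≠ 0 := by simp [hQ, hD]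
  rw [alpha5, ← mul_left_inj' h2, h1]
  have h3 : X5 L k z - e L k = -(Q5 L k).eval z * (z + 15 * e L k) ^ 2 / D5 L k z ^ 2 := by
    rw [X5_eq]
    ring
  rw [h3]
  generalize X5 L k z = X
  field_simp
  ring

/-- The wave function of `u₅` in terms of `Φ` and `Φ'`. -/
lemma Psi5_eq (hij : i ≠ j) (hjk : j ≠ k) (hik : i ≠ k)
    (hΩ : (z, w, u) ∈ Omega5 L i j k) (hx : x ∈ (poles5 L i j)ᶜ) :
    Psi5 L i j k (z, w, u) x = Complex.exp (lambda5 L k z w * x) *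
      ((lambda5 L k z w - (lambda5 L k z w * (alpha5 L j i k z - (L.weierstrassP u - e L j)) +
        L.derivWeierstrassP u / 2) / (L.weierstrassP x - e L i) -
        (lambda5 L k z w * (alpha5 L i j k z - (L.weierstrassP u - e L i)) +
          L.derivWeierstrassP u / 2) / (L.weierstrassP x - e L j)) * Phi L x u +
        (1 + alpha5 L i j k z / (L.weierstrassP x - e L i) +
          alpha5 L j i k z / (L.weierstrassP x - e L j)) * dPhi L x u) := by
  obtain ⟨-, -, c3, c4, -, -⟩ := a5_relations hij hjk hik hΩ rfl rfl rfl
  have hA := a5_mul_rootP hij hjk hik hΩ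
  have hB := a5_mul_rootP hij.symm hik hjk (by rwa [Omega5_swap])
  have hu : u ∉ L.lattice := hΩ.1.2.2.1
  obtain ⟨hx, hxi, hxj⟩ := mem_compl_poles5.mp hx
  have h1 := PhiShift_eq hij hjk hik hx hxi hu
  have h2 := PhiShift_eq hij.symm hik hjk hx hxj hu
  have h3 := weierstrassP_sub_e_ne_zero L i hx hxi
  have h4 := weierstrassP_sub_e_ne_zero L j hx hxj
  have hr := rootP_mul_mul L hij hjk hik hu
  have ha := rootP_sq L i hu
  have hb := rootP_sq L j hu
  rw [mul_comm, ← eq_div_iff h3] at h1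
  rw [mul_comm, ← eq_div_iff h4] at h2
  have e1 : a5 L i j k (z, w, u) * PhiShift L i x u = (alpha5 L i j k z * dPhi L x u -
      (lambda5 L k z w * (alpha5 L j i k z - (L.weierstrassP u - e L j)) +
        L.derivWeierstrassP u / 2) * Phi L x u) / (L.weierstrassP x - e L i) := by
    rw [h1, ← hA, ← hB, ← hb]
    field_simp
    linear_combination 2 * rootP L j u * Phi L x u * c4 + 2 * Phi L x u * hr
  have e2 : a5 L j i k (z, w, u) * PhiShift L j x u = (alpha5 L j i k z * dPhi L x u -
      (lambda5 L k z w * (alpha5 L i j k z - (L.weierstrassP u - e L i)) +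
        L.derivWeierstrassP u / 2) * Phi L x u) / (L.weierstrassP x - e L j) := by
    rw [h2, ← hA, ← hB, ← ha]
    field_simp
    linear_combination 2 * rootP L i u * Phi L x u * c3 + 2 * Phi L x u * hr
  rw [Psi5_eq_wave hx, wave, e1, e2]
  ring

include hij hjk hik in
/-- The limit of the wave function of `u₅` at a band edge over the half period `ω a`. -/
lemma tendsto_Psi5 {a b c : Fin 3} (hab : a ≠ b) (hbc : b ≠ c) (hac : a ≠ c) {z₀ : ℂ}
    (hP : (P5 L i j k).eval z₀ = 0) (hD : D5 L k z₀ ≠ 0) (hX : X5 L k z₀ = e L a)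
    (hx : x ∈ (poles5 L i j)ᶜ) : Tendsto (fun p ↦ Psi5 L i j k p x) (nhdsEdge (Omega5 L i j k) z₀)
      (𝓝 ((1 + alpha5 L i j k z₀ / (L.weierstrassP x - e L i) +
        alpha5 L j i k z₀ / (L.weierstrassP x - e L j)) * (rootP L b x * rootP L c x))) := by
  have hsub : Omega5 L i j k ⊆ Uniformised L (P5 L i j k) (D5 L k) (X5 L k) (Y5 L i j k) :=
    fun p hp ↦ hp.1
  have hXc := (hasDerivAt_X5 hij hjk hik hD).continuousAt.tendsto
  have hu := tendsto_u_nhdsEdge hsub ((hX ▸ hXc).comp tendsto_fst_nhdsEdge)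
  have hw := tendsto_w_nhdsEdge hsub hP
  have hz := tendsto_fst_nhdsEdge (Ω := Omega5 L i j k) (z₀ := z₀)
  have hDc : ContinuousAt (D5 L k) z₀ := by
    have : Continuous (D5 L k) := by
      unfold D5
      fun_prop
    exact this.continuousAt
  have hα (a b : Fin 3) : ContinuousAt (alpha5 L a b k) z₀ := by
    have h1 : ContinuousAt (X5 L k) z₀ := hXc
    have h2 : ContinuousAt (fun z ↦ (z + 15 * e L k) * R5 L k a z * R5 L k b z /
        (2 * D5 L k z ^ 2)) z₀ :=
      ContinuousAt.div (by unfold R5; fun_prop) (by fun_prop)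
        (mul_ne_zero two_ne_zero (pow_ne_zero 2 hD))
    unfold alpha5
    exact ContinuousAt.div (by fun_prop) (by fun_prop) (mul_ne_zero three_ne_zero hD)
  have hl : Tendsto (fun p : ℂ × ℂ × ℂ ↦ lambda5 L k p.1 p.2.1) (nhdsEdge (Omega5 L i j k) z₀)
      (𝓝 0) := by
    have h := (hw.const_mul (-4)).div (hDc.tendsto.comp hz) hD
    rw [mul_zero, zero_div] at h
    exact h
  have hA := (hα i j).tendsto.comp hz
  have hB := (hα j i).tendsto.comp hz
  have hp := tendsto_weierstrassP_halfPeriod hu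
  have hp' := (tendsto_derivWeierstrassP_halfPeriod hu).div_const 2
  have hc := (hl.sub (((hl.mul (hB.sub (hp.sub_const (e L j)))).add hp').div_const
    (L.weierstrassP x - e L i))).sub (((hl.mul (hA.sub (hp.sub_const (e L i)))).add hp').div_const
    (L.weierstrassP x - e L j))
  simp only [zero_mul, zero_div, add_zero, sub_zero] at hc
  refine (tendsto_wave_halfPeriod hab hbc hac (mem_compl_poles5.mp hx).1 hu hl hc
    (((hA.div_const (L.weierstrassP x - e L i)).const_add 1).add
      (hB.div_const (L.weierstrassP x - e L j)))).congr' ?_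
  filter_upwards [eventually_mem_nhdsEdge] with p hp
  exact (Psi5_eq hij hjk hik hp hx).symm

include hij hjk hik in
-- At `z₀` the quadratic factor of `P5` vanishes, so `3D = -(z₀ + 15e_k)²` and `X5 = e_j`. The
-- products of `a5_mul_rootP` become `e_i - e_j` for `Φ_i` and `0` for `Φ_j`.
lemma isLamePolynomial5 : IsLamePolynomial (fun x ↦ u5 L i j x + 2 * e L k) (poles5 L i j)
    (P5 L i j k) (Omega5 L i j k) (Psi5 L i j k) (6 * e L i - 3 * e L j)
    (fun x ↦ rootP L i x * rootP L k x + (e L i - e L j) * (rootP L k x / rootP L i x)) := by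
  set z₀ := 6 * e L i - 3 * e L j with hz₀
  have hP : (P5 L i j k).eval z₀ = 0 := by
    rw [P5_eval]
    ring
  have h3 : 3 * D5 L k z₀ = -(z₀ + 15 * e L k) ^ 2 := by
    rw [three_mul_D5 hij hjk hik]
    ring
  have hN : z₀ + 15 * e L k ≠ 0 := by
    rw [hz₀, show 6 * e L i - 3 * e L j + 15 * e L k = 9 * (e L k - e L j) by
      rw [e_third L hij hjk hik]; ring]
    exact mul_ne_zero (by norm_num) (sub_ne_zero.mpr (e_ne L hjk.symm))
  have hD : D5 L k z₀ ≠ 0 := by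
    intro h
    rw [h, mul_zero] at h3
    exact pow_ne_zero 2 hN (neg_eq_zero.mp h3.symm)
  have hX : X5 L k z₀ = e L j := by
    have h : 9 * (Q5 L k).eval z₀ = (e L k - e L j) * (z₀ + 15 * e L k) ^ 2 := by
      rw [Q5_eval, hz₀, g₂_eq_aux L hij, e_third L hij hjk hik]
      ring
    have h4 : (Q5 L k).eval z₀ * (z₀ + 15 * e L k) ^ 2 = (e L k - e L j) * D5 L k z₀ ^ 2 := by
      linear_combination (z₀ + 15 * e L k) ^ 2 / 9 * h + (e L k - e L j) * ((z₀ + 15 * e L k) ^ 2 -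
        3 * D5 L k z₀) / 9 * h3
    rw [X5_eq, h4, mul_div_cancel_right₀ _ (pow_ne_zero 2 hD)]
    ring
  have hα (a b : Fin 3) (hab : a = i ∧ b = j ∨ a = j ∧ b = i) :
      alpha5 L a b k z₀ = e L a - e L j := by
    have h5 : (z₀ - (6 * e L a - 3 * e L b)) * (z₀ - (6 * e L b - 3 * e L a)) = 0 := by
      rcases hab with ⟨rfl, rfl⟩ | ⟨rfl, rfl⟩
      · rw [hz₀]
        ring
      · rw [hz₀]
        ring
    rw [alpha5, h5, hX, h3]
    field_simp
    ring
  refine ⟨hP, solvesSchrodinger_lame5 hij hjk hik, ?_, fun x hx ↦ ?_⟩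
  · obtain ⟨x, hx, h⟩ := exists_ne_zero_of_tendsto i j
      (tendsto_sq_mul_lame (L := L) i k k i j i (e L i - e L j) 0)
    refine ⟨x, hx, ?_⟩
    rwa [zero_mul, add_zero] at h
  have h := tendsto_Psi5 hij hjk hik hij.symm hik hjk hP hD hX hx
  obtain ⟨hx, hxi, hxj⟩ := mem_compl_poles5.mp hx
  have h0 := rootP_ne_zero hx hxi
  rw [hα i j (.inl ⟨rfl, rfl⟩), hα j i (.inr ⟨rfl, rfl⟩), ← rootP_sq L i hx, sub_self, zero_div,
    add_zero, show (1 + (e L i - e L j) / rootP L i x ^ 2) * (rootP L i x * rootP L k x) =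
      rootP L i x * rootP L k x + (e L i - e L j) * (rootP L k x / rootP L i x) by field_simp] at h
  exact h

include hij hjk hik in
lemma isLamePolynomial5_swap : IsLamePolynomial (fun x ↦ u5 L i j x + 2 * e L k) (poles5 L i j)
    (P5 L i j k) (Omega5 L i j k) (Psi5 L i j k) (6 * e L j - 3 * e L i)
    (fun x ↦ rootP L j x * rootP L k x + (e L j - e L i) * (rootP L k x / rootP L j x)) := by
  have h := isLamePolynomial5 (L := L) hij.symm hik hjk
  simp only [u5_swap, poles5_swap, P5_swap, Omega5_swap, Psi5_swap] at h
  exact h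

include hij hjk hik in
lemma alpha5_eq_ta5 (hQ : (Q5 L k).eval z = 0) (hD : D5 L k z ≠ 0) :
    alpha5 L i j k z = ta5 L j i z := by
  have hX : X5 L k z = e L k := by
    rw [X5_eq, hQ]
    ring
  have d1 := sub_ne_zero.mpr (e_ne L hij.symm)
  rw [Q5_eval, g₂_eq_aux L hij, e_third L hij hjk hik] at hQ
  rw [alpha5, ta5, hX]
  field_simp
  rw [D5, R5, R5, g₂_eq_aux L hij, e_third L hij hjk hik]
  generalize e L i = a at *
  generalize e L j = b at *
  -- The factor is the quotient by `c(z)` of the difference of both sides, cleared of denominators.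
  linear_combination (154062 * a ^ 5 - 7522794 * b ^ 5 + 750 * z ^ 5 - 18243954 * a ^ 4 * b +
    1591974 * a ^ 4 * z - 354618 * b ^ 4 * z - 6631956 * a ^ 3 * b ^ 2 - 201204 * a ^ 3 * z ^ 2 +
    1948536 * a ^ 3 * b * z + 746172 * b ^ 3 * z ^ 2 - 2390148 * a ^ 2 * b ^ 3 -
    20916 * a ^ 2 * z ^ 3 + 1752516 * a ^ 2 * b ^ 2 * z + 48276 * a ^ 2 * b * z ^ 2 -
    64404 * b ^ 2 * z ^ 3 + 18631782 * a * b ^ 4 - 3066 * a * z ^ 4 - 4557384 * a * b ^ 3 * z +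
    186948 * a * b ^ 2 * z ^ 2 + 44280 * a * b * z ^ 3 - 6834 * b * z ^ 4) * hQ

include hij hjk hik in
-- At a zero of `c` one has `X5 = e_k`, so `Φ' → R_i R_j`, and `alpha5` takes the values `ã`.
lemma isLamePolynomial5' {z : ℂ} (hQ : (Q5 L k).eval z = 0) :
    IsLamePolynomial (fun x ↦ u5 L i j x + 2 * e L k) (poles5 L i j) (P5 L i j k)
      (Omega5 L i j k) (Psi5 L i j k) z
      (fun x ↦ rootP L i x * rootP L j x + ta5 L i j z * (rootP L i x / rootP L j x) +
        ta5 L j i z * (rootP L j x / rootP L i x)) := by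
  have hP : (P5 L i j k).eval z = 0 := by
    rw [P5_eval, hQ]
    ring
  have hD : D5 L k z ≠ 0 := fun h ↦
    left_ne_zero_of_mul (Q5_eval_mul_ne_zero hij hjk hik h) hQ
  have hX : X5 L k z = e L k := by
    rw [X5_eq, hQ]
    ring
  refine ⟨hP, solvesSchrodinger_lame5' hij hjk hik hQ, ?_, fun x hx ↦ ?_⟩
  · exact exists_ne_zero_of_tendsto i j (tendsto_sq_mul_lame (L := L) i j i j j i _ _)
  have h := tendsto_Psi5 hij hjk hik hik.symm hij hjk.symm hP hD hX hx
  obtain ⟨hx, hxi, hxj⟩ := mem_compl_poles5.mp hx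
  have h0 := rootP_ne_zero hx hxi
  have h1 := rootP_ne_zero hx hxj
  rw [alpha5_eq_ta5 hij hjk hik hQ hD, alpha5_eq_ta5 hij.symm hik hjk hQ hD, ← rootP_sq L i hx,
    ← rootP_sq L j hx, show (1 + ta5 L j i z / rootP L i x ^ 2 + ta5 L i j z / rootP L j x ^ 2) *
      (rootP L i x * rootP L j x) = rootP L i x * rootP L j x +
        ta5 L i j z * (rootP L i x / rootP L j x) + ta5 L j i z * (rootP L j x / rootP L i x) by
      field_simp
      ring] at h
  exact h

end

end TreibichVerdier

end

noncomputable section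

namespace TreibichVerdier

variable {L : PeriodPair} {i j k : Fin 3}

/-! ### Limits of the wave functions at band edges over the pole of `℘` -/

section

variable {ι : Type*} {F : Filter ι} {u l c₁ c₂ : ι → ℂ} {C : ℂ} {x : ℂ}
  (hu : Tendsto u F (comap L.weierstrassP (Bornology.cobounded ℂ) ⊓ 𝓟 {u | u ∉ L.lattice}))

include hu in
lemma eventually_notMem_of_cobounded : ∀ᶠ p in F, u p ∉ L.lattice :=
  hu.eventually (mem_inf_of_right (mem_principal_self _))

include hu in
lemma tendsto_weierstrassP_cobounded :
    Tendsto (fun p ↦ L.weierstrassP (u p)) F (Bornology.cobounded ℂ) :=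
  (tendsto_comap.mono_left inf_le_left).comp hu

include hu in
lemma tendsto_inv_weierstrassP : Tendsto (fun p ↦ (L.weierstrassP (u p))⁻¹) F (𝓝 0) :=
  tendsto_inv₀_cobounded.comp (tendsto_weierstrassP_cobounded hu)

include hu in
lemma tendsto_derivWeierstrassP_sq_div : Tendsto
    (fun p ↦ L.derivWeierstrassP (u p) ^ 2 / (4 * L.weierstrassP (u p) ^ 3)) F (𝓝 1) := by
  have hc := tendsto_inv_weierstrassP hu
  have h := (((hc.pow 2).const_mul (L.g₂ / 4)).add ((hc.pow 3).const_mul (L.g₃ / 4))).const_sub 1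
  norm_num at h
  refine h.congr' ?_
  filter_upwards [eventually_notMem_of_cobounded hu,
    (tendsto_weierstrassP_cobounded hu).eventually (Bornology.eventually_ne_cobounded 0)]
    with p hp h0
  rw [L.derivWeierstrassP_sq _ hp]
  field_simp
  ring

include hu in
lemma tendsto_derivWeierstrassP_div_sq : Tendsto
    (fun p ↦ L.derivWeierstrassP (u p) / L.weierstrassP (u p) ^ 2) F (𝓝 0) := by
  have h := ((tendsto_derivWeierstrassP_sq_div hu).mul (tendsto_inv_weierstrassP hu)).const_mul 4
  norm_num at h
  refine tendsto_zero_of_sq (h.congr' ?_)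
  filter_upwards [(tendsto_weierstrassP_cobounded hu).eventually
    (Bornology.eventually_ne_cobounded 0)] with p h0
  field_simp

include hu in
/-- The limit of `e^{l x} (c₁ Φ + c₂ Φ')` as `℘ (u) → ∞`. -/
lemma tendsto_wave_cobounded (hx : x ∉ L.lattice)
    (hl : Tendsto (fun p ↦ l p - L.derivWeierstrassP (u p) / (2 * L.weierstrassP (u p))) F (𝓝 0))
    (h : Tendsto (fun p ↦ L.derivWeierstrassP (u p) / (2 * L.weierstrassP (u p)) *
      (c₁ p + c₂ p * ((L.derivWeierstrassP x + L.derivWeierstrassP (u p)) /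
        (2 * (L.weierstrassP x - L.weierstrassP (u p)))))) F (𝓝 C)) :
    Tendsto (fun p ↦ Complex.exp (l p * x) * (c₁ p * Phi L x (u p) + c₂ p * dPhi L x (u p))) F
      (𝓝 (-C)) := by
  -- With `y = ℘'(u)/(2℘(u))` the expression is `e^{(l - y)x} · (e^{yx} Φ / y) · y (c₁ + c₂ Z)`; the
  -- three factors tend to `1`, `-1` and `C`.
  have hf := (tendsto_exp_mul_Phi_div hx).comp hu
  have h1 := ((hl.mul_const x).cexp.mul hf).mul h
  rw [zero_mul, Complex.exp_zero, one_mul, neg_one_mul] at h1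
  refine h1.congr' ?_
  filter_upwards [eventually_notMem_of_cobounded hu, (tendsto_weierstrassP_cobounded hu).eventually
    (Bornology.eventually_ne_cobounded (L.weierstrassP x)),
    hf.eventually_ne (neg_ne_zero.mpr one_ne_zero)] with p hp hne hy
  have hxu : x - u p ∉ L.lattice := fun h ↦
    hne ((weierstrassP_eq_iff L hx hp).mpr (.inl h)).symm
  have hZ := two_mul_zetaSum_mul hx hp hxu
  have h0 : L.weierstrassP x - L.weierstrassP (u p) ≠ 0 := sub_ne_zero.mpr hne.symm
  have hy0 : L.derivWeierstrassP (u p) / (2 * L.weierstrassP (u p)) ≠ 0 := by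
    intro h
    simp [h] at hy
  have hZ' : (L.derivWeierstrassP x + L.derivWeierstrassP (u p)) /
      (2 * (L.weierstrassP x - L.weierstrassP (u p))) = zetaSum L x (u p) := by
    rw [← hZ]
    field_simp
  rw [dPhi_eq_mul_zetaSum hx hp hxu, hZ', sub_mul, Complex.exp_sub, Function.comp_apply]
  have he := Complex.exp_ne_zero (L.derivWeierstrassP (u p) / (2 * L.weierstrassP (u p)) * x)
  generalize L.derivWeierstrassP (u p) / (2 * L.weierstrassP (u p)) = y at *
  field_simp

section

variable {z κ : ι → ℂ} {z₀ : ℂ}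

include hu in
/-- `y (y + Z)` with `y = ℘' (u) / (2 ℘ (u))` and `Z = ζ (x - u) - ζ (x) + ζ (u)`. -/
lemma eventually_mul_add_zetaSum_eq (x : ℂ) : ∀ᶠ p in F,
    L.derivWeierstrassP (u p) / (2 * L.weierstrassP (u p)) *
      (L.derivWeierstrassP (u p) / (2 * L.weierstrassP (u p)) +
        (L.derivWeierstrassP x + L.derivWeierstrassP (u p)) /
          (2 * (L.weierstrassP x - L.weierstrassP (u p)))) =
      (L.weierstrassP x * (L.weierstrassP (u p))⁻¹ - 1)⁻¹ *
        (L.derivWeierstrassP (u p) ^ 2 / (4 * L.weierstrassP (u p) ^ 3) * L.weierstrassP x +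
          L.derivWeierstrassP x * (L.derivWeierstrassP (u p) / L.weierstrassP (u p) ^ 2) / 4) := by
  have hX := tendsto_weierstrassP_cobounded hu
  filter_upwards [hX.eventually (Bornology.eventually_ne_cobounded 0),
    hX.eventually (Bornology.eventually_ne_cobounded (L.weierstrassP x))] with p h0 h1
  have h1 := sub_ne_zero.mpr h1.symm
  have h2 : L.weierstrassP x * (L.weierstrassP (u p))⁻¹ - 1 =
      (L.weierstrassP x - L.weierstrassP (u p)) / L.weierstrassP (u p) := by
    field_simp
  rw [h2]
  generalize hd : L.weierstrassP x - L.weierstrassP (u p) = d at *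
  field_simp
  rw [← hd]
  ring

include hu in
lemma tendsto_inv_mul_sub_one (a : ℂ) :
    Tendsto (fun p ↦ (a * (L.weierstrassP (u p))⁻¹ - 1)⁻¹) F (𝓝 (-1)) := by
  have h := (((tendsto_inv_weierstrassP hu).const_mul a).sub_const 1).inv₀ (by norm_num)
  norm_num at h
  exact h

include hu in
-- `y` and `Z` are both unbounded, but their leading terms cancel and `y (y + Z)` has a finite
-- limit, the source of `℘(x)` in the Lamé polynomials.
lemma tendsto_mul_add_zetaSum (x : ℂ) : Tendsto (fun p ↦
    L.derivWeierstrassP (u p) / (2 * L.weierstrassP (u p)) *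
      (L.derivWeierstrassP (u p) / (2 * L.weierstrassP (u p)) +
        (L.derivWeierstrassP x + L.derivWeierstrassP (u p)) /
          (2 * (L.weierstrassP x - L.weierstrassP (u p))))) F (𝓝 (-L.weierstrassP x)) := by
  have h := (tendsto_inv_mul_sub_one hu (L.weierstrassP x)).mul
    (((tendsto_derivWeierstrassP_sq_div hu).mul_const (L.weierstrassP x)).add
      (((tendsto_derivWeierstrassP_div_sq hu).const_mul (L.derivWeierstrassP x)).div_const 4))
  norm_num at h
  refine h.congr' ?_
  filter_upwards [eventually_mul_add_zetaSum_eq hu x] with p hp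
  rw [hp]

include hu in
-- Here `y (l + Z) = y (l - y) + y (y + Z)`, and the two terms tend to `-z₀/6` and `-℘(x)`.
lemma tendsto_wave3_cobounded (hx : x ∉ L.lattice) (hz : Tendsto z F (𝓝 z₀))
    (hl : ∀ᶠ p in F, l p ^ 2 = L.weierstrassP (u p) - z p / 3)
    (hY : ∀ᶠ p in F, L.derivWeierstrassP (u p) = l p * (2 * L.weierstrassP (u p) + z p / 3)) :
    Tendsto (fun p ↦ Complex.exp (l p * x) * (l p * Phi L x (u p) + 1 * dPhi L x (u p))) F
      (𝓝 (L.weierstrassP x + z₀ / 6)) := by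
  have hX := tendsto_weierstrassP_cobounded hu
  have hc := tendsto_inv_weierstrassP hu
  have hzc := hz.mul hc
  rw [mul_zero] at hzc
  have h1 : Tendsto (fun p ↦ l p - L.derivWeierstrassP (u p) / (2 * L.weierstrassP (u p))) F
      (𝓝 0) := by
    have h := (((hzc.div_const 3).const_sub 1).mul (hz.mul hzc)).div_const 36
    norm_num at h
    refine tendsto_zero_of_sq (h.congr' ?_)
    filter_upwards [hl, hY, hX.eventually (Bornology.eventually_ne_cobounded 0)] with p h2 h3 h0
    rw [h3, show l p - l p * (2 * L.weierstrassP (u p) + z p / 3) / (2 * L.weierstrassP (u p)) =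
      l p * (-z p / (6 * L.weierstrassP (u p))) by field_simp; ring, mul_pow, h2]
    field_simp
    ring
  have h2 : Tendsto (fun p ↦ L.derivWeierstrassP (u p) / (2 * L.weierstrassP (u p)) *
      (l p - L.derivWeierstrassP (u p) / (2 * L.weierstrassP (u p)))) F (𝓝 (-z₀ / 6)) := by
    have h := (((hzc.div_const 3).const_sub 1).mul (hzc.div_const 6 |>.const_add 1)).mul
      (hz.neg.div_const 6)
    norm_num at h
    refine h.congr' ?_
    filter_upwards [hl, hY, hX.eventually (Bornology.eventually_ne_cobounded 0)] with p h2 h3 h0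
    rw [h3, show l p * (2 * L.weierstrassP (u p) + z p / 3) / (2 * L.weierstrassP (u p)) *
      (l p - l p * (2 * L.weierstrassP (u p) + z p / 3) / (2 * L.weierstrassP (u p))) =
      l p ^ 2 * ((2 * L.weierstrassP (u p) + z p / 3) / (2 * L.weierstrassP (u p)) *
        (-z p / (6 * L.weierstrassP (u p)))) by field_simp; ring, h2]
    field_simp
    ring
  have h := tendsto_wave_cobounded hu hx h1 (c₁ := l) (c₂ := fun _ ↦ 1)
    (C := -z₀ / 6 + -L.weierstrassP x)
    ((h2.add (tendsto_mul_add_zetaSum hu x)).congr fun p ↦ by ring)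
  rwa [show -(-z₀ / 6 + -L.weierstrassP x) = L.weierstrassP x + z₀ / 6 by ring] at h

include hu in
-- No limit of `κ` is needed: the contribution `κ/6` of `y (l - y)` cancels against that of `Φ_i`,
-- and all other terms in `κ` carry a factor `1/℘(u)` or decay likewise.
lemma tendsto_wave4_cobounded (hx : x ∉ L.lattice) {a : ℂ} (hxa : L.weierstrassP x - a ≠ 0)
    (hz : Tendsto z F (𝓝 z₀))
    (hκ : Tendsto (fun p ↦ κ p * (L.weierstrassP (u p))⁻¹) F (𝓝 0))
    (hκ2 : Tendsto (fun p ↦ κ p ^ 2 * (L.weierstrassP (u p))⁻¹) F (𝓝 0))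
    (hl : ∀ᶠ p in F, l p ^ 2 = L.weierstrassP (u p) + (κ p - z p) / 3)
    (hY : ∀ᶠ p in F, L.derivWeierstrassP (u p) =
      l p * (2 * L.weierstrassP (u p) - (κ p + 6 * a) / 3)) :
    Tendsto (fun p ↦ Complex.exp (l p * x) * ((l p + κ p / (6 * (L.weierstrassP x - a)) *
      (L.derivWeierstrassP (u p) / (2 * (L.weierstrassP (u p) - a)))) * Phi L x (u p) +
        (1 + κ p / (6 * (L.weierstrassP x - a))) * dPhi L x (u p))) F
      (𝓝 (L.weierstrassP x - a)) := by
  have hX := tendsto_weierstrassP_cobounded hu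
  have hc := tendsto_inv_weierstrassP hu
  have hzc := hz.mul hc
  rw [mul_zero] at hzc
  have h0 := hX.eventually (Bornology.eventually_ne_cobounded 0)
  have hn := tendsto_derivWeierstrassP_sq_div hu
  -- the two factors `ℓ` and `m`
  have hℓ := ((hκ.sub hzc).div_const 3).const_add 1
  have hm := ((hκ.add (hc.const_mul (6 * a))).div_const 6).const_sub 1
  norm_num at hℓ hm
  have hκm := ((hκ2.add (hκ.const_mul (6 * a))).div_const 6).neg
  have hκℓ := (hκ2.sub (hz.mul hκ)).div_const 3
  norm_num at hκm hκℓ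
  have hg := tendsto_inv_mul_sub_one hu (L.weierstrassP x)
  have hg' := (tendsto_inv_mul_sub_one hu a).neg
  rw [neg_neg] at hg'
  have hκn : Tendsto (fun p ↦ κ p * (L.derivWeierstrassP (u p) ^ 2 /
      (4 * L.weierstrassP (u p) ^ 3) - 1)) F (𝓝 0) := by
    have h := (hκ.mul ((hc.const_mul (L.g₂ / 4)).add ((hc.pow 2).const_mul (L.g₃ / 4)))).neg
    norm_num at h
    refine h.congr' ?_
    filter_upwards [h0, eventually_notMem_of_cobounded hu] with p h0 hp
    rw [L.derivWeierstrassP_sq _ hp]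
    field_simp
    ring
  have hκh : Tendsto (fun p ↦ κ p * (L.derivWeierstrassP (u p) / L.weierstrassP (u p) ^ 2)) F
      (𝓝 0) := by
    have h := (hκ2.mul hn).const_mul 4
    norm_num at h
    refine tendsto_zero_of_sq (h.congr' ?_)
    filter_upwards [h0] with p h0
    field_simp
  have h1 : Tendsto (fun p ↦ l p - L.derivWeierstrassP (u p) / (2 * L.weierstrassP (u p))) F
      (𝓝 0) := by
    have h := (hℓ.mul ((hκ2.add (hκ.const_mul (12 * a))).add
      (hc.const_mul (36 * a ^ 2)))).div_const 36
    norm_num at h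
    refine tendsto_zero_of_sq (h.congr' ?_)
    filter_upwards [hl, hY, h0] with p h2 h3 h0
    rw [h3, show l p - l p * (2 * L.weierstrassP (u p) - (κ p + 6 * a) / 3) /
      (2 * L.weierstrassP (u p)) = l p * ((κ p + 6 * a) / (6 * L.weierstrassP (u p))) by
        field_simp; ring, mul_pow, h2]
    field_simp
    ring
  -- The limit of `y (c₁ + c₂ Z)`, already grouped so that the leading terms in `κ` have cancelled.
  have h2 := (((hℓ.mul hm).const_mul a).add (hg.mul
    ((hn.mul_const (L.weierstrassP x)).add (((tendsto_derivWeierstrassP_div_sq hu).const_mul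
      (L.derivWeierstrassP x)).div_const 4)))).add
    (((((hκℓ.mul hm).add hκm).add ((((((hκ.mul_const (L.weierstrassP x)).mul hg).add
      (hg.mul hκn)).const_mul (L.weierstrassP x)).add (((hκn.mul hg').add
        ((hκ.mul_const a).mul hg')).const_mul a)).div_const (L.weierstrassP x - a))).add
      (((hκh.mul hg).mul_const (L.derivWeierstrassP x)).div_const
        (4 * (L.weierstrassP x - a)))).div_const 6)
  norm_num at h2
  have h3 : ∀ᶠ p in F, a * (L.weierstrassP (u p))⁻¹ - 1 ≠ 0 := by
    filter_upwards [(tendsto_inv_mul_sub_one hu a).eventually_ne (by norm_num : (-1 : ℂ) ≠ 0)]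
      with p hp h
    simp [h] at hp
  have h4 : ∀ᶠ p in F, L.weierstrassP x * (L.weierstrassP (u p))⁻¹ - 1 ≠ 0 := by
    filter_upwards [hg.eventually_ne (by norm_num : (-1 : ℂ) ≠ 0)] with p hp h
    simp [h] at hp
  have h := tendsto_wave_cobounded hu hx h1
    (c₁ := fun p ↦ l p + κ p / (6 * (L.weierstrassP x - a)) *
      (L.derivWeierstrassP (u p) / (2 * (L.weierstrassP (u p) - a))))
    (c₂ := fun p ↦ 1 + κ p / (6 * (L.weierstrassP x - a))) (h2.congr' ?_)
  · rwa [show -(a + -L.weierstrassP x) = L.weierstrassP x - a by ring] at h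
  filter_upwards [h0, hl, hY, h3, h4, eventually_mul_add_zetaSum_eq hu x] with p h0 hl hY h3 h4 hZ
  have s1 : L.derivWeierstrassP (u p) / (2 * L.weierstrassP (u p)) *
      (l p - L.derivWeierstrassP (u p) / (2 * L.weierstrassP (u p))) =
      (1 + (κ p * (L.weierstrassP (u p))⁻¹ - z p * (L.weierstrassP (u p))⁻¹) / 3) *
        (1 - (κ p * (L.weierstrassP (u p))⁻¹ + 6 * a * (L.weierstrassP (u p))⁻¹) / 6) *
          (κ p + 6 * a) / 6 := by
    rw [hY, show l p * (2 * L.weierstrassP (u p) - (κ p + 6 * a) / 3) /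
      (2 * L.weierstrassP (u p)) * (l p - l p * (2 * L.weierstrassP (u p) - (κ p + 6 * a) / 3) /
      (2 * L.weierstrassP (u p))) = l p ^ 2 * ((2 * L.weierstrassP (u p) - (κ p + 6 * a) / 3) /
      (2 * L.weierstrassP (u p)) * ((κ p + 6 * a) / (6 * L.weierstrassP (u p)))) by
        field_simp; ring, hl]
    field_simp
    ring
  have s3 : L.derivWeierstrassP (u p) / (2 * L.weierstrassP (u p)) *
      (L.derivWeierstrassP (u p) / (2 * (L.weierstrassP (u p) - a)) -
        L.derivWeierstrassP (u p) / (2 * L.weierstrassP (u p))) =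
      L.derivWeierstrassP (u p) ^ 2 / (4 * L.weierstrassP (u p) ^ 3) * a *
        -(a * (L.weierstrassP (u p))⁻¹ - 1)⁻¹ := by
    have h5 : a * (L.weierstrassP (u p))⁻¹ - 1 = -(L.weierstrassP (u p) - a) /
        L.weierstrassP (u p) := by
      field_simp
      ring
    rw [h5] at h3 ⊢
    have h6 : L.weierstrassP (u p) - a ≠ 0 := by
      intro h
      simp [h] at h3
    field_simp
    ring
  have s4 := mul_inv_cancel₀ h3
  have s5 := mul_inv_cancel₀ h4
  -- All differences are taken relative to `y`, so that each summand has a controlled size.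
  rw [show ∀ y Z Y' k : ℂ, y * (l p + k * Y' + (1 + k) * Z) = y * (l p - y) + y * (y + Z) +
    k * (y * (Y' - y) + y * (y + Z)) by intros; ring, s1, s3, hZ]
  generalize (a * (L.weierstrassP (u p))⁻¹ - 1)⁻¹ = g' at *
  generalize (L.weierstrassP x * (L.weierstrassP (u p))⁻¹ - 1)⁻¹ = g at *
  generalize (L.weierstrassP (u p))⁻¹ = c at *
  generalize L.derivWeierstrassP (u p) ^ 2 / (4 * L.weierstrassP (u p) ^ 3) = n at *
  generalize L.derivWeierstrassP (u p) / L.weierstrassP (u p) ^ 2 = m at *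
  clear hZ s1 s3 h3 h4 hl hY h2 h1
  field_simp
  linear_combination (-72 * a * κ p) * s4 + (72 * κ p * L.weierstrassP x) * s5

end

end

end TreibichVerdier

end

noncomputable section

namespace TreibichVerdier

variable {L : PeriodPair} {i j k : Fin 3} (hij : i ≠ j) (hjk : j ≠ k) (hik : i ≠ k)

/-! ### Lamé polynomials at the band edges over the origin -/

lemma tendsto_cobounded_of_inv {ι : Type*} {F : Filter ι} {f : ι → ℂ}
    (h : Tendsto (fun p ↦ (f p)⁻¹) F (𝓝 0)) (h0 : ∀ᶠ p in F, f p ≠ 0) :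
    Tendsto f F (Bornology.cobounded ℂ) := by
  have h1 := tendsto_inv₀_nhdsNE_zero.comp
    (tendsto_nhdsWithin_iff.mpr ⟨h, h0.mono fun p hp ↦ inv_ne_zero hp⟩)
  simpa [Function.comp_def] using h1

include hij hjk hik in
-- At `z² = 3g₂` the denominator of `X3` vanishes but its numerator does not, so `℘(u) → ∞`.
lemma isLamePolynomial3' {r : ℂ} (hr : r ^ 2 = L.g₂ / 3) :
    IsLamePolynomial (u3 L) (poles3 L) (P3 L) (Omega3 L) (Psi3 L) (3 * r)
      (fun x ↦ L.weierstrassP x + 1 / 2 * r) := by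
  have hr' : (3 * r) ^ 2 = 3 * L.g₂ := by linear_combination 9 * hr
  refine ⟨?_, solvesSchrodinger_lame3' hr, ?_, fun x hx ↦ ?_⟩
  · rw [P3_eval hij hjk hik, hr', sub_self, zero_mul]
  · obtain ⟨x, hx, h⟩ := exists_ne_zero_of_tendsto i j
      (tendsto_sq_mul_weierstrassP_add (L := L) (1 / 2 * r))
    exact ⟨x, compl_poles4_subset_poles3 (compl_poles5_subset_poles4 hx), h⟩
  have hz := tendsto_fst_nhdsEdge (Ω := Omega3 L) (z₀ := 3 * r)
  have hN := numerator3_ne_zero hij hjk hik hr'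
  have hN' := ((hz.pow 3).sub_const (27 * L.g₃))
  have hX : Tendsto (fun p : ℂ × ℂ × ℂ ↦ X3 L p.1) (nhdsEdge (Omega3 L) (3 * r))
      (Bornology.cobounded ℂ) := by
    refine tendsto_cobounded_of_inv ?_ ?_
    · have h := (((hz.pow 2).sub_const (3 * L.g₂)).const_mul 9).div hN'.neg (neg_ne_zero.mpr hN)
      rw [hr', sub_self, mul_zero, zero_div] at h
      refine h.congr fun p ↦ ?_
      rw [X3, inv_div]
      rfl
    · filter_upwards [eventually_mem_nhdsEdge, hN'.eventually_ne hN] with p hp hp'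
      exact div_ne_zero (neg_ne_zero.mpr hp') (mul_ne_zero (by norm_num) hp.2.1)
  have hu := tendsto_u_nhdsEdge (L := L) (Ω := Omega3 L) subset_rfl hX
  have h := tendsto_wave3_cobounded (l := fun p ↦ lambda3 L p.1 p.2.1) hu hx hz ?_ ?_
  · rw [show L.weierstrassP x + 3 * r / 6 = L.weierstrassP x + 1 / 2 * r by ring] at h
    refine h.congr fun p ↦ ?_
    rw [Psi3, deriv_exp_mul_Phi _ _ hx, one_mul]
  · filter_upwards [eventually_mem_nhdsEdge] with p hp
    rw [hp.2.2.2.1]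
    linear_combination eq_of_krichever3 hp.1 hp.2.1 / 3
  · filter_upwards [eventually_mem_nhdsEdge] with p hp
    have hK := (mapsTo_krichever3 hp.1 hp.2.1).2
    have he := eq_of_krichever3 hp.1 hp.2.1
    simp only [K3] at hK
    rw [hp.2.2.2.1, hp.2.2.2.2]
    linear_combination hK - lambda3 L p.1 p.2.1 / 3 * he

include hij hjk hik in
-- At `z = -6e_i` the denominator of `X4` vanishes while `S4 = -27 (e_i - e_j)(e_i - e_k)` does not,
-- so `℘(u) → ∞` and `κ/℘(u)`, `κ²/℘(u)` tend to `0`.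
lemma isLamePolynomial4' :
    IsLamePolynomial (fun x ↦ u4 L i x - 2 * e L i) (poles4 L i) (P4 L i j k) (Omega4 L i j k)
      (Psi4 L i) (-6 * e L i) (fun x ↦ L.weierstrassP x - e L i) := by
  refine ⟨?_, solvesSchrodinger_lame4' hij hjk hik, ?_, fun x hx ↦ ?_⟩
  · rw [P4_eval]
    ring
  · obtain ⟨x, hx, h⟩ := exists_ne_zero_of_tendsto i j
      (tendsto_sq_mul_weierstrassP_add (L := L) (-e L i))
    exact ⟨x, compl_poles5_subset_poles4 hx, by rwa [← sub_eq_add_neg] at h⟩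
  have hsub : Omega4 L i j k ⊆ Uniformised L (P4 L i j k) (D4 L i) (X4 L i j) (Y4 L i j k) :=
    fun p hp ↦ hp.1
  have hz := tendsto_fst_nhdsEdge (Ω := Omega4 L i j k) (z₀ := -6 * e L i)
  have hS0 : S4 L i j k (-6 * e L i) ≠ 0 := by
    have : S4 L i j k (-6 * e L i) = -27 * ((e L i - e L j) * (e L i - e L k)) := by
      rw [S4, e_third L hij hjk hik]
      ring
    rw [this]
    exact mul_ne_zero (by norm_num)
      (mul_ne_zero (sub_ne_zero.mpr (e_ne L hij)) (sub_ne_zero.mpr (e_ne L hik)))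
  have hS : Tendsto (fun p : ℂ × ℂ × ℂ ↦ S4 L i j k p.1) (nhdsEdge (Omega4 L i j k) (-6 * e L i))
      (𝓝 (S4 L i j k (-6 * e L i))) := by
    have : Continuous (S4 L i j k) := by
      unfold S4
      fun_prop
    exact (this.tendsto _).comp hz
  have hs := hz.add_const (6 * e L i)
  rw [show -6 * e L i + 6 * e L i = 0 by ring] at hs
  have hd := (hz.const_mul 2).const_sub (15 * e L i)
  have hN := ((hs.mul (hd.pow 2)).mul_const (4 * e L i)).sub (hS.pow 2)
  rw [zero_mul, zero_mul, zero_sub] at hN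
  have hN0 := neg_ne_zero.mpr (pow_ne_zero 2 hS0)
  have hXeq : ∀ᶠ p : ℂ × ℂ × ℂ in nhdsEdge (Omega4 L i j k) (-6 * e L i), X4 L i j p.1 =
      ((p.1 + 6 * e L i) * (15 * e L i - 2 * p.1) ^ 2 * (4 * e L i) - S4 L i j k p.1 ^ 2) /
        (4 * (p.1 + 6 * e L i) * (15 * e L i - 2 * p.1) ^ 2) := by
    filter_upwards [eventually_mem_nhdsEdge] with p hp
    obtain ⟨h1, h2⟩ := D4_ne_zero_iff.mp hp.1.2.1
    rw [X4_eq hij hjk hik hp.1.2.1]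
    generalize p.1 + 6 * e L i = s at *
    generalize 15 * e L i - 2 * p.1 = d at *
    field_simp
  have hX : Tendsto (fun p : ℂ × ℂ × ℂ ↦ X4 L i j p.1) (nhdsEdge (Omega4 L i j k) (-6 * e L i))
      (Bornology.cobounded ℂ) := by
    refine tendsto_cobounded_of_inv ?_ ?_
    · have h := ((hs.const_mul 4).mul (hd.pow 2)).div hN hN0
      rw [mul_zero, zero_mul, zero_div] at h
      refine h.congr' ?_
      filter_upwards [hXeq] with p hp
      rw [hp, inv_div]
      rfl
    · filter_upwards [eventually_mem_nhdsEdge, hN.eventually_ne hN0, hXeq] with p hp hp' hX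
      obtain ⟨h1, h2⟩ := D4_ne_zero_iff.mp hp.1.2.1
      rw [hX]
      exact div_ne_zero hp' (mul_ne_zero (mul_ne_zero (by norm_num) h1) (pow_ne_zero 2 h2))
  have hu := tendsto_u_nhdsEdge hsub hX
  have hx' := mem_compl_poles4.mp hx
  have h := tendsto_wave4_cobounded (l := fun p ↦ lambda4 L i p.1 p.2.1)
    (κ := fun p ↦ S4 L i j k p.1 / (15 * e L i - 2 * p.1)) hu hx'.1
    (weierstrassP_sub_e_ne_zero L i hx'.1 hx'.2) hz ?_ ?_ ?_ ?_
  · refine h.congr' ?_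
    filter_upwards [eventually_mem_nhdsEdge] with p hp
    exact (Psi4_eq hij hjk hik hp hx rfl).symm
  · have h := (((hs.const_mul 4).mul hd).mul hS).div hN hN0
    rw [mul_zero, zero_mul, zero_mul, zero_div] at h
    refine h.congr' ?_
    filter_upwards [eventually_mem_nhdsEdge, hXeq] with p hp hX
    have h2 := (D4_ne_zero_iff.mp hp.1.2.1).2
    rw [hp.1.2.2.2.1, hX, inv_div, Pi.div_apply]
    generalize 15 * e L i - 2 * p.1 = d at *
    field_simp
  · have h := ((hs.const_mul 4).mul (hS.pow 2)).div hN hN0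
    rw [mul_zero, zero_mul, zero_div] at h
    refine h.congr' ?_
    filter_upwards [eventually_mem_nhdsEdge, hXeq] with p hp hX
    have h2 := (D4_ne_zero_iff.mp hp.1.2.1).2
    rw [hp.1.2.2.2.1, hX, inv_div, Pi.div_apply]
    generalize 15 * e L i - 2 * p.1 = d at *
    field_simp
  · filter_upwards [eventually_mem_nhdsEdge] with p hp
    rw [hp.1.2.2.2.1, ← kappa4_eq hij hjk hik hp.1.1 hp.1.2.1]
    ring
  · filter_upwards [eventually_mem_nhdsEdge] with p hp
    rw [hp.1.2.2.2.1, hp.1.2.2.2.2]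
    linear_combination lambda4_mul_kappa4 hij hjk hik hp.1.2.1 (w := p.2.1) / 3

end TreibichVerdier

end

theorem mainTheorem6 (L : PeriodPair) (i j k : Fin 3) (hij : i ≠ j) (hjk : j ≠ k) (hik : i ≠ k) :
    -- the branches of the square roots
    ((∀ a : Fin 3, ∀ x ∉ L.lattice,
        rootP L a x ^ 2 = L.weierstrassP x - e L a) ∧
      (∀ x ∉ L.lattice, rootP L i x * rootP L j x *
        rootP L k x = -L.derivWeierstrassP x / 2)) ∧
    -- the potential `u₃`: spectral curve
    (IsSpectralPolynomial (u3 L) (poles3 L)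
        (P3 L) ∧
      ((P3 L).Separable ↔ L.g₂ ≠ 0) ∧
      Set.BijOn (fun p : ℂ × ℂ ↦ (X3 L p.1, Y3 L p.1 p.2,
          lambda3 L p.1 p.2))
        {p ∈ Curve (P3 L) | D3 L p.1 ≠ 0}
        (KricheverCurve L K3) ∧
      -- first cover
      IsTorusCover (P3 L) (D3 L)
        (X3 L) (Y3 L) (fun z ↦ -(3 * z / 2)) L.g₂ L.g₃ 3 ∧
      (∀ z w, (z, w) ∈ Curve (P3 L) →
        D3 L z ≠ 0 → ∃ u, (z, w, u) ∈ Omega3 L) ∧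
      -- second cover and its moduli
      IsTorusCover (P3 L) (fun _ ↦ 1) (tX3 L)
        (fun z w ↦ -(deriv (tX3 L) z * w)) (fun _ ↦ -1)
        (tg₂3 L) (tg₃3 L) 3 ∧
      ((P3 L).Separable →
        tg₂3 L ^ 3 - 27 * tg₃3 L ^ 2 ≠ 0) ∧
      (∀ κ s te₁ te₂ te₃ : ℂ,
        IsJacobiModulus κ (e L i) (e L j)
          (e L k) →
        s ^ 2 = κ ^ 4 - κ ^ 2 + 1 →
        te₁ = -(81 / 8) * L.g₃ →
        te₂ = 81 / 16 * L.g₃ -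
          27 / 8 * L.g₂ * (e L i - e L k) * s →
        te₃ = 81 / 16 * L.g₃ +
          27 / 8 * L.g₂ * (e L i - e L k) * s →
        (∀ t, 4 * (t - te₁) * (t - te₂) * (t - te₃) =
          4 * t ^ 3 - tg₂3 L * t - tg₃3 L) ∧
        (L.g₂ ≠ 0 → ∀ κt : ℂ, IsJacobiModulus κt te₁ te₂ te₃ ↔
          1 / κt ^ 2 = 1 / 2 + (κ ^ 2 - 2) * (2 * κ ^ 2 - 1) * (κ ^ 2 + 1) / (4 * s ^ 3))) ∧
      -- wave function and Lamé polynomials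
      IsWaveFunction (u3 L) (poles3 L)
        (Omega3 L) (Psi3 L) ∧
      IsLamePolynomial (u3 L) (poles3 L)
        (P3 L) (Omega3 L) (Psi3 L)
        (3 * e L k)
        (fun x ↦ rootP L i x * rootP L j x) ∧
      (∀ r : ℂ, r ^ 2 = L.g₂ / 3 →
        IsLamePolynomial (u3 L) (poles3 L)
          (P3 L) (Omega3 L) (Psi3 L)
          (3 * r) (fun x ↦ L.weierstrassP x + 1 / 2 * r))) ∧
    -- the potential `u₄ - 2 e i`: spectral curve
    (IsSpectralPolynomial
        (fun x ↦ u4 L i x - 2 * e L i)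
        (poles4 L i) (P4 L i j k) ∧
      ((P4 L i j k).Separable ↔
        2 * e L j + 7 * e L i ≠ 0 ∧
        2 * e L k + 7 * e L i ≠ 0) ∧
      Set.MapsTo (fun p : ℂ × ℂ ↦ (X4 L i j p.1, Y4 L i j k p.1 p.2,
          lambda4 L i p.1 p.2))
        {p ∈ Curve (P4 L i j k) | D4 L i p.1 ≠ 0}
        (KricheverCurve L (K4 L i j k)) ∧
      Set.BijOn (fun p : ℂ × ℂ ↦ (X4 L i j p.1, Y4 L i j k p.1 p.2,
          lambda4 L i p.1 p.2))
        {p ∈ Curve (P4 L i j k) |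
          D4 L i p.1 ≠ 0 ∧ p.2 ≠ 0}
        {p ∈ KricheverCurve L (K4 L i j k) | p.2.2 ≠ 0} ∧
      -- first cover
      IsTorusCover (P4 L i j k) (D4 L i)
        (X4 L i j) (Y4 L i j k)
        (fun z ↦ 2 * z + 3 * e L i) L.g₂ L.g₃ 4 ∧
      (∀ z, D4 L i z ≠ 0 →
        X4 L i j z = X4 L i k z) ∧
      (∀ z w, (z, w) ∈ Curve (P4 L i j k) →
        D4 L i z ≠ 0 →
        ∃ u, (z, w, u) ∈ Uniformised L (P4 L i j k)
          (D4 L i) (X4 L i j) (Y4 L i j k)) ∧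
      -- second cover and its moduli
      IsTorusCover (P4 L i j k)
        (fun z ↦ z + 6 * e L i) (tX4 L i j k)
        (fun z w ↦ -(deriv (tX4 L i j k) z * w)) (fun _ ↦ -1)
        (tg₂4 L i) (tg₃4 L i) 4 ∧
      (∀ z, z + 6 * e L i ≠ 0 →
        tX4 L i j k z = tX4 L i k j z) ∧
      (∀ t, 4 * (t - te4 L i j k) * (t - te4' L i j k) *
          (t - te4' L i k j) =
        4 * t ^ 3 - tg₂4 L i * t - tg₃4 L i) ∧
      ((P4 L i j k).Separable →
        tg₂4 L i ^ 3 - 27 * tg₃4 L i ^ 2 ≠ 0) ∧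
      (∀ κ κ' : ℂ,
        IsJacobiModulus κ (e L j) (e L i)
          (e L k) →
        IsJacobiModulus κ' (e L k) (e L i)
          (e L j) →
        IsJacobiModulus (κ' * (1 - 4 * κ ^ 2)) (te4' L i k j)
          (te4 L i j k) (te4' L i j k) ∧
        IsJacobiModulus (κ * (1 - 4 * κ' ^ 2)) (te4' L i j k)
          (te4 L i j k) (te4' L i k j)) ∧
      -- wave function and Lamé polynomials
      IsWaveFunction
        (fun x ↦ u4 L i x - 2 * e L i)
        (poles4 L i) (Omega4 L i j k)
        (Psi4 L i) ∧
      (∀ r : ℂ, r ^ 2 = (e L i - e L k) *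
          (7 * e L i + 2 * e L k) →
        IsLamePolynomial
          (fun x ↦ u4 L i x - 2 * e L i)
          (poles4 L i) (P4 L i j k)
          (Omega4 L i j k) (Psi4 L i)
          (e L k + 2 * e L i + 2 * r)
          (fun x ↦ rootP L i x * rootP L j x +
            1 / 3 * (e L i - e L k + r) *
              (rootP L j x / rootP L i x))) ∧
      (∀ r : ℂ, r ^ 2 = (e L i - e L j) *
          (7 * e L i + 2 * e L j) →
        IsLamePolynomial
          (fun x ↦ u4 L i x - 2 * e L i)
          (poles4 L i) (P4 L i j k)
          (Omega4 L i j k) (Psi4 L i)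
          (e L j + 2 * e L i + 2 * r)
          (fun x ↦ rootP L i x * rootP L k x +
            1 / 3 * (e L i - e L j + r) *
              (rootP L k x / rootP L i x))) ∧
      IsLamePolynomial
        (fun x ↦ u4 L i x - 2 * e L i)
        (poles4 L i) (P4 L i j k)
        (Omega4 L i j k) (Psi4 L i)
        (-6 * e L i)
        (fun x ↦ L.weierstrassP x - e L i)) ∧
    -- the potential `u₅ + 2 e k`: spectral curve
    (IsSpectralPolynomial
        (fun x ↦ u5 L i j x + 2 * e L k)
        (poles5 L i j) (P5 L i j k) ∧
      ((P5 L i j k).Separable ↔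
        125 * L.g₂ ≠ 348 * e L k ^ 2) ∧
      Set.MapsTo (fun p : ℂ × ℂ ↦ (X5 L k p.1, Y5 L i j k p.1 p.2,
          lambda5 L k p.1 p.2))
        {p ∈ Curve (P5 L i j k) | D5 L k p.1 ≠ 0}
        (KricheverCurve L (K5 L k)) ∧
      Set.BijOn (fun p : ℂ × ℂ ↦ (X5 L k p.1, Y5 L i j k p.1 p.2,
          lambda5 L k p.1 p.2))
        {p ∈ Curve (P5 L i j k) |
          D5 L k p.1 ≠ 0 ∧ p.2 ≠ 0}
        {p ∈ KricheverCurve L (K5 L k) | p.2.2 ≠ 0} ∧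
      -- first cover
      IsTorusCover (P5 L i j k) (D5 L k)
        (X5 L k) (Y5 L i j k)
        (fun z ↦ (5 * z + 3 * e L k) / 2) L.g₂ L.g₃ 5 ∧
      (∀ z w, (z, w) ∈ Curve (P5 L i j k) →
        D5 L k z ≠ 0 →
        ∃ u, (z, w, u) ∈ Uniformised L (P5 L i j k)
          (D5 L k) (X5 L k) (Y5 L i j k)) ∧
      -- second cover and its moduli
      IsTorusCover (P5 L i j k) (tD5 L i j k)
        (tX5 L i j k)
        (fun z w ↦ -(deriv (tX5 L i j k) z * w)) (fun _ ↦ -1)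
        (tg₂5 L k) (tg₃5 L k) 5 ∧
      ((P5 L i j k).Separable →
        tg₂5 L k ^ 3 - 27 * tg₃5 L k ^ 2 ≠ 0) ∧
      -- wave function and Lamé polynomials
      IsWaveFunction
        (fun x ↦ u5 L i j x + 2 * e L k)
        (poles5 L i j) (Omega5 L i j k)
        (Psi5 L i j k) ∧
      IsLamePolynomial
        (fun x ↦ u5 L i j x + 2 * e L k)
        (poles5 L i j) (P5 L i j k)
        (Omega5 L i j k) (Psi5 L i j k)
        (6 * e L i - 3 * e L j)
        (fun x ↦ rootP L i x * rootP L k x +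
          (e L i - e L j) *
            (rootP L k x / rootP L i x)) ∧
      IsLamePolynomial
        (fun x ↦ u5 L i j x + 2 * e L k)
        (poles5 L i j) (P5 L i j k)
        (Omega5 L i j k) (Psi5 L i j k)
        (6 * e L j - 3 * e L i)
        (fun x ↦ rootP L j x * rootP L k x +
          (e L j - e L i) *
            (rootP L k x / rootP L j x)) ∧
      (∀ z, (Q5 L k).eval z = 0 →
        IsLamePolynomial
          (fun x ↦ u5 L i j x + 2 * e L k)
          (poles5 L i j) (P5 L i j k)
          (Omega5 L i j k) (Psi5 L i j k) z
          (fun x ↦ rootP L i x * rootP L j x +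
            ta5 L i j z *
              (rootP L i x / rootP L j x) +
            ta5 L j i z *
              (rootP L j x / rootP L i x)))) := by
  refine ⟨⟨fun a x hx ↦ rootP_sq L a hx, fun x hx ↦ rootP_mul_mul L hij hjk hik hx⟩,
    ⟨isSpectralPolynomial3 hij hjk hik, separable_P3_iff hij hjk hik, bijOn_krichever3,
      isTorusCover3 hij hjk hik, fun z w h hD ↦ exists_mem_Omega3 h hD,
      isTorusCover_second3 hij hjk hik,
      fun h ↦ discriminant3_ne_zero hij hjk hik ((separable_P3_iff hij hjk hik).mp h),
      fun κ s te₁ te₂ te₃ hκ hs h₁ h₂ h₃ ↦ ⟨te3_cubic hij hjk hik hκ hs h₁ h₂ h₃,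
        isJacobiModulus_te3 hij hjk hik hκ hs h₁ h₂ h₃⟩,
      isWaveFunction3, isLamePolynomial3 hij hjk hik,
      fun r hr ↦ isLamePolynomial3' hij hjk hik hr⟩,
    ⟨isSpectralPolynomial4 hij hjk hik, separable_P4_iff hij hjk hik,
      fun p hp ↦ mapsTo_krichever4 hij hjk hik hp.1 hp.2, bijOn_krichever4 hij hjk hik,
      isTorusCover4 hij hjk hik, fun z hD ↦ X4_swap hij hjk hik hD,
      fun z w h hD ↦ exists_mem_uniformised4 hij hjk hik h hD,
      isTorusCover_second4 hij hjk hik, fun z hz ↦ tX4_swap hij hjk hik hz,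
      te4_cubic hij hjk hik, fun h ↦ ?_,
      fun κ κ' hκ hκ' ↦ ⟨isJacobiModulus_te4 hij hjk hik hκ hκ', ?_⟩,
      isWaveFunction4 hij hjk hik, fun r hr ↦ isLamePolynomial4 hij hjk hik hr,
      fun r hr ↦ isLamePolynomial4_swap hij hjk hik hr, isLamePolynomial4' hij hjk hik⟩,
    isSpectralPolynomial5 hij hjk hik, separable_P5_iff hij hjk hik,
    fun p hp ↦ mapsTo_krichever5 hij hjk hik hp.1 hp.2, bijOn_krichever5 hij hjk hik,
    isTorusCover5 hij hjk hik, fun z w h hD ↦ exists_mem_uniformised5 hij hjk hik h hD,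
    isTorusCover_second5 hij hjk hik,
    fun h ↦ discriminant5_ne_zero hij hjk hik ((separable_P5_iff hij hjk hik).mp h),
    isWaveFunction5 hij hjk hik, isLamePolynomial5 hij hjk hik,
    isLamePolynomial5_swap hij hjk hik, fun z hz ↦ isLamePolynomial5' hij hjk hik hz⟩
  · obtain ⟨hj, hk⟩ := (separable_P4_iff hij hjk hik).mp h
    exact discriminant4_ne_zero hij hjk hik hj hk
  · rw [← te4_swap]
    exact isJacobiModulus_te4 hik hjk.symm hij hκ' hκ
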